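/- Let $\tfrac12<\mu<1$, $\nu=1-\mu$, let $\lambda_0\in\mathbb Q$ with $\mu<\lambda_0<1$, let $q$ be the denominator of $\lambda_0$ in lowest terms and $\beta=\lambda_0-\tfrac12$. Consider the triangular system $u_t+f(u)_x=0$, $v_t+\tfrac12v_x+g(u)_x=0$ with $f(u)=\ln(\nu+\mu e^u)$ and its Godunov (upwind) scheme with $\Delta t=\Delta x=1$, $$u^{n+1}_j=u^n_j-[f(u^n_j)-f(u^n_{j-1})],\qquad v^{n+1}_j=\tfrac12v^n_{j-1}+\tfrac12v^n_j-[g(u^n_j)-g(u^n_{j-1})].$$ *Construction.* For $\sigma\in(\mu,1)$ let $\varphi(\sigma)>0$ be the unique positive solution $b$ of $f(b)/b=\sigma$, and put $\kappa_0=\varphi(\lambda_0)$. Let $T\ge1$ be an integer with $\lambda_0+T^{-1/4}<1$. Let $\gamma(t)=\lambda_0t-2\sqrt{-t}$ for $t<-\sqrt T$, and continue $\gamma$ for $t\ge-\sqrt T$ along its tangent line at $-\sqrt T$, which has slope $\lambda_0+T^{-1/4}$. Put $u_-(t)=\varphi(\dot\gamma(t))$, $$z(t,x)=1+\int_{-2T}^0\exp\{-u_-(\tau)[x-\gamma(\tau)-\dot\gamma(\tau)(t-\tau)]\}(-\tau)^{-3/4}\,d\tau,\qquad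 u(t,x)=\ln\frac{z(t,x-1)}{z(t,x)},$$ $u^n_j=u(n,j)$, let $v^n_j$ ($n\ge-2T$) be given by the second recursion with $v^{-2T}\equiv0$, and put $V(j)=v^1_{j+1}$. For $0<a<\kappa_0$ and $c_0=2\sqrt{\pi/\kappa_0}$ let $c(a)=-\frac1{\kappa_0}\ln\frac{e^a-1}{c_0(e^{\kappa_0}-e^a)}$. Call $g$ *admissible* if it is smooth with compact support and $\{\xi\ge0: g'(\xi)\ne0\}$ is contained in a compact subset of $(0,\kappa_0)$, where $c$ is defined. For such $g$ let, with $((\cdot))$ the fractional part, $$\Pi(z)=\int_{-\infty}^\infty(2\sigma^2-1)e^{-\sigma^2}\int_0^\infty g'(\xi)\Big(\!\Big(qc(\xi)+z+\tfrac{q(\sigma-\sqrt8)}{\sqrt2\,\beta}\Big)\!\Big)\,d\xi\,d\sigma,\qquad z_j=2q\sqrt{j/\beta}.$$ Assumption (A): $g$ is admissible and $\Pi\not\equiv0$. *Claims.* 1. $(u^n_j,v^n_j)$ solves the Godunov scheme for $n\ge-2T$. For every $t$ the function $u(t,\cdot)$ is strictly decreasing with limit $0$ at $+\infty$, and the total variation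 of $j\mapsto u^{-2T}_j$ is bounded independently of $T$. 2. The level curves of $u$ follow translates of the shock curve $\gamma$: for every $\varepsilon>0$ and $[a_1,a_2]\subset(0,\kappa_0)$ there are $M,T_0$ such that for $T\ge T_0$, $-T\le t\le-2\sqrt T$ and $a\in[a_1,a_2]$ the equation $u(t,x)=a$ has exactly one solution $x$, and $|x-c(a)-\gamma(t)|\le M(-t)^{-(1/2-\varepsilon)}$. 3. There is $C>0$, depending only on $\mu,\lambda_0$, such that for every admissible $g$ there is $C_0$, independent of $T$, with $$\operatorname*{Tot.Var.}_{-T\le j\le-\sqrt T}V(j)\ \ge\ \sum_{\sqrt T\le j\le T}\frac{C\,|\Pi(z_j)|}{j}-C_0\quad\text{for all such }T.$$ 4. If $g$ satisfies (A), there are $C>0$ and $C_0$, independent of $T$, such that $\operatorname{Tot.Var.}_{-T\le j\le-\sqrt T}V(j)\ge C\ln T-C_0$ for all such $T$. 5. Functions $g$ satisfying (A) exist, and for each of them the total variation of $j\mapsto v^1_j$ tends to $\infty$ as $T\to\infty$; so there is no a priori bound on the total variation of Godunov approximations. -/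

import Mathlib

open Set Filter Topology
open scoped ContDiff ENNReal

namespace GodunovTV

/-- `(u, v)` solves, from time step `n₀` on, the Godunov (upwind) scheme with `Δt = Δx = 1` for
`u_t + f(u)_x = 0`, `v_t + lam v_x + g(u)_x = 0`. The first index is time, the second is space. -/
structure IsGodunovSolution (f g : ℝ → ℝ) (lam : ℝ) (n₀ : ℤ) (u v : ℤ → ℤ → ℝ) : Prop where
  u_step : ∀ n ≥ n₀, ∀ j, u (n + 1) j = u n j - (f (u n j) - f (u n (j - 1)))
  v_step : ∀ n ≥ n₀, ∀ j, v (n + 1) j =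
    lam * v n (j - 1) + (1 - lam) * v n j - (g (u n j) - g (u n (j - 1)))

noncomputable section

/-- The flux `f(u) = ln (ν + μ e^u)`, `ν = 1 - μ`. -/
def flux (μ u : ℝ) : ℝ := Real.log ((1 - μ) + μ * Real.exp u)

/-- Rankine–Hugoniot speed of the shock joining the left state `b` to the right state `0`. -/
def shockSpeed (μ b : ℝ) : ℝ := flux μ b / b

/-- `phi μ s` is the positive left state whose shock to the right state `0` has speed `s`
(it exists and is unique for `μ < s < 1`). -/
def phi (μ s : ℝ) : ℝ := Function.invFunOn (shockSpeed μ) (Ioi 0) s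

/-- The shock curve: `lam₀ t - 2 √(-t)` for `t < -√T`, continued along its tangent line,
of slope `lam₀ + T^(-1/4)`, for `t ≥ -√T`. -/
def gamma (lam₀ : ℚ) (T : ℕ) (t : ℝ) : ℝ :=
  if t < -√(T : ℝ) then lam₀ * t - 2 * √(-t)
  else (lam₀ * (-√(T : ℝ)) - 2 * √(√(T : ℝ))) + (lam₀ + 1 / √(√(T : ℝ))) * (t + √(T : ℝ))

/-- The state to the left of the shock. -/
def uMinus (μ : ℝ) (lam₀ : ℚ) (T : ℕ) (t : ℝ) : ℝ := phi μ (deriv (gamma lam₀ T) t)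

/-- The superposition of travelling waves, a solution of `z(t+1,x) = μ z(t,x-1) + ν z(t,x)`. -/
def z (μ : ℝ) (lam₀ : ℚ) (T : ℕ) (t x : ℝ) : ℝ :=
  1 + ∫ τ in (-2 * (T : ℝ))..0,
    Real.exp (-uMinus μ lam₀ T τ *
      (x - gamma lam₀ T τ - deriv (gamma lam₀ T) τ * (t - τ))) * (-τ) ^ (-(3 / 4) : ℝ)

/-- The discrete Cole–Hopf transform of `z`. -/
def u (μ : ℝ) (lam₀ : ℚ) (T : ℕ) (t x : ℝ) : ℝ :=
  Real.log (z μ lam₀ T t (x - 1) / z μ lam₀ T t x)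

/-- Grid values `u^n_j = u(n, j)`. -/
def uGrid (μ : ℝ) (lam₀ : ℚ) (T : ℕ) (n j : ℤ) : ℝ := u μ lam₀ T n j

/-- The second component after `m` time steps, started from `0` at time `-2T`. -/
def vSteps (μ : ℝ) (lam₀ : ℚ) (T : ℕ) (g : ℝ → ℝ) : ℕ → ℤ → ℝ
  | 0, _ => 0
  | m + 1, j =>
      1 / 2 * vSteps μ lam₀ T g m (j - 1) + (1 - 1 / 2) * vSteps μ lam₀ T g m j
        - (g (uGrid μ lam₀ T (-2 * T + m) j) - g (uGrid μ lam₀ T (-2 * T + m) (j - 1)))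

/-- Grid values `v^n_j` for `n ≥ -2T`. -/
def vGrid (μ : ℝ) (lam₀ : ℚ) (T : ℕ) (g : ℝ → ℝ) (n j : ℤ) : ℝ :=
  vSteps μ lam₀ T g (n + 2 * T).toNat j

/-- `V(j) = v^1_{j+1}`. -/
def V (μ : ℝ) (lam₀ : ℚ) (T : ℕ) (g : ℝ → ℝ) (j : ℤ) : ℝ := vGrid μ lam₀ T g 1 (j + 1)

/-- Total variation of `V` over the integers `j` with `-T ≤ j ≤ -√T`. -/
def totVar (μ : ℝ) (lam₀ : ℚ) (T : ℕ) (g : ℝ → ℝ) : ℝ≥0∞ :=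
  eVariationOn (V μ lam₀ T g) {j : ℤ | -(T : ℝ) ≤ (j : ℝ) ∧ (j : ℝ) ≤ -√(T : ℝ)}

/-- The times `T` for which all speeds of the shock curve lie below `1`. -/
def AdmissibleTime (lam₀ : ℚ) (T : ℕ) : Prop := 1 ≤ T ∧ (lam₀ : ℝ) + 1 / √(√(T : ℝ)) < 1

/-- The left state of the shock of constant speed `lam₀`. -/
def kappa₀ (μ : ℝ) (lam₀ : ℚ) : ℝ := phi μ lam₀

/-- The constant `c₀ = 2 √(π / κ₀)`. -/
def c₀ (μ : ℝ) (lam₀ : ℚ) : ℝ := 2 * √(Real.pi / kappa₀ μ lam₀)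

/-- The asymptotic displacement of the `a`-level curve of `u` from `gamma`, for `0 < a < κ₀`:
`-y`, where `y` solves `ln ((1 + c₀ e^(κ₀ (y + 1))) / (1 + c₀ e^(κ₀ y))) = a`. -/
def c (μ : ℝ) (lam₀ : ℚ) (a : ℝ) : ℝ :=
  -(1 / kappa₀ μ lam₀) * Real.log ((Real.exp a - 1) /
    (c₀ μ lam₀ * (Real.exp (kappa₀ μ lam₀) - Real.exp a)))

def beta (lam₀ : ℚ) : ℝ := (lam₀ : ℝ) - 1 / 2

/-- `π(σ; z)`, where `q` is the denominator of `lam₀` in lowest terms. -/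
def littlePi (μ : ℝ) (lam₀ : ℚ) (g : ℝ → ℝ) (σ z : ℝ) : ℝ :=
  ∫ ξ in Ioi (0 : ℝ), deriv g ξ *
    Int.fract (lam₀.den * c μ lam₀ ξ + z + lam₀.den * (σ - √8) / (√2 * beta lam₀))

/-- The `1`-periodic function `Π(z)`. -/
def bigPi (μ : ℝ) (lam₀ : ℚ) (g : ℝ → ℝ) (z : ℝ) : ℝ :=
  ∫ σ : ℝ, (2 * σ ^ 2 - 1) * Real.exp (-σ ^ 2) * littlePi μ lam₀ g σ z

/-- `z_j = 2 q √(j / β)`. -/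
def zSeq (lam₀ : ℚ) (j : ℕ) : ℝ := 2 * lam₀.den * √(j / beta lam₀)

/-- `g` is smooth with compact support, and on the half line `ξ ≥ 0` its derivative lives on a
compact part of the interval `(0, κ₀)` of levels `ξ` for which `c(ξ)` is defined. -/
def AdmissibleFlux (μ : ℝ) (lam₀ : ℚ) (g : ℝ → ℝ) : Prop :=
  ContDiff ℝ ∞ g ∧ HasCompactSupport g ∧
    ∃ a b : ℝ, 0 < a ∧ b < kappa₀ μ lam₀ ∧ ∀ ξ, 0 ≤ ξ → deriv g ξ ≠ 0 → ξ ∈ Icc a b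

def AssumptionA (μ : ℝ) (lam₀ : ℚ) (g : ℝ → ℝ) : Prop :=
  AdmissibleFlux μ lam₀ g ∧ ∃ z, bigPi μ lam₀ g z ≠ 0

end

end GodunovTV

namespace GodunovTV

/-! ### The flux and the left states -/

/-! The first component is exactly solvable. The discrete Cole–Hopf transform turns the scheme for
`u` into the linear recursion z(t+1,x) = μ z(t,x-1) + ν z(t,x), which an exponential e^{-b(x-st)}
solves when s = f(b)/b. The function `z` superposes the waves that travel along the tangent lines of
γ. After τ = -ρ⁴ the weight disappears, and at the point γ(-s) + y the exponent of the wave with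
parameter ρ is minus its rate times y + (ρ - √s/ρ)². The Cauchy–Schlömilch substitution evaluates
the limiting Gaussian integral as c₀e^{-κ₀y}, independently of s. Hence near the shock `u` is a
fixed profile of x - γ(-s) up to O(1/√s) (`exists_abs_zInt_sub_le`, `exists_abs_u_sub_profile_le`),
and `c` is the inverse of that profile.

The second component is treated by duality. Transposing its scheme writes the pairing of the
increments of `V` with a test function ψ as a sum over past times -m of source increments paired
with increments of `avg^[m] ψ` (`tsum_mul_V`). The source lives in the shock layer, so Taylor
expansion at the shock (`exists_norm_slice_sub_le`) leaves two kinds of terms. Those with constant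
coefficients cancel in the sum over time (`exists_norm_sum_avg_le`). The other is ψ'' times
`moment`, a 1-periodic function of the shock position λ₀m + 2√m. This is the effect of the lattice:
over q steps λ₀m changes by an integer, and only the slow phase 2√m is left.

The packet χ(y/A)e^{iw√y} with w = `freq lam₀ k` resonates with the mode kq of `moment`. Transport
by binomial averages multiplies it by a Gaussian factor (`exists_norm_avg_packet_le`), and this
factor times the Fourier coefficient of `moment` is, up to a phase and a constant, the k-th Fourier
coefficient of Π (`exists_norm_tsum_V_sub_le`); everything nonresonant averages out. A trigonometric
polynomial imitating the sign of Π then forces a variation of at least const·∫|Π| on each block [A,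
2A], with an error that is small once A is large compared with T^{2/3} (`exists_block_le`). The
dyadic blocks between T^{3/4} and a fixed fraction of T make up about a quarter of all dyadic
scales, whence growth like ln T (`exists_log_le_totVar`).

The lower bound through Π follows from the logarithmic one: z_j is a multiple of √j, so |Π(z_j)|
averages to ∫|Π| with weights 1/j, and the sum of |Π(z_j)|/j is at most ∫|Π| ln T + O(1)
(`exists_sum_abs_bigPi_le`). -/

lemma flux_arg_pos {μ : ℝ} (h0 : 0 < μ) (h1 : μ < 1) (b : ℝ) :
    0 < (1 - μ) + μ * Real.exp b := by
  have := Real.exp_pos b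
  have : 0 < μ * Real.exp b := by positivity
  linarith

lemma flux_zero (μ : ℝ) : flux μ 0 = 0 := by simp [flux]

lemma hasDerivAt_flux {μ : ℝ} (h0 : 0 < μ) (h1 : μ < 1) (b : ℝ) :
    HasDerivAt (flux μ) (μ * Real.exp b / ((1 - μ) + μ * Real.exp b)) b := by
  have h : HasDerivAt (fun b => (1 - μ) + μ * Real.exp b) (μ * Real.exp b) b :=
    ((Real.hasDerivAt_exp b).const_mul μ).const_add (1 - μ)
  exact h.log (flux_arg_pos h0 h1 b).ne'

lemma deriv_flux_strictMono {μ : ℝ} (h0 : 0 < μ) (h1 : μ < 1) :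
    StrictMono (fun b : ℝ => μ * Real.exp b / ((1 - μ) + μ * Real.exp b)) := by
  intro a b hab
  have ha := flux_arg_pos h0 h1 a
  have hb := flux_arg_pos h0 h1 b
  have he := Real.exp_lt_exp.2 hab
  simp only
  rw [div_lt_div_iff₀ ha hb]
  have : (1 - μ) * (μ * Real.exp a) < (1 - μ) * (μ * Real.exp b) := by
    have : 0 < 1 - μ := by linarith
    gcongr
  nlinarith

lemma strictConvexOn_flux {μ : ℝ} (h0 : 0 < μ) (h1 : μ < 1) :
    StrictConvexOn ℝ univ (flux μ) := by
  apply StrictMonoOn.strictConvexOn_of_deriv convex_univ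
  · exact fun b _ => (hasDerivAt_flux h0 h1 b).continuousAt.continuousWithinAt
  · rw [interior_univ]
    intro a _ b _ hab
    rw [(hasDerivAt_flux h0 h1 a).deriv, (hasDerivAt_flux h0 h1 b).deriv]
    exact deriv_flux_strictMono h0 h1 hab

lemma shockSpeed_strictMonoOn {μ : ℝ} (h0 : 0 < μ) (h1 : μ < 1) :
    StrictMonoOn (shockSpeed μ) (Ioi 0) := by
  intro a ha b hb hab
  have := (strictConvexOn_flux h0 h1).secant_strict_mono (a := 0) (mem_univ _) (mem_univ _)
    (mem_univ _) (ne_of_gt ha) (ne_of_gt hb) hab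
  simpa [flux_zero, shockSpeed] using this

/-- The secant slope f(b)/b tends to f'(0) = μ as b → 0+, and f(b) ≥ ln μ + b pushes it above any s
< 1 for large b; the intermediate value theorem does the rest. -/
lemma exists_shockSpeed_eq {μ s : ℝ} (h0 : 0 < μ) (h1 : μ < 1) (hs : μ < s) (hs1 : s < 1) :
    ∃ b ∈ Ioi (0 : ℝ), shockSpeed μ b = s := by
  have hd : HasDerivAt (flux μ) μ 0 := by simpa using hasDerivAt_flux h0 h1 0
  have hev : ∀ᶠ b in 𝓝[>] (0 : ℝ), shockSpeed μ b < s := by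
    have h := hasDerivAt_iff_tendsto_slope.1 hd
    have h2 := h.mono_left (nhdsWithin_mono (0 : ℝ) (fun x (hx : x ∈ Ioi 0) => ne_of_gt hx))
    filter_upwards [h2.eventually (gt_mem_nhds hs)] with b hb
    simpa [slope_def_field, flux_zero, shockSpeed] using hb
  obtain ⟨a, ha, ha0⟩ := (hev.and self_mem_nhdsWithin).exists
  set B := max a ((-Real.log μ) / (1 - s) + 1)
  have hB0 : 0 < B := lt_of_lt_of_le ha0 (le_max_left _ _)
  have hB : s < shockSpeed μ B := by
    have h2 : (-Real.log μ) / (1 - s) < B :=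
      lt_of_lt_of_le (lt_add_one _) (le_max_right _ _)
    rw [div_lt_iff₀ (by linarith)] at h2
    have h3 : Real.log μ + B ≤ flux μ B := by
      rw [flux, show Real.log μ + B = Real.log (μ * Real.exp B) by
        rw [Real.log_mul h0.ne' (Real.exp_ne_zero _), Real.log_exp]]
      exact Real.log_le_log (by positivity) (by linarith)
    rw [shockSpeed, lt_div_iff₀ hB0]
    linarith
  have hcont : ContinuousOn (shockSpeed μ) (Icc a B) := by
    intro b hb
    have hb0 : (0 : ℝ) < b := lt_of_lt_of_le ha0 hb.1
    exact ((hasDerivAt_flux h0 h1 b).continuousAt.div continuousAt_id hb0.ne').continuousWithinAt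
  obtain ⟨b, hb, hbs⟩ := intermediate_value_Icc (le_max_left _ _) hcont ⟨ha.le, hB.le⟩
  exact ⟨b, lt_of_lt_of_le ha0 hb.1, hbs⟩

section phi
variable {μ s s' : ℝ} (h0 : 0 < μ) (h1 : μ < 1)
include h0 h1

lemma phi_pos (hs : μ < s) (hs1 : s < 1) : 0 < phi μ s :=
  Function.invFunOn_mem (exists_shockSpeed_eq h0 h1 hs hs1)

lemma shockSpeed_phi (hs : μ < s) (hs1 : s < 1) : shockSpeed μ (phi μ s) = s :=
  Function.invFunOn_eq (exists_shockSpeed_eq h0 h1 hs hs1)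

lemma flux_phi (hs : μ < s) (hs1 : s < 1) : flux μ (phi μ s) = s * phi μ s := by
  have h := shockSpeed_phi h0 h1 hs hs1
  rwa [shockSpeed, div_eq_iff (phi_pos h0 h1 hs hs1).ne'] at h

/-- This dispersion relation is what makes the exponential wave of speed s and rate `phi μ s` solve
the linear recursion for `z`. -/
lemma exp_phi (hs : μ < s) (hs1 : s < 1) :
    Real.exp (s * phi μ s) = (1 - μ) + μ * Real.exp (phi μ s) := by
  rw [← flux_phi h0 h1 hs hs1, flux, Real.exp_log (flux_arg_pos h0 h1 _)]

lemma phi_strictMono (hs : μ < s) (hss : s < s') (hs1 : s' < 1) : phi μ s < phi μ s' := by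
  have ha := phi_pos h0 h1 hs (hss.trans hs1)
  have hb := phi_pos h0 h1 (hs.trans hss) hs1
  rw [← (shockSpeed_strictMonoOn h0 h1).lt_iff_lt ha hb,
    shockSpeed_phi h0 h1 hs (hss.trans hs1), shockSpeed_phi h0 h1 (hs.trans hss) hs1]
  exact hss

lemma phi_mono (hs : μ < s) (hss : s ≤ s') (hs1 : s' < 1) : phi μ s ≤ phi μ s' := by
  rcases hss.eq_or_lt with rfl | h
  · exact le_rfl
  · exact (phi_strictMono h0 h1 hs h hs1).le

/-- The slope of the tangent exceeds the slope of the secant. -/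
lemma lt_deriv_flux (hs : μ < s) (hs1 : s < 1) :
    s < μ * Real.exp (phi μ s) / ((1 - μ) + μ * Real.exp (phi μ s)) := by
  have hp := phi_pos h0 h1 hs hs1
  have h := (strictConvexOn_flux h0 h1).slope_lt_of_hasDerivAt (x := 0) (y := phi μ s)
    (mem_univ _) (mem_univ _) hp (hasDerivAt_flux h0 h1 _)
  have h2 := shockSpeed_phi h0 h1 hs hs1
  rw [slope_def_field, flux_zero, sub_zero, sub_zero] at h
  rw [shockSpeed] at h2
  rwa [h2] at h

/-- The tangent to f at `phi μ s` has slope d > s. Convexity gives d(φ(r) - φ(s)) ≤ rφ(r) - sφ(s),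
that is (d - s)(φ(r) - φ(s)) ≤ (r - s)φ(r), so no derivative of the inverse function is needed. -/
lemma exists_phi_lipschitz (hs : μ < s) (hss : s < s') (hs1 : s' < 1) :
    ∃ L > 0, ∀ r ∈ Icc s s', phi μ r - phi μ s ≤ L * (r - s) := by
  set d := μ * Real.exp (phi μ s) / ((1 - μ) + μ * Real.exp (phi μ s))
  have hd : s < d := lt_deriv_flux h0 h1 hs (hss.trans hs1)
  have hpos := phi_pos h0 h1 (hs.trans hss) hs1
  refine ⟨phi μ s' / (d - s), div_pos hpos (by linarith), fun r hr => ?_⟩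
  have hr1 := lt_of_le_of_lt hr.2 hs1
  have hr0 := lt_of_lt_of_le hs hr.1
  have hm := phi_mono h0 h1 hs hr.1 hr1
  have hm' := phi_mono h0 h1 hr0 hr.2 hs1
  have ht : d * (phi μ r - phi μ s) ≤ flux μ (phi μ r) - flux μ (phi μ s) := by
    rcases hm.eq_or_lt with h | h
    · rw [h]; simp
    · have h3 := (strictConvexOn_flux h0 h1).convexOn.le_slope_of_hasDerivAt (mem_univ _)
        (mem_univ _) h (hasDerivAt_flux h0 h1 _)
      rw [slope_def_field, le_div_iff₀ (by linarith)] at h3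
      exact h3
  rw [flux_phi h0 h1 hr0 hr1, flux_phi h0 h1 hs (hss.trans hs1)] at ht
  rw [div_mul_eq_mul_div, le_div_iff₀ (by linarith)]
  have : phi μ r * (r - s) ≤ phi μ s' * (r - s) :=
    mul_le_mul_of_nonneg_right hm' (by linarith [hr.1])
  nlinarith

end phi

end GodunovTV

namespace GodunovTV

/-! ### The superposition of travelling waves in the variable `ρ = (-τ)^(1/4)` -/

/-- The range of the parameters. -/
structure Params (μ : ℝ) (lam₀ : ℚ) : Prop where
  half_lt : 1 / 2 < μ
  lt_lam : μ < lam₀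
  lam_lt : (lam₀ : ℝ) < 1

namespace Params
variable {μ : ℝ} {lam₀ : ℚ} (hp : Params μ lam₀)
include hp
lemma pos : 0 < μ := by linarith [hp.half_lt]
lemma lt_one : μ < 1 := hp.lt_lam.trans hp.lam_lt
lemma lam_pos : 0 < (lam₀ : ℝ) := hp.pos.trans hp.lt_lam
lemma kappa₀_pos : 0 < kappa₀ μ lam₀ := phi_pos hp.pos hp.lt_one hp.lt_lam hp.lam_lt
lemma beta_pos : 0 < beta lam₀ := by
  have h1 := hp.half_lt
  have h2 := hp.lt_lam
  unfold beta
  linarith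
lemma beta_lt : beta lam₀ < 1 / 2 := by
  have h2 := hp.lam_lt
  unfold beta
  linarith
end Params

noncomputable section

/-- The eighth root of `T`; the tangent lines to `gamma` at `-ρ⁴` coincide for smaller `ρ`. -/
def root8 (T : ℕ) : ℝ := √(√(√(T : ℝ)))

/-- The cut-off of the parameter `ρ` from below. -/
def cut (T : ℕ) (ρ : ℝ) : ℝ := max ρ (root8 T)

/-- The decay rate of the travelling wave of speed `lam₀ + 1 / p²`. -/
def rate (μ : ℝ) (lam₀ : ℚ) (p : ℝ) : ℝ := phi μ (lam₀ + 1 / p ^ 2)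

/-- The tangent line to `lam₀ t - 2 √(-t)` at `t = -p⁴`. -/
def line (lam₀ : ℚ) (p t : ℝ) : ℝ := lam₀ * t + t / p ^ 2 - p ^ 2

/-- The fourth root of `2 T`. -/
def rMax (T : ℕ) : ℝ := √(√(2 * (T : ℝ)))

/-- The nonconstant part of `z`. -/
def zInt (μ : ℝ) (lam₀ : ℚ) (T : ℕ) (t x : ℝ) : ℝ :=
  ∫ ρ in Ioo 0 (rMax T), 4 * Real.exp (-rate μ lam₀ (cut T ρ) * (x - line lam₀ (cut T ρ) t))

end

lemma sqrt_pow_four {r : ℝ} : √(r ^ 4) = r ^ 2 := by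
  rw [show r ^ 4 = (r ^ 2) ^ 2 by ring, Real.sqrt_sq (by positivity)]

lemma root8_sq (T : ℕ) : root8 T ^ 2 = √(√(T : ℝ)) := Real.sq_sqrt (Real.sqrt_nonneg _)

lemma root8_pow_four (T : ℕ) : root8 T ^ 4 = √(T : ℝ) := by
  rw [show root8 T ^ 4 = (root8 T ^ 2) ^ 2 by ring, root8_sq, Real.sq_sqrt (Real.sqrt_nonneg _)]

lemma rMax_pow_four (T : ℕ) : rMax T ^ 4 = 2 * T := by
  rw [rMax, show √(√(2 * (T : ℝ))) ^ 4 = (√(√(2 * (T : ℝ))) ^ 2) ^ 2 by ring,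
    Real.sq_sqrt (Real.sqrt_nonneg _), Real.sq_sqrt (by positivity)]

lemma rMax_nonneg (T : ℕ) : 0 ≤ rMax T := Real.sqrt_nonneg _

namespace AdmissibleTime
variable {lam₀ : ℚ} {T : ℕ} (hT : AdmissibleTime lam₀ T)
include hT
lemma root8_pos : 0 < root8 T := by
  have : (0 : ℝ) < T := by exact_mod_cast hT.1
  unfold root8
  positivity
lemma rMax_pos : 0 < rMax T := by
  have : (0 : ℝ) < T := by exact_mod_cast hT.1
  unfold rMax
  positivity
lemma cut_pos (ρ : ℝ) : 0 < cut T ρ := lt_of_lt_of_le hT.root8_pos (le_max_right _ _)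

lemma speed_lt (ρ : ℝ) : (lam₀ : ℝ) + 1 / cut T ρ ^ 2 < 1 := by
  have h := hT.2
  rw [← root8_sq] at h
  have : 1 / cut T ρ ^ 2 ≤ 1 / root8 T ^ 2 := by
    have := hT.root8_pos
    have : root8 T ≤ cut T ρ := le_max_right _ _
    gcongr
  linarith
lemma lt_speed (ρ : ℝ) : (lam₀ : ℝ) < (lam₀ : ℝ) + 1 / cut T ρ ^ 2 := by
  have := hT.cut_pos ρ
  have : 0 < 1 / cut T ρ ^ 2 := by positivity
  linarith
end AdmissibleTime

/-! ### The tangent lines of the shock curve and the change of variable τ = -ρ⁴. -/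

lemma hasDerivAt_gamma_of_lt {lam₀ : ℚ} {T : ℕ} {t : ℝ} (h : t < -√(T : ℝ)) :
    HasDerivAt (gamma lam₀ T) (lam₀ + 1 / √(-t)) t := by
  have ht : 0 < -t := by linarith [Real.sqrt_nonneg (T : ℝ)]
  have h1 : HasDerivAt (fun t : ℝ => (lam₀ : ℝ) * t - 2 * √(-t)) (lam₀ + 1 / √(-t)) t := by
    have h2 := ((hasDerivAt_id t).const_mul (lam₀ : ℝ)).sub
      (((hasDerivAt_id t).neg.sqrt ht.ne').const_mul 2)
    convert! h2 using 1
    have := Real.sqrt_pos.2 ht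
    simp only [Pi.neg_apply, id]
    field_simp
    ring
  apply h1.congr_of_eventuallyEq
  filter_upwards [gt_mem_nhds h] with r hr
  simp [gamma, hr]

lemma hasDerivAt_gamma_of_gt {lam₀ : ℚ} {T : ℕ} {t : ℝ} (h : -√(T : ℝ) < t) :
    HasDerivAt (gamma lam₀ T) (lam₀ + 1 / √(√(T : ℝ))) t := by
  have h1 : HasDerivAt (fun t : ℝ => (lam₀ * (-√(T : ℝ)) - 2 * √(√(T : ℝ))) +
      (lam₀ + 1 / √(√(T : ℝ))) * (t + √(T : ℝ))) (lam₀ + 1 / √(√(T : ℝ))) t := by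
    simpa using (((hasDerivAt_id t).add_const (√(T : ℝ))).const_mul
      ((lam₀ : ℝ) + 1 / √(√(T : ℝ)))).const_add (lam₀ * (-√(T : ℝ)) - 2 * √(√(T : ℝ)))
  apply h1.congr_of_eventuallyEq
  filter_upwards [lt_mem_nhds h] with r hr
  simp [gamma, hr.le]

/-- The junction point -√T of the two pieces of γ corresponds to ρ = `root8 T`. It may be left out,
since the formula is only used under an integral in ρ. -/
lemma deriv_gamma_eq {lam₀ : ℚ} {T : ℕ} {ρ : ℝ} (hρ : 0 < ρ) (hne : ρ ≠ root8 T) :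
    deriv (gamma lam₀ T) (-ρ ^ 4) = lam₀ + 1 / cut T ρ ^ 2 := by
  have h8 : 0 ≤ root8 T := Real.sqrt_nonneg _
  rcases lt_or_gt_of_ne hne with h | h
  · have h4 : -√(T : ℝ) < -ρ ^ 4 := by
      rw [← root8_pow_four]
      have := pow_lt_pow_left₀ h hρ.le (by norm_num : 4 ≠ 0)
      linarith
    rw [(hasDerivAt_gamma_of_gt h4).deriv, cut, max_eq_right h.le, root8_sq]
  · have h4 : -ρ ^ 4 < -√(T : ℝ) := by
      rw [← root8_pow_four]
      have := pow_lt_pow_left₀ h h8 (by norm_num : 4 ≠ 0)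
      linarith
    rw [(hasDerivAt_gamma_of_lt h4).deriv, cut, max_eq_left h.le, neg_neg, sqrt_pow_four]

/-- For ρ below `root8 T` the point -ρ⁴ lies on the straight continuation, which is the tangent line
with p = `root8 T`; this is the reason for `cut`. -/
lemma tangent_gamma_eq {lam₀ : ℚ} {T : ℕ} (hT : AdmissibleTime lam₀ T) {ρ : ℝ} (hρ : 0 < ρ)
    (hne : ρ ≠ root8 T) (t : ℝ) :
    gamma lam₀ T (-ρ ^ 4) + deriv (gamma lam₀ T) (-ρ ^ 4) * (t - -ρ ^ 4) =
      line lam₀ (cut T ρ) t := by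
  have h8 := hT.root8_pos
  rw [deriv_gamma_eq hρ hne]
  rcases lt_or_gt_of_ne hne with h | h
  · have h4 : ¬ (-ρ ^ 4 < -√(T : ℝ)) := by
      rw [← root8_pow_four]
      have := pow_lt_pow_left₀ h hρ.le (by norm_num : 4 ≠ 0)
      linarith
    rw [cut, max_eq_right h.le, gamma, if_neg h4, ← root8_pow_four, sqrt_pow_four, line]
    field_simp
    ring
  · have h4 : -ρ ^ 4 < -√(T : ℝ) := by
      rw [← root8_pow_four]
      have := pow_lt_pow_left₀ h h8.le (by norm_num : 4 ≠ 0)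
      linarith
    rw [cut, max_eq_left h.le, gamma, if_pos h4, neg_neg, sqrt_pow_four, line]
    field_simp
    ring

lemma image_neg_pow_four {T : ℕ} :
    (fun ρ : ℝ => -ρ ^ 4) '' Ioo 0 (rMax T) = Ioo (-2 * (T : ℝ)) 0 := by
  ext τ
  constructor
  · rintro ⟨ρ, ⟨h1, h2⟩, rfl⟩
    have h := pow_lt_pow_left₀ h2 h1.le (by norm_num : 4 ≠ 0)
    rw [rMax_pow_four] at h
    have : 0 < ρ ^ 4 := by positivity
    constructor <;> simp only <;> linarith
  · rintro ⟨h1, h2⟩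
    have h3 : 0 < √(√(-τ)) := Real.sqrt_pos.2 (Real.sqrt_pos.2 (by linarith))
    refine ⟨√(√(-τ)), ⟨h3, ?_⟩, ?_⟩
    · apply Real.sqrt_lt_sqrt (Real.sqrt_nonneg _)
      apply Real.sqrt_lt_sqrt (by linarith)
      linarith
    · simp only
      rw [show √(√(-τ)) ^ 4 = (√(√(-τ)) ^ 2) ^ 2 by ring,
        Real.sq_sqrt (Real.sqrt_nonneg _), Real.sq_sqrt (by linarith), neg_neg]

/-- The Jacobian 4ρ³ cancels the weight (-τ)^{-3/4} = ρ^{-3}, so the waves are superposed uniformly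
in ρ. -/
lemma z_eq {μ : ℝ} {lam₀ : ℚ} {T : ℕ} (hT : AdmissibleTime lam₀ T) (t x : ℝ) :
    z μ lam₀ T t x = 1 + zInt μ lam₀ T t x := by
  rw [z, zInt, intervalIntegral.integral_of_le (by have := T.cast_nonneg (α := ℝ); linarith),
    MeasureTheory.integral_Ioc_eq_integral_Ioo, ← image_neg_pow_four,
    MeasureTheory.integral_image_eq_integral_abs_deriv_smul measurableSet_Ioo
      (f' := fun ρ => -(4 * ρ ^ 3))]
  · congr 1
    apply MeasureTheory.integral_congr_ae
    have hne : ∀ᵐ ρ : ℝ ∂(MeasureTheory.volume.restrict (Ioo 0 (rMax T))), ρ ≠ root8 T :=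
      MeasureTheory.ae_restrict_of_ae (MeasureTheory.Measure.ae_ne _ _)
    filter_upwards [hne, MeasureTheory.ae_restrict_mem measurableSet_Ioo] with ρ h1 h2
    have hρ : 0 < ρ := h2.1
    have e1 : uMinus μ lam₀ T (-ρ ^ 4) = rate μ lam₀ (cut T ρ) := by
      rw [uMinus, deriv_gamma_eq hρ h1, rate]
    have e2 : x - gamma lam₀ T (-ρ ^ 4) - deriv (gamma lam₀ T) (-ρ ^ 4) * (t - -ρ ^ 4) =
        x - line lam₀ (cut T ρ) t := by
      rw [← tangent_gamma_eq hT hρ h1]; ring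
    have e3 : (- -ρ ^ 4) ^ (-(3 / 4) : ℝ) = (ρ ^ 3)⁻¹ := by
      rw [neg_neg, ← Real.rpow_natCast ρ 4, ← Real.rpow_mul hρ.le, ← Real.rpow_natCast ρ 3,
        ← Real.rpow_neg hρ.le]
      norm_num
    rw [e1, e2, e3, smul_eq_mul, abs_neg, abs_of_pos (by positivity)]
    field_simp
  · intro ρ _
    have h := ((hasDerivAt_pow 4 ρ).neg).hasDerivWithinAt (s := Ioo 0 (rMax T))
    convert! h using 1
  · intro a ha b hb hab
    simp only [neg_inj] at hab
    exact (pow_left_inj₀ ha.1.le hb.1.le (by norm_num)).1 hab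

end GodunovTV

namespace GodunovTV

/-! ### Monotonicity of the explicit solution -/

lemma continuous_line_cut {lam₀ : ℚ} {T : ℕ} (hT : AdmissibleTime lam₀ T) (t : ℝ) : Continuous (fun ρ => line lam₀ (cut T ρ) t) := by
  have h : Continuous (cut T) := continuous_id.max continuous_const
  unfold line
  exact ((continuous_const).add (continuous_const.div (h.pow 2)
    (fun ρ => (pow_pos (hT.cut_pos ρ) 2).ne'))).sub (h.pow 2)

lemma setIntegral_wave_pos {lam₀ : ℚ} {T : ℕ} (hT : AdmissibleTime lam₀ T) {f : ℝ → ℝ} (hf : MeasureTheory.IntegrableOn f (Ioo 0 (rMax T)))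
    (hpos : ∀ ρ ∈ Ioo 0 (rMax T), 0 < f ρ) : 0 < ∫ ρ in Ioo 0 (rMax T), f ρ := by
  rw [MeasureTheory.setIntegral_pos_iff_support_of_nonneg_ae _ hf]
  · have : Function.support f ∩ Ioo 0 (rMax T) = Ioo 0 (rMax T) :=
      inter_eq_right.2 fun ρ hρ => (hpos ρ hρ).ne'
    rw [this]
    simp [hT.rMax_pos]
  · filter_upwards [MeasureTheory.ae_restrict_mem measurableSet_Ioo] with ρ hρ
    exact (hpos ρ hρ).le

section wave
variable {μ : ℝ} {lam₀ : ℚ} {T : ℕ} (hp : Params μ lam₀) (hT : AdmissibleTime lam₀ T)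
include hp hT

lemma kappa₀_lt_rate (ρ : ℝ) : kappa₀ μ lam₀ < rate μ lam₀ (cut T ρ) :=
  phi_strictMono hp.pos hp.lt_one hp.lt_lam (hT.lt_speed ρ) (hT.speed_lt ρ)

lemma rate_cut_pos (ρ : ℝ) : 0 < rate μ lam₀ (cut T ρ) :=
  hp.kappa₀_pos.trans (kappa₀_lt_rate hp hT ρ)

lemma rate_cut_antitone : Antitone (fun ρ => rate μ lam₀ (cut T ρ)) := by
  intro ρ ρ' h
  refine phi_mono hp.pos hp.lt_one (hp.lt_lam.trans (hT.lt_speed ρ')) ?_ (hT.speed_lt ρ)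
  have h1 := hT.cut_pos ρ
  have : cut T ρ ≤ cut T ρ' := max_le_max h le_rfl
  gcongr

lemma rate_cut_le (ρ : ℝ) : rate μ lam₀ (cut T ρ) ≤ rate μ lam₀ (root8 T) := by
  have h := rate_cut_antitone hp hT (min_le_left ρ (root8 T))
  simpa only [show cut T (min ρ (root8 T)) = root8 T from max_eq_right (min_le_right _ _)] using h

/-- The integrand is bounded on a finite interval; measurability of the rate comes from its
monotonicity. -/
lemma integrableOn_wave (t x : ℝ) : MeasureTheory.IntegrableOn
    (fun ρ => 4 * Real.exp (-rate μ lam₀ (cut T ρ) * (x - line lam₀ (cut T ρ) t)))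
    (Ioo 0 (rMax T)) := by
  have hc := continuous_line_cut hT t
  obtain ⟨B, hB⟩ := (isCompact_Icc (a := (0 : ℝ)) (b := rMax T)).exists_bound_of_continuousOn
    (f := fun ρ => x - line lam₀ (cut T ρ) t) (continuous_const.sub hc).continuousOn
  refine MeasureTheory.Measure.integrableOn_of_bounded (M := 4 * Real.exp
    (rate μ lam₀ (root8 T) * B)) (by simp) ?_ ?_
  · apply Measurable.aestronglyMeasurable
    have h1 := (rate_cut_antitone hp hT).measurable
    have h2 := hc.measurable
    fun_prop
  · filter_upwards [MeasureTheory.ae_restrict_mem measurableSet_Ioo] with ρ hρ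
    have h1 := hB ρ ⟨hρ.1.le, hρ.2.le⟩
    have h2 := rate_cut_le hp hT ρ
    have h3 := rate_cut_pos hp hT ρ
    rw [Real.norm_eq_abs, abs_of_pos (by positivity)]
    gcongr 4 * Real.exp ?_
    rw [Real.norm_eq_abs] at h1
    calc -rate μ lam₀ (cut T ρ) * (x - line lam₀ (cut T ρ) t)
        ≤ rate μ lam₀ (cut T ρ) * |x - line lam₀ (cut T ρ) t| := by
          nlinarith [neg_abs_le (x - line lam₀ (cut T ρ) t)]
      _ ≤ _ := by
          have := h3.le.trans h2
          gcongr

lemma zInt_pos (t x : ℝ) : 0 < zInt μ lam₀ T t x :=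
  setIntegral_wave_pos hT (integrableOn_wave hp hT t x) fun ρ _ => by positivity

lemma z_pos (t x : ℝ) : 0 < z μ lam₀ T t x := by
  rw [z_eq hT]
  linarith [zInt_pos hp hT t x]

/-- Each single wave satisfies the recursion by `exp_phi`, and the recursion is linear. -/
lemma zInt_step (t x : ℝ) : zInt μ lam₀ T (t + 1) x =
    μ * zInt μ lam₀ T t (x - 1) + (1 - μ) * zInt μ lam₀ T t x := by
  simp only [zInt]
  rw [← MeasureTheory.integral_const_mul, ← MeasureTheory.integral_const_mul,
    ← MeasureTheory.integral_add ((integrableOn_wave hp hT t (x - 1)).const_mul μ)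
      ((integrableOn_wave hp hT t x).const_mul (1 - μ))]
  congr 1
  ext ρ
  have h := exp_phi hp.pos hp.lt_one (hp.lt_lam.trans (hT.lt_speed ρ)) (hT.speed_lt ρ)
  set b := rate μ lam₀ (cut T ρ) with hb
  change Real.exp (_ * b) = 1 - μ + μ * Real.exp b at h
  have e1 : -b * (x - line lam₀ (cut T ρ) (t + 1)) =
      -b * (x - line lam₀ (cut T ρ) t) + (lam₀ + 1 / cut T ρ ^ 2) * b := by
    simp only [line]; ring
  have e2 : -b * (x - 1 - line lam₀ (cut T ρ) t) =
      -b * (x - line lam₀ (cut T ρ) t) + b := by ring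
  rw [e1, e2, Real.exp_add, Real.exp_add, h]
  ring

lemma z_step (t x : ℝ) : z μ lam₀ T (t + 1) x =
    z μ lam₀ T t x * ((1 - μ) + μ * Real.exp (u μ lam₀ T t x)) := by
  have h1 := z_pos hp hT t x
  rw [u, Real.exp_log (div_pos (z_pos hp hT _ _) h1)]
  field_simp
  simp only [z_eq hT, zInt_step hp hT]
  ring

lemma u_eq_sub (t x : ℝ) :
    u μ lam₀ T t x = Real.log (z μ lam₀ T t (x - 1)) - Real.log (z μ lam₀ T t x) := by
  rw [u, Real.log_div (z_pos hp hT _ _).ne' (z_pos hp hT _ _).ne']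

/-- Discrete Cole–Hopf: by `z_step`, ln z grows by f(u) in one step, and `u` is a spatial difference
of ln z. -/
lemma u_step (t x : ℝ) : u μ lam₀ T (t + 1) x =
    u μ lam₀ T t x - (flux μ (u μ lam₀ T t x) - flux μ (u μ lam₀ T t (x - 1))) := by
  have h := fun x => Real.log_mul (z_pos hp hT t x).ne'
    (flux_arg_pos hp.pos hp.lt_one (u μ lam₀ T t x)).ne'
  rw [u_eq_sub hp hT, z_step hp hT, z_step hp hT, h, h, flux, flux, u_eq_sub hp hT t x]
  ring

lemma zInt_mono_of_le {t t' x x' : ℝ} (h : ∀ ρ, x' - line lam₀ (cut T ρ) t' ≤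
    x - line lam₀ (cut T ρ) t) : zInt μ lam₀ T t x ≤ zInt μ lam₀ T t' x' := by
  apply MeasureTheory.setIntegral_mono_on (integrableOn_wave hp hT t x)
    (integrableOn_wave hp hT t' x') measurableSet_Ioo
  intro ρ _
  have := rate_cut_pos hp hT ρ
  have := h ρ
  gcongr 4 * Real.exp ?_
  nlinarith

lemma zInt_antitone (t : ℝ) : Antitone (zInt μ lam₀ T t) := fun x x' h =>
  zInt_mono_of_le hp hT fun ρ => by linarith

lemma zInt_mono_time (x : ℝ) : Monotone (fun t => zInt μ lam₀ T t x) := fun t t' h =>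
  zInt_mono_of_le hp hT fun ρ => by
    have h1 := hT.cut_pos ρ
    have h2 := hp.lam_pos
    have h3 : lam₀ * t ≤ lam₀ * t' := by gcongr
    have h4 : t / cut T ρ ^ 2 ≤ t' / cut T ρ ^ 2 := by gcongr
    simp only [line]
    linarith

/-- All decay rates lie between κ₀ and the rate at `root8 T`. This bound and the next one compare
`zInt` at two points with pure exponentials of these extreme rates. -/
lemma zInt_sub_le (t x : ℝ) {d : ℝ} (hd : 0 ≤ d) : zInt μ lam₀ T t (x - d) ≤
    Real.exp (rate μ lam₀ (root8 T) * d) * zInt μ lam₀ T t x := by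
  simp only [zInt]
  rw [← MeasureTheory.integral_const_mul]
  apply MeasureTheory.setIntegral_mono_on (integrableOn_wave hp hT _ _)
    ((integrableOn_wave hp hT _ _).const_mul _) measurableSet_Ioo
  intro ρ _
  have h1 := rate_cut_le hp hT ρ
  rw [mul_left_comm, ← Real.exp_add]
  gcongr 4 * Real.exp ?_
  nlinarith

lemma le_zInt_sub (t x : ℝ) {d : ℝ} (hd : 0 ≤ d) :
    Real.exp (kappa₀ μ lam₀ * d) * zInt μ lam₀ T t x ≤ zInt μ lam₀ T t (x - d) := by
  simp only [zInt]
  rw [← MeasureTheory.integral_const_mul]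
  apply MeasureTheory.setIntegral_mono_on ((integrableOn_wave hp hT _ _).const_mul _)
    (integrableOn_wave hp hT _ _) measurableSet_Ioo
  intro ρ _
  have h1 := kappa₀_lt_rate hp hT ρ
  rw [mul_left_comm, ← Real.exp_add]
  gcongr 4 * Real.exp ?_
  nlinarith

lemma one_lt_ratio (t x : ℝ) : 1 < z μ lam₀ T t (x - 1) / z μ lam₀ T t x := by
  rw [one_lt_div (z_pos hp hT t x), z_eq hT, z_eq hT]
  have h1 := le_zInt_sub hp hT t x zero_le_one
  have h2 := zInt_pos hp hT t x
  have h3 : 1 < Real.exp (kappa₀ μ lam₀ * 1) := by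
    rw [Real.one_lt_exp_iff]
    linarith [hp.kappa₀_pos]
  nlinarith

lemma u_pos (t x : ℝ) : 0 < u μ lam₀ T t x := Real.log_pos (one_lt_ratio hp hT t x)

lemma u_le (t x : ℝ) : u μ lam₀ T t x ≤ rate μ lam₀ (root8 T) := by
  rw [u, Real.log_le_iff_le_exp (by linarith [one_lt_ratio hp hT t x]),
    div_le_iff₀ (z_pos hp hT t x), z_eq hT, z_eq hT]
  have h1 := zInt_sub_le hp hT t x zero_le_one
  rw [mul_one] at h1
  have h2 : 1 ≤ Real.exp (rate μ lam₀ (root8 T)) := by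
    rw [Real.one_le_exp_iff]
    exact (rate_cut_pos hp hT 0).le.trans (rate_cut_le hp hT 0)
  linarith

/-- This is log-convexity of z, made strict by the constant mode. Let y = x + h, R = z(y-1)/z(y),
and let N be the nonconstant part of z. Each wave of rate b contributes a nonnegative multiple of
(e^b - R)(e^{bh} - R^h), whose factors have the same sign, so N(x-1) - R N(x) ≥ R^h (N(y-1) - R
N(y)). The last bracket is R - 1 > 0 and R^h > 1, hence z(x-1) > R z(x). -/
lemma u_strictAnti (t : ℝ) : StrictAnti (u μ lam₀ T t) := by
  intro x y hxy
  have hR := one_lt_ratio hp hT t y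
  have hRz : z μ lam₀ T t (y - 1) - z μ lam₀ T t (y - 1) / z μ lam₀ T t y * z μ lam₀ T t y = 0 := by
    rw [div_mul_cancel₀ _ (z_pos hp hT t y).ne', sub_self]
  refine Real.log_lt_log (by linarith) ?_
  set R := z μ lam₀ T t (y - 1) / z μ lam₀ T t y
  rw [lt_div_iff₀ (z_pos hp hT t x)]
  obtain ⟨h, rfl⟩ : ∃ h, y = x + h := ⟨y - x, by ring⟩
  have hh : 0 < h := by linarith
  have hRh : 1 < R ^ h := Real.one_lt_rpow hR hh
  have key : 0 ≤ (zInt μ lam₀ T t (x - 1) - R * zInt μ lam₀ T t x) -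
      R ^ h * (zInt μ lam₀ T t (x + h - 1) - R * zInt μ lam₀ T t (x + h)) := by
    simp only [zInt]
    have i1 := integrableOn_wave hp hT t (x - 1)
    have i2 := (integrableOn_wave hp hT t x).const_mul R
    have i3 := integrableOn_wave hp hT t (x + h - 1)
    have i4 := (integrableOn_wave hp hT t (x + h)).const_mul R
    rw [← MeasureTheory.integral_const_mul, ← MeasureTheory.integral_const_mul,
      ← MeasureTheory.integral_sub i1 i2, ← MeasureTheory.integral_sub i3 i4,
      ← MeasureTheory.integral_const_mul,
      ← MeasureTheory.integral_sub]
    rotate_left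
    · exact i1.sub i2
    · exact (i3.sub i4).const_mul _
    apply MeasureTheory.setIntegral_nonneg measurableSet_Ioo
    intro ρ _
    set b := rate μ lam₀ (cut T ρ)
    set l := line lam₀ (cut T ρ) t
    have e1 : -b * (x - 1 - l) = -b * (x + h - l) + b * h + b := by ring
    have e2 : -b * (x - l) = -b * (x + h - l) + b * h := by ring
    have e3 : -b * (x + h - 1 - l) = -b * (x + h - l) + b := by ring
    have e4 : Real.exp (b * h) = (Real.exp b) ^ h := Real.exp_mul b h
    rw [e1, e2, e3, Real.exp_add _ b, Real.exp_add _ (b * h), Real.exp_add _ b, e4]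
    have h5 : 0 ≤ (Real.exp b - R) * (Real.exp b ^ h - R ^ h) := by
      rcases le_total (Real.exp b) R with h6 | h6
      · exact mul_nonneg_of_nonpos_of_nonpos (by linarith)
          (by linarith [Real.rpow_le_rpow (Real.exp_pos b).le h6 hh.le])
      · exact mul_nonneg (by linarith)
          (by linarith [Real.rpow_le_rpow (by linarith) h6 hh.le])
    have h6 := mul_nonneg (Real.exp_pos (-b * (x + h - l))).le h5
    nlinarith
  rw [z_eq hT, z_eq hT] at hRz ⊢
  have h7 : zInt μ lam₀ T t (x + h - 1) - R * zInt μ lam₀ T t (x + h) = R - 1 := by linarith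
  rw [h7] at key
  nlinarith

lemma tendsto_zInt (t : ℝ) : Tendsto (zInt μ lam₀ T t) atTop (𝓝 0) := by
  have hk := hp.kappa₀_pos
  have h2 : Tendsto (fun x : ℝ => Real.exp (-(kappa₀ μ lam₀ * x)) * zInt μ lam₀ T t 0) atTop
      (𝓝 0) := by
    have h3 : Tendsto (fun x : ℝ => Real.exp (-(kappa₀ μ lam₀ * x))) atTop (𝓝 0) :=
      Real.tendsto_exp_neg_atTop_nhds_zero.comp (tendsto_id.const_mul_atTop hk)
    simpa using h3.mul_const (zInt μ lam₀ T t 0)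
  refine squeeze_zero' (Eventually.of_forall fun x => (zInt_pos hp hT t x).le) ?_ h2
  filter_upwards [eventually_ge_atTop 0] with x hx
  have h := le_zInt_sub hp hT t x hx
  rw [sub_self] at h
  rw [Real.exp_neg]
  rw [← div_eq_inv_mul, le_div_iff₀ (Real.exp_pos _)]
  linarith

lemma tendsto_u (t : ℝ) : Tendsto (u μ lam₀ T t) atTop (𝓝 0) := by
  have h1 := tendsto_zInt hp hT t
  have h2 : Tendsto (z μ lam₀ T t) atTop (𝓝 1) := by
    simpa [funext (z_eq (μ := μ) hT t)] using h1.const_add 1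
  have h3 : Tendsto (fun x => z μ lam₀ T t (x - 1)) atTop (𝓝 1) :=
    h2.comp (tendsto_atTop_add_const_right _ _ tendsto_id)
  have h4 := (h3.div h2 one_ne_zero).log (by norm_num)
  rw [div_one, Real.log_one] at h4
  exact h4

lemma u_le_zInt (t x : ℝ) : u μ lam₀ T t x ≤ zInt μ lam₀ T t (x - 1) := by
  rw [u_eq_sub hp hT]
  have h1 : 0 ≤ Real.log (z μ lam₀ T t x) := by
    apply Real.log_nonneg
    rw [z_eq hT]
    linarith [zInt_pos hp hT t x]
  have h2 := Real.log_le_sub_one_of_pos (z_pos hp hT t (x - 1))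
  have h3 := z_eq (μ := μ) hT t (x - 1)
  linarith

/-- If the nonconstant part of `z` is large, the state is close to `kappa₀` or above. -/
lemma le_u_of_le_zInt {t x b : ℝ} (hb : b < kappa₀ μ lam₀)
    (h : (Real.exp b - 1) / (Real.exp (kappa₀ μ lam₀) - Real.exp b) ≤ zInt μ lam₀ T t x) :
    b ≤ u μ lam₀ T t x := by
  have he : 0 < Real.exp (kappa₀ μ lam₀) - Real.exp b := by
    linarith [Real.exp_lt_exp.2 hb]
  rw [u, Real.le_log_iff_exp_le (by linarith [one_lt_ratio hp hT t x]),
    le_div_iff₀ (z_pos hp hT t x), z_eq hT, z_eq hT]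
  have h1 := le_zInt_sub hp hT t x zero_le_one
  rw [mul_one] at h1
  rw [div_le_iff₀ he] at h
  nlinarith

end wave

end GodunovTV

namespace GodunovTV

/-! ### The Cauchy–Schlömilch substitution -/

section schlomilch
open MeasureTheory

lemma image_sub_div {b : ℝ} (hb : 0 < b) : (fun ρ : ℝ => ρ - b / ρ) '' Ioi 0 = univ := by
  refine eq_univ_of_forall fun x => ?_
  have h1 : 0 < x ^ 2 + 4 * b := by positivity
  have h2 : |x| < √(x ^ 2 + 4 * b) := by
    rw [← Real.sqrt_sq_eq_abs]
    exact Real.sqrt_lt_sqrt (sq_nonneg x) (by linarith)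
  have h3 : 0 < x + √(x ^ 2 + 4 * b) := by linarith [neg_abs_le x]
  refine ⟨(x + √(x ^ 2 + 4 * b)) / 2, by simpa using h3, ?_⟩
  have h4 := Real.sq_sqrt h1.le
  simp only
  field_simp
  nlinarith

lemma injOn_sub_div {b : ℝ} (hb : 0 < b) : InjOn (fun ρ : ℝ => ρ - b / ρ) (Ioi 0) := by
  have : StrictMonoOn (fun ρ : ℝ => ρ - b / ρ) (Ioi 0) := by
    intro x hx y hy hxy
    have hx' : 0 < x := hx
    have : b / y < b / x := by gcongr
    simp only
    linarith
  exact this.injOn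

lemma hasDerivAt_sub_div {b ρ : ℝ} (hρ : 0 < ρ) :
    HasDerivAt (fun ρ : ℝ => ρ - b / ρ) (1 + b / ρ ^ 2) ρ := by
  have h := (hasDerivAt_id ρ).sub ((hasDerivAt_inv hρ.ne').const_mul b)
  convert! h using 1
  field_simp
  ring

variable {b : ℝ} (hb : 0 < b) {f : ℝ → ℝ} (hf : Integrable f) (hc : Continuous f)

include hb hf in
lemma integrableOn_one_add_mul_comp_sub_div :
    IntegrableOn (fun ρ => (1 + b / ρ ^ 2) * f (ρ - b / ρ)) (Ioi 0) := by
  have h := (integrableOn_image_iff_integrableOn_abs_deriv_smul measurableSet_Ioi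
    (fun ρ hρ => (hasDerivAt_sub_div (b := b) hρ).hasDerivWithinAt) (injOn_sub_div hb) f).1
    (by rw [image_sub_div hb]; exact hf.integrableOn)
  refine h.congr_fun (fun ρ (hρ : 0 < ρ) => ?_) measurableSet_Ioi
  simp only [smul_eq_mul]
  rw [abs_of_pos (by positivity)]

include hb hf hc in
lemma integrableOn_comp_sub_div : IntegrableOn (fun ρ => f (ρ - b / ρ)) (Ioi 0) := by
  refine MeasureTheory.Integrable.mono (integrableOn_one_add_mul_comp_sub_div hb hf) ?_ ?_
  · refine ContinuousOn.aestronglyMeasurable (fun ρ (hρ : 0 < ρ) => ?_) measurableSet_Ioi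
    exact (hc.continuousAt.comp (hasDerivAt_sub_div hρ).continuousAt).continuousWithinAt
  · filter_upwards [ae_restrict_mem measurableSet_Ioi] with ρ (hρ : 0 < ρ)
    rw [norm_mul]
    have : 1 ≤ ‖1 + b / ρ ^ 2‖ := by
      have : 0 ≤ b / ρ ^ 2 := by positivity
      rw [Real.norm_eq_abs, abs_of_pos (by positivity)]
      linarith
    nlinarith [norm_nonneg (f (ρ - b / ρ))]

include hb hf hc in
lemma integrableOn_div_sq_mul_comp_sub_div :
    IntegrableOn (fun ρ => b / ρ ^ 2 * f (ρ - b / ρ)) (Ioi 0) := by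
  refine ((integrableOn_one_add_mul_comp_sub_div hb hf).sub
    (integrableOn_comp_sub_div hb hf hc)).congr_fun (fun ρ _ => ?_) measurableSet_Ioi
  simp only [Pi.sub_apply]
  ring

include hb in
lemma image_div : (fun ρ : ℝ => b / ρ) '' Ioi 0 = Ioi 0 := by
  ext x
  constructor
  · rintro ⟨ρ, hρ, rfl⟩
    exact div_pos hb hρ
  · intro hx
    refine ⟨b / x, div_pos hb hx, ?_⟩
    have : (0 : ℝ) < x := hx
    simp only
    field_simp

include hb in
-- The inversion ρ ↦ b/ρ changes the sign of ρ - b/ρ and has Jacobian b/ρ²; evenness of f absorbs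
-- the sign.
lemma integral_div_sq_mul_comp_sub_div (he : ∀ x, f (-x) = f x) :
    ∫ ρ in Ioi 0, b / ρ ^ 2 * f (ρ - b / ρ) = ∫ ρ in Ioi 0, f (ρ - b / ρ) := by
  conv_rhs => rw [← image_div hb]
  rw [integral_image_eq_integral_abs_deriv_smul measurableSet_Ioi (f' := fun ρ => -(b / ρ ^ 2))]
  · refine setIntegral_congr_fun measurableSet_Ioi fun ρ (hρ : 0 < ρ) => ?_
    simp only [smul_eq_mul]
    rw [abs_neg, abs_of_pos (by positivity), ← he]
    congr 2
    field_simp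
    ring
  · intro ρ (hρ : 0 < ρ)
    have h := ((hasDerivAt_inv hρ.ne').const_mul b).hasDerivWithinAt (s := Ioi 0)
    convert! h using 1
    field_simp
  · intro x (hx : 0 < x) y (hy : 0 < y) hxy
    simp only at hxy
    field_simp at hxy
    exact hxy.symm

include hb hf hc in
-- The substitution x = ρ - b/ρ maps the half line onto ℝ with Jacobian 1 + b/ρ², and by inversion
-- the two summands of the Jacobian contribute equally.
lemma integral_comp_sub_div (he : ∀ x, f (-x) = f x) :
    ∫ ρ in Ioi 0, f (ρ - b / ρ) = (∫ x, f x) / 2 := by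
  have h := integral_image_eq_integral_abs_deriv_smul measurableSet_Ioi
    (fun ρ hρ => (hasDerivAt_sub_div (b := b) hρ).hasDerivWithinAt) (injOn_sub_div hb) f
  rw [image_sub_div hb, setIntegral_univ] at h
  have h2 : ∫ ρ in Ioi 0, |1 + b / ρ ^ 2| • f (ρ - b / ρ) =
      ∫ ρ in Ioi 0, (f (ρ - b / ρ) + b / ρ ^ 2 * f (ρ - b / ρ)) := by
    refine setIntegral_congr_fun measurableSet_Ioi fun ρ (hρ : 0 < ρ) => ?_
    simp only [smul_eq_mul]
    rw [abs_of_pos (by positivity)]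
    ring
  rw [h, h2, integral_add (integrableOn_comp_sub_div hb hf hc)
    (integrableOn_div_sq_mul_comp_sub_div hb hf hc), integral_div_sq_mul_comp_sub_div hb he]
  ring

end schlomilch

/-! ### Asymptotics of the superposition near the shock -/

lemma integrable_sq_mul_exp {κ : ℝ} (hκ : 0 < κ) :
    MeasureTheory.Integrable (fun x : ℝ => x ^ 2 * Real.exp (-κ * x ^ 2)) := by
  simpa using integrable_rpow_mul_exp_neg_mul_sq hκ (s := 2) (by norm_num)

/-- The phase (r² - a)²/r² vanishes only at the saddle r² = a. Outside a factor √2 of r² around the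
saddle it is at least a/10; 0.71 and 1.4 are rational substitutes for 1/√2 and √2. -/
lemma sqrt_le_sq_sub_div {a r : ℝ} (ha : 0 < a) (hr : 0 < r)
    (h : r ^ 4 ≤ a ^ 2 / 2 ∨ 2 * a ^ 2 ≤ r ^ 4) : a / 10 ≤ (r - a / r) ^ 2 := by
  have e : (r - a / r) ^ 2 = (r ^ 2 - a) ^ 2 / r ^ 2 := by
    field_simp
  rw [e, le_div_iff₀ (by positivity)]
  set q := r ^ 2 with hq
  have hq0 : 0 < q := by positivity
  have h4 : r ^ 4 = q ^ 2 := by rw [hq]; ring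
  rw [h4] at h
  rcases h with h | h
  · have h5 : q ≤ 0.71 * a := by
      by_contra! h6
      nlinarith
    nlinarith
  · have h5 : 1.4 * a ≤ q := by
      by_contra! h6
      nlinarith
    nlinarith

lemma exp_neg_le_div_sq {x : ℝ} (hx : 0 < x) : Real.exp (-x) ≤ 2 / x ^ 2 := by
  have h := Real.quadratic_le_exp_of_nonneg hx.le
  rw [Real.exp_neg, inv_le_comm₀ (Real.exp_pos x) (by positivity), inv_div]
  linarith

lemma gamma_neg {lam₀ : ℚ} {T : ℕ} {s : ℝ} (hs : √(T : ℝ) < s) :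
    gamma lam₀ T (-s) = -lam₀ * s - 2 * √s := by
  rw [gamma, if_pos (by linarith), neg_neg]
  ring

section asymptotics
variable {μ : ℝ} {lam₀ : ℚ} {T : ℕ} (hp : Params μ lam₀) (hT : AdmissibleTime lam₀ T)

include hT in
-- The terms p² - 2√s + s/p² complete a square. This identity is the reason for the choice of γ, and
-- it turns the superposition into a Gaussian integral.
lemma sub_line_eq {s : ℝ} (hs : 2 * √(T : ℝ) ≤ s) (y ρ : ℝ) :
    gamma lam₀ T (-s) + y - line lam₀ (cut T ρ) (-s) = y + (cut T ρ - √s / cut T ρ) ^ 2 := by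
  have h1 : 0 < √(T : ℝ) := Real.sqrt_pos.2 (by exact_mod_cast hT.1)
  have h2 := hT.cut_pos ρ
  have h3 : √s ^ 2 = s := Real.sq_sqrt (by linarith)
  rw [gamma_neg (by linarith), line]
  field_simp
  linear_combination -h3

/-- The limit of the integrand of `zInt`. -/
noncomputable def gaussWave (κ y a ρ : ℝ) : ℝ := 4 * Real.exp (-κ * (y + (ρ - a / ρ) ^ 2))

lemma gaussWave_eq (κ y a ρ : ℝ) :
    gaussWave κ y a ρ = 4 * Real.exp (-κ * y) * Real.exp (-κ * (ρ - a / ρ) ^ 2) := by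
  rw [gaussWave, mul_assoc, ← Real.exp_add]
  ring_nf

lemma gaussWave_nonneg (κ y a ρ : ℝ) : 0 ≤ gaussWave κ y a ρ := by
  unfold gaussWave
  positivity

lemma integrableOn_gaussWave {κ a : ℝ} (hκ : 0 < κ) (ha : 0 < a) (y : ℝ) :
    MeasureTheory.IntegrableOn (gaussWave κ y a) (Ioi 0) := by
  have h := (integrableOn_comp_sub_div ha (integrable_exp_neg_mul_sq hκ) (by fun_prop)).const_mul
    (4 * Real.exp (-κ * y))
  exact h.congr (MeasureTheory.ae_of_all _ fun ρ => (gaussWave_eq κ y a ρ).symm)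

/-- The value does not depend on a = √s, so the level curves settle at a fixed distance from γ
instead of drifting. -/
lemma integral_gaussWave {κ a : ℝ} (hκ : 0 < κ) (ha : 0 < a) (y : ℝ) :
    ∫ ρ in Ioi 0, gaussWave κ y a ρ = 2 * √(Real.pi / κ) * Real.exp (-κ * y) := by
  simp only [gaussWave_eq]
  rw [MeasureTheory.integral_const_mul,
    integral_comp_sub_div ha (integrable_exp_neg_mul_sq hκ) (by fun_prop) (by simp),
    integral_gaussian]
  ring

/-- The integrand of `zInt` at the point `gamma (-s) + y`. -/
noncomputable def wave (μ : ℝ) (lam₀ : ℚ) (T : ℕ) (s y ρ : ℝ) : ℝ :=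
  4 * Real.exp (-rate μ lam₀ (cut T ρ) * (y + (cut T ρ - √s / cut T ρ) ^ 2))

include hT in
lemma zInt_eq_integral_wave {s : ℝ} (hs : 2 * √(T : ℝ) ≤ s) (y : ℝ) :
    zInt μ lam₀ T (-s) (gamma lam₀ T (-s) + y) = ∫ ρ in Ioo 0 (rMax T), wave μ lam₀ T s y ρ := by
  simp only [zInt, sub_line_eq hT hs, wave]

include hp hT in
lemma integrableOn_wave' {s : ℝ} (hs : 2 * √(T : ℝ) ≤ s) (y : ℝ) :
    MeasureTheory.IntegrableOn (wave μ lam₀ T s y) (Ioo 0 (rMax T)) := by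
  have h := integrableOn_wave hp hT (-s) (gamma lam₀ T (-s) + y)
  simp only [sub_line_eq hT hs] at h
  exact h

include hp hT in
-- On this range the wave belongs to the straight continuation of γ. There (`root8 T`)⁴ = √T ≤ s/2
-- is off the saddle, so the exponent is of order -√s; `exp_neg_le_div_sq` trades the exponential
-- for 1/s.
lemma wave_le_of_le_root8 {s : ℝ} (hs : 2 * √(T : ℝ) ≤ s) {y Y : ℝ} (hy : -Y ≤ y)
    {ρ : ℝ} (hρ : ρ ≤ root8 T) : wave μ lam₀ T s y ρ ≤
      800 * Real.exp (rate μ lam₀ (root8 T) * Y) / (kappa₀ μ lam₀ ^ 2 * s) := by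
  have hT1 : (1 : ℝ) ≤ T := by exact_mod_cast hT.1
  have h1 : 0 < √(T : ℝ) := Real.sqrt_pos.2 (by linarith)
  have hs0 : 0 < s := by linarith
  have h3 : √s ^ 2 = s := Real.sq_sqrt hs0.le
  have hk := hp.kappa₀_pos
  have hr := kappa₀_lt_rate hp hT ρ
  have hcut : cut T ρ = root8 T := max_eq_right hρ
  rw [hcut] at hr
  have hP : √s / 10 ≤ (root8 T - √s / root8 T) ^ 2 := by
    refine sqrt_le_sq_sub_div (Real.sqrt_pos.2 hs0) hT.root8_pos (Or.inl ?_)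
    rw [root8_pow_four, h3]
    linarith
  rw [wave, hcut]
  have h4 : -rate μ lam₀ (root8 T) * (y + (root8 T - √s / root8 T) ^ 2) ≤
      rate μ lam₀ (root8 T) * Y + -(kappa₀ μ lam₀ * (√s / 10)) := by
    have e1 : rate μ lam₀ (root8 T) * (-Y) ≤ rate μ lam₀ (root8 T) * y :=
      mul_le_mul_of_nonneg_left hy (by linarith)
    have e2 : kappa₀ μ lam₀ * (√s / 10) ≤
        rate μ lam₀ (root8 T) * (root8 T - √s / root8 T) ^ 2 :=
      mul_le_mul hr.le hP (by positivity) (by linarith)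
    linarith
  have h5 := exp_neg_le_div_sq (x := kappa₀ μ lam₀ * (√s / 10)) (by positivity)
  calc 4 * Real.exp (-rate μ lam₀ (root8 T) * (y + (root8 T - √s / root8 T) ^ 2))
      ≤ 4 * Real.exp (rate μ lam₀ (root8 T) * Y + -(kappa₀ μ lam₀ * (√s / 10))) := by gcongr
    _ = 4 * Real.exp (rate μ lam₀ (root8 T) * Y) * Real.exp (-(kappa₀ μ lam₀ * (√s / 10))) := by
        rw [Real.exp_add]; ring
    _ ≤ 4 * Real.exp (rate μ lam₀ (root8 T) * Y) * (2 / (kappa₀ μ lam₀ * (√s / 10)) ^ 2) := by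
        gcongr
    _ = _ := by
        rw [mul_pow, div_pow, h3]
        field_simp
        norm_num

include hT in
lemma one_le_root8 : 1 ≤ root8 T := by
  have hT1 : (1 : ℝ) ≤ T := by exact_mod_cast hT.1
  unfold root8
  simpa using hT1

include hT in
lemma root8_le_sqrt {s : ℝ} (hs : 2 * √(T : ℝ) ≤ s) : root8 T ≤ √s := by
  have h1 := one_le_root8 hT
  have h4 := root8_pow_four T
  apply Real.le_sqrt_of_sq_le
  have : root8 T ^ 2 ≤ root8 T ^ 4 := pow_le_pow_right₀ h1 (by norm_num)
  have := Real.sqrt_nonneg (T : ℝ)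
  linarith

include hp hT in
-- For y ≥ 0 the exponents are nonpositive and every rate exceeds κ₀, so the Gaussian wave dominates
-- pointwise. Unlike the two-sided asymptotics this also covers s > T; it controls the state ahead
-- of the shock at those times.
lemma integral_wave_le {s : ℝ} (hs : 2 * √(T : ℝ) ≤ s) {y : ℝ} (hy : 0 ≤ y) :
    zInt μ lam₀ T (-s) (gamma lam₀ T (-s) + y) ≤
      c₀ μ lam₀ * Real.exp (-kappa₀ μ lam₀ * y) + 800 / kappa₀ μ lam₀ ^ 2 / √s := by
  have hk := hp.kappa₀_pos
  have hT1 : (1 : ℝ) ≤ T := by exact_mod_cast hT.1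
  have h1 : 0 < √(T : ℝ) := Real.sqrt_pos.2 (by linarith)
  have hs0 : 0 < s := by linarith
  have hss := Real.sqrt_pos.2 hs0
  set D : ℝ := 800 / (kappa₀ μ lam₀ ^ 2 * s)
  have hD : 0 ≤ D := by positivity
  have hgi := integrableOn_gaussWave hk hss y
  have hpt : ∀ ρ ∈ Ioo 0 (rMax T), wave μ lam₀ T s y ρ ≤
      gaussWave (kappa₀ μ lam₀) y (√s) ρ + (Ioc 0 (root8 T)).indicator (fun _ => D) ρ := by
    intro ρ hρ
    rcases le_or_gt ρ (root8 T) with h | h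
    · rw [indicator_of_mem (show ρ ∈ Ioc 0 (root8 T) from ⟨hρ.1, h⟩)]
      have h2 := wave_le_of_le_root8 hp hT hs (Y := 0) (by simpa using hy) h
      rw [mul_zero, Real.exp_zero, mul_one] at h2
      linarith [gaussWave_nonneg (kappa₀ μ lam₀) y (√s) ρ]
    · rw [indicator_of_notMem (fun h' => absurd h'.2 (not_le.2 h)), add_zero, wave, gaussWave,
        show cut T ρ = ρ from max_eq_left h.le]
      have hr := kappa₀_lt_rate hp hT ρ
      rw [show cut T ρ = ρ from max_eq_left h.le] at hr
      gcongr 4 * Real.exp ?_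
      have : 0 ≤ y + (ρ - √s / ρ) ^ 2 := by positivity
      nlinarith
  have hii : MeasureTheory.IntegrableOn ((Ioc 0 (root8 T)).indicator (fun _ => D)) (Ioi 0) :=
    ((MeasureTheory.integrable_indicator_iff measurableSet_Ioc).2
      (MeasureTheory.integrableOn_const (by simp))).integrableOn
  rw [zInt_eq_integral_wave hT hs]
  calc ∫ ρ in Ioo 0 (rMax T), wave μ lam₀ T s y ρ
      ≤ ∫ ρ in Ioo 0 (rMax T), (gaussWave (kappa₀ μ lam₀) y (√s) ρ +
          (Ioc 0 (root8 T)).indicator (fun _ => D) ρ) :=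
        MeasureTheory.setIntegral_mono_on (integrableOn_wave' hp hT hs y)
          ((hgi.add hii).mono_set Ioo_subset_Ioi_self) measurableSet_Ioo hpt
    _ ≤ ∫ ρ in Ioi 0, (gaussWave (kappa₀ μ lam₀) y (√s) ρ +
          (Ioc 0 (root8 T)).indicator (fun _ => D) ρ) := by
        refine MeasureTheory.setIntegral_mono_set (hgi.add hii) (MeasureTheory.ae_of_all _ fun ρ => ?_)
          (MeasureTheory.ae_of_all _ Ioo_subset_Ioi_self)
        exact add_nonneg (gaussWave_nonneg _ _ _ _) (indicator_nonneg (fun _ _ => hD) _)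
    _ = c₀ μ lam₀ * Real.exp (-kappa₀ μ lam₀ * y) + root8 T * D := by
        rw [MeasureTheory.integral_add hgi hii, integral_gaussWave hk hss,
          MeasureTheory.setIntegral_indicator measurableSet_Ioc,
          inter_eq_right.2 Ioc_subset_Ioi_self, MeasureTheory.setIntegral_const]
        simp [c₀, hT.root8_pos.le]
    _ ≤ _ := by
        have h8 := root8_le_sqrt hT hs
        have : root8 T * D ≤ √s * D := by gcongr
        have e : √s * D = 800 / kappa₀ μ lam₀ ^ 2 / √s := by
          have h3 : √s * √s = s := Real.mul_self_sqrt hs0.le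
          simp only [D]
          field_simp
          linarith
        linarith

/-- Speeds of the shock curve stay below `(1 + lam₀) / 2`. -/
def LateTime (lam₀ : ℚ) (T : ℕ) : Prop := 1 ≤ T ∧ (lam₀ : ℝ) + 1 / √(√(T : ℝ)) ≤ (1 + lam₀) / 2

include hp in
lemma LateTime.admissible (h : LateTime lam₀ T) : AdmissibleTime lam₀ T :=
  ⟨h.1, by have := h.2; have := hp.lam_lt; linarith⟩

lemma abs_exp_sub_exp_le {κ r w Y : ℝ} (hr : κ ≤ r) (hw : -Y ≤ w) :
    |Real.exp (-r * w) - Real.exp (-κ * w)| ≤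
      (r - κ) * |w| * (Real.exp (-κ * w) * Real.exp ((r - κ) * |Y|)) := by
  have e : Real.exp (-r * w) - Real.exp (-κ * w) =
      Real.exp (-κ * w) * (Real.exp (-(r - κ) * w) - 1) := by
    rw [mul_sub, ← Real.exp_add]
    ring_nf
  have h1 : |Real.exp (-(r - κ) * w) - 1| ≤
      (r - κ) * |w| * Real.exp ((r - κ) * |Y|) := by
    have hd : 0 ≤ r - κ := by linarith
    have h1 : 1 ≤ Real.exp ((r - κ) * |Y|) := Real.one_le_exp (by positivity)
    rcases le_total 0 w with h | h
    · have h2 := Real.add_one_le_exp (-(r - κ) * w)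
      have h3 : Real.exp (-(r - κ) * w) ≤ 1 := Real.exp_le_one_iff.2 (by nlinarith)
      rw [abs_of_nonpos (by linarith), abs_of_nonneg h]
      nlinarith [mul_nonneg hd h]
    · have h3 : 1 ≤ Real.exp (-(r - κ) * w) := Real.one_le_exp (by nlinarith)
      rw [abs_of_nonneg (by linarith), abs_of_nonpos h]
      have h4 := Real.add_one_le_exp ((r - κ) * w)
      have h5 : Real.exp (-(r - κ) * w) * Real.exp ((r - κ) * w) = 1 := by
        rw [← Real.exp_add, Real.exp_eq_one_iff]; ring
      have h6 : Real.exp (-(r - κ) * w) ≤ Real.exp ((r - κ) * |Y|) := by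
        apply Real.exp_le_exp.2
        have := le_abs_self Y
        nlinarith
      have h7 : 0 ≤ (r - κ) * -w := mul_nonneg hd (by linarith)
      have h8 := Real.exp_pos (-(r - κ) * w)
      nlinarith
  rw [e, abs_mul, abs_of_pos (Real.exp_pos _)]
  calc _ ≤ Real.exp (-κ * w) * ((r - κ) * |w| * Real.exp ((r - κ) * |Y|)) := by gcongr
    _ = _ := by ring

include hp in
-- The rate exceeds κ₀ by at most a multiple of 1/ρ², which is of order 1/√s at the saddle ρ² = √s.
-- This is the source of the error rate 1/√s.
lemma exists_rate_bounds : ∃ L > 0, ∃ κ₁ > 0, ∀ T : ℕ, LateTime lam₀ T → ∀ ρ,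
    rate μ lam₀ (cut T ρ) - kappa₀ μ lam₀ ≤ L * (1 / cut T ρ ^ 2) ∧
      rate μ lam₀ (cut T ρ) ≤ κ₁ := by
  have h1 : (lam₀ : ℝ) < (1 + lam₀) / 2 := by have := hp.lam_lt; linarith
  have h2 : (1 + (lam₀ : ℝ)) / 2 < 1 := by have := hp.lam_lt; linarith
  obtain ⟨L, hL, h⟩ := exists_phi_lipschitz hp.pos hp.lt_one hp.lt_lam h1 h2
  refine ⟨L, hL, phi μ ((1 + lam₀) / 2), phi_pos hp.pos hp.lt_one (hp.lt_lam.trans h1) h2,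
    fun T hT ρ => ?_⟩
  have hT' := hT.admissible hp
  have h3 : (lam₀ : ℝ) + 1 / cut T ρ ^ 2 ≤ (1 + lam₀) / 2 := by
    have h4 := hT.2
    rw [← root8_sq] at h4
    have : 1 / cut T ρ ^ 2 ≤ 1 / root8 T ^ 2 := by
      have := hT'.root8_pos
      have : root8 T ≤ cut T ρ := le_max_right _ _
      gcongr
    linarith
  constructor
  · have := h _ ⟨(hT'.lt_speed ρ).le, h3⟩
    rw [kappa₀, rate]
    linarith
  · exact phi_mono hp.pos hp.lt_one (hp.lt_lam.trans (hT'.lt_speed ρ)) h3 h2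

include hp in
/-- Laplace asymptotics of the superposition along the translates of the shock curve. -/
lemma exists_abs_zInt_sub_le {Y : ℝ} (hY : 0 ≤ Y) : ∃ C, ∀ T : ℕ, LateTime lam₀ T →
    ∀ s ∈ Icc (2 * √(T : ℝ)) T, ∀ y ∈ Icc (-Y) Y,
      |zInt μ lam₀ T (-s) (gamma lam₀ T (-s) + y) -
        c₀ μ lam₀ * Real.exp (-kappa₀ μ lam₀ * y)| ≤ C / √s := by
  obtain ⟨L, hL, κ₁, hκ₁, hrate⟩ := exists_rate_bounds hp
  have hk := hp.kappa₀_pos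
  set κ := kappa₀ μ lam₀ with hκ
  set q₁ : ℝ → ℝ := fun x => x ^ 2 * Real.exp (-κ * x ^ 2) with hq₁
  set q₂ : ℝ → ℝ := fun x => (Y + x ^ 2) * Real.exp (-κ * x ^ 2) with hq₂
  have hi₁ : MeasureTheory.Integrable q₁ := integrable_sq_mul_exp hk
  have hi₂ : MeasureTheory.Integrable q₂ := by
    have := ((integrable_exp_neg_mul_sq hk).const_mul Y).add hi₁
    refine this.congr (MeasureTheory.ae_of_all _ fun x => ?_)
    simp only [hq₁, hq₂, Pi.add_apply]
    ring
  have hc₁ : Continuous q₁ := by fun_prop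
  have hc₂ : Continuous q₂ := by fun_prop
  set K₁ : ℝ := 40 * Real.exp (κ * Y)
  set K₂ : ℝ := 4 * L * (Real.exp (κ * Y) * Real.exp (κ₁ * Y))
  refine ⟨K₁ * ((∫ x, q₁ x) / 2) + K₂ * ((∫ x, q₂ x) / 2) +
    800 * Real.exp (κ₁ * Y) / κ ^ 2, fun T hT' s hs y hy => ?_⟩
  have hT := hT'.admissible hp
  have hT1 : (1 : ℝ) ≤ T := by exact_mod_cast hT.1
  have h1 : 0 < √(T : ℝ) := Real.sqrt_pos.2 (by linarith)
  have hs0 : 0 < s := by linarith [hs.1]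
  have hss := Real.sqrt_pos.2 hs0
  have hsq : √s ^ 2 = s := Real.sq_sqrt hs0.le
  set D : ℝ := 800 * Real.exp (κ₁ * Y) / (κ ^ 2 * s)
  have hgi := integrableOn_gaussWave hk hss y
  have hwi := integrableOn_wave' hp hT hs.1 y
  -- The three terms of the majorant are the Gaussian away from the saddle, the deviation of the
  -- rate from κ₀, and the range ρ ≤ `root8 T`. The deviation 1/ρ² is written as (1/√s)(√s/ρ²) so
  -- that the Cauchy–Schlömilch identity with weight a/ρ² integrates it.
  set Bd : ℝ → ℝ := fun ρ => 1 / √s * (K₁ * q₁ (ρ - √s / ρ) +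
    K₂ * (√s / ρ ^ 2 * q₂ (ρ - √s / ρ))) + (Ioc 0 (root8 T)).indicator (fun _ => D) ρ with hBd
  -- Off the saddle 10(ρ - √s/ρ)²/√s ≥ 1; inserting this factor gains 1/√s at the price of a
  -- quadratic weight.
  have hgauss : ∀ ρ > 0, (ρ ^ 4 ≤ √s ^ 2 / 2 ∨ 2 * √s ^ 2 ≤ ρ ^ 4) →
      gaussWave κ y (√s) ρ ≤ 1 / √s * (K₁ * q₁ (ρ - √s / ρ)) := by
    intro ρ hρ hcase
    have hP := sqrt_le_sq_sub_div hss hρ hcase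
    have hone : 1 ≤ 10 * (ρ - √s / ρ) ^ 2 / √s := by
      rw [le_div_iff₀ hss]
      linarith
    rw [gaussWave_eq]
    have hey : Real.exp (-κ * y) ≤ Real.exp (κ * Y) := Real.exp_le_exp.2 (by nlinarith [hy.1])
    calc 4 * Real.exp (-κ * y) * Real.exp (-κ * (ρ - √s / ρ) ^ 2)
        ≤ 4 * Real.exp (κ * Y) * Real.exp (-κ * (ρ - √s / ρ) ^ 2) * 1 := by
          rw [mul_one]; gcongr
      _ ≤ 4 * Real.exp (κ * Y) * Real.exp (-κ * (ρ - √s / ρ) ^ 2) *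
          (10 * (ρ - √s / ρ) ^ 2 / √s) := by gcongr
      _ = _ := by simp only [hq₁, K₁]; ring
  have hq₂n : ∀ ρ, 0 ≤ 1 / √s * (K₂ * (√s / ρ ^ 2 * q₂ (ρ - √s / ρ))) := fun ρ => by
    simp only [hq₂]; positivity
  have hq₁n : ∀ ρ, 0 ≤ 1 / √s * (K₁ * q₁ (ρ - √s / ρ)) := fun ρ => by
    simp only [hq₁]; positivity
  have hindn : ∀ ρ, 0 ≤ (Ioc 0 (root8 T)).indicator (fun _ => D) ρ := fun ρ =>
    indicator_nonneg (fun _ _ => by positivity) _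
  have hpt : ∀ ρ ∈ Ioi (0 : ℝ), |(Ioo 0 (rMax T)).indicator (wave μ lam₀ T s y) ρ -
      gaussWave κ y (√s) ρ| ≤ Bd ρ := by
    intro ρ (hρ : 0 < ρ)
    have hg0 := gaussWave_nonneg κ y (√s) ρ
    simp only [hBd, mul_add]
    rcases le_or_gt ρ (root8 T) with h8 | h8
    · have hw : (Ioo 0 (rMax T)).indicator (wave μ lam₀ T s y) ρ ≤ D := by
        refine (indicator_le_self' (fun _ _ => by unfold wave; positivity) ρ).trans ?_
        refine (wave_le_of_le_root8 hp hT hs.1 hy.1 h8).trans ?_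
        have := (hrate T hT' 0).2
        rw [show cut T 0 = root8 T from max_eq_right hT.root8_pos.le] at this
        simp only [D]
        gcongr
      have hw0 : 0 ≤ (Ioo 0 (rMax T)).indicator (wave μ lam₀ T s y) ρ :=
        indicator_nonneg (fun _ _ => by unfold wave; positivity) _
      rw [indicator_of_mem (show ρ ∈ Ioc 0 (root8 T) from ⟨hρ, h8⟩)]
      have h2 := hgauss ρ hρ (Or.inl (by
        rw [hsq]
        have := pow_le_pow_left₀ hρ.le h8 4
        rw [root8_pow_four] at this
        linarith [hs.1]))
      have h3 := hq₂n ρ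
      rw [abs_le]
      constructor <;> linarith
    · rcases lt_or_ge ρ (rMax T) with hR | hR
      · rw [indicator_of_mem (show ρ ∈ Ioo 0 (rMax T) from ⟨hρ, hR⟩)]
        have hcut : cut T ρ = ρ := max_eq_left h8.le
        have hr := hrate T hT' ρ
        have hr' := kappa₀_lt_rate hp hT ρ
        rw [hcut] at hr hr'
        rw [wave, gaussWave, hcut, ← mul_sub, abs_mul, abs_of_pos (by norm_num : (0 : ℝ) < 4)]
        set r := rate μ lam₀ ρ
        have hw : -Y ≤ y + (ρ - √s / ρ) ^ 2 := by linarith [hy.1, sq_nonneg (ρ - √s / ρ)]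
        have h3 := abs_exp_sub_exp_le hr'.le hw
        have hwabs : |y + (ρ - √s / ρ) ^ 2| ≤ Y + (ρ - √s / ρ) ^ 2 := by
          rw [abs_le]
          have := sq_nonneg (ρ - √s / ρ)
          constructor <;> linarith [hy.1, hy.2]
        have he : Real.exp (-κ * (y + (ρ - √s / ρ) ^ 2)) ≤
            Real.exp (κ * Y) * Real.exp (-κ * (ρ - √s / ρ) ^ 2) := by
          rw [← Real.exp_add]
          apply Real.exp_le_exp.2
          nlinarith [hy.1]
        have he2 : Real.exp ((r - κ) * |Y|) ≤ Real.exp (κ₁ * Y) := by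
          rw [abs_of_nonneg hY]
          apply Real.exp_le_exp.2
          have : r - κ ≤ κ₁ := by linarith [hr.2]
          gcongr
        have hrk : 0 ≤ r - κ := by linarith
        have h4 : 4 * |Real.exp (-r * (y + (ρ - √s / ρ) ^ 2)) -
            Real.exp (-κ * (y + (ρ - √s / ρ) ^ 2))| ≤
            1 / √s * (K₂ * (√s / ρ ^ 2 * q₂ (ρ - √s / ρ))) := by
          calc _ ≤ 4 * ((r - κ) * |y + (ρ - √s / ρ) ^ 2| *
                (Real.exp (-κ * (y + (ρ - √s / ρ) ^ 2)) * Real.exp ((r - κ) * |Y|))) := by gcongr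
            _ ≤ 4 * ((L * (1 / ρ ^ 2)) * (Y + (ρ - √s / ρ) ^ 2) *
                ((Real.exp (κ * Y) * Real.exp (-κ * (ρ - √s / ρ) ^ 2)) *
                  Real.exp (κ₁ * Y))) := by
                have := hr.1
                gcongr
            _ = _ := by
                simp only [hq₂, K₂]
                field_simp
        have h5 := hq₁n ρ
        have h6 := hindn ρ
        linarith
      -- Beyond `rMax T` only the Gaussian remains, and ρ⁴ ≥ 2T ≥ 2s is off the saddle.
      · rw [indicator_of_notMem (fun h' => absurd h'.2 (not_lt.2 hR)), zero_sub, abs_neg,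
          abs_of_nonneg hg0]
        have h2 := hgauss ρ hρ (Or.inr (by
          rw [hsq]
          have := pow_le_pow_left₀ (rMax_nonneg T) hR 4
          rw [rMax_pow_four] at this
          linarith [hs.2]))
        have h3 := hq₂n ρ
        have h6 := hindn ρ
        linarith
  have hb₁ := (integrableOn_comp_sub_div hss hi₁ hc₁).const_mul K₁
  have hb₂ := (integrableOn_div_sq_mul_comp_sub_div hss hi₂ hc₂).const_mul K₂
  have hb₃ : MeasureTheory.IntegrableOn ((Ioc 0 (root8 T)).indicator (fun _ => D)) (Ioi 0) :=
    ((MeasureTheory.integrable_indicator_iff measurableSet_Ioc).2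
      (MeasureTheory.integrableOn_const (by simp))).integrableOn
  have hBdi : MeasureTheory.IntegrableOn Bd (Ioi 0) := ((hb₁.add hb₂).const_mul _).add hb₃
  have hwi' : MeasureTheory.IntegrableOn ((Ioo 0 (rMax T)).indicator (wave μ lam₀ T s y))
      (Ioi 0) := ((MeasureTheory.integrable_indicator_iff measurableSet_Ioo).2 hwi).integrableOn
  have hBd_int : ∫ ρ in Ioi 0, Bd ρ = 1 / √s * (K₁ * ((∫ x, q₁ x) / 2) +
      K₂ * ((∫ x, q₂ x) / 2)) + root8 T * D := by
    simp only [hBd]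
    rw [MeasureTheory.integral_add (by exact (hb₁.add hb₂).const_mul _) hb₃,
      MeasureTheory.integral_const_mul, MeasureTheory.integral_add hb₁ hb₂,
      MeasureTheory.integral_const_mul, MeasureTheory.integral_const_mul,
      integral_div_sq_mul_comp_sub_div hss (by simp [hq₂]),
      integral_comp_sub_div hss hi₁ hc₁ (by simp [hq₁]),
      integral_comp_sub_div hss hi₂ hc₂ (by simp [hq₂]),
      MeasureTheory.setIntegral_indicator measurableSet_Ioc,
      inter_eq_right.2 Ioc_subset_Ioi_self, MeasureTheory.setIntegral_const]
    simp [hT.root8_pos.le]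
  have hmain : zInt μ lam₀ T (-s) (gamma lam₀ T (-s) + y) - c₀ μ lam₀ * Real.exp (-κ * y) =
      ∫ ρ in Ioi 0, ((Ioo 0 (rMax T)).indicator (wave μ lam₀ T s y) ρ -
        gaussWave κ y (√s) ρ) := by
    rw [MeasureTheory.integral_sub hwi' hgi, integral_gaussWave hk hss,
      MeasureTheory.setIntegral_indicator measurableSet_Ioo,
      inter_eq_right.2 Ioo_subset_Ioi_self, zInt_eq_integral_wave hT hs.1]
    rfl
  rw [hmain]
  calc _ ≤ ∫ ρ in Ioi 0, Bd ρ := by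
        rw [← Real.norm_eq_abs]
        refine MeasureTheory.norm_integral_le_of_norm_le hBdi ?_
        filter_upwards [MeasureTheory.ae_restrict_mem measurableSet_Ioi] with ρ hρ
        exact hpt ρ hρ
    _ ≤ _ := by
        rw [hBd_int]
        have h8 := root8_le_sqrt hT hs.1
        have h9 : root8 T * D ≤ √s * D := by gcongr
        have e : √s * D = 800 * Real.exp (κ₁ * Y) / κ ^ 2 / √s := by
          have h3 : √s * √s = s := Real.mul_self_sqrt hs0.le
          simp only [D]
          field_simp
          linarith
        rw [e] at h9
        rw [add_div, div_eq_mul_one_div (K₁ * _ + _)]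
        linarith

end asymptotics

end GodunovTV

namespace GodunovTV

/-! ### The scheme, and the variation of the initial data -/

lemma eVariationOn_univ_le_of_antitone {f : ℤ → ℝ} (hf : Antitone f) {K : ℝ}
    (h0 : ∀ j, 0 ≤ f j) (hK : ∀ j, f j ≤ K) : eVariationOn f univ ≤ ENNReal.ofReal K := by
  refine iSup_le fun p => ?_
  obtain ⟨n, w, hw, -⟩ := p
  have h1 : ∀ i, edist (f (w (i + 1))) (f (w i)) = ENNReal.ofReal (f (w i) - f (w (i + 1))) := by
    intro i
    rw [edist_comm, edist_dist, Real.dist_eq, abs_of_nonneg (by linarith [hf (hw i.le_succ)])]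
  simp only [h1]
  rw [← ENNReal.ofReal_sum_of_nonneg (fun i _ => by linarith [hf (hw i.le_succ)]),
    Finset.sum_range_sub' (fun i => f (w i))]
  exact ENNReal.ofReal_le_ofReal (by linarith [h0 (w n), hK (w 0)])

section scheme
variable {μ : ℝ} {lam₀ : ℚ} {T : ℕ} (hp : Params μ lam₀) (hT : AdmissibleTime lam₀ T)

include hp hT in
lemma isGodunovSolution_uGrid (g : ℝ → ℝ) : IsGodunovSolution (flux μ) g (1 / 2) (-2 * T)
    (uGrid μ lam₀ T) (vGrid μ lam₀ T g) where
  u_step n _ j := by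
    simp only [uGrid]
    push_cast
    exact u_step hp hT n j
  v_step n hn j := by
    obtain ⟨m, rfl⟩ : ∃ m : ℕ, n = -2 * T + m := ⟨(n + 2 * T).toNat, by omega⟩
    have e1 : (-2 * (T : ℤ) + m + 1 + 2 * T).toNat = m + 1 := by omega
    have e2 : (-2 * (T : ℤ) + m + 2 * T).toNat = m := by omega
    simp only [vGrid, e1, e2, vSteps]

lemma vGrid_initial (g : ℝ → ℝ) (j : ℤ) : vGrid μ lam₀ T g (-2 * T) j = 0 := by
  have e : (-2 * (T : ℤ) + 2 * T).toNat = 0 := by omega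
  simp only [vGrid, e, vSteps]

lemma eventually_lateTime (hp : Params μ lam₀) (B : ℝ) :
    ∀ᶠ T : ℕ in atTop, LateTime lam₀ T ∧ B ≤ √(T : ℝ) := by
  have h1 : Tendsto (fun T : ℕ => √(T : ℝ)) atTop atTop :=
    Real.tendsto_sqrt_atTop.comp tendsto_natCast_atTop_atTop
  have h2 : Tendsto (fun T : ℕ => √(√(T : ℝ))) atTop atTop := Real.tendsto_sqrt_atTop.comp h1
  have h3 : Tendsto (fun T : ℕ => 1 / √(√(T : ℝ))) atTop (𝓝 0) := by
    simp only [one_div]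
    exact h2.inv_tendsto_atTop
  have h4 : 0 < (1 - (lam₀ : ℝ)) / 2 := by have := hp.lam_lt; linarith
  filter_upwards [eventually_ge_atTop 1, h1.eventually_ge_atTop B,
    h3.eventually (gt_mem_nhds h4)] with T a b c
  exact ⟨⟨a, by linarith⟩, b⟩

include hp in
/-- The states are bounded uniformly in `T`. -/
lemma exists_u_le : ∃ K, ∀ T : ℕ, AdmissibleTime lam₀ T → ∀ t x, u μ lam₀ T t x ≤ K := by
  classical
  have hex : ∃ T : ℕ, AdmissibleTime lam₀ T := by
    obtain ⟨T, hT, -⟩ := (eventually_lateTime hp 0).exists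
    exact ⟨T, hT.admissible hp⟩
  -- The bound by the rate at `root8 T` decreases in T, so the least admissible T serves all others.
  refine ⟨rate μ lam₀ (root8 (Nat.find hex)), fun T hT t x => (u_le hp hT t x).trans ?_⟩
  have hmin := Nat.find_min' hex hT
  have hT0 := Nat.find_spec hex
  set T0 := Nat.find hex
  have hle : root8 T0 ≤ root8 T := by
    unfold root8
    gcongr
  have h := rate_cut_antitone hp hT0 hle
  have hc := hT0.root8_pos
  simp only [cut, max_self, max_eq_left hle] at h
  exact h

include hp in
lemma exists_eVariationOn_le : ∃ K, ∀ T : ℕ, AdmissibleTime lam₀ T →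
    eVariationOn (uGrid μ lam₀ T (-2 * T)) univ ≤ ENNReal.ofReal K := by
  obtain ⟨K, hK⟩ := exists_u_le hp
  refine ⟨K, fun T hT => eVariationOn_univ_le_of_antitone (fun i j hij => ?_)
    (fun j => (u_pos hp hT _ _).le) (fun j => hK T hT _ _)⟩
  exact (u_strictAnti hp hT _).antitone (by exact_mod_cast hij)

end scheme

/-! ### The limiting profile -/

/-- The limit of `u` in the frame of the shock. -/
noncomputable def profile (μ : ℝ) (lam₀ : ℚ) (y : ℝ) : ℝ :=
  Real.log (1 + c₀ μ lam₀ * Real.exp (-kappa₀ μ lam₀ * (y - 1))) -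
    Real.log (1 + c₀ μ lam₀ * Real.exp (-kappa₀ μ lam₀ * y))

/-- The derivative of `profile`. -/
noncomputable def profileDeriv (μ : ℝ) (lam₀ : ℚ) (y : ℝ) : ℝ :=
  kappa₀ μ lam₀ * (1 / (1 + c₀ μ lam₀ * Real.exp (-kappa₀ μ lam₀ * (y - 1))) -
    1 / (1 + c₀ μ lam₀ * Real.exp (-kappa₀ μ lam₀ * y)))

section profile
variable {μ : ℝ} {lam₀ : ℚ} (hp : Params μ lam₀)
include hp

lemma c₀_pos : 0 < c₀ μ lam₀ := by
  have := hp.kappa₀_pos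
  unfold c₀
  positivity

lemma one_add_pos (y : ℝ) : 0 < 1 + c₀ μ lam₀ * Real.exp (-kappa₀ μ lam₀ * y) := by
  have := c₀_pos hp
  positivity

lemma hasDerivAt_profile (y : ℝ) :
    HasDerivAt (profile μ lam₀) (profileDeriv μ lam₀ y) y := by
  have h1 := one_add_pos hp y
  have h2 := one_add_pos hp (y - 1)
  have e1 : HasDerivAt (fun y => 1 + c₀ μ lam₀ * Real.exp (-kappa₀ μ lam₀ * y))
      (c₀ μ lam₀ * (Real.exp (-kappa₀ μ lam₀ * y) * (-kappa₀ μ lam₀ * 1))) y :=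
    ((((hasDerivAt_id y).const_mul (-kappa₀ μ lam₀)).exp).const_mul _).const_add _
  have e2 : HasDerivAt (fun y => 1 + c₀ μ lam₀ * Real.exp (-kappa₀ μ lam₀ * (y - 1)))
      (c₀ μ lam₀ * (Real.exp (-kappa₀ μ lam₀ * (y - 1)) * (-kappa₀ μ lam₀ * 1))) y :=
    (((((hasDerivAt_id y).sub_const 1).const_mul (-kappa₀ μ lam₀)).exp).const_mul _).const_add _
  convert! (e2.log h2.ne').sub (e1.log h1.ne') using 1
  rw [profileDeriv]
  generalize Real.exp (-kappa₀ μ lam₀ * y) = E at *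
  generalize Real.exp (-kappa₀ μ lam₀ * (y - 1)) = E' at *
  field_simp
  ring

lemma continuous_profileDeriv : Continuous (profileDeriv μ lam₀) := by
  have h : ∀ y, 1 + c₀ μ lam₀ * Real.exp (-kappa₀ μ lam₀ * y) ≠ 0 := fun y =>
    (one_add_pos hp y).ne'
  have h' : ∀ y, 1 + c₀ μ lam₀ * Real.exp (-kappa₀ μ lam₀ * (y - 1)) ≠ 0 := fun y => h (y - 1)
  unfold profileDeriv
  fun_prop (disch := assumption)

lemma profileDeriv_neg (y : ℝ) : profileDeriv μ lam₀ y < 0 := by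
  have h0 := c₀_pos hp
  have hk := hp.kappa₀_pos
  have h1 := one_add_pos hp y
  rw [profileDeriv]
  apply mul_neg_of_pos_of_neg hk
  rw [sub_neg]
  gcongr 1 / (1 + _ * Real.exp ?_)
  linarith

lemma profile_strictAnti : StrictAnti (profile μ lam₀) :=
  strictAnti_of_deriv_neg fun y => by
    rw [(hasDerivAt_profile hp y).deriv]
    exact profileDeriv_neg hp y

/-- With E = c₀e^{-κ₀y} the profile satisfies e^a(1 + E) = 1 + e^{κ₀}E. Solving for E produces the
formula defining `c`, and the bounds 0 < a < κ₀ can be read off. -/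
lemma exp_profile (y : ℝ) : Real.exp (profile μ lam₀ y) *
    (1 + c₀ μ lam₀ * Real.exp (-kappa₀ μ lam₀ * y)) =
      1 + c₀ μ lam₀ * (Real.exp (kappa₀ μ lam₀) * Real.exp (-kappa₀ μ lam₀ * y)) := by
  have h1 := one_add_pos hp y
  have h2 := one_add_pos hp (y - 1)
  rw [profile, Real.exp_sub, Real.exp_log h1, Real.exp_log h2, div_mul_cancel₀ _ h1.ne',
    ← Real.exp_add]
  ring_nf

lemma profile_pos (y : ℝ) : 0 < profile μ lam₀ y := by
  have h := exp_profile hp y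
  have h0 := c₀_pos hp
  have h1 := one_add_pos hp y
  have hk : 1 < Real.exp (kappa₀ μ lam₀) := Real.one_lt_exp_iff.2 hp.kappa₀_pos
  have he := mul_pos h0 (Real.exp_pos (-kappa₀ μ lam₀ * y))
  rw [← Real.one_lt_exp_iff]
  by_contra! h3
  nlinarith

lemma profile_lt (y : ℝ) : profile μ lam₀ y < kappa₀ μ lam₀ := by
  have h := exp_profile hp y
  have h0 := c₀_pos hp
  have h1 := one_add_pos hp y
  have hk : 1 < Real.exp (kappa₀ μ lam₀) := Real.one_lt_exp_iff.2 hp.kappa₀_pos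
  rw [← Real.exp_lt_exp]
  by_contra! h3
  nlinarith

lemma c_profile (y : ℝ) : c μ lam₀ (profile μ lam₀ y) = y := by
  have h := exp_profile hp y
  have h0 := c₀_pos hp
  have hk := hp.kappa₀_pos
  have h2 : 0 < Real.exp (kappa₀ μ lam₀) - Real.exp (profile μ lam₀ y) := by
    linarith [Real.exp_lt_exp.2 (profile_lt hp y)]
  have e : (Real.exp (profile μ lam₀ y) - 1) / (c₀ μ lam₀ *
      (Real.exp (kappa₀ μ lam₀) - Real.exp (profile μ lam₀ y))) =
      Real.exp (-kappa₀ μ lam₀ * y) := by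
    rw [div_eq_iff (by positivity)]
    linear_combination h
  rw [c, e, Real.log_exp]
  field_simp

lemma profile_c {a : ℝ} (h0 : 0 < a) (h1 : a < kappa₀ μ lam₀) : profile μ lam₀ (c μ lam₀ a) = a := by
  have hc := c₀_pos hp
  have hk := hp.kappa₀_pos
  have h2 : 0 < Real.exp (kappa₀ μ lam₀) - Real.exp a := by
    linarith [Real.exp_lt_exp.2 h1]
  have h3 : 0 < Real.exp a - 1 := by linarith [Real.one_lt_exp_iff.2 h0]
  have e : Real.exp (-kappa₀ μ lam₀ * c μ lam₀ a) = (Real.exp a - 1) /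
      (c₀ μ lam₀ * (Real.exp (kappa₀ μ lam₀) - Real.exp a)) := by
    have h4 : -kappa₀ μ lam₀ * c μ lam₀ a = Real.log ((Real.exp a - 1) /
        (c₀ μ lam₀ * (Real.exp (kappa₀ μ lam₀) - Real.exp a))) := by
      rw [c]
      field_simp
    rw [h4, Real.exp_log (by positivity)]
  have h := exp_profile hp (c μ lam₀ a)
  have h4 := one_add_pos hp (c μ lam₀ a)
  have h5 : Real.exp (profile μ lam₀ (c μ lam₀ a)) = Real.exp a := by
    apply mul_right_cancel₀ h4.ne'
    rw [h, e]
    field_simp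
    ring
  exact Real.exp_injective h5

lemma c_antitone {a b : ℝ} (h0 : 0 < a) (hab : a ≤ b) (h1 : b < kappa₀ μ lam₀) :
    c μ lam₀ b ≤ c μ lam₀ a := by
  rw [← (profile_strictAnti hp).le_iff_ge, profile_c hp h0 (hab.trans_lt h1),
    profile_c hp (h0.trans_le hab) h1]
  exact hab

omit hp in
lemma abs_log_sub_log_le {a b : ℝ} (ha : 0 ≤ a) (hb : 0 ≤ b) :
    |Real.log (1 + a) - Real.log (1 + b)| ≤ |a - b| := by
  wlog hab : b ≤ a generalizing a b
  · rw [abs_sub_comm, abs_sub_comm a]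
    exact this hb ha (by linarith)
  have h1 : Real.log (1 + b) ≤ Real.log (1 + a) := Real.log_le_log (by linarith) (by linarith)
  rw [abs_of_nonneg (by linarith), abs_of_nonneg (by linarith), ← Real.log_div (by linarith)
    (by linarith)]
  refine (Real.log_le_sub_one_of_pos (by positivity)).trans ?_
  rw [div_sub_one (by linarith), div_le_iff₀ (by linarith)]
  nlinarith

/-- Uniform convergence of `u` to the profile in the frame of the shock. -/
lemma exists_abs_u_sub_profile_le {Y : ℝ} (hY : 0 ≤ Y) : ∃ C > 0, ∀ T : ℕ, LateTime lam₀ T →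
    ∀ s ∈ Icc (2 * √(T : ℝ)) T, ∀ y ∈ Icc (-Y) Y,
      |u μ lam₀ T (-s) (gamma lam₀ T (-s) + y) - profile μ lam₀ y| ≤ C / √s := by
  obtain ⟨C, hC⟩ := exists_abs_zInt_sub_le hp (Y := Y + 1) (by linarith)
  refine ⟨2 * |C| + 1, by positivity, fun T hT s hs y hy => ?_⟩
  have hT' := hT.admissible hp
  have h0 := c₀_pos hp
  rw [u_eq_sub hp hT', z_eq hT', z_eq hT', profile, add_sub_assoc]
  have h1 := hC T hT s hs y ⟨by linarith [hy.1], by linarith [hy.2]⟩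
  have h2 := hC T hT s hs (y - 1) ⟨by linarith [hy.1], by linarith [hy.2]⟩
  have h3 := abs_log_sub_log_le (zInt_pos hp hT' (-s) (gamma lam₀ T (-s) + y)).le
    (show 0 ≤ c₀ μ lam₀ * Real.exp (-kappa₀ μ lam₀ * y) by positivity)
  have h4 := abs_log_sub_log_le (zInt_pos hp hT' (-s) (gamma lam₀ T (-s) + (y - 1))).le
    (show 0 ≤ c₀ μ lam₀ * Real.exp (-kappa₀ μ lam₀ * (y - 1)) by positivity)
  have h5 : C / √s ≤ |C| / √s := by gcongr; exact le_abs_self C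
  have h6 : 0 ≤ 1 / √s := by positivity
  have h7 : (2 * |C| + 1) / √s = |C| / √s + |C| / √s + 1 / √s := by ring
  rw [h7]
  have h8 := abs_le.1 (h3.trans h1)
  have h9 := abs_le.1 (h4.trans h2)
  rw [abs_le]
  constructor <;> linarith [h8.1, h8.2, h9.1, h9.2]

variable {T : ℕ} (hT : AdmissibleTime lam₀ T)
include hT

/-- The comparison bounds for `zInt` under shifts say that ln `zInt` is Lipschitz in x. -/
lemma continuous_zInt (t : ℝ) : Continuous (zInt μ lam₀ T t) := by
  have hr : 0 ≤ rate μ lam₀ (root8 T) :=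
    (rate_cut_pos hp hT 0).le.trans (rate_cut_le hp hT 0)
  have hlip : LipschitzWith (rate μ lam₀ (root8 T)).toNNReal
      (fun x => Real.log (zInt μ lam₀ T t x)) := by
    apply LipschitzWith.of_le_add_mul
    intro x y
    have hx := zInt_pos hp hT t x
    have hy := zInt_pos hp hT t y
    rcases le_total x y with h | h
    · have h1 := zInt_sub_le hp hT t y (d := y - x) (by linarith)
      rw [sub_sub_cancel] at h1
      have h2 := Real.log_le_log hx h1
      rw [Real.log_mul (Real.exp_ne_zero _) hy.ne', Real.log_exp] at h2
      rw [Real.dist_eq, abs_sub_comm, abs_of_nonneg (by linarith : 0 ≤ y - x)]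
      rw [Real.coe_toNNReal _ hr]
      linarith
    · have h2 := Real.log_le_log hx (zInt_antitone hp hT t h)
      have : 0 ≤ rate μ lam₀ (root8 T) * dist x y := mul_nonneg hr dist_nonneg
      rw [Real.coe_toNNReal _ hr]
      linarith
  have := Real.continuous_exp.comp hlip.continuous
  refine this.congr fun x => ?_
  simp [Real.exp_log (zInt_pos hp hT t x)]

lemma continuous_u (t : ℝ) : Continuous (u μ lam₀ T t) := by
  have h := continuous_zInt hp hT t
  have h1 : ∀ x, 1 + zInt μ lam₀ T t x ≠ 0 := fun x => by linarith [zInt_pos hp hT t x]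
  have h2 : ∀ x, 1 + zInt μ lam₀ T t (x - 1) ≠ 0 := fun x => h1 (x - 1)
  have e : u μ lam₀ T t = fun x => Real.log (1 + zInt μ lam₀ T t (x - 1)) -
      Real.log (1 + zInt μ lam₀ T t x) := by
    ext x
    rw [u_eq_sub hp hT, z_eq hT, z_eq hT]
  rw [e]
  fun_prop (disch := assumption)

omit hT in
/-- The level curves of `u` follow translates of the shock curve. -/
lemma exists_level_curve_bound {ε a₁ a₂ : ℝ} (hε : 0 < ε) (ha₁ : 0 < a₁)
    (ha₂ : a₂ < kappa₀ μ lam₀) : ∃ (M : ℝ) (T₀ : ℕ), ∀ T ≥ T₀,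
      ∀ t ∈ Icc (-(T : ℝ)) (-2 * √(T : ℝ)), ∀ a ∈ Icc a₁ a₂, ∃ x : ℝ,
        (∀ x', u μ lam₀ T t x' = a ↔ x' = x) ∧
          |x - (c μ lam₀ a + gamma lam₀ T t)| ≤ M * (-t) ^ (-(1 / 2 - ε)) := by
  -- The extra 1 leaves room for the displacement η ≤ 1 on both sides of c(a).
  set Y := max |c μ lam₀ a₁| |c μ lam₀ a₂| + 1 with hY
  have hY0 : 0 ≤ Y := by positivity
  obtain ⟨C, hC0, hC⟩ := exists_abs_u_sub_profile_le hp hY0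
  obtain ⟨y₀, -, hy₀⟩ := (isCompact_Icc (a := -Y) (b := Y)).exists_isMaxOn
    ⟨0, by constructor <;> linarith⟩ (continuous_profileDeriv hp).continuousOn
  set m := -profileDeriv μ lam₀ y₀
  have hm : 0 < m := by
    have := profileDeriv_neg hp y₀
    simp only [m]
    linarith
  have hslope : ∀ x ∈ Icc (-Y) Y, ∀ y ∈ Icc (-Y) Y, x ≤ y →
      m * (y - x) ≤ profile μ lam₀ x - profile μ lam₀ y := by
    intro x hx y hy hxy
    have := (convex_Icc (-Y) Y).image_sub_le_mul_sub_of_deriv_le (f := profile μ lam₀) (C := -m)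
      (fun z _ => (hasDerivAt_profile hp z).continuousAt.continuousWithinAt)
      (fun z _ => (hasDerivAt_profile hp z).differentiableAt.differentiableWithinAt)
      (fun z hz => by
        rw [(hasDerivAt_profile hp z).deriv]
        simp only [m, neg_neg]
        exact hy₀ (interior_subset hz)) x hx y hy hxy
    linarith
  -- A shift by M/√s moves the profile, whose slope is at least m in modulus on the window, by at
  -- least 2C/√s. This beats the error C/√s and forces a sign change of u - a.
  set M := 2 * C / m with hM
  have hM0 : 0 < M := by positivity
  -- M² ≤ √T ≤ s makes the shift M/√s at most 1.
  obtain ⟨T₀, hT₀⟩ := eventually_atTop.1 (eventually_lateTime hp (M ^ 2))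
  refine ⟨M, T₀, fun T hT t ht a ha => ?_⟩
  obtain ⟨hL, hB⟩ := hT₀ T hT
  have hadm := hL.admissible hp
  have hT1 : (1 : ℝ) ≤ √(T : ℝ) := by
    rw [Real.one_le_sqrt]
    exact_mod_cast hL.1
  obtain ⟨s, rfl⟩ : ∃ s, t = -s := ⟨-t, by ring⟩
  have hs : s ∈ Icc (2 * √(T : ℝ)) T := ⟨by linarith [ht.2], by linarith [ht.1]⟩
  have hs1 : 1 ≤ s := by linarith [hs.1]
  have hss : 0 < √s := Real.sqrt_pos.2 (by linarith)
  set η := M / √s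
  have hη0 : 0 < η := by positivity
  have hη1 : η ≤ 1 := by
    rw [div_le_one hss]
    exact Real.le_sqrt_of_sq_le (by linarith [hs.1])
  have ha0 : 0 < a := ha₁.trans_le ha.1
  have hak : a < kappa₀ μ lam₀ := ha.2.trans_lt ha₂
  have hca : c μ lam₀ a ∈ Icc (-(Y - 1)) (Y - 1) := by
    have h1 := c_antitone hp ha₁ ha.1 hak
    have h2 := c_antitone hp ha0 ha.2 ha₂
    have h3 := le_max_left |c μ lam₀ a₁| |c μ lam₀ a₂|
    have h4 := le_max_right |c μ lam₀ a₁| |c μ lam₀ a₂|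
    have h5 := le_abs_self (c μ lam₀ a₁)
    have h6 := neg_abs_le (c μ lam₀ a₂)
    constructor <;> simp only [hY] <;> linarith
  have hc0 : c μ lam₀ a ∈ Icc (-Y) Y := ⟨by linarith [hca.1], by linarith [hca.2]⟩
  have hc1 : c μ lam₀ a - η ∈ Icc (-Y) Y := ⟨by linarith [hca.1], by linarith [hca.2]⟩
  have hc2 : c μ lam₀ a + η ∈ Icc (-Y) Y := ⟨by linarith [hca.1], by linarith [hca.2]⟩
  have hmη : m * η = 2 * (C / √s) := by
    simp only [η, hM]
    field_simp
  have hCs : 0 < C / √s := by positivity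
  have p0 := profile_c hp ha0 hak
  have u1 : a < u μ lam₀ T (-s) (gamma lam₀ T (-s) + (c μ lam₀ a - η)) := by
    have h1 := hslope _ hc1 _ hc0 (by linarith)
    have h2 := (abs_le.1 (hC T hL s hs _ hc1)).1
    rw [p0] at h1
    have : m * (c μ lam₀ a - (c μ lam₀ a - η)) = m * η := by ring
    linarith
  have u2 : u μ lam₀ T (-s) (gamma lam₀ T (-s) + (c μ lam₀ a + η)) < a := by
    have h1 := hslope _ hc0 _ hc2 (by linarith)
    have h2 := (abs_le.1 (hC T hL s hs _ hc2)).2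
    rw [p0] at h1
    have : m * (c μ lam₀ a + η - c μ lam₀ a) = m * η := by ring
    linarith
  obtain ⟨x, hx, hxa⟩ := intermediate_value_Icc' (by linarith)
    (continuous_u hp hadm (-s)).continuousOn ⟨u2.le, u1.le⟩
  refine ⟨x, fun x' => ⟨fun h => ?_, fun h => by rw [h, hxa]⟩, ?_⟩
  · exact (u_strictAnti hp hadm (-s)).injective (h.trans hxa.symm)
  · have h1 : |x - (c μ lam₀ a + gamma lam₀ T (-s))| ≤ η := by
      rw [abs_le]
      constructor <;> linarith [hx.1, hx.2]
    refine h1.trans ?_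
    rw [neg_neg]
    simp only [η]
    rw [div_eq_mul_inv]
    gcongr
    -- The bound obtained is M s^{-1/2}; as s ≥ 1, it implies the weaker exponent.
    rw [Real.sqrt_eq_rpow, ← Real.rpow_neg (by linarith)]
    exact Real.rpow_le_rpow_of_exponent_le hs1 (by linarith)

end profile

end GodunovTV

namespace GodunovTV

/-! ### The averaging operator of the linear transport part -/

section avg
variable {E : Type*} [NormedAddCommGroup E] [NormedSpace ℝ E]

/-- One step of the upwind scheme for `v`, seen from the test function. -/
noncomputable def avg (h : ℝ → E) (y : ℝ) : E := (1 / 2 : ℝ) • (h y + h (y - 1))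

lemma avg_iterate_succ (h : ℝ → E) (m : ℕ) (y : ℝ) :
    avg^[m + 1] h y = (1 / 2 : ℝ) • (avg^[m] h y + avg^[m] h (y - 1)) := by
  rw [Function.iterate_succ_apply']
  rfl

lemma hasDerivAt_avg_iterate {h h' : ℝ → E} (hd : ∀ y, HasDerivAt h (h' y) y) (m : ℕ) (y : ℝ) :
    HasDerivAt (avg^[m] h) (avg^[m] h' y) y := by
  induction m generalizing y with
  | zero => exact hd y
  | succ m ih =>
    have h1 := ((ih y).add ((ih (y - 1)).comp_sub_const y 1)).const_smul (1 / 2 : ℝ)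
    rw [avg_iterate_succ]
    refine h1.congr_of_eventuallyEq (Eventually.of_forall fun x => ?_)
    exact avg_iterate_succ h m x

lemma norm_avg_iterate_le (h : ℝ → E) (m : ℕ) (y : ℝ) :
    ‖avg^[m] h y‖ ≤ avg^[m] (fun x => ‖h x‖) y := by
  induction m generalizing y with
  | zero => exact le_rfl
  | succ m ih =>
    rw [avg_iterate_succ, avg_iterate_succ, norm_smul, Real.norm_eq_abs, abs_of_pos (by norm_num),
      smul_eq_mul]
    gcongr
    exact (norm_add_le _ _).trans (add_le_add (ih y) (ih (y - 1)))

lemma avg_iterate_mono {h k : ℝ → ℝ} (hk : ∀ x, h x ≤ k x) (m : ℕ) (y : ℝ) :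
    avg^[m] h y ≤ avg^[m] k y := by
  induction m generalizing y with
  | zero => exact hk y
  | succ m ih =>
    rw [avg_iterate_succ, avg_iterate_succ, smul_eq_mul, smul_eq_mul]
    gcongr
    · exact ih y
    · exact ih (y - 1)

lemma avg_iterate_const (c : E) (m : ℕ) (y : ℝ) : avg^[m] (fun _ => c) y = c := by
  induction m generalizing y with
  | zero => rfl
  | succ m ih =>
    rw [avg_iterate_succ, ih, ih, ← two_smul ℝ c, smul_smul]
    norm_num

lemma norm_avg_iterate_le_of_le {h : ℝ → E} {B : ℝ} (hB : ∀ x, ‖h x‖ ≤ B) (m : ℕ) (y : ℝ) :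
    ‖avg^[m] h y‖ ≤ B :=
  (norm_avg_iterate_le h m y).trans
    ((avg_iterate_mono hB m y).trans (avg_iterate_const B m y).le)

lemma avg_iterate_sub (h k : ℝ → E) (m : ℕ) (y : ℝ) :
    avg^[m] (fun x => h x - k x) y = avg^[m] h y - avg^[m] k y := by
  induction m generalizing y with
  | zero => rfl
  | succ m ih =>
    simp only [avg_iterate_succ, ih]
    module

lemma avg_iterate_const_mul {𝕜 : Type*} [RCLike 𝕜] (c : 𝕜) (h : ℝ → 𝕜) (m : ℕ) (y : ℝ) :
    avg^[m] (fun x => c * h x) y = c * avg^[m] h y := by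
  induction m generalizing y with
  | zero => rfl
  | succ m ih =>
    simp only [avg_iterate_succ, ih, ← mul_add, mul_smul_comm]

lemma avg_iterate_eq_zero_of_lt {h : ℝ → E} {a : ℝ} (ha : ∀ x < a, h x = 0) (m : ℕ) {y : ℝ}
    (hy : y < a) : avg^[m] h y = 0 := by
  induction m generalizing y with
  | zero => exact ha y hy
  | succ m ih => rw [avg_iterate_succ, ih hy, ih (by linarith), add_zero, smul_zero]

lemma avg_iterate_eq_zero_of_gt {h : ℝ → E} {b : ℝ} (hb : ∀ x, b < x → h x = 0) (m : ℕ) {y : ℝ}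
    (hy : b + m < y) : avg^[m] h y = 0 := by
  induction m generalizing y with
  | zero => exact hb y (by simpa using hy)
  | succ m ih =>
    push_cast at hy
    rw [avg_iterate_succ, ih (by linarith), ih (by linarith), add_zero, smul_zero]

/-- `avg^[m] h y` is the mean of h(y - S) for S binomial with parameters m and 1/2; the formula
expresses its mean m/2 and variance m/4. -/
lemma avg_iterate_sq (c : ℝ) (m : ℕ) (y : ℝ) :
    avg^[m] (fun x => (x - c) ^ 2) y = (y - m / 2 - c) ^ 2 + m / 4 := by
  induction m generalizing y with
  | zero => simp
  | succ m ih =>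
    rw [avg_iterate_succ, ih, ih, smul_eq_mul]
    push_cast
    ring

/-- Plane waves are eigenfunctions: one step multiplies them by e^{-iθ/2} cos(θ/2). -/
lemma avg_iterate_cexp (θ : ℝ) (m : ℕ) (y : ℝ) :
    avg^[m] (fun x : ℝ => Complex.exp (θ * x * Complex.I)) y =
      Complex.exp (θ * (y - m / 2) * Complex.I) * Complex.cos (θ / 2) ^ m := by
  induction m generalizing y with
  | zero => simp
  | succ m ih =>
    rw [avg_iterate_succ, ih, ih, pow_succ]
    have e1 : Complex.exp (θ * (y - m / 2) * Complex.I) =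
        Complex.exp (θ * (y - ((m + 1 : ℕ) : ℂ) / 2) * Complex.I) *
          Complex.exp (θ / 2 * Complex.I) := by
      rw [← Complex.exp_add]
      push_cast
      ring_nf
    have e2 : Complex.exp (θ * (((y - 1 : ℝ) : ℂ) - m / 2) * Complex.I) =
        Complex.exp (θ * (y - ((m + 1 : ℕ) : ℂ) / 2) * Complex.I) *
          Complex.exp (-(θ / 2) * Complex.I) := by
      rw [← Complex.exp_add]
      push_cast
      ring_nf
    rw [e1, e2, Complex.cos, Complex.real_smul]
    push_cast
    ring

/-- Chebyshev's inequality for the averaging operator. -/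
lemma norm_avg_iterate_le_of_lt {h : ℝ → E} {B b : ℝ} (hB : ∀ x, ‖h x‖ ≤ B)
    (hb : ∀ x, b < x → h x = 0) (m : ℕ) {y : ℝ} (hy : b < y - m / 2) :
    ‖avg^[m] h y‖ ≤ B * (m / 4 / (y - m / 2 - b) ^ 2) := by
  have hB0 : 0 ≤ B := (norm_nonneg _).trans (hB 0)
  set c := y - m / 2 with hc
  have hcb : 0 < c - b := by linarith
  have h1 : ∀ x, ‖h x‖ ≤ B / (c - b) ^ 2 * (x - c) ^ 2 := by
    intro x
    rcases lt_or_ge b x with hx | hx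
    · rw [hb x hx, norm_zero]
      positivity
    · refine (hB x).trans ?_
      rw [div_mul_eq_mul_div, le_div_iff₀ (by positivity)]
      have : (c - b) ^ 2 ≤ (x - c) ^ 2 := by nlinarith
      gcongr
  refine (norm_avg_iterate_le h m y).trans ((avg_iterate_mono h1 m y).trans ?_)
  rw [avg_iterate_const_mul, avg_iterate_sq, ← hc]
  simp only [sub_self]
  apply le_of_eq
  ring

end avg

/-! ### The oscillating test functions -/

/-- A fixed cut-off supported in `[1, 2]`. -/
noncomputable def bump : ContDiffBump (3 / 2 : ℝ) := ⟨1 / 4, 1 / 2, by norm_num, by norm_num⟩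

lemma bump_eq_zero {x : ℝ} (hx : x ∉ Ioo (1 : ℝ) 2) : bump x = 0 := by
  apply bump.zero_of_le_dist
  rw [Real.dist_eq]
  change (1 / 2 : ℝ) ≤ _
  by_contra! h
  rw [abs_lt] at h
  exact hx ⟨by linarith, by linarith⟩

lemma bump_eq_one {x : ℝ} (hx : x ∈ Icc (5 / 4 : ℝ) (7 / 4)) : bump x = 1 := by
  apply bump.one_of_mem_closedBall
  rw [Metric.mem_closedBall, Real.dist_eq]
  change _ ≤ (1 / 4 : ℝ)
  rw [abs_le]
  constructor <;> linarith [hx.1, hx.2]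

lemma exists_bump_derivs : ∃ (χ₁ χ₂ χ₃ : ℝ → ℝ) (B : ℝ), 1 ≤ B ∧
    (∀ x, HasDerivAt bump (χ₁ x) x) ∧ (∀ x, HasDerivAt χ₁ (χ₂ x) x) ∧
    (∀ x, HasDerivAt χ₂ (χ₃ x) x) ∧ (∀ x, |χ₁ x| ≤ B) ∧ (∀ x, |χ₂ x| ≤ B) ∧
    (∀ x, |χ₃ x| ≤ B) ∧ ∀ x ∉ Icc (1 : ℝ) 2, χ₁ x = 0 ∧ χ₂ x = 0 ∧ χ₃ x = 0 := by
  have h0 : ContDiff ℝ ∞ (bump : ℝ → ℝ) := bump.contDiff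
  have h1 : ContDiff ℝ ∞ (deriv bump) := (contDiff_infty_iff_deriv.1 h0).2
  have h2 : ContDiff ℝ ∞ (deriv (deriv bump)) := (contDiff_infty_iff_deriv.1 h1).2
  have h3 : ContDiff ℝ ∞ (deriv (deriv (deriv bump))) := (contDiff_infty_iff_deriv.1 h2).2
  have z0 : ∀ x ∉ Icc (1 : ℝ) 2, bump x = 0 := fun x hx =>
    bump_eq_zero fun h => hx ⟨h.1.le, h.2.le⟩
  have zd : ∀ f : ℝ → ℝ, (∀ x ∉ Icc (1 : ℝ) 2, f x = 0) → ∀ x ∉ Icc (1 : ℝ) 2, deriv f x = 0 := by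
    intro f hf x hx
    have : f =ᶠ[𝓝 x] fun _ => 0 := by
      filter_upwards [isClosed_Icc.isOpen_compl.mem_nhds hx] with y hy
      exact hf y hy
    rw [this.deriv_eq]
    simp
  have hb : ∀ f : ℝ → ℝ, Continuous f → (∀ x ∉ Icc (1 : ℝ) 2, f x = 0) → ∃ B, ∀ x, |f x| ≤ B := by
    intro f hf hz
    obtain ⟨B, hB⟩ := isCompact_Icc.exists_bound_of_continuousOn (s := Icc (1 : ℝ) 2)
      hf.continuousOn
    refine ⟨max B 0, fun x => ?_⟩
    by_cases hx : x ∈ Icc (1 : ℝ) 2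
    · exact (hB x hx).trans (le_max_left _ _)
    · rw [hz x hx, abs_zero]
      exact le_max_right _ _
  have z1 := zd _ z0
  have z2 := zd _ z1
  have z3 := zd _ z2
  obtain ⟨B1, hB1⟩ := hb _ h1.continuous z1
  obtain ⟨B2, hB2⟩ := hb _ h2.continuous z2
  obtain ⟨B3, hB3⟩ := hb _ h3.continuous z3
  refine ⟨deriv bump, deriv (deriv bump), deriv (deriv (deriv bump)),
    max 1 (max B1 (max B2 B3)), le_max_left _ _,
    fun x => (h0.differentiable (by simp) x).hasDerivAt,
    fun x => (h1.differentiable (by simp) x).hasDerivAt,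
    fun x => (h2.differentiable (by simp) x).hasDerivAt, fun x => (hB1 x).trans ?_,
    fun x => (hB2 x).trans ?_, fun x => (hB3 x).trans ?_, fun x hx => ⟨z1 x hx, z2 x hx, z3 x hx⟩⟩
  · simp
  · simp
  · simp

/-- The test function `χ(y / A) exp (i w √y)`. -/
noncomputable def test (A w y : ℝ) : ℂ := bump (y / A) * Complex.exp (w * √y * Complex.I)

lemma norm_test_le (A w y : ℝ) : ‖test A w y‖ ≤ 1 := by
  rw [test, norm_mul, show (w : ℂ) * √y * Complex.I = ((w * √y : ℝ) : ℂ) * Complex.I by push_cast; rfl,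
    Complex.norm_exp_ofReal_mul_I, mul_one, Complex.norm_real, Real.norm_eq_abs,
    abs_of_nonneg bump.nonneg]
  exact bump.le_one

lemma test_eq_zero {A w y : ℝ} (hA : 0 < A) (hy : y ∉ Ioo A (2 * A)) : test A w y = 0 := by
  rw [test, bump_eq_zero, Complex.ofReal_zero, zero_mul]
  intro h
  rw [mem_Ioo, lt_div_iff₀ hA, div_lt_iff₀ hA] at h
  exact hy ⟨by linarith [h.1], h.2⟩

/-- On amplitudes, differentiation acts as p ↦ p' + (iw/2)y^{-1/2}p; iterating this rule gives all
derivatives of the test functions. -/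
lemma hasDerivAt_mul_cexp_sqrt {p : ℝ → ℂ} {p' : ℂ} {w y : ℝ} (hy : 0 < y)
    (hp : HasDerivAt p p' y) :
    HasDerivAt (fun y : ℝ => p y * Complex.exp (w * √y * Complex.I))
      ((p' + p y * (w / 2 * Complex.I * ((1 / √y : ℝ) : ℂ))) *
        Complex.exp (w * √y * Complex.I)) y := by
  have h1 : HasDerivAt (fun y : ℝ => (√y : ℂ)) ((1 / (2 * √y) : ℝ) : ℂ) y :=
    (Real.hasDerivAt_sqrt hy.ne').ofReal_comp
  have h2 := ((h1.const_mul (w : ℂ)).mul_const Complex.I).cexp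
  convert! hp.mul h2 using 1
  have : (√y : ℂ) ≠ 0 := by exact_mod_cast (Real.sqrt_pos.2 hy).ne'
  push_cast
  field_simp

lemma hasDerivAt_inv_sqrt {y : ℝ} (hy : 0 < y) :
    HasDerivAt (fun y : ℝ => ((1 / √y : ℝ) : ℂ)) (-(1 / 2) * ((1 / √y : ℝ) : ℂ) ^ 3) y := by
  have hs := Real.sqrt_pos.2 hy
  have h1 := (Real.hasDerivAt_sqrt hy.ne').inv hs.ne'
  have h2 : HasDerivAt (fun y : ℝ => 1 / √y) (-(1 / 2) * (1 / √y) ^ 3) y := by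
    convert! h1 using 1
    · ext x; simp
    · field_simp
  convert! h2.ofReal_comp using 1
  push_cast
  ring

/-- Derivatives of the test functions, with their sizes. -/
lemma exists_test_derivs (w : ℝ) : ∃ C > 0, ∀ A ≥ (1 : ℝ), ∃ ψ₁ ψ₂ ψ₃ : ℝ → ℂ,
    (∀ y, HasDerivAt (test A w) (ψ₁ y) y) ∧ (∀ y, HasDerivAt ψ₁ (ψ₂ y) y) ∧
    (∀ y, HasDerivAt ψ₂ (ψ₃ y) y) ∧ (∀ y, ‖ψ₁ y‖ ≤ C / √A) ∧ (∀ y, ‖ψ₂ y‖ ≤ C / A) ∧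
    (∀ y, ‖ψ₃ y‖ ≤ C / (A * √A)) ∧
    (∀ y ∉ Icc A (2 * A), ψ₁ y = 0 ∧ ψ₂ y = 0) ∧
    ∀ y, ‖ψ₂ y + (w ^ 2 / (4 * y) : ℝ) * test A w y‖ ≤ C / (A * √A) := by
  obtain ⟨χ₁, χ₂, χ₃, B, hB, d₀, d₁, d₂, b₁, b₂, b₃, hz⟩ := exists_bump_derivs
  set η : ℂ := w / 2 * Complex.I with hη
  have hηsq : η ^ 2 = -(w ^ 2 / 4 : ℝ) := by
    rw [hη, mul_pow, Complex.I_sq]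
    push_cast
    ring
  set N := 1 + ‖η‖
  have hN : 1 ≤ N := by simp [N]
  have hηN : ‖η‖ ≤ N := by simp [N]
  refine ⟨20 * B * N ^ 3, by positivity, fun A hA => ?_⟩
  have hA0 : 0 < A := by linarith
  have hsA := Real.sqrt_pos.2 hA0
  -- α is the unit of size: a derivative that hits the cut-off costs 1/A = α², one that hits the
  -- phase costs y^{-1/2} ≤ α.
  set α := 1 / √A with hα
  have hα0 : 0 < α := by positivity
  have hα1 : α ≤ 1 := by
    rw [hα, div_le_one hsA]
    exact Real.one_le_sqrt.2 hA
  have hα2 : α ^ 2 = 1 / A := by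
    rw [hα, div_pow, Real.sq_sqrt hA0.le, one_pow]
  -- the rescaled derivatives of the cut-off
  set X₀ : ℝ → ℂ := fun y => bump (y / A)
  set X₁ : ℝ → ℂ := fun y => (χ₁ (y / A) / A : ℝ)
  set X₂ : ℝ → ℂ := fun y => (χ₂ (y / A) / A ^ 2 : ℝ)
  set X₃ : ℝ → ℂ := fun y => (χ₃ (y / A) / A ^ 3 : ℝ)
  set a : ℝ → ℂ := fun y => ((1 / √y : ℝ) : ℂ)
  have hdiv : ∀ y, HasDerivAt (fun y : ℝ => y / A) (1 / A) y := fun y =>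
    (hasDerivAt_id y).div_const A
  have D₀ : ∀ y, HasDerivAt X₀ (X₁ y) y := fun y => by
    have := ((d₀ (y / A)).comp y (hdiv y)).ofReal_comp
    convert! this using 1
    simp only [X₁]
    push_cast
    ring
  have D₁ : ∀ y, HasDerivAt X₁ (X₂ y) y := fun y => by
    have := (((d₁ (y / A)).comp y (hdiv y)).div_const A).ofReal_comp
    convert! this using 1
    simp only [X₂]
    push_cast
    ring
  have D₂ : ∀ y, HasDerivAt X₂ (X₃ y) y := fun y => by
    have := (((d₂ (y / A)).comp y (hdiv y)).div_const (A ^ 2)).ofReal_comp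
    convert! this using 1
    simp only [X₃]
    push_cast
    ring
  have Da : ∀ y > 0, HasDerivAt a (-(1 / 2) * a y ^ 3) y := fun y hy => hasDerivAt_inv_sqrt hy
  -- The amplitudes of the first three derivatives, obtained from the rule p ↦ p' + ηap with a =
  -- y^{-1/2} and a' = -a³/2.
  set p₁ : ℝ → ℂ := fun y => X₁ y + X₀ y * (η * a y) with hp₁
  set p₂ : ℝ → ℂ := fun y => X₂ y + 2 * η * (a y * X₁ y) +
    (η ^ 2 * a y ^ 2 - 1 / 2 * η * a y ^ 3) * X₀ y with hp₂
  set p₃ : ℝ → ℂ := fun y => (X₃ y + 2 * η * (-(1 / 2) * a y ^ 3 * X₁ y + a y * X₂ y) +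
    ((-η ^ 2 * a y ^ 4 + 3 / 4 * η * a y ^ 5) * X₀ y +
      (η ^ 2 * a y ^ 2 - 1 / 2 * η * a y ^ 3) * X₁ y)) + p₂ y * (η * a y) with hp₃
  set e : ℝ → ℂ := fun y => Complex.exp (w * √y * Complex.I)
  have hout : ∀ y ∉ Icc A (2 * A), X₀ y = 0 ∧ X₁ y = 0 ∧ X₂ y = 0 ∧ X₃ y = 0 := by
    intro y hy
    have hy' : y / A ∉ Icc (1 : ℝ) 2 := by
      intro h
      rw [mem_Icc, le_div_iff₀ hA0, div_le_iff₀ hA0] at h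
      exact hy ⟨by linarith [h.1], h.2⟩
    obtain ⟨z1, z2, z3⟩ := hz _ hy'
    have z0 : bump (y / A) = 0 := bump_eq_zero fun h => hy' ⟨h.1.le, h.2.le⟩
    simp [X₀, X₁, X₂, X₃, z0, z1, z2, z3]
  -- The square root is not differentiable at 0, but the amplitudes vanish for y < A, so the
  -- derivative formulas extend to all y.
  have glue : ∀ (p p' : ℝ → ℂ), (∀ y ∉ Icc A (2 * A), p y = 0) →
      (∀ y ∉ Icc A (2 * A), p' y = 0) →
      (∀ y > 0, HasDerivAt (fun y => p y * e y) (p' y * e y) y) →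
      ∀ y, HasDerivAt (fun y => p y * e y) (p' y * e y) y := by
    intro p p' h1 h2 h3 y
    rcases lt_or_ge 0 y with hy | hy
    · exact h3 y hy
    · have hyA : y < A := by linarith
      rw [h2 y (fun h => absurd h.1 (not_le.2 hyA)), zero_mul]
      refine (hasDerivAt_const y (0 : ℂ)).congr_of_eventuallyEq ?_
      filter_upwards [gt_mem_nhds hyA] with x hx
      rw [h1 x (fun h => absurd h.1 (not_le.2 hx)), zero_mul]
  have o₁ : ∀ y ∉ Icc A (2 * A), p₁ y = 0 := fun y hy => by
    obtain ⟨z0, z1, z2, z3⟩ := hout y hy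
    simp [hp₁, z0, z1]
  have o₂ : ∀ y ∉ Icc A (2 * A), p₂ y = 0 := fun y hy => by
    obtain ⟨z0, z1, z2, z3⟩ := hout y hy
    simp [hp₂, z0, z1, z2]
  have o₃ : ∀ y ∉ Icc A (2 * A), p₃ y = 0 := fun y hy => by
    obtain ⟨z0, z1, z2, z3⟩ := hout y hy
    simp [hp₃, hp₂, z0, z1, z2, z3]
  have H₁ : ∀ y, HasDerivAt (fun y => X₀ y * e y) (p₁ y * e y) y :=
    glue X₀ p₁ (fun y hy => (hout y hy).1) o₁ fun y hy =>
      hasDerivAt_mul_cexp_sqrt hy (D₀ y)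
  have H₂ : ∀ y, HasDerivAt (fun y => p₁ y * e y) (p₂ y * e y) y := by
    refine glue p₁ p₂ o₁ o₂ fun y hy => ?_
    have h := (D₁ y).add ((D₀ y).mul ((Da y hy).const_mul η))
    convert! hasDerivAt_mul_cexp_sqrt (w := w) hy h using 1
    simp only [hp₂, e, ← hη, Pi.add_apply, Pi.mul_apply]
    ring
  have H₃ : ∀ y, HasDerivAt (fun y => p₂ y * e y) (p₃ y * e y) y := by
    refine glue p₂ p₃ o₂ o₃ fun y hy => ?_
    have h := ((D₂ y).add (((Da y hy).mul (D₁ y)).const_mul (2 * η))).add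
      (((((Da y hy).pow 2).const_mul (η ^ 2)).sub
        (((Da y hy).pow 3).const_mul (1 / 2 * η))).mul (D₀ y))
    convert! hasDerivAt_mul_cexp_sqrt (w := w) hy h using 1
    simp only [hp₂, hp₃, e, ← hη, Pi.add_apply, Pi.mul_apply, Pi.sub_apply, Pi.pow_apply,
      Nat.cast_ofNat]
    ring
  clear_value η
  have he : ∀ y, ‖e y‖ = 1 := fun y => by
    simp only [e]
    rw [show (w : ℂ) * √y * Complex.I = ((w * √y : ℝ) : ℂ) * Complex.I by push_cast; rfl,
      Complex.norm_exp_ofReal_mul_I]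
  have hX₀ : ∀ y, ‖X₀ y‖ ≤ B := fun y => by
    simp only [X₀]
    rw [Complex.norm_real, Real.norm_eq_abs, abs_of_nonneg bump.nonneg]
    exact bump.le_one.trans hB
  have hX₁ : ∀ y, ‖X₁ y‖ ≤ B * α ^ 2 := fun y => by
    simp only [X₁]
    rw [Complex.norm_real, Real.norm_eq_abs, abs_div, abs_of_pos hA0, hα2, div_eq_mul_one_div]
    gcongr
    exact b₁ _
  have hX₂ : ∀ y, ‖X₂ y‖ ≤ B * α ^ 4 := fun y => by
    simp only [X₂]
    rw [Complex.norm_real, Real.norm_eq_abs, abs_div, abs_of_pos (by positivity : 0 < A ^ 2),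
      show α ^ 4 = (α ^ 2) ^ 2 by ring, hα2, div_pow, one_pow, div_eq_mul_one_div]
    gcongr
    exact b₂ _
  have hX₃ : ∀ y, ‖X₃ y‖ ≤ B * α ^ 6 := fun y => by
    simp only [X₃]
    rw [Complex.norm_real, Real.norm_eq_abs, abs_div, abs_of_pos (by positivity : 0 < A ^ 3),
      show α ^ 6 = (α ^ 2) ^ 3 by ring, hα2, div_pow, one_pow, div_eq_mul_one_div]
    gcongr
    exact b₃ _
  have ha : ∀ y ∈ Icc A (2 * A), ‖a y‖ ≤ α := fun y hy => by
    simp only [a]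
    rw [Complex.norm_real, Real.norm_eq_abs, abs_of_nonneg (by positivity), hα]
    have := hy.1
    gcongr
  have hin : ∀ p : ℝ → ℂ, ∀ D : ℝ, 0 ≤ D → (∀ y ∉ Icc A (2 * A), p y = 0) →
      (∀ y ∈ Icc A (2 * A), ‖p y‖ ≤ D) → ∀ y, ‖p y * e y‖ ≤ D := by
    intro p D hD h1 h2 y
    rw [norm_mul, he, mul_one]
    by_cases hy : y ∈ Icc A (2 * A)
    · exact h2 y hy
    · rw [h1 y hy, norm_zero]
      exact hD
  have c₁ : 20 * B * N ^ 3 / √A = 20 * B * N ^ 3 * α := by rw [hα]; ring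
  have c₂ : 20 * B * N ^ 3 / A = 20 * B * N ^ 3 * α ^ 2 := by rw [hα2]; ring
  have c₃ : 20 * B * N ^ 3 / (A * √A) = 20 * B * N ^ 3 * α ^ 3 := by
    rw [show α ^ 3 = α ^ 2 * α by ring, hα2, hα]
    field_simp
  -- Since α ≤ 1 ≤ N, a monomial is dominated by one with a lower power of α and a higher power of
  -- N.
  have pw : ∀ {i j k l : ℕ}, i ≤ j → k ≤ l → B * N ^ k * α ^ j ≤ B * N ^ l * α ^ i := by
    intro i j k l hij hkl
    have h1 : α ^ j ≤ α ^ i := pow_le_pow_of_le_one hα0.le hα1 hij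
    have h2 : N ^ k ≤ N ^ l := pow_le_pow_right₀ hN hkl
    gcongr
  have P₂ : ∀ y ∈ Icc A (2 * A), ‖p₂ y‖ ≤ 5 * (B * N ^ 2 * α ^ 2) := by
    intro y hy
    have ha' := ha y hy
    have t1 : ‖X₂ y‖ ≤ B * N ^ 2 * α ^ 2 := by
      have := pw (i := 2) (j := 4) (k := 0) (l := 2) (by norm_num) (by norm_num)
      rw [pow_zero, mul_one] at this
      exact (hX₂ y).trans this
    have t2 : ‖2 * η * (a y * X₁ y)‖ ≤ 2 * (B * N ^ 2 * α ^ 2) := by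
      rw [norm_mul, norm_mul, norm_mul, Complex.norm_ofNat]
      calc 2 * ‖η‖ * (‖a y‖ * ‖X₁ y‖) ≤ 2 * N * (α * (B * α ^ 2)) := by
            gcongr; exact hX₁ y
        _ = 2 * (B * N ^ 1 * α ^ 3) := by ring
        _ ≤ 2 * (B * N ^ 2 * α ^ 2) := by gcongr 2 * ?_; exact pw (by norm_num) (by norm_num)
    have t3 : ‖(η ^ 2 * a y ^ 2 - 1 / 2 * η * a y ^ 3) * X₀ y‖ ≤ 2 * (B * N ^ 2 * α ^ 2) := by
      rw [norm_mul]
      have h1 : ‖η ^ 2 * a y ^ 2 - 1 / 2 * η * a y ^ 3‖ ≤ N ^ 2 * α ^ 2 + N * α ^ 3 := by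
        refine (norm_sub_le _ _).trans ?_
        simp only [norm_mul, norm_pow]
        gcongr
        have : ‖(1 / 2 : ℂ)‖ ≤ 1 := by norm_num
        calc ‖(1 / 2 : ℂ)‖ * ‖η‖ ≤ 1 * N := by gcongr
          _ = N := one_mul N
      calc _ ≤ (N ^ 2 * α ^ 2 + N * α ^ 3) * B := by gcongr; exact hX₀ y
        _ = B * N ^ 2 * α ^ 2 + B * N ^ 1 * α ^ 3 := by ring
        _ ≤ B * N ^ 2 * α ^ 2 + B * N ^ 2 * α ^ 2 :=
            add_le_add le_rfl (pw (by norm_num) (by norm_num))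
        _ = _ := by ring
    calc ‖p₂ y‖ ≤ ‖X₂ y‖ + ‖2 * η * (a y * X₁ y)‖ +
          ‖(η ^ 2 * a y ^ 2 - 1 / 2 * η * a y ^ 3) * X₀ y‖ := norm_add₃_le
      _ ≤ _ := by linarith
  refine ⟨fun y => p₁ y * e y, fun y => p₂ y * e y, fun y => p₃ y * e y, H₁, H₂, H₃, ?_, ?_, ?_,
    fun y hy => ⟨by simp [o₁ y hy], by simp [o₂ y hy]⟩, ?_⟩
  · rw [c₁]
    refine hin p₁ _ (by positivity) o₁ fun y hy => ?_
    have ha' := ha y hy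
    have t1 : ‖X₁ y‖ ≤ B * N ^ 3 * α := by
      have := pw (i := 1) (j := 2) (k := 0) (l := 3) (by norm_num) (by norm_num)
      rw [pow_zero, mul_one, pow_one] at this
      exact (hX₁ y).trans this
    have t2 : ‖X₀ y * (η * a y)‖ ≤ B * N ^ 3 * α := by
      rw [norm_mul, norm_mul]
      calc _ ≤ B * (N * α) := by gcongr; exact hX₀ y
        _ = B * N ^ 1 * α ^ 1 := by ring
        _ ≤ B * N ^ 3 * α ^ 1 := pw le_rfl (by norm_num)
        _ = _ := by ring
    have : 0 < B * N ^ 3 * α := by positivity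
    calc ‖p₁ y‖ ≤ _ := norm_add_le _ _
      _ ≤ _ := by linarith
  · rw [c₂]
    refine hin p₂ _ (by positivity) o₂ fun y hy => (P₂ y hy).trans ?_
    have := pw (i := 2) (j := 2) (k := 2) (l := 3) le_rfl (by norm_num)
    have : 0 < B * N ^ 3 * α ^ 2 := by positivity
    linarith
  · rw [c₃]
    refine hin p₃ _ (by positivity) o₃ fun y hy => ?_
    have ha' := ha y hy
    have half : ‖(1 / 2 : ℂ)‖ ≤ 1 := by norm_num
    have Q : ∀ {i j : ℕ}, 3 ≤ i → j ≤ 3 → B * N ^ j * α ^ i ≤ B * N ^ 3 * α ^ 3 :=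
      fun hi hj => pw hi hj
    have t1 : ‖X₃ y‖ ≤ B * N ^ 3 * α ^ 3 := by
      have := Q (i := 6) (j := 0) (by norm_num) (by norm_num)
      rw [pow_zero, mul_one] at this
      exact (hX₃ y).trans this
    have t2 : ‖2 * η * (-(1 / 2) * a y ^ 3 * X₁ y + a y * X₂ y)‖ ≤ 4 * (B * N ^ 3 * α ^ 3) := by
      have h1 : ‖-(1 / 2) * a y ^ 3 * X₁ y‖ ≤ 1 * α ^ 3 * (B * α ^ 2) := by
        rw [norm_mul, norm_mul, norm_neg, norm_pow]
        gcongr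
        exact hX₁ y
      have h2 : ‖a y * X₂ y‖ ≤ α * (B * α ^ 4) := by
        rw [norm_mul]
        gcongr
        exact hX₂ y
      rw [norm_mul, norm_mul, Complex.norm_ofNat]
      calc 2 * ‖η‖ * ‖-(1 / 2) * a y ^ 3 * X₁ y + a y * X₂ y‖
          ≤ 2 * N * (1 * α ^ 3 * (B * α ^ 2) + α * (B * α ^ 4)) := by
            gcongr
            exact (norm_add_le _ _).trans (add_le_add h1 h2)
        _ = 4 * (B * N ^ 1 * α ^ 5) := by ring
        _ ≤ 4 * (B * N ^ 3 * α ^ 3) := by gcongr 4 * ?_; exact Q (by norm_num) (by norm_num)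
    have t3 : ‖(-η ^ 2 * a y ^ 4 + 3 / 4 * η * a y ^ 5) * X₀ y‖ ≤ 2 * (B * N ^ 3 * α ^ 3) := by
      have h1 : ‖-η ^ 2 * a y ^ 4 + 3 / 4 * η * a y ^ 5‖ ≤ N ^ 2 * α ^ 4 + 1 * N * α ^ 5 := by
        refine (norm_add_le _ _).trans ?_
        simp only [norm_mul, norm_pow, norm_neg]
        have : ‖(3 / 4 : ℂ)‖ ≤ 1 := by norm_num
        gcongr
      rw [norm_mul]
      calc _ ≤ (N ^ 2 * α ^ 4 + 1 * N * α ^ 5) * B := by gcongr; exact hX₀ y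
        _ = B * N ^ 2 * α ^ 4 + B * N ^ 1 * α ^ 5 := by ring
        _ ≤ B * N ^ 3 * α ^ 3 + B * N ^ 3 * α ^ 3 := by
            gcongr ?_ + ?_
            · exact Q (by norm_num) (by norm_num)
            · exact Q (by norm_num) (by norm_num)
        _ = _ := by ring
    have t4 : ‖(η ^ 2 * a y ^ 2 - 1 / 2 * η * a y ^ 3) * X₁ y‖ ≤ 2 * (B * N ^ 3 * α ^ 3) := by
      have h1 : ‖η ^ 2 * a y ^ 2 - 1 / 2 * η * a y ^ 3‖ ≤ N ^ 2 * α ^ 2 + 1 * N * α ^ 3 := by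
        refine (norm_sub_le _ _).trans ?_
        simp only [norm_mul, norm_pow]
        gcongr
      rw [norm_mul]
      calc _ ≤ (N ^ 2 * α ^ 2 + 1 * N * α ^ 3) * (B * α ^ 2) := by gcongr; exact hX₁ y
        _ = B * N ^ 2 * α ^ 4 + B * N ^ 1 * α ^ 5 := by ring
        _ ≤ B * N ^ 3 * α ^ 3 + B * N ^ 3 * α ^ 3 := by
            gcongr ?_ + ?_
            · exact Q (by norm_num) (by norm_num)
            · exact Q (by norm_num) (by norm_num)
        _ = _ := by ring
    have t5 : ‖p₂ y * (η * a y)‖ ≤ 5 * (B * N ^ 3 * α ^ 3) := by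
      rw [norm_mul, norm_mul]
      calc _ ≤ 5 * (B * N ^ 2 * α ^ 2) * (N * α) := by gcongr; exact P₂ y hy
        _ = _ := by ring
    have : 0 < B * N ^ 3 * α ^ 3 := by positivity
    calc ‖p₃ y‖ ≤ _ := norm_add_le _ _
      _ ≤ _ := add_le_add norm_add₃_le le_rfl
      _ ≤ _ := add_le_add (add_le_add le_rfl (norm_add_le _ _)) le_rfl
      _ ≤ _ := by linarith
  · rw [c₃]
    intro y
    have e0 : p₂ y * e y + (w ^ 2 / (4 * y) : ℝ) * test A w y =
        (p₂ y + (w ^ 2 / (4 * y) : ℝ) * X₀ y) * e y := by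
      simp only [test, X₀, e]
      ring
    rw [e0]
    refine hin (fun y => p₂ y + (w ^ 2 / (4 * y) : ℝ) * X₀ y) _ (by positivity)
      (fun y hy => by simp [o₂ y hy, (hout y hy).1]) (fun y hy => ?_) y
    have ha' := ha y hy
    have hy0 : 0 < y := hA0.trans_le hy.1
    have ea : a y ^ 2 = ((1 / y : ℝ) : ℂ) := by
      simp only [a]
      rw [← Complex.ofReal_pow, div_pow, one_pow, Real.sq_sqrt hy0.le]
    -- The only term of order α² in ψ'' is η²a²χ = -w²χ/(4y); once it is removed everything left is
    -- of order α³.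
    have e1 : p₂ y + (w ^ 2 / (4 * y) : ℝ) * X₀ y =
        X₂ y + 2 * η * (a y * X₁ y) + -(1 / 2) * η * a y ^ 3 * X₀ y := by
      simp only [hp₂]
      rw [hηsq, ea]
      push_cast
      field_simp
      ring
    rw [e1]
    have t1 : ‖X₂ y‖ ≤ B * N ^ 3 * α ^ 3 := by
      have := pw (i := 3) (j := 4) (k := 0) (l := 3) (by norm_num) (by norm_num)
      rw [pow_zero, mul_one] at this
      exact (hX₂ y).trans this
    have t2 : ‖2 * η * (a y * X₁ y)‖ ≤ 2 * (B * N ^ 3 * α ^ 3) := by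
      rw [norm_mul, norm_mul, norm_mul, Complex.norm_ofNat]
      calc 2 * ‖η‖ * (‖a y‖ * ‖X₁ y‖) ≤ 2 * N * (α * (B * α ^ 2)) := by
            gcongr; exact hX₁ y
        _ = 2 * (B * N ^ 1 * α ^ 3) := by ring
        _ ≤ 2 * (B * N ^ 3 * α ^ 3) := by gcongr 2 * ?_; exact pw (by norm_num) (by norm_num)
    have t3 : ‖-(1 / 2) * η * a y ^ 3 * X₀ y‖ ≤ B * N ^ 3 * α ^ 3 := by
      have : ‖(1 / 2 : ℂ)‖ ≤ 1 := by norm_num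
      rw [norm_mul, norm_mul, norm_mul, norm_neg, norm_pow]
      calc _ ≤ 1 * N * α ^ 3 * B := by gcongr; exact hX₀ y
        _ = B * N ^ 1 * α ^ 3 := by ring
        _ ≤ _ := pw (by norm_num) (by norm_num)
    have : 0 < B * N ^ 3 * α ^ 3 := by positivity
    calc _ ≤ _ := norm_add₃_le
      _ ≤ _ := by linarith

end GodunovTV

namespace GodunovTV

/-! ### Duality for the second component -/

lemma tsum_int_eq_sum_range {E : Type*} [AddCommMonoid E] [TopologicalSpace E] {F : ℤ → E} {n : ℤ}
    {N : ℕ} (h : ∀ j, j < n ∨ n + N ≤ j → F j = 0) :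
    ∑' j, F j = ∑ k ∈ Finset.range N, F (n + k) := by
  have hinj : Function.Injective (fun k : ℕ => n + (k : ℤ)) := fun a b hab => by
    simpa using hab
  rw [tsum_eq_sum (s := (Finset.range N).map ⟨_, hinj⟩), Finset.sum_map]
  · rfl
  · intro j hj
    apply h
    by_contra! hc
    apply hj
    rw [Finset.mem_map]
    exact ⟨(j - n).toNat, by rw [Finset.mem_range]; omega,
      by simp only [Function.Embedding.coeFn_mk]; omega⟩

/-- A function that vanishes outside a bounded interval. -/
def BddSupport (P : ℝ → ℂ) : Prop := ∃ a b : ℝ, (∀ x < a, P x = 0) ∧ ∀ x, b < x → P x = 0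

lemma BddSupport.avg_iterate {P : ℝ → ℂ} (hP : BddSupport P) (m : ℕ) : BddSupport (avg^[m] P) := by
  obtain ⟨a, b, ha, hb⟩ := hP
  exact ⟨a, b + m, fun x hx => avg_iterate_eq_zero_of_lt ha m hx,
    fun x hx => avg_iterate_eq_zero_of_gt hb m hx⟩

lemma BddSupport.comp_add_const {P : ℝ → ℂ} (hP : BddSupport P) (d : ℝ) :
    BddSupport (fun x => P (x + d)) := by
  obtain ⟨a, b, ha, hb⟩ := hP
  exact ⟨a - d, b - d, fun x hx => ha _ (by linarith), fun x hx => hb _ (by linarith)⟩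

lemma BddSupport.sub {P R : ℝ → ℂ} (hP : BddSupport P) (hR : BddSupport R) :
    BddSupport (fun x => P x - R x) := by
  obtain ⟨a, b, ha, hb⟩ := hP
  obtain ⟨a', b', ha', hb'⟩ := hR
  refine ⟨min a a', max b b', fun x hx => ?_, fun x hx => ?_⟩
  · change P x - R x = 0
    rw [ha x (hx.trans_le (min_le_left _ _)), ha' x (hx.trans_le (min_le_right _ _)), sub_zero]
  · change P x - R x = 0
    rw [hb x ((le_max_left _ _).trans_lt hx), hb' x ((le_max_right _ _).trans_lt hx), sub_zero]

lemma BddSupport.summable {P : ℝ → ℂ} (hP : BddSupport P) (w : ℤ → ℂ) :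
    Summable (fun j : ℤ => w j * P (-j)) := by
  obtain ⟨a, b, ha, hb⟩ := hP
  refine summable_of_ne_finset_zero (s := Finset.Icc ⌊-b⌋ ⌈-a⌉) fun j hj => ?_
  rw [Finset.mem_Icc, not_and_or, not_le, not_le] at hj
  rcases hj with h | h
  · have h1 := Int.lt_floor_iff.1 h
    rw [hb _ (by linarith), mul_zero]
  · have h1 := Int.ceil_lt_iff.1 h
    rw [ha _ (by linarith), mul_zero]

lemma avg_iterate_comp_add (h : ℝ → ℂ) (d : ℝ) (m : ℕ) (y : ℝ) :
    avg^[m] (fun x => h (x + d)) y = avg^[m] h (y + d) := by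
  induction m generalizing y with
  | zero => rfl
  | succ m ih =>
    simp only [avg_iterate_succ, ih]
    congr 3
    ring_nf

section pairing
variable {μ : ℝ} {lam₀ : ℚ} {T : ℕ} {g : ℝ → ℝ}

/-- Duhamel's formula in transposed form. With test functions evaluated at y = -j, the shift j ↦ j -
1 of the scheme becomes y ↦ y - 1, so the transpose of one step of the scheme is `avg`; the initial
data vanish. -/
lemma tsum_vSteps_mul (n : ℕ) {P : ℝ → ℂ} (hP : BddSupport P) :
    ∑' j : ℤ, (vSteps μ lam₀ T g n j : ℂ) * P (-j) = -∑ m ∈ Finset.range n, ∑' j : ℤ,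
      ((g (uGrid μ lam₀ T (-2 * T + (n - 1 - m : ℤ)) j) -
        g (uGrid μ lam₀ T (-2 * T + (n - 1 - m : ℤ)) (j - 1)) : ℝ) : ℂ) * avg^[m] P (-j) := by
  induction n generalizing P with
  | zero => simp [vSteps]
  | succ n ih =>
    rw [Finset.sum_range_succ']
    have hav : BddSupport (avg P) := hP.avg_iterate 1
    have hsh : BddSupport (fun x => P (x - 1)) := hP.comp_add_const (-1)
    set Δ : ℤ → ℂ := fun j => ((g (uGrid μ lam₀ T (-2 * T + n) j) -
      g (uGrid μ lam₀ T (-2 * T + n) (j - 1)) : ℝ) : ℂ) with hΔ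
    have e1 : ∑' j : ℤ, (vSteps μ lam₀ T g (n + 1) j : ℂ) * P (-j) =
        ∑' j : ℤ, (vSteps μ lam₀ T g n j : ℂ) * avg P (-j) - ∑' j : ℤ, Δ j * P (-j) := by
      have s1 := hP.summable fun j => (vSteps μ lam₀ T g n j : ℂ)
      have s2 := hsh.summable fun j => (vSteps μ lam₀ T g n j : ℂ)
      have s3 := hP.summable Δ
      have s4 := hP.summable fun j => (vSteps μ lam₀ T g n (j - 1) : ℂ)
      have e2 : ∑' j : ℤ, (vSteps μ lam₀ T g n (j - 1) : ℂ) * P (-j) =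
          ∑' j : ℤ, (vSteps μ lam₀ T g n j : ℂ) * P (-j - 1) := by
        rw [← (Equiv.addRight (1 : ℤ)).tsum_eq]
        refine tsum_congr fun j => ?_
        simp only [Equiv.coe_addRight, add_sub_cancel_right]
        push_cast
        rw [neg_add, sub_eq_add_neg]
      have e3 : ∀ j : ℤ, (vSteps μ lam₀ T g n j : ℂ) * avg P (-j) =
          1 / 2 * ((vSteps μ lam₀ T g n j : ℂ) * P (-j)) +
            1 / 2 * ((vSteps μ lam₀ T g n j : ℂ) * P (-j - 1)) := by
        intro j
        rw [avg, Complex.real_smul]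
        push_cast
        ring
      have e4 : ∀ j : ℤ, (vSteps μ lam₀ T g (n + 1) j : ℂ) * P (-j) =
          1 / 2 * ((vSteps μ lam₀ T g n (j - 1) : ℂ) * P (-j)) +
            1 / 2 * ((vSteps μ lam₀ T g n j : ℂ) * P (-j)) - Δ j * P (-j) := by
        intro j
        simp only [vSteps, hΔ]
        push_cast
        ring
      rw [tsum_congr e3, tsum_congr e4,
        ((s4.mul_left (1 / 2)).add (s1.mul_left (1 / 2))).tsum_sub s3,
        (s4.mul_left (1 / 2)).tsum_add (s1.mul_left (1 / 2)),
        (s1.mul_left (1 / 2)).tsum_add (s2.mul_left (1 / 2)),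
        tsum_mul_left, tsum_mul_left, tsum_mul_left, e2]
      ring
    rw [e1, ih hav, neg_add]
    congr 1
    · congr 1
      refine Finset.sum_congr rfl fun m _ => ?_
      have : (((n + 1 : ℕ) : ℤ) - 1 - ((m + 1 : ℕ) : ℤ)) = (n : ℤ) - 1 - m := by push_cast; ring
      rw [this]
      rfl
    · congr 1
      simp [hΔ]

/-- The pairing of one slice of the source term with the evolved test function. -/
noncomputable def slice (f : ℤ → ℝ) (h : ℝ → ℂ) : ℂ :=
  ∑' j : ℤ, ((f (j + 1) - f j : ℝ) : ℂ) * (h (-j) - h (-j - 1))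

/-- Summation by parts moves the increment of `V` onto ψ, and then Duhamel's formula with 2T + 1
steps applies. Counting m backwards from the last source, the source paired with `avg^[m]` sits at
time -m. -/
lemma tsum_mul_V {ψ : ℝ → ℂ} (hψ : BddSupport ψ) :
    ∑' J : ℤ, ψ J * ((V μ lam₀ T g (-J) : ℂ) - V μ lam₀ T g (-J - 1)) =
      -∑ m ∈ Finset.range (2 * T + 1),
        slice (fun j => g (u μ lam₀ T (-m) j)) (avg^[m] ψ) := by
  have hV : ∀ j : ℤ, V μ lam₀ T g j = vSteps μ lam₀ T g (2 * T + 1) (j + 1) := by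
    intro j
    rw [V, vGrid, show ((1 : ℤ) + 2 * T).toNat = 2 * T + 1 by omega]
  set v : ℤ → ℂ := fun j => (vSteps μ lam₀ T g (2 * T + 1) j : ℂ)
  have h1 := hψ.comp_add_const 1
  have e1 : ∑' J : ℤ, ψ J * ((V μ lam₀ T g (-J) : ℂ) - V μ lam₀ T g (-J - 1)) =
      ∑' j : ℤ, v j * (ψ (-j + 1) - ψ (-j)) := by
    have s0 := hψ.summable fun j => v (j + 1)
    have s1 := hψ.summable v
    have s2 := h1.summable v
    rw [← (Equiv.neg ℤ).tsum_eq]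
    have e2 : ∀ j : ℤ, ψ ((Equiv.neg ℤ j : ℤ) : ℝ) * ((V μ lam₀ T g (-(Equiv.neg ℤ j)) : ℂ) -
        V μ lam₀ T g (-(Equiv.neg ℤ j) - 1)) = v (j + 1) * ψ (-j) - v j * ψ (-j) := by
      intro j
      simp only [Equiv.neg_apply, neg_neg, hV, v, sub_add_cancel]
      push_cast
      ring
    have e3 : ∑' j : ℤ, v (j + 1) * ψ (-j) = ∑' j : ℤ, v j * ψ (-j + 1) := by
      conv_rhs => rw [← (Equiv.addRight (1 : ℤ)).tsum_eq]
      refine tsum_congr fun j => ?_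
      simp
    rw [tsum_congr e2, s0.tsum_sub s1, e3, ← s2.tsum_sub s1]
    refine tsum_congr fun j => ?_
    ring
  rw [e1, tsum_vSteps_mul (2 * T + 1) (h1.sub hψ)]
  congr 1
  refine Finset.sum_congr rfl fun m hm => ?_
  rw [slice, ← (Equiv.addRight (1 : ℤ)).tsum_eq]
  refine tsum_congr fun j => ?_
  have e4 : -2 * (T : ℤ) + (((2 * T + 1 : ℕ) : ℤ) - 1 - m) = -m := by push_cast; ring
  rw [e4, avg_iterate_sub, avg_iterate_comp_add]
  simp only [Equiv.coe_addRight, add_sub_cancel_right, uGrid]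
  push_cast
  congr 3
  · ring_nf
  · ring_nf

end pairing

/-! ### Taylor expansion of a slice -/

section taylor
variable {h h₁ h₂ h₃ : ℝ → ℂ} {B : ℝ}

lemma norm_sub_le_of_deriv (d : ∀ y, HasDerivAt h (h₁ y) y) (hB : ∀ y, ‖h₁ y‖ ≤ B) (y x : ℝ) :
    ‖h (y + x) - h y‖ ≤ B * |x| := by
  have := convex_univ.norm_image_sub_le_of_norm_hasDerivWithin_le (𝕜 := ℝ) (f := h) (x := y)
    (y := y + x) (fun z _ => (d z).hasDerivWithinAt) (fun z _ => hB z) (mem_univ _) (mem_univ _)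
  simpa using this

lemma norm_sub_sub_le_of_deriv (d : ∀ y, HasDerivAt h (h₁ y) y)
    (d₁ : ∀ y, HasDerivAt h₁ (h₂ y) y) (hB : ∀ y, ‖h₂ y‖ ≤ B) (y x : ℝ) :
    ‖h (y + x) - h y - x * h₁ y‖ ≤ B * |x| ^ 2 := by
  have hB0 : 0 ≤ B := (norm_nonneg _).trans (hB 0)
  have hd : ∀ z, HasDerivAt (fun z : ℝ => h z - (z - y : ℝ) * h₁ y) (h₁ z - h₁ y) z := by
    intro z
    have h1 : HasDerivAt (fun z : ℝ => ((z - y : ℝ) : ℂ)) ((1 : ℝ) : ℂ) z :=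
      ((hasDerivAt_id z).sub_const y).ofReal_comp
    convert! (d z).sub (h1.mul_const (h₁ y)) using 1
    simp
  have := (convex_uIcc y (y + x)).norm_image_sub_le_of_norm_hasDerivWithin_le (𝕜 := ℝ)
    (x := y) (y := y + x) (C := B * |x|) (fun z _ => (hd z).hasDerivWithinAt) (fun z hz => by
      have h1 := norm_sub_le_of_deriv d₁ hB y (z - y)
      rw [add_sub_cancel] at h1
      have h2 : |z - y| ≤ |x| := by simpa using abs_sub_left_of_mem_uIcc hz
      exact h1.trans (mul_le_mul_of_nonneg_left h2 hB0)) left_mem_uIcc right_mem_uIcc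
  have e : (h (y + x) - ((y + x - y : ℝ) : ℂ) * h₁ y) - (h y - ((y - y : ℝ) : ℂ) * h₁ y) =
      h (y + x) - h y - x * h₁ y := by
    push_cast
    ring
  rw [e] at this
  refine this.trans (le_of_eq ?_)
  rw [add_sub_cancel_left, Real.norm_eq_abs]
  ring

lemma norm_sub_sub_sub_le_of_deriv (d : ∀ y, HasDerivAt h (h₁ y) y)
    (d₁ : ∀ y, HasDerivAt h₁ (h₂ y) y) (d₂ : ∀ y, HasDerivAt h₂ (h₃ y) y) (hB : ∀ y, ‖h₃ y‖ ≤ B)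
    (y x : ℝ) : ‖h (y + x) - h y - x * h₁ y - x ^ 2 / 2 * h₂ y‖ ≤ B * |x| ^ 3 := by
  have hB0 : 0 ≤ B := (norm_nonneg _).trans (hB 0)
  have hd : ∀ z, HasDerivAt (fun z : ℝ => h z - (z - y : ℝ) * h₁ y -
      ((z - y) ^ 2 / 2 : ℝ) * h₂ y) (h₁ z - h₁ y - (z - y : ℝ) * h₂ y) z := by
    intro z
    have h0 : HasDerivAt (fun z : ℝ => z - y) 1 z := (hasDerivAt_id z).sub_const y
    have h1 : HasDerivAt (fun z : ℝ => ((z - y : ℝ) : ℂ)) ((1 : ℝ) : ℂ) z := h0.ofReal_comp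
    have h2 : HasDerivAt (fun z : ℝ => (((z - y) ^ 2 / 2 : ℝ) : ℂ)) ((z - y : ℝ) : ℂ) z := by
      have h3 := ((h0.pow 2).div_const 2).ofReal_comp
      convert! h3 using 1
      push_cast
      ring
    convert! ((d z).sub (h1.mul_const (h₁ y))).sub (h2.mul_const (h₂ y)) using 1
    simp
  have := (convex_uIcc y (y + x)).norm_image_sub_le_of_norm_hasDerivWithin_le (𝕜 := ℝ)
    (x := y) (y := y + x) (C := B * |x| ^ 2) (fun z _ => (hd z).hasDerivWithinAt) (fun z hz => by
      have h1 := norm_sub_sub_le_of_deriv d₁ d₂ hB y (z - y)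
      rw [add_sub_cancel] at h1
      have h2 : |z - y| ≤ |x| := by simpa using abs_sub_left_of_mem_uIcc hz
      exact h1.trans (mul_le_mul_of_nonneg_left (pow_le_pow_left₀ (abs_nonneg _) h2 2) hB0)) left_mem_uIcc right_mem_uIcc
  have e : (h (y + x) - ((y + x - y : ℝ) : ℂ) * h₁ y - (((y + x - y) ^ 2 / 2 : ℝ) : ℂ) * h₂ y) -
      (h y - ((y - y : ℝ) : ℂ) * h₁ y - (((y - y) ^ 2 / 2 : ℝ) : ℂ) * h₂ y) =
      h (y + x) - h y - x * h₁ y - x ^ 2 / 2 * h₂ y := by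
    push_cast
    ring
  rw [e] at this
  refine this.trans (le_of_eq ?_)
  rw [add_sub_cancel_left, Real.norm_eq_abs]
  ring

end taylor

/-- The `1`-periodic first moment of the increments of a transition profile `G`. -/
noncomputable def moment (G : ℝ → ℝ) (θ : ℝ) : ℝ :=
  ∑' i : ℤ, ((i : ℝ) - θ) * (G (i + 1 - θ) - G (i - θ))

/-- A transition from `0` to `c` inside `[-Y, Y]`. -/
structure IsTransition (G : ℝ → ℝ) (Y c : ℝ) : Prop where
  left : ∀ y ≤ -Y, G y = 0
  right : ∀ y, Y ≤ y → G y = c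

lemma moment_eq_sum {G : ℝ → ℝ} {Y c : ℝ} (hG : IsTransition G Y c) {θ : ℝ} {n : ℤ} {N : ℕ}
    (hn : n ≤ θ - Y - 1) (hN : θ + Y ≤ n + N) :
    moment G θ = ∑ k ∈ Finset.range N, ((n + k : ℝ) - θ) * (G (n + k + 1 - θ) - G (n + k - θ)) := by
  rw [moment, tsum_int_eq_sum_range (n := n) (N := N)]
  · push_cast
    rfl
  · rintro j (h | h)
    · have h1 : (j : ℝ) + 1 ≤ n := by exact_mod_cast h
      rw [hG.left _ (by linarith), hG.left _ (by linarith), sub_zero, mul_zero]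
    · have h1 : (n : ℝ) + N ≤ j := by exact_mod_cast h
      rw [hG.right _ (by linarith), hG.right _ (by linarith), sub_self, mul_zero]

lemma slice_eq_sum {f : ℤ → ℝ} {h : ℝ → ℂ} {θ Y c : ℝ} (hl : ∀ j : ℤ, j ≤ θ - Y → f j = 0)
    (hr : ∀ j : ℤ, θ + Y ≤ j → f j = c) {n : ℤ} {N : ℕ}
    (hn : n ≤ θ - Y - 1) (hN : θ + Y ≤ n + N) :
    slice f h = ∑ k ∈ Finset.range N, ((f (n + k + 1) - f (n + k) : ℝ) : ℂ) *
      (h (-(n + k : ℝ)) - h (-(n + k : ℝ) - 1)) := by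
  rw [slice, tsum_int_eq_sum_range (n := n) (N := N)]
  · push_cast
    rfl
  · rintro j (hj | hj)
    · have h1 : (j : ℝ) + 1 ≤ n := by exact_mod_cast hj
      rw [hl (j + 1) (by push_cast; linarith), hl j (by linarith)]
      simp
    · have h1 : (n : ℝ) + N ≤ j := by exact_mod_cast hj
      rw [hr (j + 1) (by push_cast; linarith), hr j (by linarith)]
      simp

/-- Taylor expansion of a slice whose source term is close to a translated transition. -/
lemma exists_norm_slice_sub_le {Y : ℝ} (hY : 0 ≤ Y) (K : ℝ) : ∃ C > 0, ∀ (G : ℝ → ℝ) (f : ℤ → ℝ)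
    (h h₁ h₂ h₃ : ℝ → ℂ) (c θ δ B₂ B₃ : ℝ), IsTransition G Y c →
    (∀ j : ℤ, j ≤ θ - Y → f j = 0) → (∀ j : ℤ, θ + Y ≤ j → f j = c) → (∀ j, |f j| ≤ K) →
    (∀ j : ℤ, |f j - G (j - θ)| ≤ δ) → (∀ y, HasDerivAt h (h₁ y) y) →
    (∀ y, HasDerivAt h₁ (h₂ y) y) → (∀ y, HasDerivAt h₂ (h₃ y) y) → (∀ y, ‖h₂ y‖ ≤ B₂) →
    (∀ y, ‖h₃ y‖ ≤ B₃) →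
    ‖slice f h - (c * h₁ (-θ) - (moment G θ + c / 2 : ℝ) * h₂ (-θ))‖ ≤ C * (B₃ + δ * B₂) := by
  -- The number of lattice points in a window that begins at least 1 to the left of θ - Y and
  -- reaches beyond θ + Y; the increments of f vanish outside it.
  set N : ℕ := ⌈2 * Y⌉₊ + 3 with hN
  set R : ℝ := N + Y + 4 with hR
  have hR0 : 0 < R := by positivity
  refine ⟨N * (4 * (|K| + 1) * R ^ 3 + 2 * R), by positivity, ?_⟩
  intro G f h h₁ h₂ h₃ c θ δ B₂ B₃ hG hl hr hK hδ d d₁ d₂ hB₂ hB₃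
  have hB₂0 : 0 ≤ B₂ := (norm_nonneg _).trans (hB₂ 0)
  have hB₃0 : 0 ≤ B₃ := (norm_nonneg _).trans (hB₃ 0)
  have hδ0 : 0 ≤ δ := (abs_nonneg _).trans (hδ 0)
  set n : ℤ := ⌊θ - Y⌋ - 1 with hn
  have hn1 : (n : ℝ) ≤ θ - Y - 1 := by
    have := Int.floor_le (θ - Y)
    rw [hn]
    push_cast
    linarith
  have hn2 : θ - Y - 2 < n := by
    have := Int.lt_floor_add_one (θ - Y)
    rw [hn]
    push_cast
    linarith
  have hNY : 2 * Y + 3 ≤ N := by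
    have := Nat.le_ceil (2 * Y)
    rw [hN]
    push_cast
    linarith
  have hN1 : θ + Y ≤ n + N := by linarith
  rw [slice_eq_sum hl hr hn1 hN1, moment_eq_sum hG hn1 hN1]
  set Δ : ℕ → ℝ := fun k => f (n + k + 1) - f (n + k) with hΔ
  set ΔG : ℕ → ℝ := fun k => G (n + k + 1 - θ) - G (n + k - θ) with hΔG
  have tel : ∑ k ∈ Finset.range N, Δ k = c := by
    have := Finset.sum_range_sub (fun k : ℕ => f (n + k)) N
    simp only [Nat.cast_add, Nat.cast_one, ← add_assoc] at this
    rw [hΔ, this, hr (n + N) (by push_cast; linarith), Nat.cast_zero, add_zero,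
      hl n (by linarith), sub_zero]
  have telG : ∑ k ∈ Finset.range N, ΔG k = c := by
    have := Finset.sum_range_sub (fun k : ℕ => G (n + k - θ)) N
    simp only [Nat.cast_add, Nat.cast_one, ← add_assoc] at this
    rw [hΔG, this, hG.right _ (by linarith), Nat.cast_zero, add_zero,
      hG.left _ (by linarith), sub_zero]
  have hx : ∀ k ∈ Finset.range N, |(n : ℝ) + k - θ| + 1 ≤ R := by
    intro k hk
    have h1 : (k : ℝ) ≤ N := by exact_mod_cast (Finset.mem_range.1 hk).le
    have h2 : (0 : ℝ) ≤ k := k.cast_nonneg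
    rw [← le_sub_iff_add_le, abs_le]
    constructor <;> simp only [hR] <;> linarith
  -- With x = n + k - θ, the increment of h at -θ - x is h' - (x + 1/2)h'' + O(h'''). The increments
  -- of f sum exactly to c, which gives the first-order term; in the second-order term they are
  -- replaced by those of G, at cost δ, which yields moment + c/2.
  have key : ∑ k ∈ Finset.range N, ((f (n + k + 1) - f (n + k) : ℝ) : ℂ) *
      (h (-(n + k : ℝ)) - h (-(n + k : ℝ) - 1)) - (c * h₁ (-θ) -
        ((∑ k ∈ Finset.range N, ((n + k : ℝ) - θ) * (G (n + k + 1 - θ) - G (n + k - θ))) +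
          c / 2 : ℝ) * h₂ (-θ)) =
      ∑ k ∈ Finset.range N, ((Δ k : ℂ) * ((h (-(n + k : ℝ)) - h (-(n + k : ℝ) - 1)) - h₁ (-θ) +
        ((n + k - θ + 1 / 2 : ℝ) : ℂ) * h₂ (-θ)) -
        ((Δ k - ΔG k : ℝ) : ℂ) * ((n + k - θ + 1 / 2 : ℝ) : ℂ) * h₂ (-θ)) := by
    have e1 : ((c : ℝ) : ℂ) * h₁ (-θ) = ∑ k ∈ Finset.range N, (Δ k : ℂ) * h₁ (-θ) := by
      rw [← Finset.sum_mul, ← tel]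
      push_cast
      rfl
    have e2 : ((∑ k ∈ Finset.range N, ((n + k : ℝ) - θ) * (G (n + k + 1 - θ) - G (n + k - θ))) +
          c / 2 : ℝ) = ∑ k ∈ Finset.range N, (n + k - θ + 1 / 2) * ΔG k := by
      rw [← telG, Finset.sum_div, ← Finset.sum_add_distrib]
      refine Finset.sum_congr rfl fun k _ => ?_
      simp only [hΔG]
      ring
    rw [e1, e2]
    push_cast
    rw [Finset.sum_mul, ← Finset.sum_sub_distrib, ← Finset.sum_sub_distrib]
    refine Finset.sum_congr rfl fun k _ => ?_
    simp only [hΔ]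
    push_cast
    ring
  rw [key]
  have hterm : ∀ k ∈ Finset.range N, ‖(Δ k : ℂ) * ((h (-(n + k : ℝ)) - h (-(n + k : ℝ) - 1)) -
      h₁ (-θ) + ((n + k - θ + 1 / 2 : ℝ) : ℂ) * h₂ (-θ)) -
        ((Δ k - ΔG k : ℝ) : ℂ) * ((n + k - θ + 1 / 2 : ℝ) : ℂ) * h₂ (-θ)‖ ≤
      (4 * (|K| + 1) * R ^ 3 + 2 * R) * (B₃ + δ * B₂) := by
    intro k hk
    have hxk := hx k hk
    set x : ℝ := n + k - θ with hxdef
    have t1 : ‖(h (-(n + k : ℝ)) - h (-(n + k : ℝ) - 1)) - h₁ (-θ) +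
        ((x + 1 / 2 : ℝ) : ℂ) * h₂ (-θ)‖ ≤ 2 * B₃ * R ^ 3 := by
      have a1 := norm_sub_sub_sub_le_of_deriv d d₁ d₂ hB₃ (-θ) (-x)
      have a2 := norm_sub_sub_sub_le_of_deriv d d₁ d₂ hB₃ (-θ) (-x - 1)
      have e1 : -θ + -x = -(n + k : ℝ) := by rw [hxdef]; ring
      have e2 : -θ + (-x - 1) = -(n + k : ℝ) - 1 := by rw [hxdef]; ring
      rw [e1] at a1
      rw [e2] at a2
      have b1 : |-x| ^ 3 ≤ R ^ 3 := by
        rw [abs_neg]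
        gcongr
        linarith
      have b2 : |-x - 1| ^ 3 ≤ R ^ 3 := by
        gcongr
        calc |-x - 1| ≤ |-x| + |1| := abs_sub _ _
          _ ≤ R := by rw [abs_neg, abs_one]; exact hxk
      have e3 : (h (-(n + k : ℝ)) - h (-(n + k : ℝ) - 1)) - h₁ (-θ) +
          ((x + 1 / 2 : ℝ) : ℂ) * h₂ (-θ) =
          (h (-(n + k : ℝ)) - h (-θ) - ((-x : ℝ) : ℂ) * h₁ (-θ) -
            ((-x : ℝ) : ℂ) ^ 2 / 2 * h₂ (-θ)) -
          (h (-(n + k : ℝ) - 1) - h (-θ) - ((-x - 1 : ℝ) : ℂ) * h₁ (-θ) -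
            ((-x - 1 : ℝ) : ℂ) ^ 2 / 2 * h₂ (-θ)) := by
        push_cast
        ring
      rw [e3]
      refine (norm_sub_le _ _).trans ?_
      have := mul_le_mul_of_nonneg_left b1 hB₃0
      have := mul_le_mul_of_nonneg_left b2 hB₃0
      linarith
    have t2 : |Δ k| ≤ 2 * (|K| + 1) := by
      simp only [hΔ]
      have a1 := hK (n + k + 1)
      have a2 := hK (n + k)
      have a3 := le_abs_self K
      calc _ ≤ |f (n + k + 1)| + |f (n + k)| := abs_sub _ _
        _ ≤ _ := by linarith
    have t3 : |Δ k - ΔG k| ≤ 2 * δ := by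
      simp only [hΔ, hΔG]
      have a1 := hδ (n + k + 1)
      have a2 := hδ (n + k)
      push_cast at a1 a2
      rw [abs_le] at *
      constructor <;> linarith [a1.1, a1.2, a2.1, a2.2]
    have t4 : |x + 1 / 2| ≤ R := by
      calc |x + 1 / 2| ≤ |x| + |1 / 2| := abs_add_le _ _
        _ ≤ R := by rw [abs_of_pos (by norm_num : (0 : ℝ) < 1 / 2)]; linarith
    refine (norm_sub_le _ _).trans ?_
    rw [norm_mul, norm_mul, norm_mul, Complex.norm_real, Complex.norm_real, Complex.norm_real,
      Real.norm_eq_abs, Real.norm_eq_abs, Real.norm_eq_abs]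
    have c1 : |Δ k| * ‖(h (-(n + k : ℝ)) - h (-(n + k : ℝ) - 1)) - h₁ (-θ) +
        ((x + 1 / 2 : ℝ) : ℂ) * h₂ (-θ)‖ ≤ 2 * (|K| + 1) * (2 * B₃ * R ^ 3) := by gcongr
    have c2 : |Δ k - ΔG k| * |x + 1 / 2| * ‖h₂ (-θ)‖ ≤ 2 * δ * R * B₂ := by
      gcongr
      exact hB₂ _
    have c3 : 0 ≤ 2 * R * B₃ := by positivity
    have c4 : 0 ≤ 4 * (|K| + 1) * R ^ 3 * (δ * B₂) := by positivity
    linarith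
  calc _ ≤ ∑ k ∈ Finset.range N, _ := norm_sum_le _ _
    _ ≤ ∑ k ∈ Finset.range N, (4 * (|K| + 1) * R ^ 3 + 2 * R) * (B₃ + δ * B₂) :=
        Finset.sum_le_sum hterm
    _ = _ := by
        rw [Finset.sum_const, Finset.card_range, nsmul_eq_mul]
        ring

/-- A slice pairs increments of the source with increments of the test function. -/
lemma norm_slice_le {f : ℤ → ℝ} {h : ℝ → ℂ} (hh : BddSupport h) {K B : ℝ}
    (hf : ∀ (n : ℤ) (N : ℕ), ∑ k ∈ Finset.range N, |f (n + k + 1) - f (n + k)| ≤ K)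
    (hB : 0 ≤ B) (hhB : ∀ j : ℤ, f (j + 1) ≠ f j → ‖h (-j) - h (-j - 1)‖ ≤ B) :
    ‖slice f h‖ ≤ K * B := by
  obtain ⟨a, b, ha, hb⟩ := hh
  set n : ℤ := ⌊-b⌋ - 2 with hn
  set N : ℕ := (⌈-a⌉ + 2 - n).toNat with hN
  have h1 := Int.floor_le (-b)
  have h2 := Int.le_ceil (-a)
  rw [slice, tsum_int_eq_sum_range (n := n) (N := N)]
  · calc _ ≤ ∑ k ∈ Finset.range N, ‖((f (n + k + 1) - f (n + k) : ℝ) : ℂ) *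
          (h (-((n + k : ℤ) : ℝ)) - h (-((n + k : ℤ) : ℝ) - 1))‖ := norm_sum_le _ _
      _ ≤ ∑ k ∈ Finset.range N, |f (n + k + 1) - f (n + k)| * B := by
          refine Finset.sum_le_sum fun k _ => ?_
          rw [norm_mul, Complex.norm_real, Real.norm_eq_abs]
          by_cases hne : f (n + k + 1) = f (n + k)
          · simp [hne]
          · gcongr
            exact hhB _ hne
      _ ≤ _ := by
          rw [← Finset.sum_mul]
          gcongr
          exact hf n N
  · rintro j (hj | hj)
    · have h3 : (j : ℝ) + 1 ≤ ⌊-b⌋ - 2 := by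
        rw [hn] at hj
        exact_mod_cast hj
      rw [hb _ (by linarith), hb _ (by linarith), sub_zero, mul_zero]
    · have h4 : ⌈-a⌉ + 2 ≤ j := by omega
      have h3 : (⌈-a⌉ : ℝ) + 2 ≤ j := by exact_mod_cast h4
      rw [ha _ (by linarith), ha _ (by linarith), sub_zero, mul_zero]

end GodunovTV

namespace GodunovTV

/-! ### Summation in time of the smooth parts -/

/-- Minus the position of the shock at time `-m`. -/
noncomputable def front (lam₀ : ℚ) (m : ℕ) : ℝ := lam₀ * m + 2 * √(m : ℝ)

/-- The excess speed of the shock between the times `-(m + 1)` and `-m`. -/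
noncomputable def excess (m : ℕ) : ℝ := 2 / (√((m + 1 : ℕ) : ℝ) + √(m : ℝ))

lemma excess_denom_pos (m : ℕ) : 0 < √((m + 1 : ℕ) : ℝ) + √(m : ℝ) := by
  have : 0 < √((m + 1 : ℕ) : ℝ) := Real.sqrt_pos.2 (by positivity)
  positivity

lemma excess_pos (m : ℕ) : 0 < excess m := div_pos two_pos (excess_denom_pos m)

lemma excess_eq (m : ℕ) : excess m = 2 * √((m + 1 : ℕ) : ℝ) - 2 * √(m : ℝ) := by
  rw [excess, div_eq_iff (excess_denom_pos m).ne']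
  have h1 := Real.mul_self_sqrt (show (0 : ℝ) ≤ ((m + 1 : ℕ) : ℝ) by positivity)
  have h2 := Real.mul_self_sqrt (show (0 : ℝ) ≤ (m : ℝ) by positivity)
  have h3 : ((m + 1 : ℕ) : ℝ) = m + 1 := by push_cast; rfl
  nlinarith

lemma front_succ (lam₀ : ℚ) (m : ℕ) : front lam₀ (m + 1) = front lam₀ m + (lam₀ + excess m) := by
  rw [front, front, excess_eq]
  push_cast
  ring

lemma excess_antitone : Antitone excess := by
  refine antitone_nat_of_succ_le fun m => ?_
  have := excess_denom_pos m
  unfold excess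
  gcongr <;> simp

lemma excess_le {m : ℕ} (hm : 0 < m) : excess m ≤ 1 / √(m : ℝ) := by
  have h1 : 0 < √(m : ℝ) := Real.sqrt_pos.2 (by exact_mod_cast hm)
  have h2 : √(m : ℝ) ≤ √((m + 1 : ℕ) : ℝ) := Real.sqrt_le_sqrt (by simp)
  rw [excess, div_le_div_iff₀ (excess_denom_pos m) h1]
  linarith

lemma excess_le_two (m : ℕ) : excess m ≤ 2 := by
  have h1 : 1 ≤ √((m + 1 : ℕ) : ℝ) := Real.one_le_sqrt.2 (by simp)
  have h2 := Real.sqrt_nonneg (m : ℝ)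
  rw [excess, div_le_iff₀ (excess_denom_pos m)]
  linarith

lemma sum_mul_sub_eq (x : ℕ → ℂ) (w : ℕ → ℝ) {a b : ℕ} (hab : a ≤ b) :
    ∑ m ∈ Finset.Ico a b, (w m : ℂ) * (x (m + 1) - x m) =
      w b * x b - w a * x a - ∑ m ∈ Finset.Ico a b, ((w (m + 1) - w m : ℝ) : ℂ) * x (m + 1) := by
  induction b, hab using Nat.le_induction with
  | base => simp
  | succ b hb ih =>
    rw [Finset.sum_Ico_succ_top hb, Finset.sum_Ico_succ_top hb, ih]
    push_cast
    ring

/-- After Abel summation the total variation of the monotone weight collapses to w b - w a. -/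
lemma norm_sum_mul_sub_le {x : ℕ → ℂ} {w : ℕ → ℝ} (hw : Monotone w) (h0 : ∀ m, 0 ≤ w m) {W X : ℝ}
    (hW : ∀ m, w m ≤ W) (hX : ∀ m, ‖x m‖ ≤ X) {a b : ℕ} (hab : a ≤ b) :
    ‖∑ m ∈ Finset.Ico a b, (w m : ℂ) * (x (m + 1) - x m)‖ ≤
      W * ‖x b‖ + W * ‖x a‖ + X * (w b - w a) := by
  have hn : ∀ m, ‖(w m : ℂ)‖ ≤ W := fun m => by
    rw [Complex.norm_real, Real.norm_eq_abs, abs_of_nonneg (h0 m)]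
    exact hW m
  have h1 : ‖∑ m ∈ Finset.Ico a b, ((w (m + 1) - w m : ℝ) : ℂ) * x (m + 1)‖ ≤
      X * (w b - w a) := by
    calc _ ≤ ∑ m ∈ Finset.Ico a b, (w (m + 1) - w m) * X := by
          refine (norm_sum_le _ _).trans (Finset.sum_le_sum fun m _ => ?_)
          have := hw m.le_succ
          rw [norm_mul, Complex.norm_real, Real.norm_eq_abs, abs_of_nonneg (sub_nonneg.2 this)]
          exact mul_le_mul_of_nonneg_left (hX _) (sub_nonneg.2 this)
      _ = _ := by rw [← Finset.sum_mul, Finset.sum_Ico_sub w hab, mul_comm]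
  rw [sum_mul_sub_eq x w hab]
  refine (norm_sub_le _ _).trans (add_le_add ((norm_sub_le _ _).trans (add_le_add ?_ ?_)) h1)
  · rw [norm_mul]
    gcongr
    exact hn b
  · rw [norm_mul]
    gcongr
    exact hn a

section step
variable {ψ ψ₁ ψ₂ ψ₃ : ℝ → ℂ} {B₃ : ℝ} {lam₀ : ℚ}

/-- Following the front by D = λ₀ + excess and averaging over the shifts 0 and 1 gives displacements
D and D - 1: the mean D - 1/2 multiplies ψ', half the mean square multiplies ψ''. Both displacements
are at most 3 in modulus, whence 27. -/
lemma norm_avg_step_le (h0 : 0 ≤ (lam₀ : ℝ)) (h1 : (lam₀ : ℝ) ≤ 1)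
    (d : ∀ y, HasDerivAt ψ (ψ₁ y) y) (d₁ : ∀ y, HasDerivAt ψ₁ (ψ₂ y) y)
    (d₂ : ∀ y, HasDerivAt ψ₂ (ψ₃ y) y) (hB : ∀ y, ‖ψ₃ y‖ ≤ B₃) (m : ℕ) :
    ‖(avg^[m + 1] ψ (front lam₀ (m + 1)) - avg^[m] ψ (front lam₀ m)) -
      ((beta lam₀ + excess m : ℝ) * avg^[m] ψ₁ (front lam₀ m) +
        (((lam₀ + excess m) ^ 2 + (lam₀ + excess m - 1) ^ 2) / 4 : ℝ) *
          avg^[m] ψ₂ (front lam₀ m))‖ ≤ 27 * B₃ := by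
  have hB0 : 0 ≤ B₃ := (norm_nonneg _).trans (hB 0)
  have e0 := excess_pos m
  have e2 := excess_le_two m
  set y := front lam₀ m
  set D : ℝ := lam₀ + excess m with hD
  have hb : beta lam₀ + excess m = D - 1 / 2 := by rw [beta, hD]; ring
  have a1 := norm_sub_sub_sub_le_of_deriv (hasDerivAt_avg_iterate d m)
    (hasDerivAt_avg_iterate d₁ m) (hasDerivAt_avg_iterate d₂ m)
    (norm_avg_iterate_le_of_le hB m) y D
  have a2 := norm_sub_sub_sub_le_of_deriv (hasDerivAt_avg_iterate d m)
    (hasDerivAt_avg_iterate d₁ m) (hasDerivAt_avg_iterate d₂ m)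
    (norm_avg_iterate_le_of_le hB m) y (D - 1)
  have b1 : B₃ * |D| ^ 3 ≤ B₃ * 27 := by
    gcongr
    calc |D| ^ 3 ≤ 3 ^ 3 := pow_le_pow_left₀ (abs_nonneg _)
          (abs_le.2 ⟨by linarith, by linarith⟩) 3
      _ = 27 := by norm_num
  have b2 : B₃ * |D - 1| ^ 3 ≤ B₃ * 27 := by
    gcongr
    calc |D - 1| ^ 3 ≤ 3 ^ 3 := pow_le_pow_left₀ (abs_nonneg _)
          (abs_le.2 ⟨by linarith, by linarith⟩) 3
      _ = 27 := by norm_num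
  rw [front_succ, avg_iterate_succ, hb, Complex.real_smul, ← hD]
  rw [show y + D - 1 = y + (D - 1) by ring]
  set P := avg^[m] ψ y
  set P₁ := avg^[m] ψ₁ y
  set P₂ := avg^[m] ψ₂ y
  set R₁ := avg^[m] ψ (y + D)
  set R₂ := avg^[m] ψ (y + (D - 1))
  have e : (((1 / 2 : ℝ) : ℂ) * (R₁ + R₂) - P) - (((D - 1 / 2 : ℝ) : ℂ) * P₁ +
      (((D ^ 2 + (D - 1) ^ 2) / 4 : ℝ) : ℂ) * P₂) =
      1 / 2 * ((R₁ - P - (D : ℂ) * P₁ - (D : ℂ) ^ 2 / 2 * P₂) +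
        (R₂ - P - ((D - 1 : ℝ) : ℂ) * P₁ - ((D - 1 : ℝ) : ℂ) ^ 2 / 2 * P₂)) := by
    push_cast
    ring
  rw [e, norm_mul, show ‖(1 / 2 : ℂ)‖ = 1 / 2 by norm_num]
  have := norm_add_le (R₁ - P - (D : ℂ) * P₁ - (D : ℂ) ^ 2 / 2 * P₂)
    (R₂ - P - ((D - 1 : ℝ) : ℂ) * P₁ - ((D - 1 : ℝ) : ℂ) ^ 2 / 2 * P₂)
  linarith

lemma norm_avg_step_le' (h0 : 0 ≤ (lam₀ : ℝ)) (h1 : (lam₀ : ℝ) ≤ 1)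
    (d : ∀ y, HasDerivAt ψ (ψ₁ y) y) (d₁ : ∀ y, HasDerivAt ψ₁ (ψ₂ y) y)
    (hB : ∀ y, ‖ψ₂ y‖ ≤ B₃) (m : ℕ) :
    ‖(avg^[m + 1] ψ (front lam₀ (m + 1)) - avg^[m] ψ (front lam₀ m)) -
      (beta lam₀ + excess m : ℝ) * avg^[m] ψ₁ (front lam₀ m)‖ ≤ 9 * B₃ := by
  have hB0 : 0 ≤ B₃ := (norm_nonneg _).trans (hB 0)
  have e0 := excess_pos m
  have e2 := excess_le_two m
  set y := front lam₀ m
  set D : ℝ := lam₀ + excess m with hD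
  have hb : beta lam₀ + excess m = D - 1 / 2 := by rw [beta, hD]; ring
  have a1 := norm_sub_sub_le_of_deriv (hasDerivAt_avg_iterate d m)
    (hasDerivAt_avg_iterate d₁ m) (norm_avg_iterate_le_of_le hB m) y D
  have a2 := norm_sub_sub_le_of_deriv (hasDerivAt_avg_iterate d m)
    (hasDerivAt_avg_iterate d₁ m) (norm_avg_iterate_le_of_le hB m) y (D - 1)
  have b1 : B₃ * |D| ^ 2 ≤ B₃ * 9 := by
    gcongr
    calc |D| ^ 2 ≤ 3 ^ 2 := pow_le_pow_left₀ (abs_nonneg _)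
          (abs_le.2 ⟨by linarith, by linarith⟩) 2
      _ = 9 := by norm_num
  have b2 : B₃ * |D - 1| ^ 2 ≤ B₃ * 9 := by
    gcongr
    calc |D - 1| ^ 2 ≤ 3 ^ 2 := pow_le_pow_left₀ (abs_nonneg _)
          (abs_le.2 ⟨by linarith, by linarith⟩) 2
      _ = 9 := by norm_num
  rw [front_succ, avg_iterate_succ, hb, Complex.real_smul, ← hD]
  rw [show y + D - 1 = y + (D - 1) by ring]
  set P := avg^[m] ψ y
  set P₁ := avg^[m] ψ₁ y
  set R₁ := avg^[m] ψ (y + D)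
  set R₂ := avg^[m] ψ (y + (D - 1))
  have e : (((1 / 2 : ℝ) : ℂ) * (R₁ + R₂) - P) - ((D - 1 / 2 : ℝ) : ℂ) * P₁ =
      1 / 2 * ((R₁ - P - (D : ℂ) * P₁) + (R₂ - P - ((D - 1 : ℝ) : ℂ) * P₁)) := by
    push_cast
    ring
  rw [e, norm_mul, show ‖(1 / 2 : ℂ)‖ = 1 / 2 by norm_num]
  have := norm_add_le (R₁ - P - (D : ℂ) * P₁) (R₂ - P - ((D - 1 : ℝ) : ℂ) * P₁)
  linarith

end step

/-- The smooth parts of the slices cancel in the sum over time. -/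
lemma exists_norm_sum_avg_le {μ : ℝ} {lam₀ : ℚ} (hp : Params μ lam₀) {C D E : ℝ} (hC : 0 < C)
    (hD : 0 < D) (hE : 0 < E) :
    ∃ C' > 0, ∀ A ≥ (1 : ℝ), ∀ (ψ ψ₁ ψ₂ ψ₃ : ℝ → ℂ), (∀ y, HasDerivAt ψ (ψ₁ y) y) →
      (∀ y, HasDerivAt ψ₁ (ψ₂ y) y) → (∀ y, HasDerivAt ψ₂ (ψ₃ y) y) → (∀ y, ‖ψ y‖ ≤ 1) →
      (∀ y, ‖ψ₁ y‖ ≤ C / √A) → (∀ y, ‖ψ₂ y‖ ≤ C / A) → (∀ y, ‖ψ₃ y‖ ≤ C / (A * √A)) →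
      ∀ a b : ℕ, a ≤ b → A / 16 ≤ a → (b : ℝ) - a ≤ D * A →
      ‖avg^[a] ψ (front lam₀ a)‖ ≤ E / √A → ‖avg^[b] ψ (front lam₀ b)‖ ≤ E / √A →
      ‖∑ m ∈ Finset.Ico a b, avg^[m] ψ₁ (front lam₀ m)‖ ≤ C' / √A ∧
        ‖∑ m ∈ Finset.Ico a b, avg^[m] ψ₂ (front lam₀ m)‖ ≤ C' / √A := by
  have hβ := hp.beta_pos
  have hβ1 := hp.beta_lt
  set β := beta lam₀ with hβdef
  have hl0 := hp.lam_pos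
  have hl1 := hp.lam_lt
  set C₂ := 1 / β * (3 * C) + 9 / β * C * D with hC₂
  set k₀ : ℝ := ((lam₀ : ℝ) ^ 2 + (lam₀ - 1) ^ 2) / 4 with hk₀
  set L : ℝ := 3 / 2 / β + 1 / β ^ 2 with hL
  set C₁ := 1 / β * (2 * E) + 4 / β ^ 2 + (k₀ / β * C₂ + 4 * L * C * D) + 27 / β * C * D with hC₁
  have hk₀0 : 0 ≤ k₀ := by positivity
  have hk₀1 : k₀ ≤ 1 := by
    rw [hk₀]
    nlinarith
  refine ⟨C₁ + C₂, by positivity, ?_⟩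
  intro A hA ψ ψ₁ ψ₂ ψ₃ d d₁ d₂ b₀ b₁ b₂ b₃ a b hab ha hba hxa hxb
  have hA0 : 0 < A := by linarith
  have hsA := Real.sqrt_pos.2 hA0
  have ha0 : 0 < a := by
    have : (0 : ℝ) < a := by linarith
    exact_mod_cast this
  -- Multiplying the step expansion by w isolates the derivative as a weighted time increment, so
  -- its time sum reduces to boundary terms. The weight is monotone and bounded by 1/β.
  set w : ℕ → ℝ := fun m => 1 / (β + excess m) with hw
  have hden : ∀ m, 0 < β + excess m := fun m => by have := excess_pos m; linarith
  have hw0 : ∀ m, 0 ≤ w m := fun m => by have := hden m; simp only [hw]; positivity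
  have hwW : ∀ m, w m ≤ 1 / β := fun m => by
    simp only [hw]
    have := excess_pos m
    gcongr
    linarith
  have hwmono : Monotone w := fun i j hij => by
    have h1 := excess_antitone hij
    have h2 := hden j
    simp only [hw]
    gcongr
  have hwβ : ∀ m, 1 / β - w m ≤ excess m / β ^ 2 := fun m => by
    have h1 := hden m
    have h2 := excess_pos m
    simp only [hw]
    rw [div_sub_div _ _ hβ.ne' h1.ne', div_le_div_iff₀ (by positivity) (by positivity)]
    have : 0 ≤ excess m * excess m * β := by positivity
    nlinarith
  have hex : ∀ m, a ≤ m → excess m ≤ 4 / √A := fun m hm => by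
    refine (excess_le (ha0.trans_le hm)).trans ?_
    have hm' : (a : ℝ) ≤ m := by exact_mod_cast hm
    have : √A / 4 ≤ √(m : ℝ) := by
      apply Real.le_sqrt_of_sq_le
      rw [div_pow, Real.sq_sqrt hA0.le]
      linarith
    calc 1 / √(m : ℝ) ≤ 1 / (√A / 4) := by gcongr
      _ = 4 / √A := by field_simp
  have hcard : ∀ c : ℝ, 0 ≤ c → ∀ F : ℕ → ℂ, (∀ m, a ≤ m → ‖F m‖ ≤ c) →
      ‖∑ m ∈ Finset.Ico a b, F m‖ ≤ D * A * c := by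
    intro c hc F hF
    calc _ ≤ ∑ m ∈ Finset.Ico a b, c :=
          (norm_sum_le _ _).trans (Finset.sum_le_sum fun m hm => hF m (Finset.mem_Ico.1 hm).1)
      _ = ((b : ℝ) - a) * c := by
          rw [Finset.sum_const, Nat.card_Ico, nsmul_eq_mul, Nat.cast_sub hab]
      _ ≤ _ := by gcongr
  set X : ℕ → ℂ := fun m => avg^[m] ψ (front lam₀ m) with hX
  set X₁ : ℕ → ℂ := fun m => avg^[m] ψ₁ (front lam₀ m) with hX₁
  set X₂ : ℕ → ℂ := fun m => avg^[m] ψ₂ (front lam₀ m) with hX₂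
  have hX₁b : ∀ m, ‖X₁ m‖ ≤ C / √A := fun m => norm_avg_iterate_le_of_le b₁ m _
  have hX₂b : ∀ m, ‖X₂ m‖ ≤ C / A := fun m => norm_avg_iterate_le_of_le b₂ m _
  have hXb : ∀ m, ‖X m‖ ≤ 1 := fun m => norm_avg_iterate_le_of_le b₀ m _
  have hwn : ∀ m, ‖(w m : ℂ)‖ ≤ 1 / β := fun m => by
    rw [Complex.norm_real, Real.norm_eq_abs, abs_of_nonneg (hw0 m)]
    exact hwW m
  -- The step expansion is applied to ψ', whose increments produce ψ''; the boundary terms are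
  -- already of order 1/√A since ψ' is.
  have S₂ : ‖∑ m ∈ Finset.Ico a b, X₂ m‖ ≤ C₂ / √A := by
    set r : ℕ → ℂ := fun m => (X₁ (m + 1) - X₁ m) - (β + excess m : ℝ) * X₂ m with hr
    have hrb : ∀ m, ‖r m‖ ≤ 9 * (C / (A * √A)) := fun m =>
      norm_avg_step_le' hl0.le hl1.le d₁ d₂ b₃ m
    have e : ∀ m, X₂ m = w m * (X₁ (m + 1) - X₁ m) - w m * r m := fun m => by
      have h1 : ((β + excess m : ℝ) : ℂ) ≠ 0 := by exact_mod_cast (hden m).ne'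
      have h2 : (w m : ℂ) * ((β + excess m : ℝ) : ℂ) = 1 := by
        simp only [hw]
        push_cast at h1 ⊢
        field_simp
      simp only [hr]
      linear_combination -X₂ m * h2
    rw [Finset.sum_congr rfl fun m _ => e m, Finset.sum_sub_distrib]
    have t1 := norm_sum_mul_sub_le hwmono hw0 hwW hX₁b hab
    have t2 := hcard (1 / β * (9 * (C / (A * √A)))) (by positivity) (fun m => w m * r m)
      (fun m _ => by
        rw [norm_mul]
        exact mul_le_mul (hwn m) (hrb m) (norm_nonneg _) (by positivity))
    have t3 : 1 / β * ‖X₁ b‖ ≤ 1 / β * (C / √A) := by gcongr; exact hX₁b b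
    have t4 : 1 / β * ‖X₁ a‖ ≤ 1 / β * (C / √A) := by gcongr; exact hX₁b a
    have t5 : C / √A * (w b - w a) ≤ C / √A * (1 / β) := by
      gcongr
      linarith [hwW b, hw0 a]
    refine (norm_sub_le _ _).trans ?_
    have e1 : D * A * (1 / β * (9 * (C / (A * √A)))) = 9 / β * C * D / √A := by field_simp
    have e2 : C₂ / √A = 3 * (1 / β * (C / √A)) + 9 / β * C * D / √A := by rw [hC₂]; ring
    rw [e2]
    linarith
  have S₁ : ‖∑ m ∈ Finset.Ico a b, X₁ m‖ ≤ C₁ / √A := by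
    set k : ℕ → ℝ := fun m => ((lam₀ + excess m) ^ 2 + (lam₀ + excess m - 1) ^ 2) / 4 with hk
    set r : ℕ → ℂ := fun m => (X (m + 1) - X m) -
      ((β + excess m : ℝ) * X₁ m + (k m : ℝ) * X₂ m) with hr
    have hrb : ∀ m, ‖r m‖ ≤ 27 * (C / (A * √A)) := fun m =>
      norm_avg_step_le hl0.le hl1.le d d₁ d₂ b₃ m
    -- Here ψ'' enters the expansion of ψ. The limit k₀/β of its coefficient is handled by the bound
    -- on the sum of ψ'', and the deviation from the limit is of order 1/√A.
    have e : ∀ m, X₁ m = w m * (X (m + 1) - X m) - (k₀ / β : ℝ) * X₂ m -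
        (w m * k m - k₀ / β : ℝ) * X₂ m - w m * r m := fun m => by
      have h1 : ((β + excess m : ℝ) : ℂ) ≠ 0 := by exact_mod_cast (hden m).ne'
      have h2 : (w m : ℂ) * ((β + excess m : ℝ) : ℂ) = 1 := by
        simp only [hw]
        push_cast at h1 ⊢
        field_simp
      simp only [hr]
      push_cast at h2 ⊢
      linear_combination -X₁ m * h2
    have hkw : ∀ m, a ≤ m → |w m * k m - k₀ / β| ≤ L * (4 / √A) := fun m hm => by
      have h1 := excess_pos m
      have h2 := excess_le_two m
      have h3 := hex m hm
      have h4 : k m - k₀ = excess m * (4 * lam₀ - 2 + 2 * excess m) / 4 := by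
        simp only [hk, hk₀]
        ring
      have hl2 : 0 ≤ 4 * (lam₀ : ℝ) - 2 := by rw [hβdef, beta] at hβ; linarith
      have h5 : 0 ≤ k m - k₀ := by
        rw [h4]
        positivity
      have h6 : k m - k₀ ≤ 3 / 2 * excess m := by
        rw [h4]
        nlinarith
      have h7 : w m * k m - k₀ / β = w m * (k m - k₀) - k₀ * (1 / β - w m) := by ring
      have h8 : w m * (k m - k₀) ≤ 1 / β * (3 / 2 * excess m) :=
        mul_le_mul (hwW m) h6 h5 (by positivity)
      have h9 : k₀ * (1 / β - w m) ≤ 1 * (excess m / β ^ 2) :=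
        mul_le_mul hk₀1 (hwβ m) (by linarith [hwW m]) zero_le_one
      have h10 : 0 ≤ w m * (k m - k₀) := mul_nonneg (hw0 m) h5
      have h11 : 0 ≤ k₀ * (1 / β - w m) := mul_nonneg hk₀0 (by linarith [hwW m])
      have h12 : L * excess m ≤ L * (4 / √A) := by gcongr
      have h13 : L * excess m = 1 / β * (3 / 2 * excess m) + 1 * (excess m / β ^ 2) := by
        rw [hL]; ring
      rw [h7, abs_le]
      constructor <;> linarith
    rw [Finset.sum_congr rfl fun m _ => e m, Finset.sum_sub_distrib, Finset.sum_sub_distrib,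
      Finset.sum_sub_distrib, ← Finset.mul_sum]
    have t1 := norm_sum_mul_sub_le hwmono hw0 hwW hXb hab
    have t2 := hcard (1 / β * (27 * (C / (A * √A)))) (by positivity) (fun m => w m * r m)
      (fun m _ => by
        rw [norm_mul]
        exact mul_le_mul (hwn m) (hrb m) (norm_nonneg _) (by positivity))
    have t3 := hcard (L * (4 / √A) * (C / A)) (by positivity)
      (fun m => (w m * k m - k₀ / β : ℝ) * X₂ m)
      (fun m hm => by
        rw [norm_mul, Complex.norm_real, Real.norm_eq_abs]
        exact mul_le_mul (hkw m hm) (hX₂b m) (norm_nonneg _) (by positivity))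
    have t4 : ‖((k₀ / β : ℝ) : ℂ) * ∑ m ∈ Finset.Ico a b, X₂ m‖ ≤ k₀ / β * (C₂ / √A) := by
      rw [norm_mul, Complex.norm_real, Real.norm_eq_abs, abs_of_nonneg (by positivity)]
      gcongr
    have t5 : 1 / β * ‖X b‖ ≤ 1 / β * (E / √A) := by gcongr
    have t6 : 1 / β * ‖X a‖ ≤ 1 / β * (E / √A) := by gcongr
    -- ψ itself is only bounded by 1, so the smallness must come from the variation of w, which the
    -- excess speed at time a bounds.
    have t7 : 1 * (w b - w a) ≤ 4 / √A / β ^ 2 := by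
      have h1 := hwβ a
      have h2 := hwW b
      have h3 : excess a / β ^ 2 ≤ 4 / √A / β ^ 2 := by
        have := hex a le_rfl
        gcongr
      linarith
    refine (norm_sub_le _ _).trans (add_le_add ((norm_sub_le _ _).trans
      (add_le_add (norm_sub_le _ _) le_rfl)) le_rfl) |>.trans ?_
    have e1 : D * A * (1 / β * (27 * (C / (A * √A)))) = 27 / β * C * D / √A := by field_simp
    have e2 : D * A * (L * (4 / √A) * (C / A)) = 4 * L * C * D / √A := by field_simp
    have e3 : C₁ / √A = 2 * (1 / β * (E / √A)) + 4 / √A / β ^ 2 + (k₀ / β * (C₂ / √A) +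
        4 * L * C * D / √A) + 27 / β * C * D / √A := by rw [hC₁]; ring
    rw [e1] at t2
    rw [e2] at t3
    rw [e3]
    linarith
  have hpos₁ : 0 ≤ C₁ / √A := (norm_nonneg _).trans S₁
  have hpos₂ : 0 ≤ C₂ / √A := (norm_nonneg _).trans S₂
  rw [add_div]
  exact ⟨S₁.trans (by linarith), S₂.trans (by linarith)⟩

end GodunovTV

namespace GodunovTV

/-! ### Evolution of an oscillating packet -/

/-- The leading amplitude χ(y/A)/y is the function x ↦ χ(x)/x at x = y/A, up to the factor 1/A. The
singularity at 0 is harmless because χ vanishes below 1. -/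
lemma exists_abs_bump_div_sub_le : ∃ L > 0, ∀ x y : ℝ, |bump x / x - bump y / y| ≤ L * |x - y| := by
  obtain ⟨χ₁, -, -, B, hB, d₀, -, -, b₁, -⟩ := exists_bump_derivs
  have hlip : ∀ x y : ℝ, |bump x - bump y| ≤ B * |x - y| := fun x y => by
    have := convex_univ.norm_image_sub_le_of_norm_hasDerivWithin_le (𝕜 := ℝ) (f := bump) (x := y)
      (y := x) (fun z _ => (d₀ z).hasDerivWithinAt) (fun z _ => b₁ z) (mem_univ _) (mem_univ _)
    simpa using this
  have hz : ∀ x : ℝ, x < 1 → bump x = 0 := fun x hx => bump_eq_zero fun h => by linarith [h.1]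
  have hone : ∀ x y : ℝ, x < 1 → |bump x / x - bump y / y| ≤ (B + 1) * |x - y| := by
    intro x y hx
    have h1 := hlip x y
    have h2 := abs_nonneg (x - y)
    rw [hz x hx, zero_sub, abs_neg, abs_of_nonneg bump.nonneg] at h1
    rw [hz x hx, zero_div, zero_sub, abs_neg]
    rcases lt_or_ge y 1 with hy | hy
    · rw [hz y hy]
      simp only [zero_div, abs_zero]
      positivity
    · rw [abs_of_nonneg (div_nonneg bump.nonneg (by linarith))]
      have : bump y / y ≤ bump y := div_le_self bump.nonneg hy
      linarith
  refine ⟨B + 1, by positivity, fun x y => ?_⟩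
  rcases lt_or_ge x 1 with hx | hx
  · exact hone x y hx
  rcases lt_or_ge y 1 with hy | hy
  · rw [abs_sub_comm, abs_sub_comm x]
    exact hone y x hy
  have hx0 : 0 < x := by linarith
  have hy0 : 0 < y := by linarith
  have e : bump x / x - bump y / y = (bump x - bump y) / x + bump y * (y - x) / (x * y) := by
    field_simp
    ring
  rw [e]
  have h1 : |(bump x - bump y) / x| ≤ B * |x - y| := by
    rw [abs_div, abs_of_pos hx0]
    exact (div_le_self (abs_nonneg _) hx).trans (hlip x y)
  have h2 : |bump y * (y - x) / (x * y)| ≤ 1 * |x - y| := by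
    rw [abs_div, abs_mul, abs_of_pos (mul_pos hx0 hy0), abs_sub_comm y,
      abs_of_nonneg bump.nonneg]
    refine (div_le_self (mul_nonneg bump.nonneg (abs_nonneg _)) (by nlinarith)).trans ?_
    gcongr
    exact bump.le_one
  have := abs_add_le ((bump x - bump y) / x) (bump y * (y - x) / (x * y))
  linarith

/-- The error of linearising the square root is exactly (√y - √b)²/(2√b), so the quadratic bound
holds for all y ≥ 0 and not just near b. -/
lemma abs_sqrt_sub_le {b y : ℝ} (hb : 0 < b) (hy : 0 ≤ y) :
    |√y - (√b + (y - b) / (2 * √b))| ≤ (y - b) ^ 2 / (2 * b * √b) := by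
  have hs := Real.sqrt_pos.2 hb
  have hy' := Real.sqrt_nonneg y
  have e1 : y - b = (√y - √b) * (√y + √b) := by
    linear_combination Real.sq_sqrt hb.le - Real.sq_sqrt hy
  have e2 : √y - (√b + (y - b) / (2 * √b)) = -((√y - √b) ^ 2 / (2 * √b)) := by
    rw [e1]
    field_simp
    ring
  rw [e2, abs_neg, abs_of_nonneg (by positivity), div_le_div_iff₀ (by positivity) (by positivity)]
  have e3 : (y - b) ^ 2 = (√y - √b) ^ 2 * (√y + √b) ^ 2 := by rw [e1]; ring
  have h3 : b ≤ (√y + √b) ^ 2 := by nlinarith [Real.sq_sqrt hb.le]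
  rw [e3]
  have : (√y - √b) ^ 2 * b ≤ (√y - √b) ^ 2 * (√y + √b) ^ 2 := by gcongr
  nlinarith

/-- Agreement up to fourth order makes the m-th powers close when x² is of order 1/m. -/
lemma abs_cos_sub_exp_le (x : ℝ) : |Real.cos x - Real.exp (-x ^ 2 / 2)| ≤ 2 * x ^ 4 := by
  have h4 : |x| ^ 4 = x ^ 4 := by rw [← abs_pow, abs_of_nonneg (by positivity)]
  rcases le_or_gt |x| 1 with hx | hx
  · have h1 := Real.cos_bound hx
    have hx2 : x ^ 2 ≤ 1 := (sq_le_one_iff_abs_le_one x).2 hx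
    have h2 := Real.abs_exp_sub_one_sub_id_le (x := -x ^ 2 / 2)
      (by rw [abs_le]; constructor <;> nlinarith [sq_nonneg x])
    rw [h4] at h1
    rw [abs_le] at *
    have h5 : 0 ≤ x ^ 4 := by positivity
    constructor <;> nlinarith [h1.1, h1.2, h2.1, h2.2]
  · have h1 := Real.abs_cos_le_one x
    have h2 := Real.exp_pos (-x ^ 2 / 2)
    have h3 : Real.exp (-x ^ 2 / 2) ≤ 1 := Real.exp_le_one_iff.2 (by nlinarith [sq_nonneg x])
    have h5 : 1 ≤ x ^ 4 := by rw [← h4]; exact one_le_pow₀ hx.le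
    rw [abs_le] at *
    constructor <;> linarith [h1.1, h1.2]

lemma norm_cexp_sub_cexp_le (a b : ℝ) :
    ‖Complex.exp (a * Complex.I) - Complex.exp (b * Complex.I)‖ ≤ |a - b| := by
  have e : Complex.exp (a * Complex.I) - Complex.exp (b * Complex.I) =
      Complex.exp (b * Complex.I) * (Complex.exp (Complex.I * ((a - b : ℝ) : ℂ)) - 1) := by
    rw [mul_sub, ← Complex.exp_add, mul_one]
    congr 2
    push_cast
    ring
  rw [e, norm_mul, Complex.norm_exp_ofReal_mul_I, one_mul]
  exact Real.norm_exp_I_mul_ofReal_sub_one_le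

/-- The amplitude of the second derivative of an evolved packet at the shock. -/
noncomputable def packet (lam₀ : ℚ) (A w : ℝ) (m : ℕ) : ℂ :=
  ((w ^ 2 / (4 * (beta lam₀ * m)) * bump (beta lam₀ * m / A) *
    Real.exp (-w ^ 2 / (32 * beta lam₀)) : ℝ) : ℂ) *
      Complex.exp ((w * √(beta lam₀ * m) + w / √(beta lam₀) : ℝ) * Complex.I)

/-- Let b = βm. The averaging has mean position b + 2√m and spread √m, small compared with b, so the
function may be replaced by the plane wave of frequency θ = w/(2√b) that agrees with its phase to
first order at b. The plane wave is an eigenfunction: the offset 2√m adds the phase 2θ√m = w/√β, and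
cos(θ/2)^m tends to e^{-w²/(32β)}. -/
lemma exists_norm_avg_packet_le {μ : ℝ} {lam₀ : ℚ} (hp : Params μ lam₀) (w : ℝ) {D : ℝ}
    (hD : 0 < D) : ∃ C > 0, ∀ A ≥ (1 : ℝ), ∀ m : ℕ, A / 16 ≤ m → m ≤ D * A →
    ‖avg^[m] (fun y => (w ^ 2 / (4 * y) : ℝ) * test A w y) (front lam₀ m) - packet lam₀ A w m‖ ≤
      C / (A * √A) := by
  obtain ⟨L, hL, hlip⟩ := exists_abs_bump_div_sub_le
  have hβ := hp.beta_pos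
  set β := beta lam₀ with hβdef
  have hsβ := Real.sqrt_pos.2 hβ
  set C₁ : ℝ := w ^ 2 / 4 * (L * 3 * √D + |w| * (17 / 2 / (β * √β))) with hC₁
  set C₂ : ℝ := w ^ 2 / 4 * (w ^ 4 / (8 * β ^ 2)) with hC₂
  refine ⟨C₁ + C₂ + 1, by positivity, ?_⟩
  intro A hA m hm hmD
  have hA0 : 0 < A := by linarith
  have hsA := Real.sqrt_pos.2 hA0
  have hm0 : 0 < (m : ℝ) := by linarith
  have hsm := Real.sqrt_pos.2 hm0
  have hsA4 : √A / 4 ≤ √(m : ℝ) := by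
    apply Real.le_sqrt_of_sq_le
    rw [div_pow, Real.sq_sqrt hA0.le]
    linarith
  have hsAD : √(m : ℝ) ≤ √D * √A := by
    rw [← Real.sqrt_mul hD.le]
    exact Real.sqrt_le_sqrt hmD
  set b := β * m with hb
  have hb0 : 0 < b := mul_pos hβ hm0
  have hsb : √b = √β * √(m : ℝ) := Real.sqrt_mul hβ.le _
  have hsb0 : 0 < √b := Real.sqrt_pos.2 hb0
  have hssm := Real.mul_self_sqrt hm0.le
  have hssβ := Real.mul_self_sqrt hβ.le
  have hssA := Real.mul_self_sqrt hA0.le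
  set θ : ℝ := w / (2 * √b) with hθ
  set F : ℝ → ℂ := fun y => (w ^ 2 / (4 * y) : ℝ) * test A w y with hF
  set K : ℂ := ((w ^ 2 / (4 * A) * (bump (b / A) / (b / A)) : ℝ) : ℂ) *
    Complex.exp ((w * √b - θ * b : ℝ) * Complex.I) with hK
  set F₀ : ℝ → ℂ := fun y => K * Complex.exp (θ * y * Complex.I) with hF₀
  set M₁ : ℝ := w ^ 2 / (4 * A) with hM₁
  have hM₁0 : 0 ≤ M₁ := by positivity
  have hFe : ∀ y, F y = ((M₁ * (bump (y / A) / (y / A)) : ℝ) : ℂ) *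
      Complex.exp ((w * √y : ℝ) * Complex.I) := by
    intro y
    simp only [hF, test]
    rw [← mul_assoc, ← Complex.ofReal_mul]
    congr 2
    · rw [hM₁]
      rcases eq_or_ne y 0 with rfl | hy
      · simp
      · field_simp
    · push_cast
      rfl
  have hF₀e : ∀ y, F₀ y = ((M₁ * (bump (b / A) / (b / A)) : ℝ) : ℂ) *
      Complex.exp ((w * (√b + (y - b) / (2 * √b)) : ℝ) * Complex.I) := by
    intro y
    simp only [hF₀, hK]
    rw [mul_assoc, ← Complex.exp_add]
    congr 2
    rw [← Complex.ofReal_mul, ← add_mul, ← Complex.ofReal_add]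
    congr 2
    rw [hθ]
    ring
  have hpt : ∀ y, ‖F y - F₀ y‖ ≤ M₁ * (L / A * ((√(m : ℝ) + (y - b) ^ 2 / √(m : ℝ)) / 2) +
      |w| * ((y - b) ^ 2 / (2 * b * √b))) := by
    intro y
    set k₁ := bump (y / A) / (y / A)
    set k₂ := bump (b / A) / (b / A)
    set E₁ := Complex.exp ((w * √y : ℝ) * Complex.I)
    set E₂ := Complex.exp ((w * (√b + (y - b) / (2 * √b)) : ℝ) * Complex.I) with hE₂
    have e : F y - F₀ y = (M₁ : ℂ) * (((k₁ - k₂ : ℝ) : ℂ) * E₂ + (k₁ : ℂ) * (E₁ - E₂)) := by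
      have h1 : F y = ((M₁ * k₁ : ℝ) : ℂ) * E₁ := hFe y
      have h2 : F₀ y = ((M₁ * k₂ : ℝ) : ℂ) * E₂ := hF₀e y
      rw [h1, h2, Complex.ofReal_mul, Complex.ofReal_mul, Complex.ofReal_sub]
      ring
    rw [e, norm_mul, Complex.norm_real, Real.norm_eq_abs, abs_of_nonneg hM₁0]
    refine mul_le_mul_of_nonneg_left ((norm_add_le _ _).trans (add_le_add ?_ ?_)) hM₁0
    · rw [norm_mul, hE₂, Complex.norm_exp_ofReal_mul_I, mul_one, Complex.norm_real,
        Real.norm_eq_abs]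
      refine (hlip _ _).trans ?_
      rw [← sub_div, abs_div, abs_of_pos hA0, mul_div_assoc', div_mul_eq_mul_div]
      gcongr
      -- The inequality 2|y - b| ≤ √m + (y - b)²/√m reduces the linear deviation to second moments,
      -- which `avg_iterate_sq` computes.
      rw [le_div_iff₀ two_pos, ← sub_nonneg]
      have e3 : √(m : ℝ) + (y - b) ^ 2 / √(m : ℝ) - |y - b| * 2 =
          (√(m : ℝ) - |y - b|) ^ 2 / √(m : ℝ) := by
        rw [← sq_abs (y - b)]
        field_simp
        ring
      rw [e3]
      positivity
    · rw [norm_mul, Complex.norm_real, Real.norm_eq_abs]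
      rcases lt_or_ge y 0 with hy | hy
      · have : k₁ = 0 := by
          simp only [k₁]
          rw [bump_eq_zero, zero_div]
          intro h
          have : y / A < 0 := div_neg_of_neg_of_pos hy hA0
          linarith [h.1]
        rw [this]
        simp only [abs_zero, zero_mul]
        positivity
      · have hk : |k₁| ≤ 1 := by
          simp only [k₁]
          by_cases h : y / A ∈ Ioo (1 : ℝ) 2
          · rw [abs_of_nonneg (div_nonneg bump.nonneg (by linarith [h.1])),
              div_le_one (by linarith [h.1])]
            exact bump.le_one.trans h.1.le
          · rw [bump_eq_zero h]
            simp
        calc |k₁| * ‖E₁ - E₂‖ ≤ 1 * |w * √y - w * (√b + (y - b) / (2 * √b))| := by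
              gcongr
              exact norm_cexp_sub_cexp_le _ _
          _ = |w| * |√y - (√b + (y - b) / (2 * √b))| := by rw [one_mul, ← mul_sub, abs_mul]
          _ ≤ _ := by
              gcongr
              exact abs_sqrt_sub_le hb0 hy
  have hfr : front lam₀ m - m / 2 - b = 2 * √(m : ℝ) := by
    rw [hb, hβdef, front, beta]
    ring
  have havg1 : ‖avg^[m] F (front lam₀ m) - avg^[m] F₀ (front lam₀ m)‖ ≤ C₁ / (A * √A) := by
    rw [← avg_iterate_sub]
    refine (norm_avg_iterate_le _ m _).trans ((avg_iterate_mono hpt m _).trans ?_)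
    have e1 : ∀ y, M₁ * (L / A * ((√(m : ℝ) + (y - b) ^ 2 / √(m : ℝ)) / 2) +
      |w| * ((y - b) ^ 2 / (2 * b * √b))) = M₁ * (L / A * (√(m : ℝ) / 2)) -
        (-(M₁ * (L / A / √(m : ℝ) / 2 + |w| / (2 * b * √b)))) * (y - b) ^ 2 := by
      intro y
      ring
    simp only [e1]
    rw [avg_iterate_sub, avg_iterate_const, avg_iterate_const_mul, avg_iterate_sq, hfr]
    -- The second moment about b: the squared bias 4m plus the variance m/4.
    have e2 : (2 * √(m : ℝ)) ^ 2 + (m : ℝ) / 4 = 17 / 4 * (√(m : ℝ) * √(m : ℝ)) := by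
      linear_combination (-1 / 4) * hssm
    have e3 : M₁ * (L / A * (√(m : ℝ) / 2)) -
        (-(M₁ * (L / A / √(m : ℝ) / 2 + |w| / (2 * b * √b)))) *
          (17 / 4 * (√(m : ℝ) * √(m : ℝ))) =
        w ^ 2 / 4 / A * (L * (21 / 8) * (√(m : ℝ) / A) +
          |w| * (17 / 8 / (β * √β)) * (1 / √(m : ℝ))) := by
      have hbb : 2 * b * √b = 2 * (β * √β) * (√(m : ℝ) * √(m : ℝ)) * √(m : ℝ) := by
        rw [hsb, hb, hssm]
        ring
      rw [hbb, hM₁]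
      field_simp
      ring
    rw [e2, e3]
    have e4 : C₁ / (A * √A) = w ^ 2 / 4 / A * (L * 3 * (√D * √A / A) +
          |w| * (17 / 8 / (β * √β)) * (1 / (√A / 4))) := by
      rw [hC₁]
      conv_rhs => rw [show √D * √A / A = √D / √A by rw [div_eq_div_iff hA0.ne' hsA.ne', mul_assoc, hssA]]
      field_simp
      ring
    rw [e4]
    gcongr
    norm_num
  have havg2 : ‖avg^[m] F₀ (front lam₀ m) - packet lam₀ A w m‖ ≤ C₂ / (A * √A) := by
    have e1 : avg^[m] F₀ (front lam₀ m) = ((M₁ * (bump (b / A) / (b / A)) : ℝ) : ℂ) *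
        Complex.exp ((w * √b + w / √β : ℝ) * Complex.I) * ((Real.cos (θ / 2) ^ m : ℝ) : ℂ) := by
      rw [hF₀, avg_iterate_const_mul, avg_iterate_cexp, hK]
      have : Complex.exp ((w * √b + w / √β : ℝ) * Complex.I) =
          Complex.exp ((w * √b - θ * b : ℝ) * Complex.I) *
            Complex.exp (θ * (front lam₀ m - m / 2) * Complex.I) := by
        rw [← Complex.exp_add]
        congr 1
        have h1 : θ * (front lam₀ m - m / 2) = θ * b + w / √β := by
          rw [show front lam₀ m - m / 2 = b + 2 * √(m : ℝ) by linarith, mul_add, hθ, hsb]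
          congr 1
          field_simp
        have h2 : (θ : ℂ) * (front lam₀ m - m / 2) = ((θ * b + w / √β : ℝ) : ℂ) := by
          rw [← h1]
          push_cast
          rfl
        rw [h2]
        push_cast
        ring
      rw [this]
      push_cast
      ring
    have e2 : packet lam₀ A w m = ((M₁ * (bump (b / A) / (b / A)) : ℝ) : ℂ) *
        Complex.exp ((w * √b + w / √β : ℝ) * Complex.I) *
          ((Real.exp (-w ^ 2 / (32 * β)) : ℝ) : ℂ) := by
      rw [packet, ← hβdef, ← hb]
      have : M₁ * (bump (b / A) / (b / A)) = w ^ 2 / (4 * b) * bump (b / A) := by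
        rw [hM₁]
        field_simp
      rw [this]
      push_cast
      ring
    rw [e1, e2, ← mul_sub, norm_mul, norm_mul, Complex.norm_exp_ofReal_mul_I, mul_one,
      ← Complex.ofReal_sub, Complex.norm_real, Complex.norm_real, Real.norm_eq_abs,
      Real.norm_eq_abs]
    have hk : |M₁ * (bump (b / A) / (b / A))| ≤ M₁ := by
      rw [abs_mul, abs_of_nonneg hM₁0]
      refine mul_le_of_le_one_right hM₁0 ?_
      by_cases h : b / A ∈ Ioo (1 : ℝ) 2
      · rw [abs_of_nonneg (div_nonneg bump.nonneg (by linarith [h.1])),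
          div_le_one (by linarith [h.1])]
        exact bump.le_one.trans h.1.le
      · rw [bump_eq_zero h]
        simp
    have hx4 : (θ / 2) ^ 4 = w ^ 4 / (256 * β ^ 2 * m ^ 2) := by
      rw [hθ, hsb]
      have : (w / (2 * (√β * √(m : ℝ))) / 2) ^ 4 =
          w ^ 4 / (256 * (√β * √β) ^ 2 * (√(m : ℝ) * √(m : ℝ)) ^ 2) := by
        field_simp
        ring
      rw [this, hssm, hssβ]
    have hx2 : (m : ℝ) * (-(θ / 2) ^ 2 / 2) = -w ^ 2 / (32 * β) := by
      rw [hθ, hsb]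
      have : (m : ℝ) * (-(w / (2 * (√β * √(m : ℝ))) / 2) ^ 2 / 2) =
          m * (-w ^ 2 / (32 * (√β * √β) * (√(m : ℝ) * √(m : ℝ)))) := by
        field_simp
        ring
      rw [this, hssm, hssβ]
      field_simp
    -- Both bases have modulus at most 1, so the m-th powers differ by at most m times the
    -- difference of the bases, hence by O(mθ⁴) = O(1/m).
    have hcos : |Real.cos (θ / 2) ^ m - Real.exp (-w ^ 2 / (32 * β))| ≤
        w ^ 4 / (128 * β ^ 2) / m := by
      rw [← hx2, Real.exp_nat_mul]
      refine (abs_pow_sub_pow_le _ _ m).trans ?_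
      have h1 : max |Real.cos (θ / 2)| |Real.exp (-(θ / 2) ^ 2 / 2)| ^ (m - 1) ≤ 1 := by
        refine pow_le_one₀ (by positivity) (max_le (Real.abs_cos_le_one _) ?_)
        rw [abs_of_pos (Real.exp_pos _)]
        exact Real.exp_le_one_iff.2 (by nlinarith [sq_nonneg (θ / 2)])
      calc _ ≤ 2 * (θ / 2) ^ 4 * m * 1 := by
            gcongr
            exact abs_cos_sub_exp_le _
        _ = _ := by
            rw [hx4]
            field_simp
            ring
    calc _ ≤ M₁ * (w ^ 4 / (128 * β ^ 2) / m) := by gcongr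
      _ ≤ M₁ * (w ^ 4 / (128 * β ^ 2) / (√A / 16)) := by
          have h1 : √A ≤ A := Real.sqrt_le_self_iff.2 (Or.inr hA)
          gcongr
          linarith
      _ = _ := by
          rw [hC₂, hM₁]
          field_simp
          ring
  calc _ ≤ ‖avg^[m] F (front lam₀ m) - avg^[m] F₀ (front lam₀ m)‖ +
        ‖avg^[m] F₀ (front lam₀ m) - packet lam₀ A w m‖ := norm_sub_le_norm_sub_add_norm_sub _ _ _
    _ ≤ C₁ / (A * √A) + C₂ / (A * √A) := add_le_add havg1 havg2
    _ ≤ (C₁ + C₂ + 1) / (A * √A) := by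
        rw [← add_div]
        exact div_le_div_of_nonneg_right (by linarith) (by positivity)

end GodunovTV

namespace GodunovTV

/-! ### Shape of the source term -/

/-- The source term seen along the limiting shock profile. -/
noncomputable def shape (μ : ℝ) (lam₀ : ℚ) (g : ℝ → ℝ) (y : ℝ) : ℝ := g (profile μ lam₀ y)

lemma abs_profile_sub_le {μ : ℝ} {lam₀ : ℚ} (hp : Params μ lam₀) (x y : ℝ) :
    |profile μ lam₀ x - profile μ lam₀ y| ≤ kappa₀ μ lam₀ * |x - y| := by
  have hk := hp.kappa₀_pos
  have hc := c₀_pos hp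
  have h01 : ∀ z, 0 < 1 / (1 + c₀ μ lam₀ * Real.exp (-kappa₀ μ lam₀ * z)) ∧
      1 / (1 + c₀ μ lam₀ * Real.exp (-kappa₀ μ lam₀ * z)) ≤ 1 := fun z => by
    have h1 := one_add_pos hp z
    refine ⟨by positivity, (div_le_one h1).2 ?_⟩
    have := mul_pos hc (Real.exp_pos (-kappa₀ μ lam₀ * z))
    linarith
  have := convex_univ.norm_image_sub_le_of_norm_hasDerivWithin_le (𝕜 := ℝ) (f := profile μ lam₀)
    (x := y) (y := x) (C := kappa₀ μ lam₀) (fun z _ => (hasDerivAt_profile hp z).hasDerivWithinAt)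
    (fun z _ => ?_) (mem_univ _) (mem_univ _)
  · simpa using this
  · have h1 := h01 z
    have h2 := h01 (z - 1)
    rw [profileDeriv, norm_mul, Real.norm_eq_abs, abs_of_pos hk, Real.norm_eq_abs]
    refine mul_le_of_le_one_right hk.le (abs_le.2 ⟨?_, ?_⟩) <;> linarith [h1.1, h1.2, h2.1, h2.2]

section flux
variable {μ : ℝ} {lam₀ : ℚ} {g : ℝ → ℝ}

lemma eqOn_of_deriv_eq_zero {s : Set ℝ} (hs : Convex ℝ s) (hg : Differentiable ℝ g)
    (h : ∀ x ∈ s, deriv g x = 0) {x y : ℝ} (hx : x ∈ s) (hy : y ∈ s) : g x = g y := by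
  have := hs.norm_image_sub_le_of_norm_hasDerivWithin_le (𝕜 := ℝ) (f := g) (x := y)
    (y := x) (C := 0) (fun z _ => (hg z).hasDerivAt.hasDerivWithinAt)
    (fun z hz => by rw [h z hz, norm_zero]) hy hx
  rw [zero_mul] at this
  exact sub_eq_zero.1 (norm_le_zero_iff.1 this)

lemma AdmissibleFlux.differentiable (hg : AdmissibleFlux μ lam₀ g) : Differentiable ℝ g :=
  hg.1.differentiable (by simp)

lemma AdmissibleFlux.continuous_deriv (hg : AdmissibleFlux μ lam₀ g) : Continuous (deriv g) :=
  hg.1.continuous_deriv (by simp)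

/-- On ξ ≥ 0 the flux equals g(0) below the level a and, by compact support, 0 above the level b.
The source is therefore confined to the layer where u lies between two levels inside (0, κ₀). -/
lemma AdmissibleFlux.exists_levels (hp : Params μ lam₀) (hg : AdmissibleFlux μ lam₀ g) :
    ∃ a b : ℝ, 0 < a ∧ a < b ∧ b < kappa₀ μ lam₀ ∧ (∀ x ∈ Icc 0 a, g x = g 0) ∧
      (∀ x, b ≤ x → g x = 0) ∧ ∀ x, 0 ≤ x → deriv g x ≠ 0 → x ∈ Icc a b := by
  have hd := hg.differentiable
  obtain ⟨-, hs, a, b, ha, hb, h⟩ := hg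
  have hk := hp.kappa₀_pos
  set κ := kappa₀ μ lam₀
  obtain ⟨b', hb1, hb2⟩ := exists_between (max_lt hb hk)
  have hb'0 : 0 < b' := (le_max_right _ _).trans_lt hb1
  have hb'b : b < b' := (le_max_left _ _).trans_lt hb1
  have hm : 0 < min a b' := lt_min ha hb'0
  refine ⟨min a b' / 2, b', by positivity, ?_, hb2, ?_, ?_, ?_⟩
  · linarith [min_le_right a b']
  · intro x hx
    refine eqOn_of_deriv_eq_zero (convex_Icc 0 (min a b' / 2)) hd (fun y hy => ?_) hx
      ⟨le_rfl, by positivity⟩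
    by_contra hne
    have := (h y hy.1 hne).1
    linarith [min_le_left a b', hy.2]
  · obtain ⟨R, hR⟩ := hs.isCompact.bddAbove
    intro x hx
    have h1 : g x = g (max x (R + 1)) := by
      refine eqOn_of_deriv_eq_zero (convex_Ici b') hd (fun y hy => ?_) hx (hx.trans (le_max_left _ _))
      by_contra hne
      have := (h y (hb'0.le.trans hy) hne).2
      linarith [mem_Ici.1 hy]
    rw [h1]
    by_contra hne
    have := hR (subset_tsupport g hne)
    linarith [le_max_right x (R + 1)]
  · intro x hx hne
    have := h x hx hne
    exact ⟨by linarith [min_le_left a b', this.1], this.2.trans hb'b.le⟩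

lemma AdmissibleFlux.exists_lipschitz (hg : AdmissibleFlux μ lam₀ g) :
    ∃ L > 0, (∀ x y, |g x - g y| ≤ L * |x - y|) ∧ ∀ x, |g x| ≤ L := by
  obtain ⟨C, hC⟩ := ContDiff.lipschitzWith_of_hasCompactSupport hg.2.1 hg.1 (by simp)
  obtain ⟨B, hB⟩ := hg.2.1.exists_bound_of_continuous hg.1.continuous
  have hB0 : 0 ≤ B := (norm_nonneg _).trans (hB 0)
  refine ⟨C + B + 1, by positivity, fun x y => ?_, fun x => ?_⟩
  · have := hC.dist_le_mul x y
    rw [Real.dist_eq, Real.dist_eq] at this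
    nlinarith [abs_nonneg (x - y)]
  · have := hB x
    rw [Real.norm_eq_abs] at this
    linarith [C.coe_nonneg]

/-- Behind the shock `zInt` is large, so u ≥ b; ahead of it u ≤ `zInt` is small; in between u is
close to the profile. The statement on the left extends to later times s' ≤ s because `zInt`
increases in time; this serves to discard times before the packet meets the shock. -/
lemma exists_source_bounds (hp : Params μ lam₀) (hg : AdmissibleFlux μ lam₀ g) :
    ∃ Y ≥ 0, ∃ C > 0, ∃ N : ℝ, IsTransition (shape μ lam₀ g) Y (g 0) ∧
      ∀ T : ℕ, LateTime lam₀ T → N ≤ √(T : ℝ) →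
      (∀ s ∈ Icc (2 * √(T : ℝ)) T, ∀ s' ≤ s, ∀ x ≤ gamma lam₀ T (-s) - Y,
        g (u μ lam₀ T (-s') x) = 0) ∧
      (∀ s, 2 * √(T : ℝ) ≤ s → ∀ x, gamma lam₀ T (-s) + Y ≤ x → g (u μ lam₀ T (-s) x) = g 0) ∧
      ∀ s ∈ Icc (2 * √(T : ℝ)) T, ∀ x,
        |g (u μ lam₀ T (-s) x) - shape μ lam₀ g (x - gamma lam₀ T (-s))| ≤ C / √s := by
  obtain ⟨a, b, ha, hab, hbκ, hl, hr, -⟩ := hg.exists_levels hp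
  obtain ⟨L, hL, hlip, -⟩ := hg.exists_lipschitz
  have hk := hp.kappa₀_pos
  have hc0 := c₀_pos hp
  set κ := kappa₀ μ lam₀ with hκ
  -- R is the size of `zInt` that guarantees u ≥ b by `le_u_of_le_zInt`.
  set R : ℝ := (Real.exp b - 1) / (Real.exp κ - Real.exp b) with hR
  have hte : Tendsto (fun y : ℝ => Real.exp (-κ * y)) atTop (𝓝 0) := by
    have := Real.tendsto_exp_neg_atTop_nhds_zero.comp (tendsto_id.const_mul_atTop hk)
    refine this.congr fun y => ?_
    simp
  have hY1 : ∀ᶠ y : ℝ in atTop, c₀ μ lam₀ * Real.exp (-κ * (y - 1)) < a / 2 := by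
    have h1 : Tendsto (fun y : ℝ => c₀ μ lam₀ * Real.exp (-κ * (y - 1))) atTop (𝓝 (c₀ μ lam₀ * 0)) :=
      (hte.comp (tendsto_atTop_add_const_right _ (-1) tendsto_id)).const_mul _
    rw [mul_zero] at h1
    exact h1.eventually (gt_mem_nhds (by positivity))
  have hY2 : ∀ᶠ y : ℝ in atTop, R + 1 ≤ c₀ μ lam₀ * Real.exp (κ * y) :=
    ((Real.tendsto_exp_atTop.comp (tendsto_id.const_mul_atTop hk)).const_mul_atTop
      hc0).eventually (eventually_ge_atTop _)
  -- The first two conditions give the limiting `zInt` a margin of a/2 ahead of the shock and of 1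
  -- behind it, for the asymptotic error; the last two place the profile outside the levels a and b.
  obtain ⟨Y, hYa, hYb, hY0, hYc, hYd⟩ := (hY1.and (hY2.and ((eventually_ge_atTop 1).and
    ((eventually_ge_atTop (c μ lam₀ a)).and (eventually_ge_atTop (-c μ lam₀ b)))))).exists
  obtain ⟨C₁, hC₁, hprof⟩ := exists_abs_u_sub_profile_le hp (Y := Y) (by linarith)
  obtain ⟨C₂, hz⟩ := exists_abs_zInt_sub_le hp (Y := Y) (by linarith)
  have hpa : profile μ lam₀ Y ≤ a := by
    rw [← profile_c hp ha (hab.trans hbκ)]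
    exact (profile_strictAnti hp).antitone hYc
  have hpb : b ≤ profile μ lam₀ (-Y) := by
    rw [← profile_c hp (ha.trans hab) hbκ]
    exact (profile_strictAnti hp).antitone (by linarith)
  have htr : IsTransition (shape μ lam₀ g) Y (g 0) :=
    ⟨fun y hy => hr _ (hpb.trans ((profile_strictAnti hp).antitone hy)),
      fun y hy => hl _ ⟨(profile_pos hp y).le, ((profile_strictAnti hp).antitone hy).trans hpa⟩⟩
  -- The square turns the assumption on √T into a lower bound on √s, by s ≥ 2√T. The entries of the
  -- maximum make the errors at most 1 and a/2.
  refine ⟨Y, by linarith, L * C₁, by positivity, max 1 (max C₂ (800 / κ ^ 2 * (2 / a))) ^ 2, htr,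
    fun T hT hN => ?_⟩
  have hT' := hT.admissible hp
  set N := max 1 (max C₂ (800 / κ ^ 2 * (2 / a)))
  have hN1 : 1 ≤ N := le_max_left _ _
  have hsN : ∀ s, 2 * √(T : ℝ) ≤ s → N ≤ √s := fun s hs =>
    Real.le_sqrt_of_sq_le (by linarith [Real.sqrt_nonneg (T : ℝ)])
  have hleft : ∀ s ∈ Icc (2 * √(T : ℝ)) T, ∀ s' ≤ s, ∀ x ≤ gamma lam₀ T (-s) - Y,
      g (u μ lam₀ T (-s') x) = 0 := by
    intro s hs s' hs' x hx
    have hsq := hsN s hs.1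
    apply hr
    apply le_u_of_le_zInt hp hT' hbκ
    have h1 := (abs_le.1 (hz T hT s hs (-Y) ⟨le_rfl, by linarith⟩)).1
    have h2 : C₂ / √s ≤ 1 := by
      rw [div_le_one (by linarith)]
      exact ((le_max_left _ _).trans (le_max_right _ _)).trans hsq
    have h3 : zInt μ lam₀ T (-s) (gamma lam₀ T (-s) + -Y) ≤ zInt μ lam₀ T (-s') x :=
      (zInt_antitone hp hT' (-s) (by linarith)).trans (zInt_mono_time hp hT' x (by linarith))
    have h4 : -κ * -Y = κ * Y := by ring
    rw [h4] at h1
    linarith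
  have hright : ∀ s, 2 * √(T : ℝ) ≤ s → ∀ x, gamma lam₀ T (-s) + Y ≤ x →
      g (u μ lam₀ T (-s) x) = g 0 := by
    intro s hs x hx
    have hsq := hsN s hs
    refine hl _ ⟨(u_pos hp hT' _ _).le, ?_⟩
    have h1 := u_le_zInt hp hT' (-s) x
    have h2 := integral_wave_le hp hT' hs (y := Y - 1) (by linarith)
    have h3 := zInt_antitone hp hT' (-s)
      (show gamma lam₀ T (-s) + (Y - 1) ≤ x - 1 by linarith)
    have h4 : 800 / κ ^ 2 / √s ≤ a / 2 := by
      rw [div_le_iff₀ (by linarith)]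
      have : 800 / κ ^ 2 * (2 / a) ≤ √s := ((le_max_right _ _).trans (le_max_right _ _)).trans hsq
      calc 800 / κ ^ 2 = a / 2 * (800 / κ ^ 2 * (2 / a)) := by field_simp
        _ ≤ _ := by gcongr
    linarith
  refine ⟨hleft, hright, fun s hs x => ?_⟩
  have hs0 : 0 < √s := by linarith [hsN s hs.1]
  set y := x - gamma lam₀ T (-s) with hy
  have hx : x = gamma lam₀ T (-s) + y := by rw [hy]; ring
  rcases lt_or_ge y (-Y) with h | h
  · rw [hleft s hs s le_rfl x (by linarith), htr.left y h.le]
    simp only [sub_self, abs_zero]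
    positivity
  rcases lt_or_ge Y y with h' | h'
  · rw [hright s hs.1 x (by linarith), htr.right y h'.le]
    simp only [sub_self, abs_zero]
    positivity
  · rw [shape, hx, mul_div_assoc]
    exact (hlip _ _).trans (mul_le_mul_of_nonneg_left (hprof T hT s hs y ⟨h, h'⟩) hL.le)

lemma exists_sum_abs_source_le (hp : Params μ lam₀) (hg : AdmissibleFlux μ lam₀ g) :
    ∃ K > 0, ∀ T : ℕ, AdmissibleTime lam₀ T → ∀ (t : ℝ) (n : ℤ) (N : ℕ), ∑ k ∈ Finset.range N,
      |g (u μ lam₀ T t ((n + k + 1 : ℤ) : ℝ)) - g (u μ lam₀ T t ((n + k : ℤ) : ℝ))| ≤ K := by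
  obtain ⟨L, hL, hlip, -⟩ := hg.exists_lipschitz
  obtain ⟨K, hK⟩ := exists_u_le hp
  refine ⟨L * |K| + 1, by positivity, fun T hT t n N => ?_⟩
  have h1 : ∀ k ∈ Finset.range N,
      |g (u μ lam₀ T t ((n + k + 1 : ℤ) : ℝ)) - g (u μ lam₀ T t ((n + k : ℤ) : ℝ))| ≤
      L * (u μ lam₀ T t ((n + k : ℤ) : ℝ) - u μ lam₀ T t ((n + (k + 1 : ℕ) : ℤ) : ℝ)) := by
    intro k _
    refine (hlip _ _).trans ?_
    have : u μ lam₀ T t ((n + k + 1 : ℤ) : ℝ) ≤ u μ lam₀ T t ((n + k : ℤ) : ℝ) :=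
      (u_strictAnti hp hT t).antitone (by push_cast; linarith)
    rw [abs_sub_comm, abs_of_nonneg (by linarith)]
    push_cast
    rw [add_assoc]
  refine (Finset.sum_le_sum h1).trans ?_
  rw [← Finset.mul_sum, Finset.sum_range_sub' (fun k : ℕ => u μ lam₀ T t ((n + k : ℤ) : ℝ))]
  have h2 := u_pos hp hT t ((n + N : ℤ) : ℝ)
  have h3 := (hK T hT t ((n + (0 : ℕ) : ℤ) : ℝ)).trans (le_abs_self K)
  nlinarith

end flux

/-! ### The first moment of the increments -/

section moment
variable {G : ℝ → ℝ} {Y c K L : ℝ}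

lemma moment_add_one (G : ℝ → ℝ) (θ : ℝ) : moment G (θ + 1) = moment G θ := by
  rw [moment, ← (Equiv.addRight (1 : ℤ)).tsum_eq, moment]
  refine tsum_congr fun i => ?_
  simp only [Equiv.coe_addRight]
  push_cast
  congr 1
  · ring
  · congr 2 <;> ring

/-- For |θ - θ'| ≤ 1 both sums run over a common finite window and are compared term by term; for
larger distances the uniform bound suffices. -/
lemma exists_moment_bounds (hG : IsTransition G Y c) (hY : 0 ≤ Y) (hK : ∀ y, |G y| ≤ K)
    (hL : ∀ x y, |G x - G y| ≤ L * |x - y|) (hL0 : 0 ≤ L) :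
    ∃ B > 0, (∀ θ, |moment G θ| ≤ B) ∧ ∀ θ θ', |moment G θ - moment G θ'| ≤ B * |θ - θ'| := by
  have hK0 : 0 ≤ K := (abs_nonneg _).trans (hK 0)
  set N : ℕ := ⌈2 * Y⌉₊ + 5 with hN
  set R : ℝ := N + Y + 6 with hR
  have hR0 : 0 < R := by positivity
  have hNY : 2 * Y + 5 ≤ N := by
    have := Nat.le_ceil (2 * Y)
    rw [hN]
    push_cast
    linarith
  have hrep : ∀ θ θ', |θ - θ'| ≤ 1 → ∃ n : ℤ, (∀ k ∈ Finset.range N, |(n : ℝ) + k - θ'| ≤ R) ∧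
      moment G θ = ∑ k ∈ Finset.range N, ((n + k : ℝ) - θ) * (G (n + k + 1 - θ) - G (n + k - θ)) ∧
      moment G θ' =
        ∑ k ∈ Finset.range N, ((n + k : ℝ) - θ') * (G (n + k + 1 - θ') - G (n + k - θ')) := by
    intro θ θ' h
    rw [abs_le] at h
    have h1 := Int.floor_le (θ - Y)
    have h2 := Int.lt_floor_add_one (θ - Y)
    refine ⟨⌊θ - Y⌋ - 2, fun k hk => ?_, moment_eq_sum hG ?_ ?_, moment_eq_sum hG ?_ ?_⟩
    · have h3 : (k : ℝ) ≤ N := by exact_mod_cast (Finset.mem_range.1 hk).le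
      have h4 : (0 : ℝ) ≤ k := k.cast_nonneg
      push_cast
      rw [abs_le]
      constructor <;> linarith
    all_goals
      push_cast
      linarith
  set B₁ : ℝ := N * (R * (2 * K)) with hB₁
  set B₂ : ℝ := N * (2 * K + R * (2 * L)) with hB₂
  have hbd : ∀ θ, |moment G θ| ≤ B₁ := by
    intro θ
    obtain ⟨n, h1, h2, -⟩ := hrep θ θ (by simp)
    rw [h2]
    calc _ ≤ ∑ k ∈ Finset.range N, |((n + k : ℝ) - θ) * (G (n + k + 1 - θ) - G (n + k - θ))| :=
          Finset.abs_sum_le_sum_abs _ _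
      _ ≤ ∑ k ∈ Finset.range N, R * (2 * K) := by
          refine Finset.sum_le_sum fun k hk => ?_
          rw [abs_mul]
          have h3 := abs_sub (G (n + k + 1 - θ)) (G (n + k - θ))
          have h4 := hK (n + k + 1 - θ)
          have h5 := hK (n + k - θ)
          exact mul_le_mul (h1 k hk) (by linarith) (abs_nonneg _) hR0.le
      _ = _ := by rw [Finset.sum_const, Finset.card_range, nsmul_eq_mul]
  refine ⟨2 * B₁ + B₂ + 1, by positivity, fun θ => ?_, fun θ θ' => ?_⟩
  · have h1 : 0 ≤ B₁ := by positivity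
    have h2 : 0 ≤ B₂ := by positivity
    linarith [hbd θ]
  rcases le_or_gt |θ - θ'| 1 with h | h
  · obtain ⟨n, h1, h2, h3⟩ := hrep θ θ' h
    rw [h2, h3, ← Finset.sum_sub_distrib]
    calc _ ≤ ∑ k ∈ Finset.range N, |((n + k : ℝ) - θ) * (G (n + k + 1 - θ) - G (n + k - θ)) -
            ((n + k : ℝ) - θ') * (G (n + k + 1 - θ') - G (n + k - θ'))| :=
          Finset.abs_sum_le_sum_abs _ _
      _ ≤ ∑ k ∈ Finset.range N, (2 * K + R * (2 * L)) * |θ - θ'| := by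
          refine Finset.sum_le_sum fun k hk => ?_
          set x := (n + k : ℝ)
          have e : (x - θ) * (G (x + 1 - θ) - G (x - θ)) - (x - θ') * (G (x + 1 - θ') - G (x - θ')) =
              (θ' - θ) * (G (x + 1 - θ) - G (x - θ)) + (x - θ') *
                ((G (x + 1 - θ) - G (x + 1 - θ')) - (G (x - θ) - G (x - θ'))) := by ring
          have g1 : |G (x + 1 - θ) - G (x - θ)| ≤ 2 * K := by
            have h3 := abs_sub (G (x + 1 - θ)) (G (x - θ))
            linarith [hK (x + 1 - θ), hK (x - θ)]
          have g2 : |(G (x + 1 - θ) - G (x + 1 - θ')) - (G (x - θ) - G (x - θ'))| ≤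
              2 * L * |θ - θ'| := by
            have h3 := abs_sub (G (x + 1 - θ) - G (x + 1 - θ')) (G (x - θ) - G (x - θ'))
            have h4 := hL (x + 1 - θ) (x + 1 - θ')
            have h5 := hL (x - θ) (x - θ')
            rw [sub_sub_sub_cancel_left, abs_sub_comm θ'] at h4 h5
            linarith
          rw [e]
          refine (abs_add_le _ _).trans ?_
          rw [abs_mul, abs_mul, abs_sub_comm θ']
          calc _ ≤ |θ - θ'| * (2 * K) + R * (2 * L * |θ - θ'|) := by
                gcongr
                exact h1 k hk
            _ = _ := by ring
      _ = B₂ * |θ - θ'| := by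
          rw [Finset.sum_const, Finset.card_range, nsmul_eq_mul, hB₂]
          ring
      _ ≤ _ := by
          gcongr
          have h1 : 0 ≤ B₁ := by positivity
          linarith
  · have h1 := abs_sub (moment G θ) (moment G θ')
    have h2 := hbd θ
    have h3 := hbd θ'
    have h4 : 0 ≤ B₁ := by positivity
    have h5 : 0 ≤ B₂ := by positivity
    nlinarith

lemma exists_shape_moment_bounds {μ : ℝ} {lam₀ : ℚ} {g : ℝ → ℝ} (hp : Params μ lam₀)
    (hg : AdmissibleFlux μ lam₀ g) : ∃ B > 0, (∀ θ, |moment (shape μ lam₀ g) θ| ≤ B) ∧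
      ∀ θ θ', |moment (shape μ lam₀ g) θ - moment (shape μ lam₀ g) θ'| ≤ B * |θ - θ'| := by
  obtain ⟨Y, hY, -, -, -, htr, -⟩ := exists_source_bounds hp hg
  obtain ⟨L, hL, hlip, hbd⟩ := hg.exists_lipschitz
  refine exists_moment_bounds htr hY (fun y => hbd _) (L := L * kappa₀ μ lam₀) (fun x y => ?_)
    (mul_nonneg hL.le hp.kappa₀_pos.le)
  rw [mul_assoc]
  exact (hlip _ _).trans (mul_le_mul_of_nonneg_left (abs_profile_sub_le hp x y) hL.le)

end moment

end GodunovTV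

namespace GodunovTV

/-! ### Pairing of the increments of `V` with an oscillating packet -/

lemma bddSupport_test {A w : ℝ} (hA : 0 < A) : BddSupport (test A w) :=
  ⟨A, 2 * A, fun _ hx => test_eq_zero hA fun h => by linarith [h.1],
    fun _ hx => test_eq_zero hA fun h => by linarith [h.2]⟩

lemma packet_eq_zero {lam₀ : ℚ} {A w : ℝ} {m : ℕ} (h : beta lam₀ * m / A ∉ Ioo (1 : ℝ) 2) :
    packet lam₀ A w m = 0 := by
  rw [packet, bump_eq_zero h]
  simp

/-- Far behind the packet the increments of the evolved packet are small. -/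
lemma norm_avg_test_sub_le {μ : ℝ} {lam₀ : ℚ} (hp : Params μ lam₀) {A w B Y : ℝ} (hA : 0 < A)
    (hY : Y + 1 ≤ A) (hB : ∀ x, ‖test A w x - test A w (x - 1)‖ ≤ B) {m : ℕ}
    (hm : 8 * A ≤ beta lam₀ * m) {y : ℝ} (hy : front lam₀ m - Y ≤ y) :
    ‖avg^[m] (test A w) y - avg^[m] (test A w) (y - 1)‖ ≤ B * (1 / (8 * beta lam₀ * A)) := by
  have hβ := hp.beta_pos
  set β := beta lam₀ with hβdef
  have hB0 : 0 ≤ B := (norm_nonneg _).trans (hB 0)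
  have hm0 : 0 < (m : ℝ) := by
    by_contra! h
    nlinarith
  have e : avg^[m] (test A w) y - avg^[m] (test A w) (y - 1) =
      avg^[m] (fun x => test A w x - test A w (x - 1)) y := by
    have h1 := avg_iterate_comp_add (test A w) (-1) m y
    simp only [← sub_eq_add_neg] at h1
    rw [avg_iterate_sub, h1]
  have h2 : β * m / 2 ≤ y - m / 2 - (2 * A + 1) := by
    have : front lam₀ m - m / 2 = β * m + 2 * √(m : ℝ) := by
      rw [hβdef, front, beta]
      ring
    linarith [Real.sqrt_nonneg (m : ℝ)]
  have h3 : 0 < β * m / 2 := by positivity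
  rw [e]
  refine (norm_avg_iterate_le_of_lt (b := 2 * A + 1) hB (fun x hx => ?_) m (by linarith)).trans ?_
  · rw [test_eq_zero hA fun h => by linarith [h.2], test_eq_zero hA fun h => by linarith [h.2],
      sub_zero]
  · refine mul_le_mul_of_nonneg_left ?_ hB0
    calc (m : ℝ) / 4 / (y - m / 2 - (2 * A + 1)) ^ 2 ≤ m / 4 / (β * m / 2) ^ 2 := by gcongr
      _ = 1 / (β * (β * m)) := by
          field_simp
          norm_num
      _ ≤ 1 / (β * (8 * A)) := by gcongr
      _ = _ := by ring

/-- Chebyshev: at these times the mean position βm + 2√m lies beyond the support by at least βm/2,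
while the variance is m/4. -/
lemma norm_avg_test_le {μ : ℝ} {lam₀ : ℚ} (hp : Params μ lam₀) {A w : ℝ} (hA : 0 < A) {m : ℕ}
    (hm : 8 * A ≤ beta lam₀ * m) :
    ‖avg^[m] (test A w) (front lam₀ m)‖ ≤ 1 / (8 * beta lam₀ * A) := by
  have hβ := hp.beta_pos
  set β := beta lam₀ with hβdef
  have hm0 : 0 < (m : ℝ) := by
    by_contra! h
    nlinarith
  have h2 : β * m / 2 ≤ front lam₀ m - m / 2 - 2 * A := by
    have : front lam₀ m - m / 2 = β * m + 2 * √(m : ℝ) := by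
      rw [hβdef, front, beta]
      ring
    linarith [Real.sqrt_nonneg (m : ℝ)]
  have h3 : 0 < β * m / 2 := by positivity
  refine (norm_avg_iterate_le_of_lt (b := 2 * A) (norm_test_le A w) (fun x hx => ?_) m
    (by linarith)).trans ?_
  · exact test_eq_zero hA fun h => by linarith [h.2]
  · rw [one_mul]
    calc (m : ℝ) / 4 / (front lam₀ m - m / 2 - 2 * A) ^ 2 ≤ m / 4 / (β * m / 2) ^ 2 := by gcongr
      _ = 1 / (β * (β * m)) := by
          field_simp
          norm_num
      _ ≤ 1 / (β * (8 * A)) := by gcongr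
      _ = _ := by ring

set_option maxHeartbeats 1000000 in
-- Three time ranges. Up to m of order A/8 the packet has not met the shock and contributes nothing.
-- After βm = 8A it has been passed; each of the at most 3T slices is O(1/(A√A)), the source of the
-- term T/(A√A). In between the Taylor expansion applies, its constant-coefficient terms cancel in
-- the sum, and the resonant sum of packet times moment remains.
lemma exists_norm_tsum_V_add_le {μ : ℝ} {lam₀ : ℚ} {g : ℝ → ℝ} (hp : Params μ lam₀)
    (hg : AdmissibleFlux μ lam₀ g) (w : ℝ) : ∃ C > 0, ∃ N : ℝ, ∀ T : ℕ, LateTime lam₀ T →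
      N ≤ √(T : ℝ) → ∀ A : ℝ, 32 * √(T : ℝ) ≤ A → (8 / beta lam₀ + 1) * A ≤ T →
      ‖∑' J : ℤ, test A w J * ((V μ lam₀ T g (-J) : ℂ) - V μ lam₀ T g (-J - 1)) +
        ∑ m ∈ Finset.range ⌈8 / beta lam₀ * A⌉₊,
          packet lam₀ A w m * moment (shape μ lam₀ g) (-front lam₀ m)‖ ≤
        C * (1 / √A + T / (A * √A)) := by
  have hβ := hp.beta_pos
  have hβ1 := hp.beta_lt
  have hl0 := hp.lam_pos
  have hl1 := hp.lam_lt
  set β := beta lam₀ with hβdef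
  set D : ℝ := 8 / β + 1 with hD
  have hD0 : 0 < D := by positivity
  obtain ⟨Y, hY, C₁, hC₁, N₁, htr, hsrc⟩ := exists_source_bounds hp hg
  obtain ⟨K, hK, hvar⟩ := exists_sum_abs_source_le hp hg
  obtain ⟨L, hL, -, hgb⟩ := hg.exists_lipschitz
  obtain ⟨B, hB, hmom, -⟩ := exists_shape_moment_bounds hp hg
  obtain ⟨C₂, hC₂, htest⟩ := exists_test_derivs w
  obtain ⟨C₃, hC₃, hpacket⟩ := exists_norm_avg_packet_le hp w hD0
  obtain ⟨C₄, hC₄, hslice⟩ := exists_norm_slice_sub_le hY L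
  obtain ⟨C₅, hC₅, hsum⟩ := exists_norm_sum_avg_le hp (C := C₂) (D := D) (E := 1 / β) hC₂ hD0
    (by positivity)
  set c := g 0 with hc
  set G := shape μ lam₀ g with hG
  set Ca : ℝ := C₄ * (C₂ + 4 * C₁ * C₂) + B * (C₂ + C₃) with hCa
  set Cb : ℝ := |c| * C₅ + |c| / 2 * C₅ with hCb
  set Cc : ℝ := 3 * K * (C₂ / (8 * β)) with hCc
  refine ⟨Cb + D * Ca + Cc, by positivity, max N₁ (max 1 (Y + 1)), ?_⟩
  intro T hT hN A hA hAT
  obtain ⟨hs1, hs2, hs3⟩ := hsrc T hT ((le_max_left _ _).trans hN)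
  have hN2 : 1 ≤ √(T : ℝ) := ((le_max_left _ _).trans (le_max_right _ _)).trans hN
  have hN3 : Y + 1 ≤ √(T : ℝ) := ((le_max_right _ _).trans (le_max_right _ _)).trans hN
  have hT' := hT.admissible hp
  have hA32 : 32 ≤ A := by linarith
  have hA0 : 0 < A := by linarith
  have hA1 : 1 ≤ A := by linarith
  have hAY : Y + 1 ≤ A := by linarith
  have hsA := Real.sqrt_pos.2 hA0
  have hssA := Real.mul_self_sqrt hA0.le
  have hT1 : (1 : ℝ) ≤ T := by exact_mod_cast hT.1
  -- Small enough that the front stays below the lower edge A of the packet, yet at least A/16 ≥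
  -- 2√T, where the asymptotics of `u` hold.
  set m₁ : ℕ := ⌊A / 8⌋₊ with hm₁
  -- From βm ≥ 8A on the Chebyshev bounds apply; the hypothesis on A keeps m₂ ≤ T.
  set m₂ : ℕ := ⌈8 / β * A⌉₊ with hm₂
  have hm₁a : (m₁ : ℝ) ≤ A / 8 := Nat.floor_le (by positivity)
  have hm₁b : A / 16 ≤ m₁ := by
    have := Nat.lt_floor_add_one (A / 8)
    linarith
  have hm₂a : 8 / β * A ≤ m₂ := Nat.le_ceil _
  have hm₂b : (m₂ : ℝ) ≤ D * A := by
    have := Nat.ceil_lt_add_one (a := 8 / β * A) (by positivity)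
    rw [hD]
    linarith
  have hm₂c : 8 * A ≤ β * m₂ := by
    rw [div_mul_eq_mul_div, div_le_iff₀ hβ] at hm₂a
    linarith
  have h12 : m₁ ≤ m₂ := by
    have h1 : A / 8 ≤ m₂ := by nlinarith
    exact_mod_cast hm₁a.trans h1
  have hm₂T : m₂ ≤ T := by exact_mod_cast hm₂b.trans hAT
  have hgam : ∀ m : ℕ, m₁ ≤ m → gamma lam₀ T (-(m : ℝ)) = -front lam₀ m := fun m hm => by
    have hm' : (m₁ : ℝ) ≤ m := by exact_mod_cast hm
    rw [gamma_neg (by linarith), front]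
    ring
  have h2T : ∀ m : ℕ, m₁ ≤ m → 2 * √(T : ℝ) ≤ m := fun m hm => by
    have hm' : (m₁ : ℝ) ≤ m := by exact_mod_cast hm
    linarith
  set ψ := test A w with hψ
  obtain ⟨ψ₁, ψ₂, ψ₃, d, d₁, d₂, b₁, b₂, b₃, -, hψ₂⟩ := htest A hA1
  set f : ℕ → ℤ → ℝ := fun m j => g (u μ lam₀ T (-m) j) with hf
  have hfront₁ : front lam₀ m₁ + Y + 1 < A := by
    have h1 : √(m₁ : ℝ) ≤ (1 + m₁) / 2 := by
      nlinarith [sq_nonneg (√(m₁ : ℝ) - 1), Real.sq_sqrt (m₁.cast_nonneg (α := ℝ))]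
    rw [front]
    nlinarith [m₁.cast_nonneg (α := ℝ)]
  -- early times: the packet has not met the shock
  have early : ∀ m < m₁, slice (f m) (avg^[m] ψ) = 0 := by
    intro m hm
    rw [slice]
    have : ∀ j : ℤ, ((f m (j + 1) - f m j : ℝ) : ℂ) *
        (avg^[m] ψ (-j) - avg^[m] ψ (-j - 1)) = 0 := by
      intro j
      have hz : ∀ x < A, ψ x = 0 := fun x hx => test_eq_zero hA0 fun h => by linarith [h.1]
      rcases lt_or_ge (-(j : ℝ)) A with h | h
      · rw [avg_iterate_eq_zero_of_lt hz m h, avg_iterate_eq_zero_of_lt hz m (by linarith),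
          sub_zero, mul_zero]
      · have hm' : (m : ℝ) ≤ m₁ := by exact_mod_cast hm.le
        have hI : (m₁ : ℝ) ∈ Icc (2 * √(T : ℝ)) T :=
          ⟨h2T m₁ le_rfl, by exact_mod_cast h12.trans hm₂T⟩
        have h3 := hs1 m₁ hI m hm'
        rw [hgam m₁ le_rfl] at h3
        simp only [hf]
        rw [h3 _ (by push_cast; linarith), h3 _ (by linarith), sub_zero, Complex.ofReal_zero,
          zero_mul]
    rw [tsum_congr this, tsum_zero]
  -- late times
  have late : ‖∑ m ∈ Finset.Ico m₂ (2 * T + 1), slice (f m) (avg^[m] ψ)‖ ≤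
      Cc * (T / (A * √A)) := by
    have h1 : ∀ m ∈ Finset.Ico m₂ (2 * T + 1), ‖slice (f m) (avg^[m] ψ)‖ ≤
        K * (C₂ / √A * (1 / (8 * β * A))) := by
      intro m hm
      have hm' : m₂ ≤ m := (Finset.mem_Ico.1 hm).1
      have hm1 : m₁ ≤ m := h12.trans hm'
      refine norm_slice_le ((bddSupport_test hA0).avg_iterate m) (hvar T hT' _) (by positivity)
        fun j hj => ?_
      have hj' : (j : ℝ) < -front lam₀ m + Y := by
        by_contra! hc'
        apply hj
        have h3 := hs2 m (h2T m hm1)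
        rw [hgam m hm1] at h3
        simp only [hf]
        rw [h3 _ (by push_cast; linarith), h3 _ hc']
      refine norm_avg_test_sub_le hp hA0 hAY (fun x => ?_) ?_ (by linarith)
      · have := norm_sub_le_of_deriv d b₁ (x - 1) 1
        simpa using this
      · have : (m₂ : ℝ) ≤ m := by exact_mod_cast hm'
        nlinarith
    calc _ ≤ ∑ m ∈ Finset.Ico m₂ (2 * T + 1), K * (C₂ / √A * (1 / (8 * β * A))) :=
          (norm_sum_le _ _).trans (Finset.sum_le_sum h1)
      _ ≤ (3 * T) * (K * (C₂ / √A * (1 / (8 * β * A)))) := by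
          rw [Finset.sum_const, nsmul_eq_mul, Nat.card_Ico]
          gcongr
          have : ((2 * T + 1 - m₂ : ℕ) : ℝ) ≤ ((2 * T + 1 : ℕ) : ℝ) := by
            exact_mod_cast Nat.sub_le _ _
          push_cast at this
          linarith
      _ = _ := by
          rw [hCc]
          field_simp
  -- main times
  have main : ∀ m ∈ Finset.Ico m₁ m₂, ‖slice (f m) (avg^[m] ψ) -
      (c * avg^[m] ψ₁ (front lam₀ m) - (c / 2 : ℝ) * avg^[m] ψ₂ (front lam₀ m) +
        packet lam₀ A w m * moment G (-front lam₀ m))‖ ≤ Ca / (A * √A) := by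
    intro m hm
    obtain ⟨hma, hmb⟩ := Finset.mem_Ico.1 hm
    have hma' : (m₁ : ℝ) ≤ m := by exact_mod_cast hma
    have hmb' : (m : ℝ) ≤ m₂ := by exact_mod_cast hmb.le
    have hI : (m : ℝ) ∈ Icc (2 * √(T : ℝ)) T :=
      ⟨h2T m hma, by exact_mod_cast hmb.le.trans hm₂T⟩
    have hgm := hgam m hma
    have hsm : √A / 4 ≤ √(m : ℝ) := by
      apply Real.le_sqrt_of_sq_le
      rw [div_pow, Real.sq_sqrt hA0.le]
      linarith
    have s1 := hslice G (f m) (avg^[m] ψ) (avg^[m] ψ₁) (avg^[m] ψ₂) (avg^[m] ψ₃) c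
      (-front lam₀ m) (4 * C₁ / √A) (C₂ / A) (C₂ / (A * √A)) htr
      (fun j hj => hs1 m hI m le_rfl j (by rw [hgm]; exact hj))
      (fun j hj => hs2 m hI.1 j (by rw [hgm]; exact hj)) (fun j => hgb _)
      (fun j => by
        have := hs3 m hI j
        rw [hgm] at this
        refine this.trans ?_
        calc C₁ / √(m : ℝ) ≤ C₁ / (√A / 4) := by gcongr
          _ = 4 * C₁ / √A := by field_simp)
      (hasDerivAt_avg_iterate d m) (hasDerivAt_avg_iterate d₁ m) (hasDerivAt_avg_iterate d₂ m)
      (norm_avg_iterate_le_of_le b₂ m) (norm_avg_iterate_le_of_le b₃ m)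
    rw [neg_neg] at s1
    have s2 := hpacket A hA1 m (by linarith) (hmb'.trans hm₂b)
    have s3 : ‖avg^[m] ψ₂ (front lam₀ m) +
        avg^[m] (fun y => (w ^ 2 / (4 * y) : ℝ) * test A w y) (front lam₀ m)‖ ≤
        C₂ / (A * √A) := by
      have h := avg_iterate_sub ψ₂ (fun y => (-1 : ℂ) * ((w ^ 2 / (4 * y) : ℝ) * test A w y)) m
        (front lam₀ m)
      rw [avg_iterate_const_mul, neg_one_mul, sub_neg_eq_add] at h
      rw [← h]
      refine norm_avg_iterate_le_of_le (fun x => ?_) m _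
      rw [neg_one_mul, sub_neg_eq_add]
      exact hψ₂ x
    set Q := avg^[m] (fun y => (w ^ 2 / (4 * y) : ℝ) * test A w y) (front lam₀ m)
    set P₂ := avg^[m] ψ₂ (front lam₀ m)
    set P₁ := avg^[m] ψ₁ (front lam₀ m)
    set S := slice (f m) (avg^[m] ψ)
    set M := moment G (-front lam₀ m)
    set R := packet lam₀ A w m
    -- The moment term -M P₂ becomes M R in two replacements: P₂ by -Q, the leading term of ψ'', and
    -- Q by its value R at the shock.
    have e : S - (c * P₁ - (c / 2 : ℝ) * P₂ + R * M) =
        (S - (c * P₁ - (M + c / 2 : ℝ) * P₂)) - M * ((P₂ + Q) - (Q - R)) := by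
      push_cast
      ring
    rw [e]
    calc _ ≤ C₄ * (C₂ / (A * √A) + 4 * C₁ / √A * (C₂ / A)) +
          B * (C₂ / (A * √A) + C₃ / (A * √A)) := by
          refine (norm_sub_le _ _).trans (add_le_add s1 ?_)
          rw [norm_mul, Complex.norm_real, Real.norm_eq_abs]
          have := (norm_sub_le (P₂ + Q) (Q - R)).trans (add_le_add s3 s2)
          exact mul_le_mul (hmom _) this (norm_nonneg _) hB.le
      _ = _ := by
          rw [hCa]
          field_simp
  have hcard : ((m₂ : ℝ) - m₁) ≤ D * A := by linarith [m₁.cast_nonneg (α := ℝ)]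
  have smooth := hsum A hA1 ψ ψ₁ ψ₂ ψ₃ d d₁ d₂ (norm_test_le A w) b₁ b₂ b₃ m₁ m₂ h12 hm₁b hcard
    (by
      rw [avg_iterate_eq_zero_of_lt (a := A)
        (fun x hx => test_eq_zero hA0 fun h => by linarith [h.1]) m₁ (by linarith), norm_zero]
      positivity)
    (by
      refine (norm_avg_test_le hp hA0 hm₂c).trans ?_
      have h1 : √A ≤ A := Real.sqrt_le_self_iff.2 (Or.inr hA1)
      rw [div_div]
      refine one_div_le_one_div_of_le (by positivity) ?_
      nlinarith)
  have split : ∑ m ∈ Finset.range (2 * T + 1), slice (f m) (avg^[m] ψ) =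
      ∑ m ∈ Finset.Ico m₁ m₂, slice (f m) (avg^[m] ψ) +
        ∑ m ∈ Finset.Ico m₂ (2 * T + 1), slice (f m) (avg^[m] ψ) := by
    rw [Finset.sum_Ico_consecutive _ h12 (by omega), Finset.range_eq_Ico,
      ← Finset.sum_Ico_consecutive _ (Nat.zero_le m₁) (by omega),
      Finset.sum_eq_zero (fun m hm => early m (Finset.mem_Ico.1 hm).2), zero_add]
  have psplit : ∑ m ∈ Finset.range m₂, packet lam₀ A w m * moment G (-front lam₀ m) =
      ∑ m ∈ Finset.Ico m₁ m₂, packet lam₀ A w m * moment G (-front lam₀ m) := by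
    rw [Finset.range_eq_Ico, ← Finset.sum_Ico_consecutive _ (Nat.zero_le m₁) h12,
      Finset.sum_eq_zero, zero_add]
    intro m hm
    have hm' : (m : ℝ) ≤ m₁ := by exact_mod_cast (Finset.mem_Ico.1 hm).2.le
    rw [packet_eq_zero, zero_mul]
    intro h
    have h1 := h.1
    rw [lt_div_iff₀ hA0] at h1
    nlinarith
  rw [tsum_mul_V (bddSupport_test hA0), split, psplit]
  set S₁ := ∑ m ∈ Finset.Ico m₁ m₂, avg^[m] ψ₁ (front lam₀ m)
  set S₂ := ∑ m ∈ Finset.Ico m₁ m₂, avg^[m] ψ₂ (front lam₀ m)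
  set X := ∑ m ∈ Finset.Ico m₁ m₂, slice (f m) (avg^[m] ψ)
  set Z := ∑ m ∈ Finset.Ico m₂ (2 * T + 1), slice (f m) (avg^[m] ψ)
  set W := ∑ m ∈ Finset.Ico m₁ m₂, packet lam₀ A w m * moment G (-front lam₀ m)
  have hX : ‖X - (c * S₁ - (c / 2 : ℝ) * S₂ + W)‖ ≤ D * A * (Ca / (A * √A)) := by
    have e : X - (c * S₁ - (c / 2 : ℝ) * S₂ + W) = ∑ m ∈ Finset.Ico m₁ m₂,
        (slice (f m) (avg^[m] ψ) - (c * avg^[m] ψ₁ (front lam₀ m) -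
          (c / 2 : ℝ) * avg^[m] ψ₂ (front lam₀ m) +
            packet lam₀ A w m * moment G (-front lam₀ m))) := by
      rw [Finset.sum_sub_distrib, Finset.sum_add_distrib, Finset.sum_sub_distrib, Finset.mul_sum,
        Finset.mul_sum]
    rw [e]
    calc _ ≤ ∑ m ∈ Finset.Ico m₁ m₂, Ca / (A * √A) :=
          (norm_sum_le _ _).trans (Finset.sum_le_sum main)
      _ = ((m₂ : ℝ) - m₁) * (Ca / (A * √A)) := by
          rw [Finset.sum_const, nsmul_eq_mul, Nat.card_Ico, Nat.cast_sub h12]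
      _ ≤ _ := by gcongr
  have e : -(X + Z) + W = -(X - (c * S₁ - (c / 2 : ℝ) * S₂ + W)) - Z - (c * S₁ - (c / 2 : ℝ) * S₂) := by
    ring
  rw [e]
  have hS : ‖(c : ℂ) * S₁ - ((c / 2 : ℝ) : ℂ) * S₂‖ ≤ Cb / √A := by
    refine (norm_sub_le _ _).trans ?_
    rw [norm_mul, norm_mul, Complex.norm_real, Complex.norm_real, Real.norm_eq_abs,
      Real.norm_eq_abs, abs_div, abs_two]
    calc |c| * ‖S₁‖ + |c| / 2 * ‖S₂‖ ≤ |c| * (C₅ / √A) + |c| / 2 * (C₅ / √A) := by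
          gcongr
          · exact smooth.1
          · exact smooth.2
      _ = _ := by
          rw [hCb]
          ring
  have hfin : D * A * (Ca / (A * √A)) = D * Ca * (1 / √A) := by field_simp
  have n1 := norm_sub_le (-(X - (c * S₁ - (c / 2 : ℝ) * S₂ + W)) - Z) (c * S₁ - (c / 2 : ℝ) * S₂)
  have n2 := norm_sub_le (-(X - (c * S₁ - (c / 2 : ℝ) * S₂ + W))) Z
  rw [norm_neg] at n2
  have hp1 : 0 ≤ Cc * (1 / √A) := by positivity
  have hp2 : 0 ≤ (Cb + D * Ca) * (T / (A * √A)) := by positivity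
  rw [hfin] at hX
  rw [div_eq_mul_one_div Cb] at hS
  linarith

end GodunovTV

namespace GodunovTV

/-! ### Averages of periodic functions along square roots -/

lemma sum_Ico_sub_succ {E : Type*} [AddCommGroup E] (y : ℕ → E) {n M : ℕ} (h : n ≤ M) :
    ∑ m ∈ Finset.Ico n M, (y m - y (m + 1)) = y n - y M := by
  rw [← neg_sub (y M), ← Finset.sum_Ico_sub y h, ← Finset.sum_neg_distrib]
  exact Finset.sum_congr rfl fun m _ => (neg_sub _ _).symm

lemma sum_Ico_sub_shift {E : Type*} [AddCommGroup E] (y : ℕ → E) (q : ℕ) {n M : ℕ} (h : n ≤ M) :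
    ∑ m ∈ Finset.Ico n M, (y (m + q) - y m) = ∑ i ∈ Finset.range q, (y (M + i) - y (n + i)) := by
  induction M, h using Nat.le_induction with
  | base => simp
  | succ M hM ih =>
    have h1 := Finset.sum_range_sub (fun i => y (M + i)) q
    simp only [add_zero] at h1
    rw [Finset.sum_Ico_succ_top hM, ih, ← h1, ← Finset.sum_add_distrib]
    refine Finset.sum_congr rfl fun i _ => ?_
    rw [show M + 1 + i = M + (i + 1) by ring]
    abel

/-- Ψ is an approximate primitive of H along steps of length q. Writing aH as (a/d) times a q-step
increment of Ψ and summing by parts leaves the variation of a/d, q boundary terms at each end, and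
the primitive error. -/
lemma norm_sum_mul_le_of_primitive {a d : ℕ → ℝ} {Ψ H : ℕ → ℂ} {q n M : ℕ} {P L : ℝ}
    (hnM : n ≤ M) (hd : ∀ m, 0 < d m) (hΨ : ∀ m, ‖Ψ m‖ ≤ P)
    (hH : ∀ m, ‖Ψ (m + q) - Ψ m - d m * H m‖ ≤ L * d m ^ 2) :
    ‖∑ m ∈ Finset.Ico n M, (a m : ℂ) * H m‖ ≤
      P * (∑ m ∈ Finset.Ico n M, |a (m + q) / d (m + q) - a m / d m| +
        ∑ i ∈ Finset.range q, (|a (M + i) / d (M + i)| + |a (n + i) / d (n + i)|)) +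
      L * ∑ m ∈ Finset.Ico n M, |a m| * d m := by
  set b : ℕ → ℝ := fun m => a m / d m with hb
  have hP : 0 ≤ P := (norm_nonneg _).trans (hΨ 0)
  have e : ∀ m, (a m : ℂ) * H m = ((b (m + q) : ℂ) * Ψ (m + q) - b m * Ψ m) -
      ((b (m + q) - b m : ℝ) : ℂ) * Ψ (m + q) - b m * (Ψ (m + q) - Ψ m - d m * H m) := by
    intro m
    have h1 : (a m : ℂ) = b m * d m := by
      rw [← Complex.ofReal_mul]
      congr 1
      simp only [hb]
      rw [div_mul_cancel₀ _ (hd m).ne']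
    rw [h1]
    push_cast
    ring
  rw [Finset.sum_congr rfl fun m _ => e m, Finset.sum_sub_distrib, Finset.sum_sub_distrib,
    sum_Ico_sub_shift (fun m => (b m : ℂ) * Ψ m) q hnM]
  have s1 : ‖∑ i ∈ Finset.range q, ((b (M + i) : ℂ) * Ψ (M + i) - b (n + i) * Ψ (n + i))‖ ≤
      P * ∑ i ∈ Finset.range q, (|b (M + i)| + |b (n + i)|) := by
    rw [Finset.mul_sum]
    refine (norm_sum_le _ _).trans (Finset.sum_le_sum fun i _ => ?_)
    refine (norm_sub_le _ _).trans ?_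
    rw [norm_mul, norm_mul, Complex.norm_real, Complex.norm_real, Real.norm_eq_abs,
      Real.norm_eq_abs, mul_add, mul_comm P, mul_comm P]
    exact add_le_add (mul_le_mul_of_nonneg_left (hΨ _) (abs_nonneg _))
      (mul_le_mul_of_nonneg_left (hΨ _) (abs_nonneg _))
  have s2 : ‖∑ m ∈ Finset.Ico n M, ((b (m + q) - b m : ℝ) : ℂ) * Ψ (m + q)‖ ≤
      P * ∑ m ∈ Finset.Ico n M, |b (m + q) - b m| := by
    rw [Finset.mul_sum]
    refine (norm_sum_le _ _).trans (Finset.sum_le_sum fun i _ => ?_)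
    rw [norm_mul, Complex.norm_real, Real.norm_eq_abs, mul_comm P]
    exact mul_le_mul_of_nonneg_left (hΨ _) (abs_nonneg _)
  have s3 : ‖∑ m ∈ Finset.Ico n M, (b m : ℂ) * (Ψ (m + q) - Ψ m - d m * H m)‖ ≤
      L * ∑ m ∈ Finset.Ico n M, |a m| * d m := by
    rw [Finset.mul_sum]
    refine (norm_sum_le _ _).trans (Finset.sum_le_sum fun m _ => ?_)
    rw [norm_mul, Complex.norm_real, Real.norm_eq_abs]
    calc |b m| * _ ≤ |b m| * (L * d m ^ 2) := mul_le_mul_of_nonneg_left (hH m) (abs_nonneg _)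
      _ = _ := by
          have := hd m
          simp only [hb]
          rw [abs_div, abs_of_pos this]
          field_simp
  refine (norm_sub_le _ _).trans (add_le_add ((norm_sub_le _ _).trans ?_) s3)
  rw [mul_add]
  linarith

section primitive
variable {H : ℝ → ℂ} {B L : ℝ} (hc : Continuous H) (hper : Function.Periodic H 1)
  (hmean : ∫ x in (0 : ℝ)..1, H x = 0)
include hc

lemma norm_primitive_sub_le (hL : ∀ x y, ‖H x - H y‖ ≤ L * |x - y|) (hL0 : 0 ≤ L) {x d : ℝ}
    (hd : 0 ≤ d) :
    ‖(∫ t in (0 : ℝ)..(x + d), H t) - (∫ t in (0 : ℝ)..x, H t) - d * H x‖ ≤ L * d ^ 2 := by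
  rw [intervalIntegral.integral_interval_sub_left (hc.intervalIntegrable _ _)
    (hc.intervalIntegrable _ _)]
  have e : (d : ℂ) * H x = ∫ _ in x..(x + d), H x := by
    rw [intervalIntegral.integral_const, add_sub_cancel_left, Complex.real_smul]
  rw [e, ← intervalIntegral.integral_sub (hc.intervalIntegrable _ _) (by simp)]
  refine (intervalIntegral.norm_integral_le_of_norm_le_const (C := L * d) fun t ht => ?_).trans ?_
  · rw [uIoc_of_le (by linarith)] at ht
    refine (hL t x).trans (mul_le_mul_of_nonneg_left ?_ hL0)
    rw [abs_of_nonneg (by linarith [ht.1])]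
    linarith [ht.2]
  · rw [add_sub_cancel_left, abs_of_nonneg hd]
    exact le_of_eq (by ring)

include hper hmean

lemma primitive_periodic : Function.Periodic (fun x => ∫ t in (0 : ℝ)..x, H t) 1 := by
  intro x
  change ∫ t in (0 : ℝ)..(x + 1), H t = ∫ t in (0 : ℝ)..x, H t
  have h1 := hper.intervalIntegral_add_eq x 0
  rw [zero_add, hmean] at h1
  rw [← intervalIntegral.integral_add_adjacent_intervals (hc.intervalIntegrable 0 x)
    (hc.intervalIntegrable x (x + 1)), h1, add_zero]

lemma norm_primitive_le (hB : ∀ x, ‖H x‖ ≤ B) (x : ℝ) : ‖∫ t in (0 : ℝ)..x, H t‖ ≤ B := by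
  have hp := primitive_periodic hc hper hmean
  have e : ∫ t in (0 : ℝ)..x, H t = ∫ t in (0 : ℝ)..(Int.fract x), H t := by
    have := hp.sub_int_mul_eq (x := x) ⌊x⌋
    simp only [mul_one, Int.self_sub_floor] at this
    exact this.symm
  rw [e]
  refine (intervalIntegral.norm_integral_le_of_norm_le_const (C := B) fun t _ => hB t).trans ?_
  rw [sub_zero, abs_of_nonneg (Int.fract_nonneg x)]
  have hB0 : 0 ≤ B := (norm_nonneg _).trans (hB 0)
  exact mul_le_of_le_one_right hB0 (Int.fract_lt_one x).le

/-- Over q steps rm changes by the integer p, so modulo 1 the argument advances only by d. The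
primitive of H is itself periodic because H has mean zero, so it cannot distinguish the two. -/
lemma norm_sum_periodic_le (hB : ∀ x, ‖H x‖ ≤ B) (hL : ∀ x y, ‖H x - H y‖ ≤ L * |x - y|)
    (hL0 : 0 ≤ L) (a : ℕ → ℝ) {q : ℕ} (hq : 0 < q) {r s : ℝ} (hs : 0 < s) {p : ℤ} (hr : r * q = p)
    {d : ℕ → ℝ} (hd : ∀ m : ℕ, d m = s * (√((m + q : ℕ) : ℝ) - √(m : ℝ))) {n M : ℕ}
    (hnM : n ≤ M) :
    ‖∑ m ∈ Finset.Ico n M, (a m : ℂ) * H (r * m + s * √(m : ℝ))‖ ≤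
      B * (∑ m ∈ Finset.Ico n M, |a (m + q) / d (m + q) - a m / d m| +
        ∑ i ∈ Finset.range q, (|a (M + i) / d (M + i)| + |a (n + i) / d (n + i)|)) +
      L * ∑ m ∈ Finset.Ico n M, |a m| * d m := by
  have hd0 : ∀ m, 0 < d m := fun m => by
    rw [hd]
    have : √(m : ℝ) < √((m + q : ℕ) : ℝ) :=
      Real.sqrt_lt_sqrt (Nat.cast_nonneg m) (by exact_mod_cast Nat.lt_add_of_pos_right hq)
    exact mul_pos hs (by linarith)
  refine norm_sum_mul_le_of_primitive (q := q)
    (Ψ := fun m => ∫ t in (0 : ℝ)..(r * m + s * √(m : ℝ)), H t) hnM hd0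
    (fun m => norm_primitive_le hc hper hmean hB _) fun m => ?_
  have e : ∫ t in (0 : ℝ)..(r * (m + q : ℕ) + s * √((m + q : ℕ) : ℝ)), H t =
      ∫ t in (0 : ℝ)..(r * m + s * √(m : ℝ) + d m), H t := by
    have h := ((primitive_periodic hc hper hmean).int_mul p) (r * m + s * √(m : ℝ) + d m)
    simp only [mul_one] at h
    rw [← h, ← hr, hd]
    congr 1
    push_cast
    ring
  rw [e]
  exact norm_primitive_sub_le hc hL hL0 (hd0 m).le

end primitive

/-- The mass of a packet. -/
noncomputable def packetMass (lam₀ : ℚ) (A : ℝ) : ℝ :=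
  ∑ m ∈ Finset.range ⌈8 / beta lam₀ * A⌉₊, bump (beta lam₀ * m / A) / m

/-- The weights are O(1/A) and d is of order 1/√A on the support of the cut-off. Both the variation
of a/d and the product ad are O(1/(A√A)) per term, over O(A) terms. -/
lemma exists_norm_sum_bump_le {μ : ℝ} {lam₀ : ℚ} (hp : Params μ lam₀) {H : ℝ → ℂ} {B L : ℝ}
    (hc : Continuous H) (hper : Function.Periodic H 1) (hmean : ∫ x in (0 : ℝ)..1, H x = 0)
    (hB : ∀ x, ‖H x‖ ≤ B) (hL : ∀ x y, ‖H x - H y‖ ≤ L * |x - y|) (hL0 : 0 ≤ L) :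
    ∃ C > 0, ∀ A : ℝ, 1 ≤ A → lam₀.den ≤ A → ‖∑ m ∈ Finset.range ⌈8 / beta lam₀ * A⌉₊,
      ((bump (beta lam₀ * m / A) / m : ℝ) : ℂ) * H (front lam₀ m)‖ ≤ C / √A := by
  obtain ⟨Lb, hLb, hlip⟩ := exists_abs_bump_div_sub_le
  have hβ := hp.beta_pos
  have hβ1 := hp.beta_lt
  have hB0 : 0 ≤ B := (norm_nonneg _).trans (hB 0)
  set β := beta lam₀ with hβdef
  set q := lam₀.den with hq
  have hq0 : 0 < q := lam₀.den_pos
  have hq0' : (0 : ℝ) < q := by exact_mod_cast hq0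
  set D : ℝ := 8 / β + 1 with hD
  have hD0 : 0 < D := by positivity
  set E : ℝ := √(D + 2 * q) with hE
  set C₁ : ℝ := D * ((Lb * q * (2 * E) + 2 * q) / (2 * q)) with hC₁
  set C₂ : ℝ := D * (2 * q) with hC₂
  refine ⟨B * C₁ + L * C₂ + 1, by positivity, fun A hA hqA => ?_⟩
  have hA0 : 0 < A := by linarith
  have hsA := Real.sqrt_pos.2 hA0
  have hssA := Real.mul_self_sqrt hA0.le
  set M : ℕ := ⌈8 / β * A⌉₊ with hM
  have hMa : 8 / β * A ≤ M := Nat.le_ceil _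
  have hMb : (M : ℝ) ≤ D * A := by
    have := Nat.ceil_lt_add_one (a := 8 / β * A) (by positivity)
    rw [hD]
    linarith
  set a : ℕ → ℝ := fun m => bump (β * m / A) / m with ha
  set d : ℕ → ℝ := fun m => 2 * (√((m + q : ℕ) : ℝ) - √(m : ℝ)) with hd
  set r : ℕ → ℝ := fun m => √((m + q : ℕ) : ℝ) + √(m : ℝ) with hr
  have hsq : ∀ m : ℕ, √(m : ℝ) * √(m : ℝ) = m := fun m => Real.mul_self_sqrt m.cast_nonneg
  have hsn : ∀ m : ℕ, 0 ≤ √(m : ℝ) := fun m => Real.sqrt_nonneg _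
  have hsp : ∀ m : ℕ, 0 < m → 0 < √(m : ℝ) := fun m hm => Real.sqrt_pos.2 (by exact_mod_cast hm)
  have hr0 : ∀ m, 0 < r m := fun m => by
    have := hsp (m + q) (by omega)
    have := hsn m
    simp only [hr]
    linarith
  -- Rationalising d turns division by d into multiplication by r, whose variation is easy to
  -- control.
  have hdr : ∀ m, d m = 2 * q / r m := fun m => by
    rw [eq_div_iff (hr0 m).ne']
    simp only [hd, hr]
    have h1 := hsq (m + q)
    have h2 := hsq m
    push_cast at h1 ⊢
    nlinarith
  have hd0 : ∀ m, 0 < d m := fun m => by rw [hdr]; exact div_pos (by positivity) (hr0 m)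
  have haκ : ∀ m, a m = β / A * (bump (β * m / A) / (β * m / A)) := fun m => by
    simp only [ha]
    rcases eq_or_ne (m : ℝ) 0 with h | h
    · simp [h]
    · field_simp
  have haz : ∀ m : ℕ, β * m / A ∉ Ioo (1 : ℝ) 2 → a m = 0 := fun m h => by
    simp only [ha]
    rw [bump_eq_zero h, zero_div]
  have ham : ∀ m : ℕ, a m ≠ 0 → A ≤ m := fun m h => by
    by_contra! hlt
    refine h (haz m fun h' => ?_)
    have h1 := h'.1
    rw [lt_div_iff₀ hA0] at h1
    nlinarith [m.cast_nonneg (α := ℝ)]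
  have hab : ∀ m, |a m| ≤ 1 / A := fun m => by
    by_cases h : a m = 0
    · rw [h, abs_zero]
      positivity
    · have h1 := ham m h
      simp only [ha]
      rw [abs_of_nonneg (div_nonneg bump.nonneg m.cast_nonneg)]
      exact div_le_div₀ zero_le_one bump.le_one hA0 h1
  have hadiff : ∀ m, |a (m + q) - a m| ≤ Lb * q / A ^ 2 := fun m => by
    rw [haκ, haκ, ← mul_sub, abs_mul, abs_of_pos (by positivity)]
    calc _ ≤ β / A * (Lb * |β * ((m + q : ℕ) : ℝ) / A - β * m / A|) := by
          gcongr
          exact hlip _ _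
      _ = β * β * (Lb * q / A ^ 2) := by
          rw [← sub_div, ← mul_sub, abs_of_nonneg (by push_cast; simp; positivity)]
          push_cast
          field_simp
          ring
      _ ≤ 1 * (Lb * q / A ^ 2) := by
          gcongr
          nlinarith
      _ = _ := one_mul _
  have hrd : ∀ m : ℕ, A ≤ m → |r (m + q) - r m| ≤ 2 * q / √A := fun m hm => by
    have hsm : √A ≤ √(m : ℝ) := Real.sqrt_le_sqrt hm
    have h1 := hsq (m + q + q)
    have h2 := hsq m
    have h3 : √(m : ℝ) ≤ √((m + q + q : ℕ) : ℝ) := Real.sqrt_le_sqrt (by push_cast; linarith)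
    have e : r (m + q) - r m = √((m + q + q : ℕ) : ℝ) - √(m : ℝ) := by simp only [hr]; ring
    rw [e, abs_of_nonneg (by linarith), le_div_iff₀ hsA]
    push_cast at h1 h3 ⊢
    nlinarith
  have hrb : ∀ m, m < M → r (m + q) ≤ 2 * E * √A := fun m hm => by
    have hm' : (m : ℝ) ≤ M := by exact_mod_cast hm.le
    have h1 : √((m + q + q : ℕ) : ℝ) ≤ E * √A := by
      rw [hE, ← Real.sqrt_mul (by positivity)]
      refine Real.sqrt_le_sqrt ?_
      push_cast
      nlinarith
    have h2 : √((m + q : ℕ) : ℝ) ≤ √((m + q + q : ℕ) : ℝ) :=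
      Real.sqrt_le_sqrt (by push_cast; linarith)
    simp only [hr]
    linarith
  have key := norm_sum_periodic_le hc hper hmean hB hL hL0 a hq0 (r := lam₀) (s := 2) two_pos
    (p := lam₀.num) (by
      have := lam₀.mul_den_eq_num
      exact_mod_cast this) (d := d) (fun m => rfl) (Nat.zero_le M)
  have t1 : ∀ m ∈ Finset.Ico 0 M, |a (m + q) / d (m + q) - a m / d m| ≤
      (Lb * q * (2 * E) + 2 * q) / (2 * q) / (A * √A) := by
    intro m hm
    have hmM := (Finset.mem_Ico.1 hm).2
    have e : a (m + q) / d (m + q) - a m / d m =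
        ((a (m + q) - a m) * r (m + q) + a m * (r (m + q) - r m)) / (2 * q) := by
      rw [hdr, hdr]
      have := hr0 m
      have := hr0 (m + q)
      field_simp
      ring
    rw [e, abs_div, abs_of_pos (by positivity : (0 : ℝ) < 2 * q), div_div,
      mul_comm (2 * (q : ℝ)) (A * √A), ← div_div _ (A * √A)]
    refine div_le_div_of_nonneg_right ?_ (by positivity)
    refine (abs_add_le _ _).trans ?_
    rw [abs_mul, abs_mul, add_div]
    refine add_le_add ?_ ?_
    · rw [abs_of_pos (hr0 _)]
      calc _ ≤ Lb * q / A ^ 2 * (2 * E * √A) :=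
            mul_le_mul (hadiff m) (hrb m hmM) (hr0 _).le (by positivity)
        _ = _ := by
            have : A ^ 2 = A * (√A * √A) := by rw [hssA]; ring
            rw [this]
            field_simp
    · by_cases h : a m = 0
      · rw [h, abs_zero, zero_mul]
        positivity
      · calc _ ≤ 1 / A * (2 * q / √A) :=
              mul_le_mul (hab m) (hrd m (ham m h)) (abs_nonneg _) (by positivity)
          _ = _ := by field_simp
  -- Both ends lie outside the support of the cut-off: at the start βm < A since β < 1/2 and q ≤ A,
  -- at the end βm ≥ 8A.
  have t2 : ∑ i ∈ Finset.range q, (|a (M + i) / d (M + i)| + |a (0 + i) / d (0 + i)|) = 0 := by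
    refine Finset.sum_eq_zero fun i hi => ?_
    have hi' : (i : ℝ) ≤ q := by exact_mod_cast (Finset.mem_range.1 hi).le
    have h1 : a (M + i) = 0 := haz _ fun h => by
      have h2 := h.2
      rw [div_lt_iff₀ hA0] at h2
      push_cast at h2
      rw [div_mul_eq_mul_div, div_le_iff₀ hβ] at hMa
      nlinarith [i.cast_nonneg (α := ℝ)]
    have h2 : a (0 + i) = 0 := haz _ fun h => by
      have h2 := h.1
      rw [lt_div_iff₀ hA0, zero_add] at h2
      nlinarith [i.cast_nonneg (α := ℝ)]
    rw [h1, h2]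
    simp
  have t3 : ∀ m ∈ Finset.Ico 0 M, |a m| * d m ≤ 2 * q / (A * √A) := by
    intro m _
    by_cases h : a m = 0
    · rw [h, abs_zero, zero_mul]
      positivity
    · have h1 := ham m h
      have h2 : √A ≤ r m := by
        have : √A ≤ √(m : ℝ) := Real.sqrt_le_sqrt h1
        simp only [hr]
        linarith [hsn (m + q)]
      rw [hdr]
      calc _ ≤ 1 / A * (2 * q / √A) := by
            refine mul_le_mul (hab m) ?_ (by have := hr0 m; positivity) (by positivity)
            gcongr
        _ = _ := by field_simp
  have hsum : ∀ (F : ℕ → ℝ) (c : ℝ), 0 ≤ c → (∀ m ∈ Finset.Ico 0 M, F m ≤ c / (A * √A)) →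
      ∑ m ∈ Finset.Ico 0 M, F m ≤ D * c / √A := fun F c hc0 hF => by
    calc _ ≤ ∑ m ∈ Finset.Ico 0 M, c / (A * √A) := Finset.sum_le_sum hF
      _ = M * (c / (A * √A)) := by
          rw [Finset.sum_const, Nat.card_Ico, nsmul_eq_mul, Nat.sub_zero]
      _ ≤ D * A * (c / (A * √A)) := by gcongr
      _ = _ := by field_simp
  rw [Finset.range_eq_Ico]
  refine key.trans ?_
  rw [t2, add_zero]
  have k1 := mul_le_mul_of_nonneg_left (hsum _ _ (by positivity) t1) hB0
  have k2 := mul_le_mul_of_nonneg_left (hsum _ _ (by positivity) t3) hL0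
  have e : (B * C₁ + L * C₂ + 1) / √A = B * (C₁ / √A) + L * (C₂ / √A) + 1 / √A := by ring
  rw [e]
  have : 0 ≤ 1 / √A := by positivity
  linarith

/-- The cut-off equals 1 for βm/A in [5/4, 7/4]. This interval contains at least A/(4β) integers,
each with weight at least 4β/(7A). -/
lemma packetMass_bounds {μ : ℝ} {lam₀ : ℚ} (hp : Params μ lam₀) {A : ℝ} (hA : 4 ≤ A) :
    1 / 7 ≤ packetMass lam₀ A := by
  have hβ := hp.beta_pos
  have hβ1 := hp.beta_lt
  set β := beta lam₀ with hβdef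
  have hA0 : 0 < A := by linarith
  rw [packetMass, ← hβdef]
  set M : ℕ := ⌈8 / β * A⌉₊ with hM
  set n₁ : ℕ := ⌈5 / 4 * A / β⌉₊ with hn₁
  set n₂ : ℕ := ⌊7 / 4 * A / β⌋₊ with hn₂
  have h1 : (5 / 4 * A / β) ≤ n₁ := Nat.le_ceil _
  have h1' : (n₁ : ℝ) < 5 / 4 * A / β + 1 := Nat.ceil_lt_add_one (by positivity)
  have h2 : (n₂ : ℝ) ≤ 7 / 4 * A / β := Nat.floor_le (by positivity)
  have h2' : 7 / 4 * A / β < n₂ + 1 := Nat.lt_floor_add_one _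
  have hAβ : 8 ≤ A / β := by
    rw [le_div_iff₀ hβ]
    linarith
  have hsub : Finset.Ico n₁ (n₂ + 1) ⊆ Finset.range M := by
    intro m hm
    rw [Finset.mem_Ico] at hm
    rw [Finset.mem_range]
    have h3 : (m : ℝ) ≤ n₂ := by exact_mod_cast Nat.lt_succ_iff.1 hm.2
    have h4 : 7 / 4 * A / β < 8 / β * A := by
      rw [show 8 / β * A = 8 * A / β by ring]
      exact div_lt_div_of_pos_right (by linarith) hβ
    have h5 : (m : ℝ) < M := (h3.trans h2).trans_lt (h4.trans_le (Nat.le_ceil _))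
    exact_mod_cast h5
  calc (1 : ℝ) / 7 ≤ (A / β / 4) * (1 / (7 / 4 * A / β)) := by
        rw [div_div, div_mul_div_comm, div_le_div_iff₀ (by norm_num) (by positivity)]
        field_simp
        norm_num
    _ ≤ ∑ m ∈ Finset.Ico n₁ (n₂ + 1), 1 / (7 / 4 * A / β) := by
        rw [Finset.sum_const, Nat.card_Ico, nsmul_eq_mul]
        gcongr
        have h6 : ((n₂ + 1 - n₁ : ℕ) : ℝ) ≥ (n₂ : ℝ) + 1 - n₁ := by
          have h7 : n₂ + 1 ≤ (n₂ + 1 - n₁) + n₁ := by omega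
          have h8 : (n₂ : ℝ) + 1 ≤ ((n₂ + 1 - n₁ : ℕ) : ℝ) + n₁ := by exact_mod_cast h7
          linarith
        have e1 : 5 / 4 * A / β = 5 / 4 * (A / β) := by ring
        have e2 : 7 / 4 * A / β = 7 / 4 * (A / β) := by ring
        rw [e1] at h1'
        rw [e2] at h2'
        linarith
    _ ≤ ∑ m ∈ Finset.Ico n₁ (n₂ + 1), bump (β * m / A) / m := by
        refine Finset.sum_le_sum fun m hm => ?_
        rw [Finset.mem_Ico] at hm
        have h3 : (m : ℝ) ≤ n₂ := by exact_mod_cast Nat.lt_succ_iff.1 hm.2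
        have h4 : (n₁ : ℝ) ≤ m := by exact_mod_cast hm.1
        have h5 : 0 < (m : ℝ) := lt_of_lt_of_le (by positivity) (h1.trans h4)
        rw [bump_eq_one]
        · gcongr
          exact h3.trans h2
        · have h6 := h1.trans h4
          have h7 := h3.trans h2
          rw [div_le_iff₀ hβ] at h6
          rw [le_div_iff₀ hβ] at h7
          rw [mem_Icc, le_div_iff₀ hA0, div_le_iff₀ hA0]
          constructor <;> linarith
    _ ≤ _ := Finset.sum_le_sum_of_subset_of_nonneg hsub fun m _ _ =>
        div_nonneg bump.nonneg m.cast_nonneg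

/-- Logarithmic averages along square roots are bounded by the mean. -/
lemma exists_norm_sum_div_le {H : ℝ → ℂ} {B L s : ℝ} (hs : 0 < s)
    (hc : Continuous H) (hper : Function.Periodic H 1) (hmean : ∫ x in (0 : ℝ)..1, H x = 0)
    (hB : ∀ x, ‖H x‖ ≤ B) (hL : ∀ x y, ‖H x - H y‖ ≤ L * |x - y|) (hL0 : 0 ≤ L) :
    ∃ C, ∀ n M : ℕ, 1 ≤ n → n ≤ M →
      ‖∑ m ∈ Finset.Ico n M, ((1 / m : ℝ) : ℂ) * H (s * √(m : ℝ))‖ ≤ C := by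
  have hB0 : 0 ≤ B := (norm_nonneg _).trans (hB 0)
  refine ⟨B * (9 / s + (3 / s + 3 / s)) + L * (2 * s), fun n M hn hnM => ?_⟩
  set d : ℕ → ℝ := fun m => s * (√((m + 1 : ℕ) : ℝ) - √(m : ℝ)) with hd
  have hsq : ∀ m : ℕ, √(m : ℝ) * √(m : ℝ) = m := fun m => Real.mul_self_sqrt m.cast_nonneg
  have hsn : ∀ m : ℕ, 0 ≤ √(m : ℝ) := fun m => Real.sqrt_nonneg _
  have hs1 : ∀ m : ℕ, 0 < m → 1 ≤ √(m : ℝ) := fun m hm =>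
    Real.one_le_sqrt.2 (by exact_mod_cast hm)
  have hlt : ∀ m : ℕ, √(m : ℝ) < √((m + 1 : ℕ) : ℝ) := fun m =>
    Real.sqrt_lt_sqrt m.cast_nonneg (by push_cast; linarith)
  set b : ℕ → ℝ := fun m => 1 / m / d m with hb
  -- In rationalised form 1/(m d) is visibly decreasing, so its variation telescopes; its value at m
  -- = 1 is at most 3/s.
  have hbe : ∀ m : ℕ, 0 < m → b m = 1 / s * (√((m + 1 : ℕ) : ℝ) / m + 1 / √(m : ℝ)) := by
    intro m hm
    have h1 := hsq m
    have h2 := hsq (m + 1)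
    have h3 := hlt m
    have h4 := hs1 m hm
    have h5 : (0 : ℝ) < m := by exact_mod_cast hm
    have h6 : √((m + 1 : ℕ) : ℝ) - √(m : ℝ) ≠ 0 := by linarith
    have e1 : 1 / √(m : ℝ) = √(m : ℝ) / m := by
      rw [div_eq_div_iff (by linarith) (by linarith), h1, one_mul]
    simp only [hb, hd]
    rw [e1, ← add_div, div_div, div_mul_div_comm, one_mul, div_eq_div_iff (by positivity)
      (by positivity)]
    push_cast at h2 ⊢
    linear_combination (-(s * m : ℝ)) * h2 + s * m * h1
  have hsucc : ∀ m : ℕ, 0 < m → b (m + 1) ≤ b m := by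
    intro m hm
    have h5 : (0 : ℝ) < m := by exact_mod_cast hm
    rw [hbe m hm, hbe (m + 1) (by omega)]
    have h4 := hs1 m hm
    gcongr 1 / s * (?_ + 1 / ?_)
    · rw [div_le_div_iff₀ (by positivity) h5]
      rw [← pow_le_pow_iff_left₀ (by positivity) (by positivity) two_ne_zero, mul_pow, mul_pow,
        sq √_, sq √_, hsq, hsq]
      push_cast
      nlinarith
    · exact (hlt m).le
  have hb0 : ∀ m : ℕ, 0 < m → 0 ≤ b m := fun m hm => by
    rw [hbe m hm]
    positivity
  have hb3 : ∀ m : ℕ, 1 ≤ m → b m ≤ 3 / s := fun m hm => by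
    induction m, hm using Nat.le_induction with
    | base =>
      have : √((1 + 1 : ℕ) : ℝ) ≤ 2 := by
        rw [Real.sqrt_le_left (by norm_num)]
        norm_num
      rw [hbe 1 one_pos, Nat.cast_one, Real.sqrt_one, div_one, div_one, one_div, inv_mul_eq_div]
      gcongr
      linarith
    | succ m hm ih => exact (hsucc m hm).trans ih
  have key := norm_sum_periodic_le hc hper hmean hB hL hL0 (fun m => 1 / m) one_pos (r := 0)
    hs (p := 0) (by simp) (d := d) (fun m => rfl) hnM
  simp only [zero_mul, zero_add] at key
  have t1 : ∑ m ∈ Finset.Ico n M, |b (m + 1) - b m| ≤ 9 / s := by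
    have : ∀ m ∈ Finset.Ico n M, |b (m + 1) - b m| = b m - b (m + 1) := fun m hm => by
      have := hsucc m (hn.trans (Finset.mem_Ico.1 hm).1)
      rw [abs_sub_comm, abs_of_nonneg (by linarith)]
    rw [Finset.sum_congr rfl this, sum_Ico_sub_succ b hnM]
    have h1 := hb3 n hn
    have h2 := hb0 M (by omega)
    have : 3 / s ≤ 9 / s := by gcongr; norm_num
    linarith
  have t2 : ∑ i ∈ Finset.range 1, (|b (M + i)| + |b (n + i)|) ≤ 3 / s + 3 / s := by
    rw [Finset.sum_range_one, add_zero, add_zero, abs_of_nonneg (hb0 M (by omega)),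
      abs_of_nonneg (hb0 n hn)]
    exact add_le_add (hb3 M (by omega)) (hb3 n hn)
  -- From √m√(m+1) ≤ 2m, the term d/m is at most 2s(1/√m - 1/√(m+1)), which telescopes.
  have t3 : ∑ m ∈ Finset.Ico n M, |1 / (m : ℝ)| * d m ≤ 2 * s := by
    have : ∀ m ∈ Finset.Ico n M, |1 / (m : ℝ)| * d m ≤
        2 * s * (1 / √(m : ℝ)) - 2 * s * (1 / √((m + 1 : ℕ) : ℝ)) := fun m hm => by
      have hm0 : 0 < m := hn.trans (Finset.mem_Ico.1 hm).1
      have h5 : (0 : ℝ) < m := by exact_mod_cast hm0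
      have h4 := hs1 m hm0
      have h3 := hlt m
      have h6 : √(m : ℝ) * √((m + 1 : ℕ) : ℝ) ≤ 2 * m := by
        have h7 := hsq (m + 1)
        have h8 : √((m + 1 : ℕ) : ℝ) ≤ 2 * √(m : ℝ) := by
          rw [Real.sqrt_le_left (by positivity), mul_pow, sq, sq, hsq]
          push_cast
          have : (1 : ℝ) ≤ m := by exact_mod_cast hm0
          linarith
        nlinarith [hsq m]
      rw [abs_of_pos (by positivity), ← mul_sub, div_sub_div _ _ (by linarith) (by linarith)]
      simp only [hd]
      rw [one_mul, mul_one, mul_div_assoc', le_div_iff₀ (by nlinarith), one_div,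
        inv_mul_eq_div, div_mul_eq_mul_div, div_le_iff₀ h5]
      have h9 : 0 ≤ s * (√((m + 1 : ℕ) : ℝ) - √(m : ℝ)) := mul_nonneg hs.le (by linarith)
      nlinarith [mul_le_mul_of_nonneg_left h6 h9]
    refine (Finset.sum_le_sum this).trans ?_
    rw [sum_Ico_sub_succ (fun m : ℕ => 2 * s * (1 / √(m : ℝ))) hnM]
    have h1 : 1 / √(n : ℝ) ≤ 1 := by
      rw [div_le_one (by linarith [hs1 n hn])]
      exact hs1 n hn
    have h2 : 0 ≤ 2 * s * (1 / √(M : ℝ)) := by positivity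
    nlinarith
  refine key.trans ?_
  gcongr

end GodunovTV

namespace GodunovTV

/-! ### Fourier coefficients of the moment -/

/-- The character `e^{2πinx}`. -/
noncomputable def osc (n : ℤ) (x : ℝ) : ℂ := Complex.exp ((2 * Real.pi * n * x : ℝ) * Complex.I)

lemma norm_osc (n : ℤ) (x : ℝ) : ‖osc n x‖ = 1 := Complex.norm_exp_ofReal_mul_I _

@[fun_prop]
lemma continuous_osc (n : ℤ) : Continuous (osc n) := by
  unfold osc
  fun_prop

lemma osc_add (n : ℤ) (x y : ℝ) : osc n (x + y) = osc n x * osc n y := by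
  rw [osc, osc, osc, ← Complex.exp_add]
  congr 1
  push_cast
  ring

lemma osc_zero_right (n : ℤ) : osc n 0 = 1 := by simp [osc]

lemma osc_intCast (n k : ℤ) : osc n k = 1 := by
  rw [osc, Complex.exp_eq_one_iff]
  refine ⟨n * k, ?_⟩
  push_cast
  ring

lemma osc_periodic (n : ℤ) : Function.Periodic (osc n) 1 := fun x => by
  have := osc_intCast n 1
  rw [Int.cast_one] at this
  rw [osc_add, this, mul_one]

lemma osc_neg_left (n : ℤ) (x : ℝ) : osc (-n) x = osc n (-x) := by
  rw [osc, osc]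
  congr 1
  push_cast
  ring

lemma osc_mul_left (n k : ℤ) (x : ℝ) : osc (n * k) x = osc n (k * x) := by
  rw [osc, osc]
  congr 1
  push_cast
  ring

lemma norm_osc_sub_le (n : ℤ) (x y : ℝ) :
    ‖osc n x - osc n y‖ ≤ 2 * Real.pi * |(n : ℝ)| * |x - y| := by
  refine (norm_cexp_sub_cexp_le _ _).trans (le_of_eq ?_)
  rw [← mul_sub, abs_mul, abs_mul, abs_of_pos Real.two_pi_pos]

lemma hasDerivAt_osc (n : ℤ) (x : ℝ) :
    HasDerivAt (osc n) (2 * Real.pi * n * Complex.I * osc n x) x := by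
  have h1 : HasDerivAt (fun x : ℝ => ((2 * Real.pi * n * x : ℝ) : ℂ)) ((2 * Real.pi * n : ℝ) : ℂ)
      x := by
    have := ((hasDerivAt_id x).const_mul (2 * Real.pi * n)).ofReal_comp
    simpa using this
  convert! (h1.mul_const Complex.I).cexp using 1
  rw [osc]
  push_cast
  ring

lemma two_pi_I_mul_ne_zero {n : ℤ} (hn : n ≠ 0) : (2 * Real.pi * n * Complex.I : ℂ) ≠ 0 := by
  have h : (n : ℂ) ≠ 0 := by exact_mod_cast hn
  have hπ : (Real.pi : ℂ) ≠ 0 := by exact_mod_cast Real.pi_ne_zero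
  simp [h, hπ, Complex.I_ne_zero]

/-- The derivative of `shape`. -/
noncomputable def shapeDeriv (μ : ℝ) (lam₀ : ℚ) (g : ℝ → ℝ) (y : ℝ) : ℝ :=
  deriv g (profile μ lam₀ y) * profileDeriv μ lam₀ y

/-- The Fourier transform of `shapeDeriv` at the integers. -/
noncomputable def shapeHat (μ : ℝ) (lam₀ : ℚ) (g : ℝ → ℝ) (n : ℤ) : ℂ :=
  ∫ y : ℝ, (shapeDeriv μ lam₀ g y : ℂ) * osc n y

lemma sum_mul_sub_eq_sub (F : ℕ → ℝ) (a : ℝ) (N : ℕ) :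
    ∑ k ∈ Finset.range N, (a + k) * (F (k + 1) - F k) =
      (a + N) * F N - a * F 0 - ∑ k ∈ Finset.range N, F (k + 1) := by
  induction N with
  | zero => simp
  | succ N ih =>
    rw [Finset.sum_range_succ, Finset.sum_range_succ, ih]
    push_cast
    ring

section shape
variable {μ : ℝ} {lam₀ : ℚ} {g : ℝ → ℝ} (hp : Params μ lam₀) (hg : AdmissibleFlux μ lam₀ g)
include hp hg

lemma hasDerivAt_shape (y : ℝ) : HasDerivAt (shape μ lam₀ g) (shapeDeriv μ lam₀ g y) y :=
  (hg.differentiable _).hasDerivAt.comp y (hasDerivAt_profile hp y)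

lemma continuous_shapeDeriv : Continuous (shapeDeriv μ lam₀ g) := by
  have h1 : Continuous (profile μ lam₀) :=
    continuous_iff_continuousAt.2 fun y => (hasDerivAt_profile hp y).continuousAt
  exact (hg.continuous_deriv.comp h1).mul (continuous_profileDeriv hp)

lemma exists_shapeDeriv_eq_zero : ∃ Y ≥ 0, ∀ y, Y ≤ |y| → shapeDeriv μ lam₀ g y = 0 := by
  obtain ⟨a, b, ha, hab, hb, -, -, h⟩ := hg.exists_levels hp
  refine ⟨max |c μ lam₀ a| |c μ lam₀ b| + 1, by positivity, fun y hy => ?_⟩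
  by_contra hne
  have h1 := h (profile μ lam₀ y) (profile_pos hp y).le (left_ne_zero_of_mul hne)
  have h2 : y ≤ c μ lam₀ a := by
    rw [← c_profile hp y]
    exact c_antitone hp ha h1.1 (profile_lt hp y)
  have h3 : c μ lam₀ b ≤ y := by
    conv_rhs => rw [← c_profile hp y]
    exact c_antitone hp (profile_pos hp y) h1.2 hb
  have h4 : |y| ≤ max |c μ lam₀ a| |c μ lam₀ b| := by
    rw [abs_le]
    constructor
    · linarith [neg_abs_le (c μ lam₀ b), le_max_right |c μ lam₀ a| |c μ lam₀ b|]
    · linarith [le_abs_self (c μ lam₀ a), le_max_left |c μ lam₀ a| |c μ lam₀ b|]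
  linarith

lemma hasCompactSupport_shapeDeriv : HasCompactSupport (shapeDeriv μ lam₀ g) := by
  obtain ⟨Y, -, hY⟩ := exists_shapeDeriv_eq_zero hp hg
  refine HasCompactSupport.intro (isCompact_Icc (a := -Y) (b := Y)) fun y hy => hY y ?_
  by_contra! h
  rw [abs_lt] at h
  exact hy ⟨h.1.le, h.2.le⟩

lemma continuous_moment : Continuous (moment (shape μ lam₀ g)) := by
  obtain ⟨B, hB, -, h⟩ := exists_shape_moment_bounds hp hg
  refine LipschitzWith.continuous (K := B.toNNReal) (LipschitzWith.of_dist_le_mul fun x y => ?_)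
  rw [Real.coe_toNNReal _ hB.le]
  exact h x y

/-- Abel summation gives, for x in [0, 1], the moment at -x as (N + x)g(0) minus a sum of translates
G(k + x). Integration by parts passes to G', and the translates of the unit interval assemble to the
Fourier integral over ℝ. The constant g(0) drops out because n ≠ 0. -/
lemma integral_osc_mul_moment {n : ℤ} (hn : n ≠ 0) :
    ∫ x in (0 : ℝ)..1, osc n x * moment (shape μ lam₀ g) (-x) =
      shapeHat μ lam₀ g n / (2 * Real.pi * n * Complex.I) := by
  obtain ⟨Y, hY, -, -, -, htr, -⟩ := exists_source_bounds hp hg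
  obtain ⟨Y', hY', hz⟩ := exists_shapeDeriv_eq_zero hp hg
  set G := shape μ lam₀ g with hG
  set G' := shapeDeriv μ lam₀ g with hG'
  have hcG' : Continuous G' := continuous_shapeDeriv hp hg
  obtain ⟨N, hN⟩ := exists_nat_ge (Y + Y' + 3)
  set S : ℝ → ℝ := fun x => (N + x) * g 0 - ∑ k ∈ Finset.range (2 * N), G (-N + k + 1 + x) with hS
  set S' : ℝ → ℝ := fun x => g 0 - ∑ k ∈ Finset.range (2 * N), G' (-N + k + 1 + x) with hS'
  have hmS : ∀ x ∈ Icc (0 : ℝ) 1, moment G (-x) = S x := by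
    intro x hx
    rw [moment_eq_sum htr (n := -N) (N := 2 * N) (by push_cast; linarith [hx.2])
      (by push_cast; linarith [hx.1])]
    have := sum_mul_sub_eq_sub (fun k => G (-N + k + x)) (-N + x) (2 * N)
    simp only [hS]
    push_cast at this ⊢
    rw [htr.right (-(N : ℝ) + 2 * N + x) (by linarith [hx.1]), htr.left (-(N : ℝ) + 0 + x) (by linarith [hx.2])]
      at this
    rw [show (-(N : ℝ) + x + 2 * N) * g 0 - (-(N : ℝ) + x) * 0 = (N + x) * g 0 by ring] at this
    refine Eq.trans (Finset.sum_congr rfl fun k _ => ?_) (this.trans ?_)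
    · simp only [sub_neg_eq_add]
      ring_nf
    · congr 1
      refine Finset.sum_congr rfl fun k _ => ?_
      ring_nf
  have hdS : ∀ x, HasDerivAt S (S' x) x := by
    intro x
    have h1 : ∀ k ∈ Finset.range (2 * N), HasDerivAt (fun x => G (-N + k + 1 + x))
        (G' (-N + k + 1 + x)) x := fun k _ =>
      (hasDerivAt_shape hp hg _).comp_const_add (-N + k + 1 : ℝ) x
    have h2 := HasDerivAt.fun_sum h1
    have h3 : HasDerivAt (fun x : ℝ => (N + x) * g 0) (1 * g 0) x :=
      ((hasDerivAt_id x).const_add (N : ℝ)).mul_const _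
    rw [one_mul] at h3
    exact h3.sub h2
  have hcS' : Continuous S' := by fun_prop
  have e1 : ∫ x in (0 : ℝ)..1, osc n x * moment G (-x) =
      ∫ x in (0 : ℝ)..1, (S x : ℂ) * ((2 * Real.pi * n * Complex.I)⁻¹ *
        (2 * Real.pi * n * Complex.I * osc n x)) := by
    refine intervalIntegral.integral_congr fun x hx => ?_
    rw [uIcc_of_le zero_le_one] at hx
    rw [hmS x hx, inv_mul_cancel_left₀ (two_pi_I_mul_ne_zero hn), mul_comm]
  have e2 := intervalIntegral.integral_mul_deriv_eq_deriv_mul (a := 0) (b := 1)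
    (u := fun x => (S x : ℂ)) (u' := fun x => (S' x : ℂ))
    (v := fun x => (2 * Real.pi * n * Complex.I)⁻¹ * osc n x)
    (fun x _ => (hdS x).ofReal_comp)
    (fun x _ => (hasDerivAt_osc n x).const_mul (2 * Real.pi * n * Complex.I : ℂ)⁻¹)
    ((by fun_prop : Continuous fun x => (S' x : ℂ)).intervalIntegrable _ _)
    ((by fun_prop : Continuous fun x : ℝ => (2 * Real.pi * n * Complex.I : ℂ)⁻¹ *
      (2 * Real.pi * n * Complex.I * osc n x)).intervalIntegrable _ _)
  -- Periodicity of the moment makes the boundary terms cancel.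
  have hS01 : S 1 = S 0 := by
    rw [← hmS 1 ⟨zero_le_one, le_rfl⟩, ← hmS 0 ⟨le_rfl, zero_le_one⟩, ← moment_add_one G (-1)]
    norm_num
  have h1 : osc n 1 = 1 := by
    have := osc_intCast n 1
    rwa [Int.cast_one] at this
  rw [e1, e2, hS01, h1, osc_zero_right, sub_self, zero_sub]
  have e3 : ∫ x in (0 : ℝ)..1, (S' x : ℂ) * ((2 * Real.pi * n * Complex.I)⁻¹ * osc n x) =
      (2 * Real.pi * n * Complex.I)⁻¹ * (g 0 * ∫ x in (0 : ℝ)..1, osc n x) -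
      (2 * Real.pi * n * Complex.I)⁻¹ *
        ∑ k ∈ Finset.range (2 * N), ∫ x in (0 : ℝ)..1, (G' (-N + k + 1 + x) : ℂ) * osc n x := by
    rw [← intervalIntegral.integral_const_mul, ← intervalIntegral.integral_finsetSum,
      ← intervalIntegral.integral_const_mul, ← intervalIntegral.integral_const_mul,
      ← intervalIntegral.integral_sub]
    · refine intervalIntegral.integral_congr fun x _ => ?_
      simp only [hS']
      push_cast
      rw [← Finset.sum_mul]
      ring
    · exact (by fun_prop : Continuous fun x : ℝ => (2 * Real.pi * n * Complex.I : ℂ)⁻¹ *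
        (g 0 * osc n x)).intervalIntegrable _ _
    · exact (by fun_prop : Continuous fun x : ℝ => (2 * Real.pi * n * Complex.I : ℂ)⁻¹ *
        ∑ k ∈ Finset.range (2 * N), (G' (-N + k + 1 + x) : ℂ) * osc n x).intervalIntegrable _ _
    · intro k _
      exact (by fun_prop : Continuous fun x : ℝ =>
        (G' (-N + k + 1 + x) : ℂ) * osc n x).intervalIntegrable _ _
  have e4 : ∫ x in (0 : ℝ)..1, osc n x = 0 := by
    have := intervalIntegral.integral_eq_sub_of_hasDerivAt (a := 0) (b := 1)
      (f := fun x => (2 * Real.pi * n * Complex.I : ℂ)⁻¹ * osc n x) (f' := osc n) (fun x _ => by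
        have := (hasDerivAt_osc n x).const_mul (2 * Real.pi * n * Complex.I : ℂ)⁻¹
        rwa [inv_mul_cancel_left₀ (two_pi_I_mul_ne_zero hn)] at this)
      ((continuous_osc n).intervalIntegrable _ _)
    rw [this, h1, osc_zero_right, sub_self]
  -- Unfolding: the character has period 1, so the shifted unit intervals glue together; outside
  -- their union G' vanishes.
  have e5 : ∑ k ∈ Finset.range (2 * N), ∫ x in (0 : ℝ)..1, (G' (-N + k + 1 + x) : ℂ) * osc n x =
      shapeHat μ lam₀ g n := by
    have h2 : ∀ k : ℕ, ∫ x in (0 : ℝ)..1, (G' (-N + k + 1 + x) : ℂ) * osc n x =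
        ∫ y in (-N + k + 1 : ℝ)..(-N + (k + 1 : ℕ) + 1), (G' y : ℂ) * osc n y := by
      intro k
      have h3 := intervalIntegral.integral_comp_add_left (a := 0) (b := 1)
        (fun y => (G' y : ℂ) * osc n y) (-N + k + 1 : ℝ)
      rw [add_zero] at h3
      push_cast
      rw [show (-N + (k + 1) + 1 : ℝ) = -N + k + 1 + 1 by ring, ← h3]
      refine intervalIntegral.integral_congr fun x _ => ?_
      rw [osc_add, show (-N + k + 1 : ℝ) = ((-N + k + 1 : ℤ) : ℝ) by push_cast; ring,
        osc_intCast, one_mul]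
    rw [Finset.sum_congr rfl fun k _ => h2 k,
      intervalIntegral.sum_integral_adjacent_intervals (a := fun k : ℕ => (-N + k + 1 : ℝ))
        (fun k _ => (by fun_prop : Continuous fun y => (G' y : ℂ) * osc n y).intervalIntegrable _ _),
      intervalIntegral.integral_eq_integral_of_support_subset, shapeHat]
    intro y hy
    by_contra hc
    apply hy
    simp only
    have : Y' ≤ |y| := by
      by_contra! h
      rw [abs_lt] at h
      refine hc ⟨?_, ?_⟩ <;> push_cast <;> linarith
    rw [hz y this]
    simp
  rw [e3, e4, e5, mul_zero, mul_zero, zero_sub, neg_neg, inv_mul_eq_div]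

end shape

end GodunovTV

namespace GodunovTV

open MeasureTheory

/-! ### The sawtooth average -/

/-- The average of the sawtooth over the levels. -/
noncomputable def sawAvg (μ : ℝ) (lam₀ : ℚ) (g : ℝ → ℝ) (s : ℝ) : ℝ :=
  ∫ ξ in Ioi (0 : ℝ), deriv g ξ * Int.fract (lam₀.den * c μ lam₀ ξ + s)

lemma littlePi_eq (μ : ℝ) (lam₀ : ℚ) (g : ℝ → ℝ) (σ z : ℝ) :
    littlePi μ lam₀ g σ z =
      sawAvg μ lam₀ g (z + lam₀.den * (σ - √8) / (√2 * beta lam₀)) := by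
  simp only [littlePi, sawAvg, add_assoc]

/-- The sawtooth is discontinuous, so regularity of its average must come from the weight W; P is
only required to be bounded and measurable. -/
lemma exists_abs_integral_translate_le {W : ℝ → ℝ} {L Y : ℝ} (hc : Continuous W) (hL0 : 0 ≤ L)
    (hL : ∀ x y, |W x - W y| ≤ L * |x - y|) (hY : 0 ≤ Y) (hW : ∀ y, Y ≤ |y| → W y = 0) :
    ∃ C > 0, ∀ P : ℝ → ℝ, Measurable P → (∀ y, |P y| ≤ 1) →
      (∀ t, |∫ y, W (y - t) * P y| ≤ C) ∧
      ∀ t t', |(∫ y, W (y - t) * P y) - ∫ y, W (y - t') * P y| ≤ C * |t - t'| := by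
  have hWb : ∀ y, |W y| ≤ L * Y := by
    intro y
    rcases le_or_gt Y |y| with h | h
    · rw [hW y h, abs_zero]
      positivity
    · have h1 := hL y (if 0 ≤ y then Y else -Y)
      split_ifs at h1 with h2
      · rw [hW Y (le_abs_self Y), sub_zero] at h1
        rw [abs_lt] at h
        refine h1.trans (mul_le_mul_of_nonneg_left ?_ hL0)
        rw [abs_le]
        constructor <;> linarith
      · rw [hW (-Y) (by rw [abs_neg]; exact le_abs_self Y), sub_zero] at h1
        rw [abs_lt] at h
        push Not at h2
        refine h1.trans (mul_le_mul_of_nonneg_left ?_ hL0)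
        rw [abs_le]
        constructor <;> linarith
  have hsupp : HasCompactSupport W := by
    refine HasCompactSupport.intro (isCompact_Icc (a := -Y) (b := Y)) fun y hy => hW y ?_
    by_contra! h
    rw [abs_lt] at h
    exact hy ⟨h.1.le, h.2.le⟩
  have hint : Integrable W := hc.integrable_of_hasCompactSupport hsupp
  set B := ∫ y, |W y| with hB
  have hB0 : 0 ≤ B := integral_nonneg fun y => abs_nonneg _
  refine ⟨L * (2 * Y + 2) + 2 * B + 1, by positivity, fun P hP hP1 => ?_⟩
  have hintP : ∀ t, Integrable fun y => W (y - t) * P y := fun t =>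
    (hint.comp_sub_right t).mul_bdd hP.aestronglyMeasurable (ae_of_all _ hP1)
  have hbd : ∀ t, |∫ y, W (y - t) * P y| ≤ B := by
    intro t
    calc |∫ y, W (y - t) * P y| ≤ ∫ y, |W (y - t) * P y| := abs_integral_le_integral_abs
      _ ≤ ∫ y, |W (y - t)| := by
          refine integral_mono (hintP t).abs (hint.comp_sub_right t).abs fun y => ?_
          simp only
          rw [abs_mul]
          exact mul_le_of_le_one_right (abs_nonneg _) (hP1 y)
      _ = B := integral_sub_right_eq_self (fun y => |W y|) t
  have hLY : 0 ≤ L * (2 * Y + 2) := by positivity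
  refine ⟨fun t => by linarith [hbd t], fun t t' => ?_⟩
  rcases le_or_gt |t - t'| 1 with h | h
  · rw [← integral_sub (hintP t) (hintP t')]
    have hz : ∀ y ∉ Icc (t - (Y + 1)) (t + (Y + 1)), W (y - t) * P y - W (y - t') * P y = 0 := by
      intro y hy
      rw [abs_le] at h
      have h1 : Y + 1 < |y - t| := by
        by_contra! h2
        rw [abs_le] at h2
        exact hy ⟨by linarith, by linarith⟩
      have h2 : Y ≤ |y - t'| := by
        have := abs_sub_abs_le_abs_sub (y - t) (y - t')
        rw [sub_sub_sub_cancel_left, abs_sub_comm t'] at this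
        have h3 := abs_le.2 h
        linarith
      rw [hW _ (by linarith), hW _ h2]
      simp
    rw [← setIntegral_eq_integral_of_forall_compl_eq_zero hz]
    have := norm_setIntegral_le_of_norm_le_const (μ := volume)
      (s := Icc (t - (Y + 1)) (t + (Y + 1)))
      (f := fun y => W (y - t) * P y - W (y - t') * P y) (C := L * |t - t'|)
      (by simp) (fun y _ => by
        rw [← sub_mul, norm_mul, Real.norm_eq_abs, Real.norm_eq_abs]
        have h1 := hL (y - t) (y - t')
        rw [sub_sub_sub_cancel_left, abs_sub_comm t'] at h1
        calc _ ≤ |W (y - t) - W (y - t')| * 1 := by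
              gcongr
              exact hP1 y
          _ ≤ _ := by rwa [mul_one])
    rw [Real.norm_eq_abs, measureReal_def, Real.volume_Icc, ENNReal.toReal_ofReal (by linarith)]
      at this
    refine this.trans ?_
    have h3 := abs_nonneg (t - t')
    nlinarith
  · have h1 := abs_sub (∫ y, W (y - t) * P y) (∫ y, W (y - t') * P y)
    have h2 := hbd t
    have h3 := hbd t'
    nlinarith

section saw
variable {μ : ℝ} {lam₀ : ℚ} {g : ℝ → ℝ} (hp : Params μ lam₀) (hg : AdmissibleFlux μ lam₀ g)
include hp hg

/-- The substitution ξ = profile(y) replaces c(ξ) by y; the sign appears because the profile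
decreases. This links Π to the Fourier transform of the shape. -/
lemma sawAvg_eq (s : ℝ) : sawAvg μ lam₀ g s =
    -∫ y, shapeDeriv μ lam₀ g y * Int.fract (lam₀.den * y + s) := by
  obtain ⟨a, b, ha, hab, hb, -, -, h⟩ := hg.exists_levels hp
  have himg : profile μ lam₀ '' univ = Ioo 0 (kappa₀ μ lam₀) := by
    ext ξ
    constructor
    · rintro ⟨y, -, rfl⟩
      exact ⟨profile_pos hp y, profile_lt hp y⟩
    · rintro ⟨h1, h2⟩
      exact ⟨c μ lam₀ ξ, mem_univ _, profile_c hp h1 h2⟩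
  rw [sawAvg, setIntegral_eq_of_subset_of_forall_sdiff_eq_zero measurableSet_Ioi
    (Ioo_subset_Ioi_self : Ioo 0 (kappa₀ μ lam₀) ⊆ Ioi 0), ← himg,
    integral_image_eq_integral_abs_deriv_smul MeasurableSet.univ
      (fun y _ => (hasDerivAt_profile hp y).hasDerivWithinAt) (profile_strictAnti hp).injective.injOn,
    setIntegral_univ, ← integral_neg]
  · refine integral_congr_ae (ae_of_all _ fun y => ?_)
    simp only [smul_eq_mul]
    rw [c_profile hp, abs_of_neg (profileDeriv_neg hp y), shapeDeriv]
    ring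
  · intro ξ hξ
    have h1 : kappa₀ μ lam₀ ≤ ξ := by
      by_contra! h2
      exact hξ.2 ⟨hξ.1, h2⟩
    have h2 : deriv g ξ = 0 := by
      by_contra hne
      linarith [(h ξ (le_of_lt hξ.1) hne).2]
    rw [h2, zero_mul]

lemma exists_shapeDeriv_lipschitz : ∃ L ≥ 0, ∀ x y,
    |shapeDeriv μ lam₀ g x - shapeDeriv μ lam₀ g y| ≤ L * |x - y| := by
  have hk := hp.kappa₀_pos
  have hc := c₀_pos hp
  have h1 : ∀ y, 1 + c₀ μ lam₀ * Real.exp (-kappa₀ μ lam₀ * y) ≠ 0 := fun y =>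
    (one_add_pos hp y).ne'
  have h2 : ∀ y, 1 + c₀ μ lam₀ * Real.exp (-kappa₀ μ lam₀ * (y - 1)) ≠ 0 := fun y => h1 (y - 1)
  have hprof : ContDiff ℝ ∞ (profile μ lam₀) := by
    unfold profile
    fun_prop (disch := assumption)
  have hG : ContDiff ℝ ∞ (shape μ lam₀ g) := hg.1.comp hprof
  have hd : shapeDeriv μ lam₀ g = deriv (shape μ lam₀ g) :=
    funext fun y => (hasDerivAt_shape hp hg y).deriv.symm
  have hG' : ContDiff ℝ ∞ (shapeDeriv μ lam₀ g) := by
    rw [hd]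
    exact (contDiff_infty_iff_deriv.1 hG).2
  obtain ⟨C, hC⟩ := ContDiff.lipschitzWith_of_hasCompactSupport
    (hasCompactSupport_shapeDeriv hp hg) hG' (by simp)
  exact ⟨C, C.coe_nonneg, fun x y => hC.dist_le_mul x y⟩

omit hp hg in
lemma sawAvg_periodic : Function.Periodic (sawAvg μ lam₀ g) 1 := fun s => by
  simp only [sawAvg, ← add_assoc, Int.fract_add_one]

lemma exists_sawAvg_bounds : ∃ C > 0, (∀ s, |sawAvg μ lam₀ g s| ≤ C) ∧
    ∀ s s', |sawAvg μ lam₀ g s - sawAvg μ lam₀ g s'| ≤ C * |s - s'| := by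
  obtain ⟨L, hL0, hL⟩ := exists_shapeDeriv_lipschitz hp hg
  obtain ⟨Y, hY, hz⟩ := exists_shapeDeriv_eq_zero hp hg
  obtain ⟨C, hC, h⟩ := exists_abs_integral_translate_le (continuous_shapeDeriv hp hg) hL0 hL hY hz
  obtain ⟨h1, h2⟩ := h (fun y => Int.fract (lam₀.den * y))
    (measurable_fract.comp (measurable_const.mul measurable_id))
    (fun y => by
      rw [abs_of_nonneg (Int.fract_nonneg _)]
      exact (Int.fract_lt_one _).le)
  have hq : (1 : ℝ) ≤ lam₀.den := by exact_mod_cast lam₀.den_pos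
  have e : ∀ s, sawAvg μ lam₀ g s =
      -∫ y, shapeDeriv μ lam₀ g (y - s / lam₀.den) * Int.fract (lam₀.den * y) := by
    intro s
    rw [sawAvg_eq hp hg, ← integral_sub_right_eq_self _ (s / lam₀.den)]
    congr 1
    refine integral_congr_ae (ae_of_all _ fun y => ?_)
    simp only
    congr 2
    field_simp
    ring
  refine ⟨C, hC, fun s => ?_, fun s s' => ?_⟩
  · rw [e, abs_neg]
    exact h1 _
  · rw [e, e, neg_sub_neg, abs_sub_comm]
    refine (h2 _ _).trans (mul_le_mul_of_nonneg_left ?_ hC.le)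
    rw [← sub_div, abs_div, abs_of_pos (by linarith : (0 : ℝ) < lam₀.den)]
    exact div_le_self (abs_nonneg _) hq

lemma continuous_sawAvg : Continuous (sawAvg μ lam₀ g) := by
  obtain ⟨C, hC, -, h⟩ := exists_sawAvg_bounds hp hg
  refine LipschitzWith.continuous (K := C.toNNReal) (LipschitzWith.of_dist_le_mul fun x y => ?_)
  rw [Real.coe_toNNReal _ hC.le]
  exact h x y

omit hp hg in
-- Periodicity removes the shift t at the cost of a phase; on [0, 1) the sawtooth is s, and one
-- integration by parts finishes.
lemma integral_fract_mul_osc {k : ℤ} (hk : k ≠ 0) (t : ℝ) :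
    ∫ s in (0 : ℝ)..1, ((Int.fract (t + s) : ℝ) : ℂ) * osc (-k) s =
      osc k t * (Complex.I / (2 * Real.pi * k)) := by
  have hk' : (k : ℂ) ≠ 0 := by exact_mod_cast hk
  have hπ : (Real.pi : ℂ) ≠ 0 := by exact_mod_cast Real.pi_ne_zero
  have hper : Function.Periodic (fun s : ℝ => ((Int.fract s : ℝ) : ℂ) * osc (-k) s) 1 := fun s => by
    simp only [Int.fract_add_one, osc_periodic (-k) s]
  have e1 : ∫ s in (0 : ℝ)..1, ((Int.fract (t + s) : ℝ) : ℂ) * osc (-k) s =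
      osc k t * ∫ s in (0 : ℝ)..1, ((Int.fract (t + s) : ℝ) : ℂ) * osc (-k) (t + s) := by
    rw [← intervalIntegral.integral_const_mul]
    refine intervalIntegral.integral_congr fun s _ => ?_
    have : osc k t * osc (-k) t = 1 := by
      rw [osc_neg_left, ← osc_add, add_neg_cancel, osc_zero_right]
    rw [osc_add]
    linear_combination (-((Int.fract (t + s) : ℝ) : ℂ) * osc (-k) s) * this
  have e2 : ∫ s in (0 : ℝ)..1, ((Int.fract (t + s) : ℝ) : ℂ) * osc (-k) (t + s) =
      ∫ s in (0 : ℝ)..1, ((Int.fract s : ℝ) : ℂ) * osc (-k) s := by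
    have h1 := intervalIntegral.integral_comp_add_left (a := 0) (b := 1)
      (fun s : ℝ => ((Int.fract s : ℝ) : ℂ) * osc (-k) s) t
    have h2 := hper.intervalIntegral_add_eq t 0
    rw [zero_add] at h2
    rw [h1, add_zero, h2]
  have e3 : ∫ s in (0 : ℝ)..1, ((Int.fract s : ℝ) : ℂ) * osc (-k) s =
      ∫ s in (0 : ℝ)..1, (s : ℂ) * osc (-k) s := by
    rw [intervalIntegral.integral_of_le zero_le_one, intervalIntegral.integral_of_le zero_le_one,
      integral_Ioc_eq_integral_Ioo, integral_Ioc_eq_integral_Ioo]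
    refine setIntegral_congr_fun measurableSet_Ioo fun s hs => ?_
    rw [Int.fract_eq_self.2 ⟨hs.1.le, hs.2⟩]
  set w : ℂ := 2 * Real.pi * ((-k : ℤ) : ℂ) * Complex.I with hw
  have hw0 : w ≠ 0 := two_pi_I_mul_ne_zero (neg_ne_zero.2 hk)
  have hd : ∀ x : ℝ, HasDerivAt (fun s : ℝ => (s : ℂ) * (w⁻¹ * osc (-k) s) - w⁻¹ * (w⁻¹ * osc (-k) s))
      ((x : ℂ) * osc (-k) x) x := by
    intro x
    have h1 : HasDerivAt (fun s => w⁻¹ * osc (-k) s) (osc (-k) x) x := by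
      have := (hasDerivAt_osc (-k) x).const_mul w⁻¹
      rwa [inv_mul_cancel_left₀ hw0] at this
    have h2 : HasDerivAt (fun s : ℝ => (s : ℂ)) 1 x := by
      simpa using (hasDerivAt_id x).ofReal_comp
    convert! (h2.mul h1).sub (h1.const_mul w⁻¹) using 1
    ring
  have e4 := intervalIntegral.integral_eq_sub_of_hasDerivAt (a := 0) (b := 1) (fun x _ => hd x)
    ((by fun_prop : Continuous fun x : ℝ => (x : ℂ) * osc (-k) x).intervalIntegrable _ _)
  have h1 : osc (-k) 1 = 1 := by
    have := osc_intCast (-k) 1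
    rwa [Int.cast_one] at this
  rw [e1, e2, e3, e4, h1, osc_zero_right, hw]
  congr 1
  push_cast
  field_simp
  simp

/-- The Fourier coefficients of the sawtooth average. -/
lemma integral_sawAvg_mul_osc {k : ℤ} (hk : k ≠ 0) :
    ∫ s in (0 : ℝ)..1, (sawAvg μ lam₀ g s : ℂ) * osc (-k) s =
      -(Complex.I / (2 * Real.pi * k)) * shapeHat μ lam₀ g (k * lam₀.den) := by
  set q : ℝ := (lam₀.den : ℝ) with hq
  have hW := continuous_shapeDeriv hp hg
  have hWi : Integrable (fun y => (shapeDeriv μ lam₀ g y : ℂ)) :=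
    (hW.integrable_of_hasCompactSupport (hasCompactSupport_shapeDeriv hp hg)).ofReal
  set F : ℝ → ℝ → ℂ := fun s y =>
    ((shapeDeriv μ lam₀ g y : ℂ) * ((Int.fract (q * y + s) : ℝ) : ℂ)) * osc (-k) s with hF
  have e1 : ∀ s, (sawAvg μ lam₀ g s : ℂ) * osc (-k) s = -∫ y, F s y := by
    intro s
    rw [sawAvg_eq hp hg, hF, integral_mul_const, Complex.ofReal_neg, neg_mul]
    congr 2
    rw [← integral_complex_ofReal]
    simp only [Complex.ofReal_mul, ← hq]
  have hFi : Integrable (Function.uncurry F) ((volume.restrict (uIoc (0 : ℝ) 1)).prod volume) := by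
    have h0 : Integrable (fun _ : ℝ => (1 : ℂ)) (volume.restrict (uIoc (0 : ℝ) 1)) := by
      rw [uIoc_of_le zero_le_one]
      exact integrable_const _
    have h1 : Integrable (fun z : ℝ × ℝ => (1 : ℂ) * (shapeDeriv μ lam₀ g z.2 : ℂ))
        ((volume.restrict (uIoc (0 : ℝ) 1)).prod volume) :=
      h0.mul_prod hWi
    have hm : Measurable fun z : ℝ × ℝ => Int.fract (q * z.2 + z.1) :=
      measurable_fract.comp ((measurable_const.mul measurable_snd).add measurable_fst)
    have hm2 : Measurable fun z : ℝ × ℝ => ((Int.fract (q * z.2 + z.1) : ℝ) : ℂ) * osc (-k) z.1 :=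
      (Complex.measurable_ofReal.comp hm).mul ((continuous_osc (-k)).measurable.comp measurable_fst)
    have h2 := h1.mul_bdd (c := 1) hm2.aestronglyMeasurable (ae_of_all _ fun z => by
      rw [norm_mul, norm_osc, mul_one, Complex.norm_real, Real.norm_eq_abs,
        abs_of_nonneg (Int.fract_nonneg _)]
      exact (Int.fract_lt_one _).le)
    refine h2.congr (ae_of_all _ fun z => ?_)
    simp only [Function.uncurry, hF]
    ring
  rw [intervalIntegral.integral_congr (fun s _ => e1 s), intervalIntegral.integral_neg,
    intervalIntegral_integral_swap hFi, neg_mul]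
  congr 1
  rw [shapeHat, ← integral_const_mul]
  refine integral_congr_ae (ae_of_all _ fun y => ?_)
  simp only [hF, mul_assoc]
  rw [intervalIntegral.integral_const_mul, integral_fract_mul_osc hk, osc_mul_left]
  simp only [hq, Int.cast_natCast]
  ring

end saw

end GodunovTV

namespace GodunovTV

open MeasureTheory

/-! ### The function `Π` -/

/-- The kernel of `Π`. -/
noncomputable def kern (σ : ℝ) : ℝ := (2 * σ ^ 2 - 1) * Real.exp (-σ ^ 2)

/-- The shift in the definition of `Π`. -/
noncomputable def piShift (lam₀ : ℚ) (σ : ℝ) : ℝ := lam₀.den * (σ - √8) / (√2 * beta lam₀)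

lemma integrable_exp_neg_sq : Integrable fun σ : ℝ => Real.exp (-σ ^ 2) := by
  simpa using integrable_exp_neg_mul_sq one_pos

lemma integrable_mul_exp_neg_sq : Integrable fun σ : ℝ => σ * Real.exp (-σ ^ 2) := by
  simpa using integrable_mul_exp_neg_mul_sq one_pos

lemma integrable_sq_mul_exp_neg_sq : Integrable fun σ : ℝ => σ ^ 2 * Real.exp (-σ ^ 2) := by
  simpa using integrable_rpow_mul_exp_neg_mul_sq one_pos (s := 2) (by norm_num)

lemma integrable_kern : Integrable kern := by
  refine ((integrable_sq_mul_exp_neg_sq.const_mul 2).sub integrable_exp_neg_sq).congr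
    (ae_of_all _ fun σ => ?_)
  simp only [Pi.sub_apply, kern]
  ring

@[fun_prop]
lemma continuous_piShift (lam₀ : ℚ) : Continuous (piShift lam₀) := by
  unfold piShift
  fun_prop

/-- 2·`kern` is the second derivative of e^{-σ²}, so two integrations by parts reduce to the Fourier
transform of a Gaussian. -/
lemma integral_kern_mul_exp (t : ℝ) :
    ∫ σ : ℝ, (kern σ : ℂ) * Complex.exp (Complex.I * t * σ) =
      ((-(t ^ 2 / 2) * (√Real.pi * Real.exp (-t ^ 2 / 4)) : ℝ) : ℂ) := by
  set U : ℝ → ℂ := fun σ => Complex.exp (Complex.I * t * σ) with hU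
  set v : ℝ → ℂ := fun σ => ((Real.exp (-σ ^ 2) : ℝ) : ℂ) with hv
  set v₁ : ℝ → ℂ := fun σ => ((-2 * (σ * Real.exp (-σ ^ 2)) : ℝ) : ℂ) with hv₁
  set v₂ : ℝ → ℂ := fun σ => ((2 * kern σ : ℝ) : ℂ) with hv₂
  have hUd : ∀ σ, HasDerivAt U (Complex.I * t * U σ) σ := by
    intro σ
    have h1 : HasDerivAt (fun σ : ℝ => (σ : ℂ)) 1 σ := by
      simpa using (hasDerivAt_id σ).ofReal_comp
    convert! (h1.const_mul (Complex.I * t)).cexp using 1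
    simp only [hU]
    ring
  have he : ∀ σ : ℝ, HasDerivAt (fun σ : ℝ => Real.exp (-σ ^ 2)) (-2 * (σ * Real.exp (-σ ^ 2))) σ := by
    intro σ
    convert! ((hasDerivAt_pow 2 σ).neg).exp using 1
    simp
    ring
  have hvd : ∀ σ, HasDerivAt v (v₁ σ) σ := fun σ => (he σ).ofReal_comp
  have hv₁d : ∀ σ, HasDerivAt v₁ (v₂ σ) σ := fun σ => by
    have h1 := (((hasDerivAt_id σ).mul (he σ)).const_mul (-2)).ofReal_comp
    convert! h1 using 1
    simp only [hv₂, kern, id]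
    push_cast
    ring
  have hUc : Continuous U := by fun_prop
  have hUn : ∀ σ, ‖U σ‖ ≤ 1 := fun σ => by
    simp only [hU]
    rw [show Complex.I * t * σ = ((t * σ : ℝ) : ℂ) * Complex.I by push_cast; ring,
      Complex.norm_exp_ofReal_mul_I]
  have iv : Integrable v := integrable_exp_neg_sq.ofReal
  have iv₁ : Integrable v₁ := (integrable_mul_exp_neg_sq.const_mul (-2)).ofReal
  have iv₂ : Integrable v₂ := (integrable_kern.const_mul 2).ofReal
  have iU : ∀ {f : ℝ → ℂ}, Integrable f → Integrable (U * f) := fun hf =>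
    hf.bdd_mul hUc.aestronglyMeasurable (ae_of_all _ hUn)
  have iU' : ∀ {f : ℝ → ℂ}, Integrable f →
      Integrable ((fun σ => Complex.I * t * U σ) * f) := fun hf => by
    refine ((iU hf).const_mul (Complex.I * t)).congr (ae_of_all _ fun σ => ?_)
    simp only [Pi.mul_apply]
    ring
  have s1 := integral_mul_deriv_eq_deriv_mul_of_integrable (fun σ _ => hUd σ) (fun σ _ => hv₁d σ)
    (iU iv₂) (iU' iv₁) (iU iv₁)
  have s2 := integral_mul_deriv_eq_deriv_mul_of_integrable (fun σ _ => hUd σ) (fun σ _ => hvd σ)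
    (iU iv₁) (iU' iv) (iU iv)
  simp only [mul_assoc (Complex.I * (t : ℂ)), integral_const_mul] at s1 s2
  have s3 := fourierIntegral_gaussian (b := 1) (by simp) t
  have s4 : ∫ σ : ℝ, U σ * v σ = ((√Real.pi * Real.exp (-t ^ 2 / 4) : ℝ) : ℂ) := by
    have h1 : ∫ σ : ℝ, U σ * v σ =
        ∫ x : ℝ, Complex.exp (Complex.I * t * x) * Complex.exp (-1 * (x : ℂ) ^ 2) := by
      refine integral_congr_ae (ae_of_all _ fun x => ?_)
      simp only [hU, hv]
      push_cast
      rw [neg_one_mul]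
    have h2 : ((Real.pi : ℂ) / 1) ^ (1 / 2 : ℂ) = (√Real.pi : ℂ) := by
      rw [div_one, Real.sqrt_eq_rpow, Complex.ofReal_cpow Real.pi_pos.le]
      push_cast
      rfl
    rw [h1, s3, h2]
    push_cast
    rw [mul_one]
  have s5 : ∫ σ : ℝ, U σ * v₂ σ = 2 * ∫ σ : ℝ, (kern σ : ℂ) * U σ := by
    rw [← integral_const_mul]
    refine integral_congr_ae (ae_of_all _ fun σ => ?_)
    simp only [hv₂]
    push_cast
    ring
  rw [s5, s2, s4] at s1
  have s6 : ∫ σ : ℝ, (kern σ : ℂ) * U σ = (Complex.I * t) * (Complex.I * t) / 2 *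
      ((√Real.pi * Real.exp (-t ^ 2 / 4) : ℝ) : ℂ) := by
    linear_combination s1 / 2
  rw [s6, Complex.ofReal_mul (-(t ^ 2 / 2)), show Complex.I * t * (Complex.I * t) =
    Complex.I * Complex.I * (t * t) by ring, Complex.I_mul_I]
  congr 1
  push_cast
  ring

/-- The Fourier coefficients of `Π`. -/
noncomputable def piHat (μ : ℝ) (lam₀ : ℚ) (g : ℝ → ℝ) (k : ℤ) : ℂ :=
  ∫ z in (0 : ℝ)..1, (bigPi μ lam₀ g z : ℂ) * osc (-k) z

section bigPi
variable {μ : ℝ} {lam₀ : ℚ} {g : ℝ → ℝ} (hp : Params μ lam₀) (hg : AdmissibleFlux μ lam₀ g)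

lemma bigPi_eq (z : ℝ) : bigPi μ lam₀ g z =
    ∫ σ, kern σ * sawAvg μ lam₀ g (z + piShift lam₀ σ) := by
  simp only [bigPi, littlePi_eq, kern, piShift]

lemma bigPi_periodic : Function.Periodic (bigPi μ lam₀ g) 1 := fun z => by
  rw [bigPi_eq, bigPi_eq]
  refine integral_congr_ae (ae_of_all _ fun σ => ?_)
  simp only
  rw [add_right_comm, sawAvg_periodic]

include hp

/-- √8/√2 = 2 gives the phase. The factor k² e^{-π²k²q²/(2β²)} is the same that the transported
packet acquires at `freq lam₀ k`, which is why the kernel of Π has this form. -/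
lemma integral_kern_mul_osc (k : ℤ) :
    ∫ σ : ℝ, (kern σ : ℂ) * osc k (piShift lam₀ σ) =
      ((-(√Real.pi * (Real.pi ^ 2 * k ^ 2 * lam₀.den ^ 2 / beta lam₀ ^ 2) *
        Real.exp (-(Real.pi ^ 2 * k ^ 2 * lam₀.den ^ 2 / (2 * beta lam₀ ^ 2)))) : ℝ) : ℂ) *
      osc (-k) (2 * lam₀.den / beta lam₀) := by
  have hβ := hp.beta_pos
  set β := beta lam₀ with hβdef
  set q : ℝ := (lam₀.den : ℝ) with hqdef
  have h2 : √2 * √2 = 2 := Real.mul_self_sqrt (by norm_num)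
  have h2p : 0 < √2 := Real.sqrt_pos.2 (by norm_num)
  have h8 : √8 = 2 * √2 := by
    rw [show (8 : ℝ) = 2 ^ 2 * 2 by norm_num, Real.sqrt_mul (by norm_num),
      Real.sqrt_sq (by norm_num)]
  set t : ℝ := 2 * Real.pi * k * (q / (√2 * β)) with ht
  have e1 : ∀ σ : ℝ, osc k (piShift lam₀ σ) =
      Complex.exp (Complex.I * t * σ) * osc (-k) (2 * q / β) := by
    intro σ
    rw [osc, osc, ← Complex.exp_add]
    congr 1
    have : 2 * Real.pi * k * piShift lam₀ σ = t * σ + 2 * Real.pi * ((-k : ℤ) : ℝ) * (2 * q / β) := by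
      rw [piShift, ← hβdef, ← hqdef, h8, ht]
      push_cast
      field_simp
      ring
    rw [this]
    push_cast
    ring
  have e2 : t ^ 2 = 2 * (Real.pi ^ 2 * k ^ 2 * q ^ 2 / β ^ 2) := by
    have : t ^ 2 = 4 * (Real.pi ^ 2 * k ^ 2 * q ^ 2 / ((√2 * √2) * β ^ 2)) := by
      rw [ht]
      field_simp
      ring
    rw [this, h2]
    field_simp
    ring
  have e3 : -t ^ 2 / 4 = -(Real.pi ^ 2 * k ^ 2 * q ^ 2 / (2 * β ^ 2)) := by
    rw [e2]
    field_simp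
    ring
  simp only [e1, ← mul_assoc]
  rw [integral_mul_const, integral_kern_mul_exp, e3, e2]
  congr 2
  ring

include hg

lemma exists_bigPi_bounds : ∃ C > 0, (∀ z, |bigPi μ lam₀ g z| ≤ C) ∧
    ∀ z z', |bigPi μ lam₀ g z - bigPi μ lam₀ g z'| ≤ C * |z - z'| := by
  obtain ⟨C, hC, hb, hl⟩ := exists_sawAvg_bounds hp hg
  have hcs := continuous_sawAvg hp hg
  set K := ∫ σ, |kern σ| with hK
  have hK0 : 0 ≤ K := integral_nonneg fun σ => abs_nonneg _
  have hint : ∀ z, Integrable fun σ => kern σ * sawAvg μ lam₀ g (z + piShift lam₀ σ) := fun z =>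
    integrable_kern.mul_bdd (by fun_prop : Continuous fun σ =>
      sawAvg μ lam₀ g (z + piShift lam₀ σ)).aestronglyMeasurable (ae_of_all _ fun σ => hb _)
  have hkey : ∀ (F : ℝ → ℝ) (D : ℝ), (∀ σ, |F σ| ≤ |kern σ| * D) → |∫ σ, F σ| ≤ K * D := by
    intro F D hF
    have := norm_integral_le_of_norm_le (f := F) (integrable_kern.abs.mul_const D)
      (ae_of_all _ fun σ => hF σ)
    rwa [integral_mul_const] at this
  refine ⟨K * C + 1, by positivity, fun z => ?_, fun z z' => ?_⟩
  · rw [bigPi_eq]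
    have := hkey (fun σ => kern σ * sawAvg μ lam₀ g (z + piShift lam₀ σ)) C fun σ => by
      rw [abs_mul]
      exact mul_le_mul_of_nonneg_left (hb _) (abs_nonneg _)
    linarith
  · rw [bigPi_eq, bigPi_eq, ← integral_sub (hint z) (hint z')]
    have := hkey (fun σ => kern σ * sawAvg μ lam₀ g (z + piShift lam₀ σ) -
      kern σ * sawAvg μ lam₀ g (z' + piShift lam₀ σ)) (C * |z - z'|) fun σ => by
        rw [← mul_sub, abs_mul]
        refine mul_le_mul_of_nonneg_left ((hl _ _).trans (le_of_eq ?_)) (abs_nonneg _)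
        rw [add_sub_add_right_eq_sub]
    have h0 := abs_nonneg (z - z')
    nlinarith

lemma continuous_bigPi : Continuous (bigPi μ lam₀ g) := by
  obtain ⟨C, hC, -, h⟩ := exists_bigPi_bounds hp hg
  refine LipschitzWith.continuous (K := C.toNNReal) (LipschitzWith.of_dist_le_mul fun x y => ?_)
  rw [Real.coe_toNNReal _ hC.le]
  exact h x y

/-- Π is a convolution of the sawtooth average with the kernel, so Fourier coefficients multiply. -/
lemma piHat_eq_mul (k : ℤ) : piHat μ lam₀ g k =
    (∫ σ : ℝ, (kern σ : ℂ) * osc k (piShift lam₀ σ)) *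
      ∫ s in (0 : ℝ)..1, (sawAvg μ lam₀ g s : ℂ) * osc (-k) s := by
  obtain ⟨C, hC, hb, -⟩ := exists_sawAvg_bounds hp hg
  have hcs := continuous_sawAvg hp hg
  set F : ℝ → ℝ → ℂ := fun z σ =>
    ((kern σ : ℂ) * (sawAvg μ lam₀ g (z + piShift lam₀ σ) : ℂ)) * osc (-k) z with hF
  have e1 : ∀ z, (bigPi μ lam₀ g z : ℂ) * osc (-k) z = ∫ σ, F z σ := by
    intro z
    rw [bigPi_eq, hF, integral_mul_const, ← integral_complex_ofReal]
    simp only [Complex.ofReal_mul]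
  have hFi : Integrable (Function.uncurry F) ((volume.restrict (uIoc (0 : ℝ) 1)).prod volume) := by
    have h0 : Integrable (fun _ : ℝ => (1 : ℂ)) (volume.restrict (uIoc (0 : ℝ) 1)) := by
      rw [uIoc_of_le zero_le_one]
      exact integrable_const _
    have h1 : Integrable (fun z : ℝ × ℝ => (1 : ℂ) * (kern z.2 : ℂ))
        ((volume.restrict (uIoc (0 : ℝ) 1)).prod volume) := h0.mul_prod integrable_kern.ofReal
    have hm2 : Continuous fun z : ℝ × ℝ =>
        (sawAvg μ lam₀ g (z.1 + piShift lam₀ z.2) : ℂ) * osc (-k) z.1 := by fun_prop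
    have h2 := h1.mul_bdd (c := C) hm2.aestronglyMeasurable (ae_of_all _ fun z => by
      rw [norm_mul, norm_osc, mul_one, Complex.norm_real, Real.norm_eq_abs]
      exact hb _)
    refine h2.congr (ae_of_all _ fun z => ?_)
    simp only [Function.uncurry, hF]
    ring
  rw [piHat, intervalIntegral.integral_congr (fun z _ => e1 z), intervalIntegral_integral_swap hFi,
    ← integral_mul_const]
  refine integral_congr_ae (ae_of_all _ fun σ => ?_)
  simp only [hF, mul_assoc]
  rw [intervalIntegral.integral_const_mul]
  congr 1
  set τ := piShift lam₀ σ
  have hper : Function.Periodic (fun s : ℝ => (sawAvg μ lam₀ g s : ℂ) * osc (-k) s) 1 :=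
    fun s => by
      simp only [sawAvg_periodic s, osc_periodic (-k) s]
  have h1 := intervalIntegral.integral_comp_add_right (a := 0) (b := 1)
    (fun s : ℝ => (sawAvg μ lam₀ g s : ℂ) * osc (-k) s) τ
  have h2 := hper.intervalIntegral_add_eq τ 0
  rw [zero_add] at h2
  rw [zero_add, add_comm 1 τ, h2] at h1
  rw [← h1, ← intervalIntegral.integral_const_mul]
  refine intervalIntegral.integral_congr fun s _ => ?_
  have : osc k τ * osc (-k) τ = 1 := by
    rw [osc_neg_left, ← osc_add, add_neg_cancel, osc_zero_right]
  rw [osc_add]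
  linear_combination (-(sawAvg μ lam₀ g (s + τ) : ℂ) * osc (-k) s) * this

/-- The transform of the kernel carries the factor k², so Π has mean zero. -/
lemma piHat_zero : piHat μ lam₀ g 0 = 0 := by
  rw [piHat_eq_mul hp hg, integral_kern_mul_osc hp]
  simp

lemma piHat_eq {k : ℤ} (hk : k ≠ 0) : piHat μ lam₀ g k =
    ((√Real.pi * (Real.pi ^ 2 * k ^ 2 * lam₀.den ^ 2 / beta lam₀ ^ 2) *
        Real.exp (-(Real.pi ^ 2 * k ^ 2 * lam₀.den ^ 2 / (2 * beta lam₀ ^ 2))) : ℝ) : ℂ) *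
      osc (-k) (2 * lam₀.den / beta lam₀) *
      ((Complex.I / (2 * Real.pi * k)) * shapeHat μ lam₀ g (k * lam₀.den)) := by
  rw [piHat_eq_mul hp hg, integral_kern_mul_osc hp, integral_sawAvg_mul_osc hp hg hk]
  push_cast
  ring

end bigPi

end GodunovTV

namespace GodunovTV

/-! ### The oscillation of `V` reproduces `Π` -/

/-- The frequency whose packet detects the `k`-th Fourier mode of `Π`. -/
noncomputable def freq (lam₀ : ℚ) (k : ℤ) : ℝ := 4 * Real.pi * k * lam₀.den / √(beta lam₀)

section transfer
variable {μ : ℝ} {lam₀ : ℚ} {g : ℝ → ℝ} (hp : Params μ lam₀)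
include hp

omit hp in
-- Rationality enters here: λ₀ times its denominator is an integer, so the linear part of the front
-- is invisible to the modes kq.
lemma osc_front (k : ℤ) (m : ℕ) : osc (k * lam₀.den) (front lam₀ m) =
    osc (k * lam₀.den) (2 * √(m : ℝ)) := by
  have h1 : (((lam₀.den : ℤ) : ℝ) * (lam₀ * m) : ℝ) = ((lam₀.num * m : ℤ) : ℝ) := by
    have : (lam₀ : ℝ) * lam₀.den = lam₀.num := by exact_mod_cast lam₀.mul_den_eq_num
    push_cast
    rw [← this]
    ring
  rw [front, osc_add, osc_mul_left, h1, osc_intCast, one_mul]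

/-- The resonance: at this frequency w√(βm) = 2πkq·2√m, which modulo 2π is the phase of the mode kq
at the front. -/
lemma packet_freq (A : ℝ) (k : ℤ) (m : ℕ) : packet lam₀ A (freq lam₀ k) m =
    ((4 * (Real.pi ^ 2 * k ^ 2 * lam₀.den ^ 2 / beta lam₀ ^ 2) *
        Real.exp (-(Real.pi ^ 2 * k ^ 2 * lam₀.den ^ 2 / (2 * beta lam₀ ^ 2))) : ℝ) : ℂ) *
      osc k (2 * lam₀.den / beta lam₀) *
      (((bump (beta lam₀ * m / A) / m : ℝ) : ℂ) * osc (k * lam₀.den) (front lam₀ m)) := by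
  have hβ := hp.beta_pos
  rw [osc_front, packet]
  set β := beta lam₀ with hβdef
  have hsβ := Real.sqrt_pos.2 hβ
  have hss := Real.mul_self_sqrt hβ.le
  set q : ℝ := (lam₀.den : ℝ) with hq
  have hf : freq lam₀ k = 4 * Real.pi * k * q / √β := rfl
  have e1 : freq lam₀ k ^ 2 = 16 * (Real.pi ^ 2 * k ^ 2 * q ^ 2 / β) := by
    have : freq lam₀ k ^ 2 = 16 * (Real.pi ^ 2 * k ^ 2 * q ^ 2 / (√β * √β)) := by
      rw [hf]
      field_simp
      ring
    rw [this, hss]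
  have e2 : -freq lam₀ k ^ 2 / (32 * β) = -(Real.pi ^ 2 * k ^ 2 * q ^ 2 / (2 * β ^ 2)) := by
    rw [e1]
    field_simp
    ring
  have e3 : freq lam₀ k ^ 2 / (4 * (β * m)) * bump (β * m / A) =
      4 * (Real.pi ^ 2 * k ^ 2 * q ^ 2 / β ^ 2) * (bump (β * m / A) / m) := by
    rw [e1]
    rcases eq_or_ne (m : ℝ) 0 with h | h
    · simp [h]
    · field_simp
      ring
  have e4 : freq lam₀ k * √(β * m) + freq lam₀ k / √β =
      2 * Real.pi * k * (2 * q / β) + 2 * Real.pi * ((k * lam₀.den : ℤ) : ℝ) * (2 * √(m : ℝ)) := by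
    have h1 : freq lam₀ k / √β = 2 * Real.pi * k * (2 * q / (√β * √β)) := by
      rw [hf]
      field_simp
      ring
    rw [h1, hss, Real.sqrt_mul hβ.le, hf]
    push_cast
    rw [← hq]
    field_simp
    ring
  rw [e2, e3, e4, osc, osc, Complex.ofReal_add, add_mul, Complex.exp_add]
  push_cast
  ring

/-- In the resonant sum the oscillation and the moment combine into one periodic function of the
front. Its fluctuation averages out by `exists_norm_sum_bump_le`, and its mean, the Fourier
coefficient kq of the moment, is weighted by the packet mass. -/
lemma exists_norm_tsum_V_sub_le (hg : AdmissibleFlux μ lam₀ g) (k : ℤ) :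
    ∃ C > 0, ∃ N : ℝ, ∀ T : ℕ, LateTime lam₀ T →
      N ≤ √(T : ℝ) → ∀ A : ℝ, 32 * √(T : ℝ) ≤ A → (8 / beta lam₀ + 1) * A ≤ T →
      ‖∑' J : ℤ, test A (freq lam₀ k) J * ((V μ lam₀ T g (-J) : ℂ) - V μ lam₀ T g (-J - 1)) -
        ((packetMass lam₀ A * (4 / (√Real.pi * lam₀.den)) : ℝ) : ℂ) *
          osc k (4 * lam₀.den / beta lam₀) * piHat μ lam₀ g k‖ ≤
        C * (1 / √A + T / (A * √A)) := by
  obtain ⟨C, hC, N, h⟩ := exists_norm_tsum_V_add_le hp hg (freq lam₀ k)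
  -- For k = 0 both the packet, whose amplitude carries w², and the Fourier coefficient of Π vanish.
  rcases eq_or_ne k 0 with rfl | hk
  · refine ⟨C, hC, N, fun T hT hN A hA hAT => ?_⟩
    have h1 := h T hT hN A hA hAT
    rw [Finset.sum_eq_zero (fun m _ => by rw [packet_freq hp]; simp), add_zero] at h1
    rw [piHat_zero hp hg, mul_zero, sub_zero]
    exact h1
  have hβ := hp.beta_pos
  have hq0 : (0 : ℝ) < lam₀.den := by exact_mod_cast lam₀.den_pos
  obtain ⟨B, hB, hmb, hml⟩ := exists_shape_moment_bounds hp hg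
  have hcm := continuous_moment hp hg
  set M := moment (shape μ lam₀ g) with hM
  set n : ℤ := k * lam₀.den with hn
  have hn0 : n ≠ 0 := mul_ne_zero hk (by exact_mod_cast lam₀.den_pos.ne')
  set mean : ℂ := shapeHat μ lam₀ g n / (2 * Real.pi * n * Complex.I) with hmean
  set H : ℝ → ℂ := fun x => osc n x * M (-x) - mean with hH
  have hHc : Continuous H := by fun_prop
  have hMper : ∀ x, M (-(x + 1)) = M (-x) := fun x => by
    have := moment_add_one (shape μ lam₀ g) (-(x + 1))
    rw [show -(x + 1) + 1 = -x by ring] at this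
    exact this.symm
  have hHper : Function.Periodic H 1 := fun x => by
    simp only [hH, hMper, osc_periodic n x]
  have hHmean : ∫ x in (0 : ℝ)..1, H x = 0 := by
    simp only [hH]
    rw [intervalIntegral.integral_sub
      ((by fun_prop : Continuous fun x => osc n x * (M (-x) : ℂ)).intervalIntegrable _ _) (by simp),
      integral_osc_mul_moment hp hg hn0, intervalIntegral.integral_const]
    simp [hmean]
  have hHb : ∀ x, ‖H x‖ ≤ B + ‖mean‖ := fun x => by
    refine (norm_sub_le _ _).trans (add_le_add ?_ le_rfl)
    rw [norm_mul, norm_osc, one_mul, Complex.norm_real]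
    exact hmb _
  have hHl : ∀ x y, ‖H x - H y‖ ≤ (2 * Real.pi * |(n : ℝ)| * B + B) * |x - y| := fun x y => by
    have e : H x - H y = (osc n x - osc n y) * M (-x) + osc n y * ((M (-x) - M (-y) : ℝ) : ℂ) := by
      simp only [hH]
      push_cast
      ring
    rw [e, add_mul]
    refine (norm_add_le _ _).trans (add_le_add ?_ ?_)
    · rw [norm_mul, Complex.norm_real]
      calc _ ≤ 2 * Real.pi * |(n : ℝ)| * |x - y| * B :=
            mul_le_mul (norm_osc_sub_le n x y) (hmb _) (abs_nonneg _)
              (by have := Real.pi_pos; positivity)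
        _ = _ := by ring
    · rw [norm_mul, norm_osc, one_mul, Complex.norm_real]
      have := hml (-x) (-y)
      rwa [neg_sub_neg, abs_sub_comm y] at this
  obtain ⟨C', hC', h'⟩ := exists_norm_sum_bump_le hp hHc hHper hHmean hHb hHl
    (by have := Real.pi_pos; positivity)
  set Kc : ℂ := ((4 * (Real.pi ^ 2 * k ^ 2 * lam₀.den ^ 2 / beta lam₀ ^ 2) *
        Real.exp (-(Real.pi ^ 2 * k ^ 2 * lam₀.den ^ 2 / (2 * beta lam₀ ^ 2))) : ℝ) : ℂ) *
      osc k (2 * lam₀.den / beta lam₀) with hKc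
  -- Both sides are multiples of `shapeHat` at kq with the same Gaussian factor; the phase 4q/β
  -- compensates the opposite signs of the phase 2q/β in the packet and in Π.
  have hconst : ((4 / (√Real.pi * lam₀.den) : ℝ) : ℂ) * osc k (4 * lam₀.den / beta lam₀) *
      piHat μ lam₀ g k = -(Kc * mean) := by
    rw [piHat_eq hp hg hk, hKc, hmean, ← hn]
    have ho : osc k (4 * lam₀.den / beta lam₀) * osc (-k) (2 * lam₀.den / beta lam₀) =
        osc k (2 * lam₀.den / beta lam₀) := by
      rw [osc_neg_left, ← osc_add]
      congr 1
      ring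
    have hk' : (k : ℂ) ≠ 0 := by exact_mod_cast hk
    have hq' : (lam₀.den : ℂ) ≠ 0 := by exact_mod_cast lam₀.den_pos.ne'
    have hπ : (Real.pi : ℂ) ≠ 0 := by exact_mod_cast Real.pi_ne_zero
    have hsπ : (√Real.pi : ℂ) ≠ 0 := by
      exact_mod_cast (Real.sqrt_pos.2 Real.pi_pos).ne'
    have hIinv : (2 * Real.pi * (n : ℂ) * Complex.I)⁻¹ =
        -(Complex.I / (2 * Real.pi * k) / lam₀.den) := by
      rw [hn]
      push_cast
      rw [mul_inv, Complex.inv_I]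
      field_simp
    rw [div_eq_mul_inv (shapeHat μ lam₀ g n), hIinv, ← ho]
    push_cast
    field_simp
  refine ⟨C + ‖Kc‖ * C', by positivity, max N lam₀.den, fun T hT hN A hA hAT => ?_⟩
  have h1 := h T hT ((le_max_left _ _).trans hN) A hA hAT
  have hqT : (lam₀.den : ℝ) ≤ √(T : ℝ) := (le_max_right _ _).trans hN
  have hT1 : 1 ≤ √(T : ℝ) := Real.one_le_sqrt.2 (by exact_mod_cast hT.1)
  have hA1 : 1 ≤ A := by linarith
  have h2 := h' A hA1 (by linarith)
  set Sig := ∑' J : ℤ, test A (freq lam₀ k) J *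
    ((V μ lam₀ T g (-J) : ℂ) - V μ lam₀ T g (-J - 1))
  have e1 : ∑ m ∈ Finset.range ⌈8 / beta lam₀ * A⌉₊, packet lam₀ A (freq lam₀ k) m *
      (M (-front lam₀ m) : ℂ) = Kc * ∑ m ∈ Finset.range ⌈8 / beta lam₀ * A⌉₊,
        ((bump (beta lam₀ * m / A) / m : ℝ) : ℂ) * H (front lam₀ m) +
          Kc * (packetMass lam₀ A * mean) := by
    rw [← mul_add, packetMass, Complex.ofReal_sum, Finset.sum_mul, ← Finset.sum_add_distrib,
      Finset.mul_sum]
    refine Finset.sum_congr rfl fun m _ => ?_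
    rw [packet_freq hp, ← hKc]
    simp only [hH]
    ring
  rw [e1] at h1
  set S := ∑ m ∈ Finset.range ⌈8 / beta lam₀ * A⌉₊,
        ((bump (beta lam₀ * m / A) / m : ℝ) : ℂ) * H (front lam₀ m)
  have e2 : Sig - ((packetMass lam₀ A * (4 / (√Real.pi * lam₀.den)) : ℝ) : ℂ) *
          osc k (4 * lam₀.den / beta lam₀) * piHat μ lam₀ g k =
      (Sig + (Kc * S + Kc * (packetMass lam₀ A * mean))) - Kc * S := by
    rw [Complex.ofReal_mul]
    linear_combination (-(packetMass lam₀ A : ℂ)) * hconst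
  rw [e2]
  refine (norm_sub_le _ _).trans ?_
  rw [norm_mul, add_mul]
  refine add_le_add h1 ?_
  rw [mul_assoc]
  refine mul_le_mul_of_nonneg_left (h2.trans ?_) (norm_nonneg _)
  rw [div_eq_mul_one_div]
  refine mul_le_mul_of_nonneg_left ?_ hC'.le
  have : 0 ≤ (T : ℝ) / (A * √A) := by positivity
  linarith

end transfer

end GodunovTV

namespace GodunovTV

open MeasureTheory

/-! ### Trigonometric approximation -/

lemma exists_osc_approx {f : ℝ → ℝ} (hf : Continuous f) (hper : Function.Periodic f 1) {ε : ℝ}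
    (hε : 0 < ε) : ∃ (s : Finset ℤ) (p : ℤ → ℂ), ∀ x, ‖∑ k ∈ s, p k * osc (-k) x - f x‖ ≤ ε := by
  have hper' : Function.Periodic (fun x => (f x : ℂ)) 1 := fun x => by simp only [hper x]
  set F : C(AddCircle (1 : ℝ), ℂ) := ⟨hper'.lift, by
    refine continuous_coinduced_dom.2 ?_
    exact Complex.continuous_ofReal.comp hf⟩ with hF
  have hmem : F ∈ closure (Submodule.span ℂ (range (fourier (T := (1 : ℝ)))) : Set _) := by
    rw [← Submodule.topologicalClosure_coe, span_fourier_closure_eq_top]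
    trivial
  obtain ⟨P, hP, hd⟩ := Metric.mem_closure_iff.1 hmem ε hε
  obtain ⟨c, hc⟩ := Finsupp.mem_span_range_iff_exists_finsupp.1 hP
  refine ⟨c.support.map (Equiv.neg ℤ).toEmbedding, fun k => c (-k), fun x => ?_⟩
  have h1 := (ContinuousMap.norm_coe_le_norm (P - F) (x : AddCircle (1 : ℝ)))
  rw [← dist_eq_norm P F, dist_comm] at h1
  have e1 : (P - F) (x : AddCircle (1 : ℝ)) =
      ∑ k ∈ c.support.map (Equiv.neg ℤ).toEmbedding, c (-k) * osc (-k) x - f x := by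
    rw [ContinuousMap.sub_apply, ← hc, Finset.sum_map]
    congr 1
    rw [Finsupp.sum, ContinuousMap.coe_sum, Finset.sum_apply]
    refine Finset.sum_congr rfl fun k _ => ?_
    simp only [Equiv.coe_toEmbedding, Equiv.neg_apply, neg_neg]
    rw [ContinuousMap.smul_apply, smul_eq_mul, fourier_coe_apply, osc]
    congr 2
    push_cast
    ring
  rw [← e1]
  exact h1.trans hd.le

/-- A continuous periodic function is almost normed by trigonometric polynomials. -/
lemma exists_osc_dual {f : ℝ → ℝ} (hf : Continuous f) (hper : Function.Periodic f 1)
    (hI : 0 < ∫ x in (0 : ℝ)..1, |f x|) : ∃ (s : Finset ℤ) (p : ℤ → ℂ),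
      (∀ x, ‖∑ k ∈ s, p k * osc (-k) x‖ ≤ 2) ∧
      (∫ x in (0 : ℝ)..1, |f x|) / 2 ≤
        ‖∑ k ∈ s, p k * ∫ x in (0 : ℝ)..1, (f x : ℂ) * osc (-k) x‖ := by
  set I := ∫ x in (0 : ℝ)..1, |f x| with hIdef
  have hden : ∀ x, 0 < |f x| + I / 4 := fun x => by positivity
  -- A continuous substitute for the sign of f. It loses at most I/4 in the pairing, and the
  -- trigonometric approximation another I/4.
  set φ : ℝ → ℝ := fun x => f x / (|f x| + I / 4) with hφ
  have hφc : Continuous φ := hf.div (by fun_prop) fun x => (hden x).ne'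
  have hφper : Function.Periodic φ 1 := fun x => by simp only [hφ, hper x]
  have hφ1 : ∀ x, |φ x| ≤ 1 := fun x => by
    simp only [hφ]
    rw [abs_div, abs_of_pos (hden x), div_le_one (hden x)]
    linarith
  obtain ⟨s, p, hsp⟩ := exists_osc_approx hφc hφper (ε := 1 / 4) (by norm_num)
  refine ⟨s, p, fun x => ?_, ?_⟩
  · have h1 := norm_add_le (∑ k ∈ s, p k * osc (-k) x - φ x) (φ x : ℂ)
    rw [sub_add_cancel, Complex.norm_real, Real.norm_eq_abs] at h1
    linarith [hsp x, hφ1 x]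
  · set P : ℝ → ℂ := fun x => ∑ k ∈ s, p k * osc (-k) x with hP
    have hPc : Continuous P := by fun_prop
    have e1 : ∑ k ∈ s, p k * ∫ x in (0 : ℝ)..1, (f x : ℂ) * osc (-k) x =
        ∫ x in (0 : ℝ)..1, (f x : ℂ) * P x := by
      simp only [← intervalIntegral.integral_const_mul]
      rw [← intervalIntegral.integral_finsetSum]
      · refine intervalIntegral.integral_congr fun x _ => ?_
        simp only [hP]
        rw [Finset.mul_sum]
        exact Finset.sum_congr rfl fun k _ => by ring
      · intro k _
        exact (by fun_prop : Continuous fun x => p k * ((f x : ℂ) * osc (-k) x)).intervalIntegrable _ _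
    have e2 : ∫ x in (0 : ℝ)..1, (f x : ℂ) * P x =
        ((∫ x in (0 : ℝ)..1, f x * φ x : ℝ) : ℂ) +
          ∫ x in (0 : ℝ)..1, (f x : ℂ) * (P x - φ x) := by
      rw [← intervalIntegral.integral_ofReal, ← intervalIntegral.integral_add]
      · refine intervalIntegral.integral_congr fun x _ => ?_
        push_cast
        ring
      · exact (by fun_prop : Continuous fun x => ((f x * φ x : ℝ) : ℂ)).intervalIntegrable _ _
      · exact (by fun_prop : Continuous fun x => (f x : ℂ) * (P x - φ x)).intervalIntegrable _ _
    have e3 : ‖∫ x in (0 : ℝ)..1, (f x : ℂ) * (P x - φ x)‖ ≤ I * (1 / 4) := by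
      rw [hIdef, ← intervalIntegral.integral_mul_const]
      refine intervalIntegral.norm_integral_le_of_norm_le zero_le_one (ae_of_all _ fun x _ => ?_)
        ((by fun_prop : Continuous fun x => |f x| * (1 / 4)).intervalIntegrable _ _)
      rw [norm_mul, Complex.norm_real, Real.norm_eq_abs]
      exact mul_le_mul_of_nonneg_left (hsp x) (abs_nonneg _)
    have e4 : I - I / 4 ≤ ∫ x in (0 : ℝ)..1, f x * φ x := by
      have : I - I / 4 = ∫ x in (0 : ℝ)..1, (|f x| - I / 4) := by
        rw [intervalIntegral.integral_sub (hf.abs.intervalIntegrable _ _) (by simp),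
          intervalIntegral.integral_const]
        simp [hIdef]
      rw [this]
      refine intervalIntegral.integral_mono_on zero_le_one
        ((by fun_prop : Continuous fun x => |f x| - I / 4).intervalIntegrable _ _)
        ((hf.mul hφc).intervalIntegrable _ _) fun x _ => ?_
      simp only [hφ]
      rw [mul_div_assoc', le_div_iff₀ (hden x), ← abs_mul_abs_self (f x)]
      nlinarith [sq_nonneg I]
    rw [e1, e2]
    have h1 := norm_sub_le (((∫ x in (0 : ℝ)..1, f x * φ x : ℝ) : ℂ) +
      ∫ x in (0 : ℝ)..1, (f x : ℂ) * (P x - φ x)) (∫ x in (0 : ℝ)..1, (f x : ℂ) * (P x - φ x))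
    rw [add_sub_cancel_right, Complex.norm_real, Real.norm_eq_abs] at h1
    have h2 := le_abs_self (∫ x in (0 : ℝ)..1, f x * φ x)
    linarith

/-! ### Lower bounds for the variation -/

section blocks
variable {μ : ℝ} {lam₀ : ℚ} {g : ℝ → ℝ}

/-- All packets are characters evaluated at the same point 2q√(y/β), so a combination of packets is
a trigonometric polynomial there. -/
lemma test_freq (hp : Params μ lam₀) (A : ℝ) (k : ℤ) (y : ℝ) : test A (freq lam₀ k) y =
    bump (y / A) * osc k (2 * lam₀.den / √(beta lam₀) * √y) := by
  have hβ := Real.sqrt_pos.2 hp.beta_pos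
  rw [test, osc]
  congr 2
  rw [← Complex.ofReal_mul]
  congr 2
  rw [freq]
  field_simp
  ring

/-- Duality between L¹ and bounded functions: combine the packets with the coefficients of a
trigonometric polynomial that is bounded by 2 and nearly norms Π. The pairing is at most twice the
variation on the block, and at least the packet mass factor r times ∫|Π|/2, up to errors. -/
lemma exists_block_le (hp : Params μ lam₀) (hg : AdmissibleFlux μ lam₀ g)
    (hI : 0 < ∫ z in (0 : ℝ)..1, |bigPi μ lam₀ g z|) :
    ∃ C > 0, ∃ N : ℝ, ∀ T : ℕ, LateTime lam₀ T → N ≤ √(T : ℝ) → ∀ A : ℕ, 32 * √(T : ℝ) ≤ A →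
      (8 / beta lam₀ + 1) * A ≤ T →
      1 / (7 * √Real.pi * lam₀.den) * (∫ z in (0 : ℝ)..1, |bigPi μ lam₀ g z|) -
        C * (1 / √(A : ℝ) + T / (A * √(A : ℝ))) ≤
      ∑ J ∈ Finset.Ico A (2 * A), |V μ lam₀ T g (-J) - V μ lam₀ T g (-J - 1)| := by
  set I := ∫ z in (0 : ℝ)..1, |bigPi μ lam₀ g z| with hIdef
  obtain ⟨s, p, hp2, hpI⟩ := exists_osc_dual (continuous_bigPi hp hg) bigPi_periodic hI
  choose C hC N h using exists_norm_tsum_V_sub_le hp hg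
  have hq0 : (0 : ℝ) < lam₀.den := by exact_mod_cast lam₀.den_pos
  have hπ := Real.sqrt_pos.2 Real.pi_pos
  set D : ℝ := ∑ k ∈ s, ‖p k‖ * C k with hD
  have hD0 : 0 ≤ D := Finset.sum_nonneg fun k _ => mul_nonneg (norm_nonneg _) (hC k).le
  refine ⟨D + 1, by positivity, ∑ k ∈ s, |N k|, fun T hT hN A hA hAT => ?_⟩
  have hT1 : 1 ≤ √(T : ℝ) := Real.one_le_sqrt.2 (by exact_mod_cast hT.1)
  have hA4 : (4 : ℝ) ≤ A := by linarith
  have hA0 : (0 : ℝ) < A := by linarith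
  set r := packetMass lam₀ A * (4 / (√Real.pi * lam₀.den)) with hr
  have hr0 : 4 / (7 * √Real.pi * lam₀.den) ≤ r := by
    have := packetMass_bounds hp hA4
    calc 4 / (7 * √Real.pi * lam₀.den) = 1 / 7 * (4 / (√Real.pi * lam₀.den)) := by field_simp
      _ ≤ _ := by rw [hr]; gcongr
  set Q : ℝ := 4 * lam₀.den / beta lam₀ with hQ
  set ΔV : ℤ → ℂ := fun J => (V μ lam₀ T g (-J) : ℂ) - V μ lam₀ T g (-J - 1) with hΔ
  set S : ℤ → ℂ := fun k => ∑' J : ℤ, test A (freq lam₀ k) J * ΔV J with hS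
  set W := ∑ J ∈ Finset.Ico A (2 * A), |V μ lam₀ T g (-J) - V μ lam₀ T g (-J - 1)| with hW
  set ρ : ℝ := 1 / √(A : ℝ) + T / (A * √(A : ℝ)) with hρ
  have hρ0 : 0 ≤ ρ := by positivity
  have hSe : ∀ k, S k = ∑ j ∈ Finset.range A, test A (freq lam₀ k) (A + j : ℕ) *
      ΔV ((A + j : ℕ) : ℤ) := by
    intro k
    simp only [hS]
    rw [tsum_int_eq_sum_range (n := A) (N := A)]
    · refine Finset.sum_congr rfl fun j _ => ?_
      push_cast
      rfl
    · rintro j (hj | hj)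
      · have h1 : (j : ℝ) < A := by exact_mod_cast hj
        rw [test_eq_zero hA0 fun h' => by linarith [h'.1], zero_mul]
      · have h1 : (A : ℝ) + A ≤ j := by exact_mod_cast hj
        rw [test_eq_zero hA0 fun h' => by linarith [h'.2], zero_mul]
  -- Collecting the modes at each J gives the polynomial at one translated and reflected point,
  -- where the bound 2 applies.
  have hupper : ‖∑ k ∈ s, p k * osc (-k) Q * S k‖ ≤ 2 * W := by
    have e1 : ∑ k ∈ s, p k * osc (-k) Q * S k = ∑ j ∈ Finset.range A,
        (bump (((A + j : ℕ) : ℝ) / A) : ℂ) * (∑ k ∈ s, p k *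
          osc (-k) (Q - 2 * lam₀.den / √(beta lam₀) * √((A + j : ℕ) : ℝ))) *
            ΔV ((A + j : ℕ) : ℤ) := by
      simp only [hSe, Finset.mul_sum, Finset.sum_mul]
      rw [Finset.sum_comm]
      refine Finset.sum_congr rfl fun j _ => Finset.sum_congr rfl fun k _ => ?_
      rw [test_freq hp, sub_eq_add_neg, osc_add, osc_neg_left k (-_), neg_neg]
      ring
    rw [e1, hW, Finset.sum_Ico_eq_sum_range, show 2 * A - A = A by omega, Finset.mul_sum]
    refine (norm_sum_le _ _).trans (Finset.sum_le_sum fun j _ => ?_)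
    rw [norm_mul, norm_mul, Complex.norm_real, Real.norm_eq_abs, abs_of_nonneg bump.nonneg]
    simp only [hΔ]
    rw [← Complex.ofReal_sub, Complex.norm_real, Real.norm_eq_abs]
    refine mul_le_mul_of_nonneg_right ?_ (abs_nonneg _)
    have h1 := hp2 (Q - 2 * lam₀.den / √(beta lam₀) * √((A + j : ℕ) : ℝ))
    exact (mul_le_mul bump.le_one h1 (norm_nonneg _) zero_le_one).trans (one_mul 2).le
  -- The factors e^{-2πikQ} undo the mode-dependent phases in the asymptotics of the pairings.
  have hlower : ‖∑ k ∈ s, p k * osc (-k) Q * S k - r * ∑ k ∈ s, p k * piHat μ lam₀ g k‖ ≤ D * ρ := by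
    have e1 : ∑ k ∈ s, p k * osc (-k) Q * S k - r * ∑ k ∈ s, p k * piHat μ lam₀ g k =
        ∑ k ∈ s, p k * osc (-k) Q * (S k - r * osc k Q * piHat μ lam₀ g k) := by
      rw [Finset.mul_sum, ← Finset.sum_sub_distrib]
      refine Finset.sum_congr rfl fun k _ => ?_
      have : osc (-k) Q * osc k Q = 1 := by
        rw [osc_neg_left, ← osc_add, neg_add_cancel, osc_zero_right]
      linear_combination (p k * r * piHat μ lam₀ g k) * this
    rw [e1, hD, Finset.sum_mul]
    refine (norm_sum_le _ _).trans (Finset.sum_le_sum fun k hk => ?_)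
    rw [norm_mul, norm_mul, norm_osc, mul_one, mul_assoc ‖p k‖]
    refine mul_le_mul_of_nonneg_left ?_ (norm_nonneg (p k))
    refine h k T hT ?_ A hA hAT
    exact (le_abs_self _).trans ((Finset.single_le_sum (f := fun k => |N k|)
      (fun k _ => abs_nonneg _) hk).trans hN)
  have hr0' : 0 ≤ r := le_trans (by positivity) hr0
  have h3 : r * (I / 2) ≤ ‖(r : ℂ) * ∑ k ∈ s, p k * piHat μ lam₀ g k‖ := by
    rw [norm_mul, Complex.norm_real, Real.norm_eq_abs, abs_of_nonneg hr0']
    exact mul_le_mul_of_nonneg_left hpI hr0'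
  have h4 := norm_sub_norm_le ((r : ℂ) * ∑ k ∈ s, p k * piHat μ lam₀ g k)
    (∑ k ∈ s, p k * osc (-k) Q * S k)
  rw [norm_sub_rev] at h4
  have h5 : 4 / (7 * √Real.pi * lam₀.den) * (I / 2) ≤ r * (I / 2) :=
    mul_le_mul_of_nonneg_right hr0 (by positivity)
  have h6 : 4 / (7 * √Real.pi * lam₀.den) * (I / 2) = 2 * (1 / (7 * √Real.pi * lam₀.den) * I) := by
    ring
  have h7 : 0 ≤ D * ρ := mul_nonneg hD0 hρ0
  linarith

lemma ofReal_sum_le_totVar {T m M : ℕ} (hm : √(T : ℝ) ≤ m) (hM : M ≤ T) :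
    ENNReal.ofReal (∑ J ∈ Finset.Ico m M, |V μ lam₀ T g (-J) - V μ lam₀ T g (-J - 1)|) ≤
      totVar μ lam₀ T g := by
  rw [Finset.sum_Ico_eq_sum_range, ← Finset.sum_range_reflect,
    ENNReal.ofReal_sum_of_nonneg fun _ _ => abs_nonneg _]
  rcases le_or_gt M m with hmM | hmM
  · simp [Nat.sub_eq_zero_of_le hmM]
  have hM' : (M : ℝ) ≤ T := by exact_mod_cast hM
  have key := eVariationOn.sum_le_of_monotoneOn_Iic (f := V μ lam₀ T g)
    (s := {j : ℤ | -(T : ℝ) ≤ (j : ℝ) ∧ (j : ℝ) ≤ -√(T : ℝ)}) (n := M - m)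
    (u := fun i : ℕ => -(M : ℤ) + i) (fun i _ j _ hij => by simpa using hij) (fun i hi => by
      have h1 : (i : ℝ) + m ≤ M := by
        have : i + m ≤ M := by omega
        exact_mod_cast this
      simp only [mem_ofPred_eq]
      push_cast
      constructor <;> linarith [i.cast_nonneg (α := ℝ)])
  refine le_trans (le_of_eq ?_) key
  refine Finset.sum_congr rfl fun i hi => ?_
  have hi' := Finset.mem_range.1 hi
  rw [edist_dist, Real.dist_eq]
  congr 4
  · push_cast
    omega
  · push_cast
    omega

end blocks

end GodunovTV

namespace GodunovTV

open MeasureTheory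

/-! ### Logarithmic growth of the variation -/

section growth
variable {μ : ℝ} {lam₀ : ℚ} {g : ℝ → ℝ}

/-- The mean of `|Π|`. -/
noncomputable def piMean (μ : ℝ) (lam₀ : ℚ) (g : ℝ → ℝ) : ℝ := ∫ z in (0 : ℝ)..1, |bigPi μ lam₀ g z|

/-- The constant in the lower bounds of the variation. -/
noncomputable def growthRate (lam₀ : ℚ) : ℝ := 1 / (56 * √Real.pi * lam₀.den)

lemma growthRate_pos (lam₀ : ℚ) : 0 < growthRate lam₀ := by
  have hq0 : (0 : ℝ) < lam₀.den := by exact_mod_cast lam₀.den_pos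
  have hπ := Real.sqrt_pos.2 Real.pi_pos
  unfold growthRate
  positivity

lemma mul_le_sum_Ico_two_pow {F : ℕ → ℝ} {w : ℝ} {a b : ℕ} (hab : a ≤ b)
    (h : ∀ i, a ≤ i → i < b → w ≤ ∑ J ∈ Finset.Ico (2 ^ i) (2 * 2 ^ i), F J) :
    ((b : ℝ) - a) * w ≤ ∑ J ∈ Finset.Ico (2 ^ a) (2 ^ b), F J := by
  induction b, hab using Nat.le_induction with
  | base => simp
  | succ b hb ih =>
    have h1 := ih fun i hi hi' => h i hi (by omega)
    have h2 := h b hb (by omega)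
    rw [← Finset.sum_Ico_consecutive F (Nat.pow_le_pow_right two_pos hb)
      (Nat.pow_le_pow_right two_pos b.le_succ), pow_succ' 2 b]
    push_cast
    linarith

/-- For A ≥ T^{3/4} the quotient T/A^{3/2} is at most A^{-1/6}; sixth powers avoid fractional
exponents. -/
lemma div_mul_sqrt_le {A T ε : ℝ} (hA : 0 < A) (hT : 0 ≤ T) (hAT : T ^ 3 ≤ A ^ 4) (hε : 0 < ε)
    (hAε : 1 / ε ^ 6 ≤ A) : T / (A * √A) ≤ ε := by
  have hs := Real.sqrt_pos.2 hA
  rw [← pow_le_pow_iff_left₀ (by positivity) hε.le (by norm_num : 6 ≠ 0), div_pow]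
  have e : (A * √A) ^ 6 = A ^ 9 := by
    rw [mul_pow, show √A ^ 6 = (√A ^ 2) ^ 3 by ring, Real.sq_sqrt hA.le]
    ring
  rw [e, div_le_iff₀ (by positivity)]
  rw [div_le_iff₀ (by positivity)] at hAε
  calc T ^ 6 = (T ^ 3) ^ 2 := by ring
    _ ≤ (A ^ 4) ^ 2 := by gcongr
    _ = 1 * A ^ 8 := by ring
    _ ≤ (A * ε ^ 6) * A ^ 8 := by gcongr
    _ = _ := by ring

set_option maxHeartbeats 800000 in
-- Apply the block estimate to A = 2^i with T^{3/4} ≤ A ≤ T/2^κ. The blocks are disjoint and each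
-- yields at least w; their number is at least (ln T)/4 minus a constant.
lemma exists_log_le_totVar (hp : Params μ lam₀) (hg : AdmissibleFlux μ lam₀ g)
    (hI : 0 < piMean μ lam₀ g) : ∃ C₀ : ℝ, ∀ T : ℕ, 1 ≤ T →
      ENNReal.ofReal (growthRate lam₀ * piMean μ lam₀ g * Real.log T - C₀) ≤
        totVar μ lam₀ T g := by
  have hq0 : (0 : ℝ) < lam₀.den := by exact_mod_cast lam₀.den_pos
  have hπ := Real.sqrt_pos.2 Real.pi_pos
  have hβ := hp.beta_pos
  obtain ⟨C, hC, N, h⟩ := exists_block_le hp hg hI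
  rw [← piMean] at h
  set I := piMean μ lam₀ g
  set w : ℝ := 1 / (14 * √Real.pi * lam₀.den) * I with hw
  have hw0 : 0 < w := by positivity
  -- The 56 in `growthRate` is 7·2·4: 7 from the block estimate, 2 to absorb the error, 4 from using
  -- a quarter of the dyadic scales.
  have hgr : growthRate lam₀ * I = w / 4 := by
    rw [growthRate, hw]
    field_simp
    norm_num
  set ε : ℝ := w / (2 * C) with hε
  have hε0 : 0 < ε := by positivity
  -- Omitting the top κ dyadic scales ensures (8/β + 1)A ≤ T.
  obtain ⟨κ, hκ⟩ := pow_unbounded_of_one_lt (8 / beta lam₀ + 1) (one_lt_two : (1 : ℝ) < 2)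
  set B : ℝ := max N (max (1 / ε ^ 2) (max (1 / ε ^ 6) 1024)) with hB
  obtain ⟨T₀, hT₀⟩ := eventually_atTop.1 (eventually_lateTime hp B)
  set C₁ : ℝ := (κ + 9 / 4) * w with hC₁
  have hC₁0 : 0 ≤ C₁ := by positivity
  refine ⟨C₁ + w / 4 * Real.log (T₀ + 1), fun T hT => ?_⟩
  have hT' : (1 : ℝ) ≤ T := by exact_mod_cast hT
  have hlog0 : 0 ≤ Real.log (T₀ + 1 : ℝ) := Real.log_nonneg (by linarith [T₀.cast_nonneg (α := ℝ)])
  rw [hgr]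
  -- For small T the additive constant makes the left side nonpositive.
  rcases lt_or_ge T T₀ with hlt | hge
  · rw [ENNReal.ofReal_of_nonpos]
    · exact zero_le
    · have h1 : (T : ℝ) ≤ T₀ + 1 := by
        have : (T : ℝ) < T₀ := by exact_mod_cast hlt
        linarith
      have h2 := Real.log_le_log (by linarith) h1
      nlinarith
  obtain ⟨hlate, hTB⟩ := hT₀ T hge
  have hN : N ≤ √(T : ℝ) := (le_max_left _ _).trans hTB
  have hB1 := (le_max_right N _).trans hTB
  have hB2 := (le_max_right (1 / ε ^ 2) _).trans hB1
  have hε2 : 1 / ε ^ 2 ≤ √(T : ℝ) := (le_max_left _ _).trans hB1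
  have hε6 : 1 / ε ^ 6 ≤ √(T : ℝ) := (le_max_left _ _).trans hB2
  have h1024 : 1024 ≤ √(T : ℝ) := (le_max_right _ _).trans hB2
  have hssT := Real.mul_self_sqrt (show (0 : ℝ) ≤ T by linarith)
  have hTbig : (1024 : ℝ) ^ 2 ≤ T := by nlinarith
  set n := Nat.log 2 T with hn
  have hn1 : 2 ^ n ≤ T := Nat.pow_log_le_self 2 (by omega)
  have hn2 : T < 2 ^ (n + 1) := Nat.lt_pow_succ_log_self one_lt_two T
  -- The least exponent guaranteeing 4i ≥ 3(n + 1) after integer division, hence A⁴ ≥ T³.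
  set a : ℕ := 3 * (n + 1) / 4 + 1 with ha
  set b : ℕ := n - κ with hb
  have hblock : ∀ i, a ≤ i → i < b → 32 * √(T : ℝ) ≤ (2 ^ i : ℕ) ∧
      w ≤ ∑ J ∈ Finset.Ico (2 ^ i : ℕ) (2 * 2 ^ i), |V μ lam₀ T g (-J) - V μ lam₀ T g (-J - 1)| := by
    intro i hai hib
    set A : ℕ := 2 ^ i with hA
    have hA0 : (0 : ℝ) < A := by
      rw [hA]
      positivity
    have hAT : (T : ℝ) ^ 3 ≤ (A : ℝ) ^ 4 := by
      have h1 : T ^ 3 ≤ A ^ 4 := by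
        calc T ^ 3 ≤ (2 ^ (n + 1)) ^ 3 := Nat.pow_le_pow_left hn2.le 3
          _ = 2 ^ ((n + 1) * 3) := (pow_mul _ _ _).symm
          _ ≤ 2 ^ (i * 4) := Nat.pow_le_pow_right two_pos (by omega)
          _ = A ^ 4 := pow_mul _ _ _
      exact_mod_cast h1
    have h32 : 32 * √(T : ℝ) ≤ A := by
      rw [← pow_le_pow_iff_left₀ (by positivity) hA0.le (by norm_num : 4 ≠ 0)]
      refine le_trans ?_ hAT
      have : (32 * √(T : ℝ)) ^ 4 = 1024 ^ 2 * (T : ℝ) ^ 2 := by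
        rw [mul_pow, show √(T : ℝ) ^ 4 = (√(T : ℝ) * √(T : ℝ)) ^ 2 by ring, hssT]
        norm_num
      rw [this]
      nlinarith [sq_nonneg (T : ℝ)]
    have hKA : (8 / beta lam₀ + 1) * A ≤ T := by
      calc (8 / beta lam₀ + 1) * A ≤ 2 ^ κ * A := by gcongr
        _ = ((2 ^ (κ + i) : ℕ) : ℝ) := by
            rw [hA]
            push_cast
            rw [pow_add]
        _ ≤ ((2 ^ n : ℕ) : ℝ) := by
            exact_mod_cast Nat.pow_le_pow_right two_pos (by omega)
        _ ≤ T := by exact_mod_cast hn1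
    refine ⟨h32, le_trans ?_ (h T hlate hN A h32 hKA)⟩
    have hsA := Real.sqrt_pos.2 hA0
    have hTA : √(T : ℝ) ≤ A := by linarith [Real.sqrt_nonneg (T : ℝ)]
    have r1 : 1 / √(A : ℝ) ≤ ε := by
      rw [div_le_iff₀ hsA, mul_comm, ← div_le_iff₀ hε0]
      apply Real.le_sqrt_of_sq_le
      rw [div_pow, one_pow]
      exact hε2.trans hTA
    have r2 : (T : ℝ) / (A * √(A : ℝ)) ≤ ε :=
      div_mul_sqrt_le hA0 (by linarith) hAT hε0 (hε6.trans hTA)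
    have r3 : C * (1 / √(A : ℝ) + T / (A * √(A : ℝ))) ≤ w := by
      calc _ ≤ C * (ε + ε) := by gcongr
        _ = w := by
            rw [hε]
            field_simp
            norm_num
    have r4 : 1 / (7 * √Real.pi * lam₀.den) * I = 2 * w := by
      rw [hw]
      field_simp
      norm_num
    linarith
  have hlogT : Real.log T ≤ n + 1 := by
    have h1 : (T : ℝ) ≤ 2 ^ (n + 1) := by exact_mod_cast hn2.le
    have h2 := Real.log_le_log (by linarith) h1
    rw [Real.log_pow] at h2
    have h3 : Real.log 2 ≤ 1 := by linarith [Real.log_two_lt_d9]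
    push_cast at h2
    nlinarith
  have ha' : (a : ℝ) ≤ 3 * (n + 1) / 4 + 1 := by
    have h1 : 4 * a ≤ 3 * (n + 1) + 4 := by omega
    have h2 : (4 : ℝ) * a ≤ 3 * (n + 1) + 4 := by exact_mod_cast h1
    linarith
  have hb' : (n : ℝ) - κ ≤ b := by
    have h1 : n ≤ b + κ := by omega
    have h2 : (n : ℝ) ≤ b + κ := by exact_mod_cast h1
    linarith
  have hfin : w / 4 * Real.log T - (C₁ + w / 4 * Real.log (T₀ + 1)) ≤ ((b : ℝ) - a) * w := by
    have h1 : (Real.log T - 1) / 4 - κ - 2 ≤ (b : ℝ) - a := by linarith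
    have h2 := mul_le_mul_of_nonneg_right h1 hw0.le
    have h3 : 0 ≤ w / 4 * Real.log (T₀ + 1) := by positivity
    rw [hC₁]
    nlinarith
  rcases lt_or_ge a b with hab | hab
  · refine le_trans (ENNReal.ofReal_le_ofReal (hfin.trans
      (mul_le_sum_Ico_two_pow hab.le fun i hi hi' => (hblock i hi hi').2))) ?_
    refine ofReal_sum_le_totVar ?_ ?_
    · have := (hblock a le_rfl hab).1
      linarith [Real.sqrt_nonneg (T : ℝ)]
    · exact (Nat.pow_le_pow_right two_pos (by omega)).trans hn1
  · rw [ENNReal.ofReal_of_nonpos]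
    · exact zero_le
    · have h1 : (b : ℝ) ≤ a := by exact_mod_cast hab
      nlinarith

lemma piMean_pos (hp : Params μ lam₀) (hg : AdmissibleFlux μ lam₀ g)
    (h : ∃ z, bigPi μ lam₀ g z ≠ 0) : 0 < piMean μ lam₀ g := by
  have hc := (continuous_bigPi hp hg).abs
  obtain ⟨z, hz⟩ := h
  have e : bigPi μ lam₀ g (Int.fract z) = bigPi μ lam₀ g z := by
    have := (bigPi_periodic (μ := μ) (lam₀ := lam₀) (g := g)).sub_int_mul_eq (x := z) ⌊z⌋
    rwa [mul_one, Int.self_sub_floor] at this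
  refine intervalIntegral.integral_pos zero_lt_one hc.continuousOn (fun x _ => abs_nonneg _)
    ⟨Int.fract z, ⟨Int.fract_nonneg z, (Int.fract_lt_one z).le⟩, ?_⟩
  rw [e]
  exact abs_pos.2 hz

/-- |Π| minus its mean is periodic with mean zero and z_j is a multiple of √j, so its sums with
weights 1/j stay bounded. Only the mean times a harmonic sum remains. -/
lemma exists_sum_abs_bigPi_le (hp : Params μ lam₀) (hg : AdmissibleFlux μ lam₀ g) :
    ∃ C : ℝ, ∀ T : ℕ, 1 ≤ T → ∑ j ∈ Finset.Icc ⌈√(T : ℝ)⌉₊ T,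
      |bigPi μ lam₀ g (zSeq lam₀ j)| / j ≤ piMean μ lam₀ g * Real.log T + C := by
  have hβ := hp.beta_pos
  have hsβ := Real.sqrt_pos.2 hβ
  have hq0 : (0 : ℝ) < lam₀.den := by exact_mod_cast lam₀.den_pos
  obtain ⟨B, hB, hb, hl⟩ := exists_bigPi_bounds hp hg
  have hcP := continuous_bigPi hp hg
  set I := piMean μ lam₀ g with hI
  have hI0 : 0 ≤ I := intervalIntegral.integral_nonneg zero_le_one fun x _ => abs_nonneg _
  set H : ℝ → ℂ := fun x => ((|bigPi μ lam₀ g x| - I : ℝ) : ℂ) with hH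
  obtain ⟨C, hC⟩ := exists_norm_sum_div_le (H := H) (B := B + I) (L := B)
    (s := 2 * lam₀.den / √(beta lam₀)) (by positivity) (by fun_prop)
    (fun x => by simp only [hH, bigPi_periodic x])
    (by
      simp only [hH]
      rw [intervalIntegral.integral_ofReal, intervalIntegral.integral_sub
        (hcP.abs.intervalIntegrable _ _) (by simp), intervalIntegral.integral_const]
      simp [hI, piMean])
    (fun x => by
      simp only [hH]
      rw [Complex.norm_real, Real.norm_eq_abs, abs_le]
      constructor <;> linarith [hb x, abs_nonneg (bigPi μ lam₀ g x)])
    (fun x y => by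
      simp only [hH]
      rw [← Complex.ofReal_sub, Complex.norm_real, Real.norm_eq_abs, sub_sub_sub_cancel_right]
      exact (abs_abs_sub_abs_le_abs_sub _ _).trans (hl x y)) hB.le
  refine ⟨I + C, fun T hT => ?_⟩
  have hT' : (1 : ℝ) ≤ T := by exact_mod_cast hT
  set n := ⌈√(T : ℝ)⌉₊ with hn
  have hn1 : 1 ≤ n := Nat.one_le_ceil_iff.2 (Real.sqrt_pos.2 (by linarith))
  have hnT : n ≤ T + 1 := by
    have : n ≤ T := Nat.ceil_le.2 (Real.sqrt_le_self_iff.2 (Or.inr hT'))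
    omega
  have h1 := hC n (T + 1) hn1 hnT
  have hz : ∀ j : ℕ, zSeq lam₀ j = 2 * lam₀.den / √(beta lam₀) * √(j : ℝ) := fun j => by
    rw [zSeq, Real.sqrt_div j.cast_nonneg]
    ring
  have e1 : ∑ m ∈ Finset.Ico n (T + 1), ((1 / m : ℝ) : ℂ) *
      H (2 * lam₀.den / √(beta lam₀) * √(m : ℝ)) =
      ((∑ j ∈ Finset.Icc n T, |bigPi μ lam₀ g (zSeq lam₀ j)| / j -
        I * ∑ j ∈ Finset.Icc n T, (1 / j : ℝ) : ℝ) : ℂ) := by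
    rw [show Finset.Ico n (T + 1) = Finset.Icc n T from rfl, Finset.mul_sum,
      ← Finset.sum_sub_distrib, Complex.ofReal_sum]
    refine Finset.sum_congr rfl fun j _ => ?_
    simp only [hH]
    rw [← Complex.ofReal_mul, hz]
    congr 1
    ring
  rw [e1, Complex.norm_real, Real.norm_eq_abs] at h1
  -- Extending the harmonic sum down to 1 is wasteful but enough: only an upper bound by a multiple
  -- of ln T is required.
  have h2 : ∑ j ∈ Finset.Icc n T, (1 / j : ℝ) ≤ 1 + Real.log T := by
    calc ∑ j ∈ Finset.Icc n T, (1 / j : ℝ) ≤ ∑ j ∈ Finset.Icc 1 T, (1 / j : ℝ) :=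
          Finset.sum_le_sum_of_subset_of_nonneg (Finset.Icc_subset_Icc_left hn1)
            fun _ _ _ => by positivity
      _ = (harmonic T : ℝ) := by
          rw [harmonic_eq_sum_Icc]
          push_cast
          exact Finset.sum_congr rfl fun j _ => one_div _
      _ ≤ _ := harmonic_le_one_add_log T
  have h3 := (abs_le.1 h1).2
  have h4 := mul_le_mul_of_nonneg_left h2 hI0
  linarith

end growth

/-! ### A flux with a nontrivial `Π` -/

/-- A bump in ξ so narrow that its shape in y is supported where cos(2πqy) ≥ 0 has a nonzero Fourier
coefficient at q; so has its derivative, and the first Fourier coefficient of Π does not vanish. -/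
lemma exists_assumptionA {μ : ℝ} {lam₀ : ℚ} (hp : Params μ lam₀) :
    ∃ g : ℝ → ℝ, AssumptionA μ lam₀ g := by
  have hq0 : (0 : ℝ) < lam₀.den := by exact_mod_cast lam₀.den_pos
  -- For |y| ≤ 1/(4q) the angle 2πqy stays within π/2.
  set ε : ℝ := 1 / (4 * lam₀.den) with hε
  have hε0 : 0 < ε := by positivity
  have hanti := profile_strictAnti hp
  set ξ₀ := profile μ lam₀ 0 with hξ₀
  have h1 : profile μ lam₀ ε < ξ₀ := hanti hε0
  have h2 : ξ₀ < profile μ lam₀ (-ε) := hanti (by linarith)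
  set r := min (ξ₀ - profile μ lam₀ ε) (profile μ lam₀ (-ε) - ξ₀) with hr
  have hr0 : 0 < r := lt_min (by linarith) (by linarith)
  have hr1 : r ≤ ξ₀ - profile μ lam₀ ε := min_le_left _ _
  have hr2 : r ≤ profile μ lam₀ (-ε) - ξ₀ := min_le_right _ _
  set g : ContDiffBump ξ₀ := ⟨r / 2, r, by positivity, by linarith⟩ with hg
  have hadm : AdmissibleFlux μ lam₀ g := by
    refine ⟨g.contDiff, g.hasCompactSupport, ξ₀ - r, ξ₀ + r, ?_, ?_, fun ξ _ hξ => ?_⟩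
    · linarith [profile_pos hp ε]
    · linarith [profile_lt hp (-ε)]
    · have h3 : ξ ∈ tsupport g := support_deriv_subset hξ
      rw [g.tsupport_eq, Real.closedBall_eq_Icc] at h3
      exact h3
  have hprofc : Continuous (profile μ lam₀) :=
    continuous_iff_continuousAt.2 fun y => (hasDerivAt_profile hp y).continuousAt
  set G := shape μ lam₀ g with hG
  have hGc : Continuous G := g.continuous.comp hprofc
  have hGz : ∀ y, ε ≤ |y| → G y = 0 := by
    intro y hy
    refine g.zero_of_le_dist ?_
    change r ≤ _
    rw [Real.dist_eq]
    rcases le_abs'.1 hy with h | h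
    · have := hanti.antitone h
      exact le_trans (by linarith) (le_abs_self _)
    · have := hanti.antitone h
      exact le_trans (by linarith) (neg_le_abs _)
  have hGs : HasCompactSupport G := by
    refine HasCompactSupport.intro (isCompact_Icc (a := -ε) (b := ε)) fun y hy => hGz y ?_
    by_contra! h
    rw [abs_lt] at h
    exact hy ⟨h.1.le, h.2.le⟩
  set n : ℤ := 1 * lam₀.den with hn
  have hn0 : n ≠ 0 := by
    rw [hn, one_mul]
    exact_mod_cast lam₀.den_pos.ne'
  have hnq : (n : ℝ) = lam₀.den := by
    rw [hn]
    push_cast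
    ring
  have hosc : Continuous (osc n) := continuous_osc n
  have hGi : Integrable fun y => (G y : ℂ) := (hGc.integrable_of_hasCompactSupport hGs).ofReal
  have hG'i : Integrable fun y => (shapeDeriv μ lam₀ g y : ℂ) :=
    ((continuous_shapeDeriv hp hadm).integrable_of_hasCompactSupport
      (hasCompactSupport_shapeDeriv hp hadm)).ofReal
  have hmul : ∀ {f : ℝ → ℂ}, Integrable f → Integrable (osc n * f) := fun hf =>
    hf.bdd_mul hosc.aestronglyMeasurable (ae_of_all _ fun y => (norm_osc n y).le)
  have hibp := integral_mul_deriv_eq_deriv_mul_of_integrable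
    (u := osc n) (u' := fun y => 2 * Real.pi * n * Complex.I * osc n y)
    (v := fun y => (G y : ℂ)) (v' := fun y => (shapeDeriv μ lam₀ g y : ℂ))
    (fun y _ => hasDerivAt_osc n y) (fun y _ => (hasDerivAt_shape hp hadm y).ofReal_comp)
    (hmul hG'i) (by
      refine ((hmul hGi).const_mul (2 * Real.pi * n * Complex.I)).congr (ae_of_all _ fun y => ?_)
      simp only [Pi.mul_apply]
      ring) (hmul hGi)
  have hre : 0 < (∫ y, osc n y * (G y : ℂ)).re := by
    have e1 : (∫ y, osc n y * (G y : ℂ)).re = ∫ y, Real.cos (2 * Real.pi * n * y) * G y := by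
      have := integral_re (hmul hGi)
      simp only [Pi.mul_apply] at this
      refine Eq.trans this.symm (integral_congr_ae (ae_of_all _ fun y => ?_))
      change (osc n y * (G y : ℂ)).re = _
      rw [Complex.re_mul_ofReal, osc, Complex.exp_ofReal_mul_I_re]
    rw [e1]
    refine Continuous.integral_pos_of_hasCompactSupport_nonneg_nonzero (x := 0) (by fun_prop)
      hGs.mul_left (fun y => ?_) ?_
    · change 0 ≤ Real.cos (2 * Real.pi * n * y) * G y
      rcases le_or_gt ε |y| with h | h
      · rw [hGz y h, mul_zero]
      · refine mul_nonneg (Real.cos_nonneg_of_mem_Icc ?_) g.nonneg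
        rw [Set.mem_Icc, ← abs_le, abs_mul, abs_mul, abs_of_pos Real.two_pi_pos, hnq, abs_of_pos hq0]
        calc 2 * Real.pi * lam₀.den * |y| ≤ 2 * Real.pi * lam₀.den * ε := by
              have := Real.pi_pos
              gcongr
          _ = Real.pi / 2 := by
              rw [hε]
              field_simp
              norm_num
    · have : G 0 = 1 := by
        refine g.one_of_mem_closedBall (Metric.mem_closedBall_self ?_)
        change 0 ≤ r / 2
        positivity
      simp [this]
  have hhat : shapeHat μ lam₀ g n ≠ 0 := by
    have e1 : shapeHat μ lam₀ g n = -(2 * Real.pi * n * Complex.I * ∫ y, osc n y * (G y : ℂ)) := by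
      rw [shapeHat, ← integral_const_mul]
      refine Eq.trans (integral_congr_ae (ae_of_all _ fun y => mul_comm _ _)) (hibp.trans ?_)
      simp only [mul_assoc]
    rw [e1, neg_ne_zero]
    refine mul_ne_zero (two_pi_I_mul_ne_zero hn0) fun h0 => ?_
    rw [h0, Complex.zero_re] at hre
    exact lt_irrefl _ hre
  refine ⟨g, hadm, ?_⟩
  by_contra! hzero
  have h3 := piHat_eq hp hadm one_ne_zero
  have h4 : piHat μ lam₀ g 1 = 0 := by simp [piHat, hzero]
  have hβ := hp.beta_pos
  have hπ := Real.pi_pos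
  have hsπ := Real.sqrt_pos.2 hπ
  rw [h4] at h3
  refine mul_ne_zero (mul_ne_zero ?_ ?_) (mul_ne_zero ?_ hhat) h3.symm
  · rw [Complex.ofReal_ne_zero]
    push_cast
    positivity
  · exact Complex.exp_ne_zero _
  · refine div_ne_zero Complex.I_ne_zero ?_
    have : (Real.pi : ℂ) ≠ 0 := by exact_mod_cast hπ.ne'
    simp [this]

end GodunovTV

/-! ### Assembly of the claims. -/

theorem mainTheorem1 (μ : ℝ) (hμ : 1 / 2 < μ) (hμ' : μ < 1)
    (lam₀ : ℚ) (hlam : μ < lam₀) (hlam' : lam₀ < 1) :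
    -- the explicit pair is a Godunov solution with `v = 0` at time `-2T`
    (∀ T : ℕ, GodunovTV.AdmissibleTime lam₀ T → ∀ g : ℝ → ℝ,
      GodunovTV.IsGodunovSolution (GodunovTV.flux μ) g (1 / 2) (-2 * T)
        (GodunovTV.uGrid μ lam₀ T) (GodunovTV.vGrid μ lam₀ T g) ∧
      ∀ j, GodunovTV.vGrid μ lam₀ T g (-2 * T) j = 0) ∧
    -- `u` is a decreasing profile with right state `0`, with data of bounded variation
    (∀ T : ℕ, GodunovTV.AdmissibleTime lam₀ T → ∀ t : ℝ,
      StrictAnti (GodunovTV.u μ lam₀ T t) ∧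
      Filter.Tendsto (GodunovTV.u μ lam₀ T t) Filter.atTop (nhds 0)) ∧
    (∃ K : ℝ, ∀ T : ℕ, GodunovTV.AdmissibleTime lam₀ T →
      eVariationOn (GodunovTV.uGrid μ lam₀ T (-2 * T)) Set.univ ≤ ENNReal.ofReal K) ∧
    -- its level curves follow the translates `gamma + c(a)` of the shock curve
    (∀ ε > (0 : ℝ), ∀ a₁ a₂ : ℝ, 0 < a₁ → a₂ < GodunovTV.kappa₀ μ lam₀ →
      ∃ (M : ℝ) (T₀ : ℕ), ∀ T ≥ T₀, ∀ t ∈ Set.Icc (-(T : ℝ)) (-2 * √(T : ℝ)),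
        ∀ a ∈ Set.Icc a₁ a₂, ∃ x : ℝ, (∀ x', GodunovTV.u μ lam₀ T t x' = a ↔ x' = x) ∧
          |x - (GodunovTV.c μ lam₀ a + GodunovTV.gamma lam₀ T t)| ≤
            M * (-t) ^ (-(1 / 2 - ε))) ∧
    -- lower bound of the total variation of `V` through `Π`
    (∃ C > (0 : ℝ), ∀ g : ℝ → ℝ, GodunovTV.AdmissibleFlux μ lam₀ g →
      ∃ C₀ : ℝ, ∀ T : ℕ, GodunovTV.AdmissibleTime lam₀ T →
        ENNReal.ofReal ((∑ j ∈ Finset.Icc ⌈√(T : ℝ)⌉₊ T,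
          C * |GodunovTV.bigPi μ lam₀ g (GodunovTV.zSeq lam₀ j)| / j) - C₀) ≤
        GodunovTV.totVar μ lam₀ T g) ∧
    -- logarithmic growth under Assumption (A)
    (∀ g : ℝ → ℝ, GodunovTV.AssumptionA μ lam₀ g →
      ∃ C > (0 : ℝ), ∃ C₀ : ℝ, ∀ T : ℕ, GodunovTV.AdmissibleTime lam₀ T →
        ENNReal.ofReal (C * Real.log T - C₀) ≤ GodunovTV.totVar μ lam₀ T g) ∧
    -- Assumption (A) can be met, and then the total variation is unbounded
    (∃ g : ℝ → ℝ, GodunovTV.AssumptionA μ lam₀ g) ∧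
    (∀ g : ℝ → ℝ, GodunovTV.AssumptionA μ lam₀ g →
      Filter.Tendsto
        (fun T : ℕ => eVariationOn (fun j : ℤ => GodunovTV.vGrid μ lam₀ T g 1 j) Set.univ)
        Filter.atTop (nhds ⊤)) := by
  have hp : GodunovTV.Params μ lam₀ := ⟨hμ, hlam, by exact_mod_cast hlam'⟩
  have hr := GodunovTV.growthRate_pos lam₀
  refine ⟨fun T hT g => ⟨GodunovTV.isGodunovSolution_uGrid hp hT g, fun j =>
    GodunovTV.vGrid_initial g j⟩, fun T hT t => ⟨GodunovTV.u_strictAnti hp hT t,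
    GodunovTV.tendsto_u hp hT t⟩, GodunovTV.exists_eVariationOn_le hp,
    fun ε hε a₁ a₂ ha₁ ha₂ => GodunovTV.exists_level_curve_bound hp hε ha₁ ha₂,
    ⟨GodunovTV.growthRate lam₀, hr, fun g hg => ?_⟩, fun g hg => ?_,
    GodunovTV.exists_assumptionA hp, fun g hg => ?_⟩
  -- If Π vanishes identically the sum is zero; otherwise the logarithmic bound dominates the sum,
  -- with the constant `growthRate lam₀`, which does not depend on g.
  · by_cases h : ∃ z, GodunovTV.bigPi μ lam₀ g z ≠ 0
    · obtain ⟨C₀, hC₀⟩ := GodunovTV.exists_log_le_totVar hp hg (GodunovTV.piMean_pos hp hg h)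
      obtain ⟨C₁, hC₁⟩ := GodunovTV.exists_sum_abs_bigPi_le hp hg
      refine ⟨C₀ + GodunovTV.growthRate lam₀ * C₁, fun T hT =>
        (ENNReal.ofReal_le_ofReal ?_).trans (hC₀ T hT.1)⟩
      have h1 := mul_le_mul_of_nonneg_left (hC₁ T hT.1) hr.le
      simp only [Finset.mul_sum, ← mul_div_assoc] at h1
      linarith
    · push Not at h
      refine ⟨0, fun T _ => ?_⟩
      simp [h]
  · obtain ⟨C₀, hC₀⟩ :=
      GodunovTV.exists_log_le_totVar hp hg.1 (GodunovTV.piMean_pos hp hg.1 hg.2)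
    exact ⟨_, mul_pos hr (GodunovTV.piMean_pos hp hg.1 hg.2), C₀, fun T hT => hC₀ T hT.1⟩
  · have hI := GodunovTV.piMean_pos hp hg.1 hg.2
    obtain ⟨C₀, hC₀⟩ := GodunovTV.exists_log_le_totVar hp hg.1 hI
    have hlim : Filter.Tendsto (fun T : ℕ => ENNReal.ofReal
        (GodunovTV.growthRate lam₀ * GodunovTV.piMean μ lam₀ g * Real.log T - C₀))
        Filter.atTop (nhds ⊤) :=
      ENNReal.tendsto_ofReal_atTop.comp (Filter.tendsto_atTop_add_const_right _ (-C₀)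
        ((Real.tendsto_log_atTop.comp tendsto_natCast_atTop_atTop).const_mul_atTop
          (mul_pos hr hI)))
    refine tendsto_nhds_top_mono hlim ?_
    filter_upwards [Filter.eventually_ge_atTop 1] with T hT
    refine (hC₀ T hT).trans ?_
    -- `V` is `vGrid` at time 1 shifted by one cell, restricted to a window, so its variation is at
    -- most the full one.
    exact eVariationOn.comp_le_of_monotoneOn (fun j : ℤ => GodunovTV.vGrid μ lam₀ T g 1 j)
      (fun j : ℤ => j + 1) (fun a _ b _ hab => by simpa using hab) (fun _ _ => Set.mem_univ _)
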